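/- Let $k$ be a field, $A$ an associative unital $k$-algebra and $m,p\ge 0$ integers. **Conventions.** Complexes are graded homologically. $\mathrm{Bar}_*(A)$ is the bar complex of $A$-$A$-bimodules, $\mathrm{Bar}_r(A)=A^{\otimes r+2}$ for $r\ge 0$, with the maps $d_r:A^{\otimes r+2}\to A^{\otimes r+1}$, $d_r(a_1\otimes\cdots\otimes a_{r+2})=\sum_{i=1}^{r+1}(-1)^{i-1}a_1\otimes\cdots\otimes a_ia_{i+1}\otimes\cdots\otimes a_{r+2}$; its differential is $d_r$ for $r\ge 1$. We write $a_{i,j}=a_i\otimes\cdots\otimes a_j$. Put $\Omega^p(A)=\operatorname{im}(d_p)\subseteq A^{\otimes p+1}$ (so $\Omega^0(A)=A$), and let $\mathrm{Bar}_*(\Omega^p(A))$ be its resolution with $\mathrm{Bar}_s(\Omega^p(A))=A^{\otimes p+s+2}=\mathrm{Bar}_{p+s}(A)$ for $s\geq0$ and differential $d_{p+s}$ for $s\ge 1$, augmented by $d_p$. Let $\epsilon_c$ denote a copy of $k$ in degree $c$. Let $R=R_{m-p-1}=k[\epsilon]/(\epsilon^2)$ with $\epsilon$ of degree $m-p-1$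 and zero differential. A dg right $(A^{\mathrm{op}}\otimes A\otimes R)$-module is a complex of ($k$-central) $A$-$A$-bimodules with a bimodule endomorphism $x\mapsto x\epsilon$ of degree $m-p-1$ such that $(x\epsilon)\epsilon=0$ and $d(x\epsilon)=(dx)\epsilon$. A morphism of such modules is an $R$-relative quasi-isomorphism if it is a homotopy equivalence of dg $R$-modules. The $R$-relative derived category $\mathcal D_R(A^{\mathrm{op}}\otimes A\otimes R)$ is the localization of the category of dg modules at the $R$-relative quasi-isomorphisms. The tensor product $M\otimes_{A\otimes R}N$ is the quotient of $M\otimes_k N$ by the relations $xa\otimes y=x\otimes ay$ and $x\epsilon\otimes y=x\otimes\epsilon y$, where $\epsilon y=(-1)^{(m-p-1)|y|}y\epsilon$, with $d(x\otimes y)=dx\otimes y+(-1)^{|x|}x\otimes dy$ and $(x\otimes y)\epsilon=x\otimes y\epsilon$. The $R$-relative derived tensor product $-\otimes^{\mathbb L,R}_{A\otimes R}N$ is the total left derived functor of $-\otimes_{A\otimes R}N$ with respect to $R$-relative quasi-isomorphisms. **The modules $C(\theta_i)$.** Let $f,g\in \mathrm{HH}^m(A,\Omega^p(A))$ be represented by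 arbitrary Hochschild cocycles $f,g:A^{\otimes m}\to\Omega^p(A)$. For $s\ge 0$ define $\theta_1(f),\theta_2(f):\mathrm{Bar}_{m+s}(A)\to \mathrm{Bar}_s(\Omega^p(A))$ by $$\theta_1(f)(a_{1,m+s+2})=(-1)^{p+1+(m-p-1)s}\,a_1f(a_{2,m+1})\otimes a_{m+2,m+s+2},$$ $$\theta_2(f)(a_{1,m+s+2})=(-1)^{s+1}a_{1,s+1}\otimes f(a_{s+2,s+m+1})a_{s+m+2},$$ and put $\theta_i(f)=0$ on $\mathrm{Bar}_r(A)$ for $r<m$. Then $C(\theta_i(f))=\mathrm{Bar}_*(A)\oplus \mathrm{Bar}_*(\Omega^p(A))\otimes\epsilon_{m-1}$, with $d(x,y)=(dx,\theta_i(f)(x)+dy)$ and $(x,y)\epsilon=(0,\tau(x))$, where $\tau$ is the identity $\mathrm{Bar}_{p+s}(A)=\mathrm{Bar}_s(\Omega^p(A))$ for $s\ge0$ and zero on $\mathrm{Bar}_r(A)$ for $r<p$. **The module $C_6(f,g)$.** As a complex of bimodules with $\epsilon$-action, $$C_6(f,g)=\mathrm{Bar}_*(A)\ \oplus\ \bigl(\Omega^p(A)\otimes_A\Omega^p(A)\bigr)\otimes\epsilon_{m+p-1},\qquad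 d(x,y)=(dx,t(x)),\quad (x,y)\epsilon=(0,\rho(x)).$$ Here the twisting map $t$ is $f\otimes_A d+d\otimes_A g$ with its Koszul signs: it vanishes outside $\mathrm{Bar}_{m+p}(A)$, where $$t(a_{1,m+p+2})=-(-1)^{mp}\,a_1f(a_{2,m+1})\otimes_A d_p(1\otimes a_{m+2,m+p+2})-(-1)^{p}\,d_p(a_{1,p+1}\otimes 1)\otimes_A g(a_{p+2,m+p+1})a_{m+p+2},$$ and $\rho$ vanishes outside $\mathrm{Bar}_{2p}(A)$, where $\rho(a_{1,2p+2})=d_p(a_{1,p+1}\otimes1)\otimes_A d_p(1\otimes a_{p+2,2p+2})$. **Proposition.** The functor $-\otimes_{A\otimes R}C(\theta_2(g))$ from dg right $(A^{\mathrm{op}}\otimes A\otimes R)$-modules to $\mathcal D_R(A^{\mathrm{op}}\otimes A\otimes R)$ has a total left derived functor, and the canonical morphism $$C(\theta_1(f))\otimes^{\mathbb L,R_{m-p-1}}_{A\otimes R_{m-p-1}}C(\theta_2(g))\longrightarrow C(\theta_1(f))\otimes_{A\otimes R_{m-p-1}}C(\theta_2(g))$$ is an isomorphism in $\mathcal D_{R_{m-p-1}}(A^{\mathrm{op}}\otimes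 A\otimes R_{m-p-1})$. Moreover $$C(\theta_1(f))\otimes_{A\otimes R_{m-p-1}}C(\theta_2(g))\;\cong\; C_6(f,g)$$ in $\mathcal D_{R_{m-p-1}}(A^{\mathrm{op}}\otimes A\otimes R_{m-p-1})$. -/

import Mathlib

universe v u

set_option linter.unusedSimpArgs false

open scoped TensorProduct DirectSum
open MulOpposite

namespace SingDef

/-- A `k`-central `A`-`A`-bimodule. -/
structure Bimod (k : Type v) (A : Type u) [CommRing k] [Ring A] [Algebra k A] where
  carrier : Type u
  [acg : AddCommGroup carrier]
  [modK : Module k carrier]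
  [modL : Module A carrier]
  [modR : Module Aᵐᵒᵖ carrier]
  [towerL : IsScalarTower k A carrier]
  [towerR : IsScalarTower k Aᵐᵒᵖ carrier]
  [comm : SMulCommClass A Aᵐᵒᵖ carrier]

instance (k : Type v) (A : Type u) [CommRing k] [Ring A] [Algebra k A] :
    CoeSort (Bimod k A) (Type u) := ⟨Bimod.carrier⟩

attribute [instance] Bimod.acg Bimod.modK Bimod.modL Bimod.modR Bimod.towerL Bimod.towerR
  Bimod.comm

section

variable {k : Type v} {A : Type u} [CommRing k] [Ring A] [Algebra k A]

/-- A `k`-linear map is left `A`-linear. -/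
def IsLeft {M N : Bimod k A} (φ : M →ₗ[k] N) : Prop := ∀ (a : A) (x : M), φ (a • x) = a • φ x

/-- A `k`-linear map is right `A`-linear. -/
def IsRight {M N : Bimod k A} (φ : M →ₗ[k] N) : Prop :=
  ∀ (a : A) (x : M), φ (op a • x) = op a • φ x

/-- A `k`-linear map is a morphism of bimodules. -/
def IsBimodMap {M N : Bimod k A} (φ : M →ₗ[k] N) : Prop := IsLeft φ ∧ IsRight φ

/-- The bimodule structure given by commuting left and right actions. -/
@[reducible] def Bimod.ofEnd (Q : Type u) [AddCommGroup Q] [Module k Q] (l : A →ₐ[k] Module.End k Q)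
    (r : Aᵐᵒᵖ →ₐ[k] Module.End k Q) (h : ∀ a b x, l a (r b x) = r b (l a x)) : Bimod k A :=
  letI : Module A Q := Module.compHom Q l.toRingHom
  letI : Module Aᵐᵒᵖ Q := Module.compHom Q r.toRingHom
  { carrier := Q
    towerL := ⟨fun c a x => by
      change l (c • a) x = c • l a x
      simp⟩
    towerR := ⟨fun c a x => by
      change r (c • a) x = c • r a x
      simp⟩
    comm := ⟨fun a b x => h a b x⟩ }

/-- The algebra `A` as a bimodule over itself. -/
def Bimod.self (k : Type v) (A : Type u) [CommRing k] [Ring A] [Algebra k A] : Bimod k A where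
  carrier := A

/-- For a bimodule `M`, the bimodule `A ⊗ M`, with `A` acting on the left on the factor `A` and
on the right on the factor `M`. -/
def Bimod.tens (M : Bimod k A) : Bimod k A :=
  Bimod.ofEnd (A ⊗[k] M)
    (AlgHom.ofLinearMap ((LinearMap.rTensorHom M).comp (Algebra.lsmul k k A).toLinearMap)
      (by ext; simp) (by intro a b; ext x y; simp))
    (AlgHom.ofLinearMap ((LinearMap.lTensorHom A).comp (Algebra.lsmul k k M).toLinearMap)
      (by ext; simp) (by intro a b; ext x y; simp))
    (by
      intro a b x
      induction x with
      | zero => simp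
      | tmul x y => simp
      | add x y hx hy => simp only [map_add, hx, hy])

/-- The pure tensor `a ⊗ x`. -/
def Bimod.cons (M : Bimod k A) : A →ₗ[k] M →ₗ[k] M.tens := TensorProduct.mk k A M

/-- The linear map on `A ⊗ M` given by a bilinear map. -/
def Bimod.tensLift {M : Bimod k A} {Z : Type*} [AddCommGroup Z] [Module k Z]
    (φ : A →ₗ[k] M →ₗ[k] Z) : M.tens →ₗ[k] Z := TensorProduct.lift φ

@[simp] lemma Bimod.tensLift_cons {M : Bimod k A} {Z : Type*} [AddCommGroup Z] [Module k Z]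
    (φ : A →ₗ[k] M →ₗ[k] Z) (a : A) (x : M) : Bimod.tensLift φ (M.cons a x) = φ a x :=
  TensorProduct.lift.tmul a x

lemma Bimod.tens_hom_ext {M : Bimod k A} {Z : Type*} [AddCommGroup Z] [Module k Z]
    {φ ψ : M.tens →ₗ[k] Z} (h : ∀ a x, φ (M.cons a x) = ψ (M.cons a x)) : φ = ψ :=
  TensorProduct.ext' h

@[simp] lemma Bimod.smul_cons {M : Bimod k A} (a b : A) (x : M) :
    a • M.cons b x = M.cons (a * b) x := rfl

@[simp] lemma Bimod.op_smul_cons {M : Bimod k A} (a b : A) (x : M) :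
    op a • M.cons b x = M.cons b (op a • x) := rfl

/-- `1 ⊗ φ : A ⊗ M → A ⊗ N`. -/
def tensMap {M N : Bimod k A} (φ : M →ₗ[k] N) : M.tens →ₗ[k] N.tens :=
  Bimod.tensLift (N.cons.compl₂ φ)

@[simp] lemma tensMap_cons {M N : Bimod k A} (φ : M →ₗ[k] N) (a : A) (x : M) :
    tensMap φ (M.cons a x) = N.cons a (φ x) := by simp [tensMap]

/-- The left action `A ⊗ M → M`. -/
def Bimod.act (M : Bimod k A) : M.tens →ₗ[k] M :=
  Bimod.tensLift (Algebra.lsmul k k M : A →ₐ[k] Module.End k M).toLinearMap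

@[simp] lemma Bimod.act_cons {M : Bimod k A} (a : A) (x : M) : M.act (M.cons a x) = a • x := by
  simp [Bimod.act]

lemma isLeft_iff {M N : Bimod k A} (φ : M →ₗ[k] N) :
    IsLeft φ ↔ ∀ a : A, φ ∘ₗ (Algebra.lsmul k k M a) = (Algebra.lsmul k k N a) ∘ₗ φ :=
  ⟨fun h a => LinearMap.ext fun x => h a x, fun h a x => LinearMap.congr_fun (h a) x⟩

lemma isRight_iff {M N : Bimod k A} (φ : M →ₗ[k] N) :
    IsRight φ ↔ ∀ a : A, φ ∘ₗ (Algebra.lsmul k k M (op a)) = (Algebra.lsmul k k N (op a)) ∘ₗ φ :=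
  ⟨fun h a => LinearMap.ext fun x => h a x, fun h a x => LinearMap.congr_fun (h a) x⟩

lemma isLeft_of_cons {M N : Bimod k A} (φ : M.tens →ₗ[k] N)
    (h : ∀ a b x, φ (M.cons (a * b) x) = a • φ (M.cons b x)) : IsLeft φ :=
  (isLeft_iff φ).2 fun a => Bimod.tens_hom_ext fun b x => h a b x

lemma isRight_of_cons {M N : Bimod k A} (φ : M.tens →ₗ[k] N)
    (h : ∀ (a b : A) (x : M), φ (M.cons b (op a • x)) = op a • φ (M.cons b x)) : IsRight φ :=
  (isRight_iff φ).2 fun a => Bimod.tens_hom_ext fun b x => h a b x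

lemma isLeft_tensMap {M N : Bimod k A} (φ : M →ₗ[k] N) : IsLeft (tensMap φ) :=
  isLeft_of_cons _ fun a b x => by simp

lemma isRight_tensMap {M N : Bimod k A} {φ : M →ₗ[k] N} (h : IsRight φ) : IsRight (tensMap φ) :=
  isRight_of_cons _ fun a b x => by simp [h a x]

lemma isBimodMap_act (M : Bimod k A) : IsBimodMap M.act :=
  ⟨isLeft_of_cons _ fun a b x => by simp [mul_smul],
    isRight_of_cons _ fun a b x => by simp [smul_comm]⟩

lemma IsLeft.comp {M N P : Bimod k A} {ψ : N →ₗ[k] P} {φ : M →ₗ[k] N} (hψ : IsLeft ψ)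
    (hφ : IsLeft φ) : IsLeft (ψ ∘ₗ φ) := fun a x => by simp [hφ a x, hψ a]

lemma IsRight.comp {M N P : Bimod k A} {ψ : N →ₗ[k] P} {φ : M →ₗ[k] N} (hψ : IsRight ψ)
    (hφ : IsRight φ) : IsRight (ψ ∘ₗ φ) := fun a x => by simp [hφ a x, hψ a]

lemma IsBimodMap.comp {M N P : Bimod k A} {ψ : N →ₗ[k] P} {φ : M →ₗ[k] N} (hψ : IsBimodMap ψ)
    (hφ : IsBimodMap φ) : IsBimodMap (ψ ∘ₗ φ) := ⟨hψ.1.comp hφ.1, hψ.2.comp hφ.2⟩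

lemma IsBimodMap.sub {M N : Bimod k A} {ψ φ : M →ₗ[k] N} (hψ : IsBimodMap ψ)
    (hφ : IsBimodMap φ) : IsBimodMap (ψ - φ) :=
  ⟨fun a x => by simp [hφ.1 a x, hψ.1 a x, smul_sub],
    fun a x => by simp [hφ.2 a x, hψ.2 a x, smul_sub]⟩

lemma IsBimodMap.add {M N : Bimod k A} {ψ φ : M →ₗ[k] N} (hψ : IsBimodMap ψ)
    (hφ : IsBimodMap φ) : IsBimodMap (ψ + φ) :=
  ⟨fun a x => by simp [hφ.1 a x, hψ.1 a x, smul_add],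
    fun a x => by simp [hφ.2 a x, hψ.2 a x, smul_add]⟩

lemma IsBimodMap.neg {M N : Bimod k A} {φ : M →ₗ[k] N}
    (hφ : IsBimodMap φ) : IsBimodMap (-φ) :=
  ⟨fun a x => by simp [hφ.1 a x], fun a x => by simp [hφ.2 a x]⟩

lemma IsBimodMap.zero {M N : Bimod k A} : IsBimodMap (0 : M →ₗ[k] N) :=
  ⟨fun a x => by simp, fun a x => by simp⟩

lemma IsBimodMap.zsmul {M N : Bimod k A} {φ : M →ₗ[k] N} (n : ℤ)
    (hφ : IsBimodMap φ) : IsBimodMap (n • φ) :=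
  ⟨fun a x => by rw [LinearMap.smul_apply, LinearMap.smul_apply, hφ.1 a x, smul_comm],
    fun a x => by rw [LinearMap.smul_apply, LinearMap.smul_apply, hφ.2 a x, smul_comm]⟩

variable (k A) in
/-- `T n` is the bimodule `A^{⊗ (n+1)} = A ⊗ (A ⊗ (⋯ ⊗ A))`. -/
def T : ℕ → Bimod k A
  | 0 => Bimod.self k A
  | n + 1 => (T n).tens

/-- The pure tensor `a ⊗ x` in `A^{⊗ (n+2)}`. -/
def consT (n : ℕ) : A →ₗ[k] T k A n →ₗ[k] T k A (n + 1) := (T k A n).cons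

/-- The pure tensor `b₀ ⊗ ⋯ ⊗ b_n` in `A^{⊗ (n+1)}`. -/
def pure : ∀ n : ℕ, (Fin (n + 1) → A) → T k A n
  | 0, b => (b 0 : A)
  | n + 1, b => consT n (b 0) (pure n (Fin.tail b))

/-- From `d : A ⊗ M → M`, the map `A ⊗ (A ⊗ M) → A ⊗ M`, `a ⊗ x ↦ a x - a ⊗ d x`. -/
def barStep {M : Bimod k A} (d : M.tens →ₗ[k] M) : M.tens.tens →ₗ[k] M.tens :=
  M.tens.act - tensMap d

variable (k A) in
/-- The bar differential `A^{⊗ (n+2)} → A^{⊗ (n+1)}`, that is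
`d (a ⊗ x) = a x - a ⊗ d x`, starting from the multiplication `A ⊗ A → A`. -/
def dT : ∀ n : ℕ, T k A (n + 1) →ₗ[k] T k A n
  | 0 => (T k A 0).act
  | n + 1 => barStep (dT n)

lemma isBimodMap_dT : ∀ n, IsBimodMap (dT k A n)
  | 0 => isBimodMap_act _
  | n + 1 => IsBimodMap.sub (M := (T k A n).tens.tens) (N := (T k A n).tens) (isBimodMap_act _)
      ⟨isLeft_tensMap _, isRight_tensMap (isBimodMap_dT n).2⟩

@[simp] lemma dT_cons (n : ℕ) (a : A) (x : T k A (n + 1)) :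
    dT k A (n + 1) (consT (n + 1) a x) = a • x - consT n a (dT k A n x) := by
  have h1 := Bimod.act_cons a x
  have h2 := tensMap_cons (dT k A n) a x
  exact congrArg₂ (fun y z : (T k A n).tens => y - z) h1 h2

lemma dT_zero (a : A) (x : T k A 0) : dT k A 0 (consT 0 a x) = a • x :=
  Bimod.act_cons (M := T k A 0) a x

lemma T_hom_ext {n : ℕ} {Z : Type*} [AddCommGroup Z] [Module k Z]
    {φ ψ : T k A (n + 1) →ₗ[k] Z} (h : ∀ a x, φ (consT n a x) = ψ (consT n a x)) : φ = ψ :=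
  Bimod.tens_hom_ext (M := T k A n) h

instance (M : Bimod k A) : SMulCommClass Aᵐᵒᵖ A M := SMulCommClass.symm _ _ _

/-- The linear map on `A^{⊗ (n+2)}` given by a bilinear map. -/
def liftT {n : ℕ} {Z : Type*} [AddCommGroup Z] [Module k Z] (φ : A →ₗ[k] T k A n →ₗ[k] Z) :
    T k A (n + 1) →ₗ[k] Z := Bimod.tensLift (M := T k A n) φ

@[simp] lemma liftT_consT {n : ℕ} {Z : Type*} [AddCommGroup Z] [Module k Z]
    (φ : A →ₗ[k] T k A n →ₗ[k] Z) (a : A) (x : T k A n) : liftT φ (consT n a x) = φ a x :=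
  TensorProduct.lift.tmul a x

@[simp] lemma smul_consT (n : ℕ) (a b : A) (x : T k A n) :
    a • consT n b x = consT n (a * b) x := rfl

@[simp] lemma op_smul_consT (n : ℕ) (a b : A) (x : T k A n) :
    op a • consT n b x = consT n b (op a • x) := rfl

lemma dT_dT : ∀ n, dT k A n ∘ₗ dT k A (n + 1) = 0
  | 0 => T_hom_ext fun a x => by
      simp [(isBimodMap_dT (k := k) (A := A) 0).1 a x, dT_zero]
  | n + 1 => T_hom_ext fun a x => by
      have := LinearMap.congr_fun (dT_dT n) x
      simp only [LinearMap.comp_apply, LinearMap.zero_apply] at this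
      simp [(isBimodMap_dT (k := k) (A := A) (n + 1)).1 a x, this]

lemma contractNth_succ_tail {n : ℕ} (b : Fin (n + 3) → A) (j : Fin (n + 1)) :
    Fin.contractNth j.succ.castSucc (· * ·) b 0 = b 0 ∧
    Fin.tail (Fin.contractNth j.succ.castSucc (· * ·) b) =
      Fin.contractNth j.castSucc (· * ·) (Fin.tail b) := by
  constructor
  · simp [Fin.contractNth]
  · ext i
    simp [Fin.contractNth, Fin.tail]

/-- On pure tensors the bar differential is the alternating sum of the multiplications of
neighbours. -/
lemma dT_pure : ∀ (n : ℕ) (b : Fin (n + 2) → A),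
    dT k A n (pure (n + 1) b) =
      ∑ j : Fin (n + 1), (-1 : ℤ) ^ (j : ℕ) • pure n (Fin.contractNth j.castSucc (· * ·) b)
  | 0, b => by
      rw [Fin.sum_univ_one]
      simp only [Fin.val_zero, pow_zero, one_smul]
      change dT k A 0 (consT 0 _ _) = _
      rw [dT_zero]
      rfl
  | n + 1, b => by
      rw [Fin.sum_univ_succ]
      change dT k A (n + 1) (consT (n + 1) _ _) = _
      rw [dT_cons, dT_pure n, sub_eq_add_neg, map_sum, ← Finset.sum_neg_distrib]
      congr 1
      · simp only [Fin.val_zero, pow_zero, one_smul]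
        change b 0 • consT n (b 1) _ = consT n _ _
        rw [smul_consT]
        rfl
      · refine Finset.sum_congr rfl fun j _ => ?_
        rw [map_zsmul, Fin.val_succ, pow_succ, mul_neg_one, neg_smul]
        congr 2
        change _ = consT n _ _
        rw [(contractNth_succ_tail b j).1, (contractNth_succ_tail b j).2]


lemma T_hom_ext_pure : ∀ {n : ℕ} {Z : Type*} [AddCommGroup Z] [Module k Z]
    {φ ψ : T k A n →ₗ[k] Z}, (∀ b, φ (pure n b) = ψ (pure n b)) → φ = ψ
  | 0, _, _, _, _, _, h => LinearMap.ext fun x => h fun _ => x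
  | n + 1, _, _, _, φ, ψ, h => T_hom_ext fun a x => by
      have := T_hom_ext_pure (φ := φ ∘ₗ consT n a) (ψ := ψ ∘ₗ consT n a)
        fun b => h (Fin.cons a b)
      exact LinearMap.congr_fun this x

/-- The image of a morphism of bimodules, as a bimodule. -/
def Bimod.range {M N : Bimod k A} (φ : M →ₗ[k] N) (h : IsBimodMap φ) : Bimod k A :=
  letI : SMul A (LinearMap.range φ) := ⟨fun a x => ⟨a • (x : N), by
    obtain ⟨_, y, rfl⟩ := x
    exact ⟨a • y, h.1 a y⟩⟩⟩
  letI : SMul Aᵐᵒᵖ (LinearMap.range φ) := ⟨fun a x => ⟨a • (x : N), by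
    obtain ⟨_, y, rfl⟩ := x
    exact ⟨a • y, h.2 a.unop y⟩⟩⟩
  letI : Module A (LinearMap.range φ) :=
    Function.Injective.module A (LinearMap.range φ).subtype.toAddMonoidHom
      Subtype.val_injective fun _ _ => rfl
  letI : Module Aᵐᵒᵖ (LinearMap.range φ) :=
    Function.Injective.module Aᵐᵒᵖ (LinearMap.range φ).subtype.toAddMonoidHom
      Subtype.val_injective fun _ _ => rfl
  { carrier := LinearMap.range φ
    towerL := ⟨fun c a x => Subtype.ext (smul_assoc c a (x : N))⟩
    towerR := ⟨fun c a x => Subtype.ext (smul_assoc c a (x : N))⟩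
    comm := ⟨fun a b x => Subtype.ext (smul_comm a b (x : N))⟩ }

variable (k A) in
/-- The bimodule `Ω^p(A)`: the image of the bar differential `A^{⊗ (p+2)} → A^{⊗ (p+1)}`. For
`p = 0` this is `A` itself, the multiplication being surjective. -/
def Om (p : ℕ) : Bimod k A := Bimod.range (dT k A p) (isBimodMap_dT p)

variable (k A) in
/-- The inclusion `Ω^p(A) ⊆ A^{⊗ (p+1)}`. -/
def omIncl (p : ℕ) : Om k A p →ₗ[k] T k A p := (LinearMap.range (dT k A p)).subtype

variable (k A) in
/-- The bar differential as a surjection `A^{⊗ (p+2)} → Ω^p(A)`. -/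
def dOm (p : ℕ) : T k A (p + 1) →ₗ[k] Om k A p := (dT k A p).rangeRestrict

lemma isBimodMap_omIncl (p : ℕ) : IsBimodMap (omIncl k A p) :=
  ⟨fun _ _ => rfl, fun _ _ => rfl⟩

lemma isBimodMap_dOm (p : ℕ) : IsBimodMap (dOm k A p) :=
  ⟨fun a x => Subtype.ext ((isBimodMap_dT p).1 a x),
    fun a x => Subtype.ext ((isBimodMap_dT p).2 a x)⟩

lemma dOm_dT (p : ℕ) : dOm k A p ∘ₗ dT k A (p + 1) = 0 :=
  LinearMap.ext fun x => Subtype.ext (LinearMap.congr_fun (dT_dT p) x)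

lemma dT_omIncl (p : ℕ) (x : Om k A (p + 1)) : dT k A p (omIncl k A (p + 1) x) = 0 := by
  obtain ⟨_, y, rfl⟩ := x
  exact LinearMap.congr_fun (dT_dT p) y

/-! ### Hochschild cochains -/

/-- Hochschild `m`-cochains with coefficients in `M`, that is `Hom_k(A^{⊗ m}, M)`. -/
abbrev Cochain (m : ℕ) (M : Bimod k A) := MultilinearMap k (fun _ : Fin m => A) M

/-- The Hochschild differential `δ f` of an `m`-cochain. -/
def hochD {m : ℕ} {M : Bimod k A} (f : Cochain m M) (b : Fin (m + 1) → A) : M :=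
  b 0 • f (Fin.tail b) +
    ∑ j : Fin m, (-1 : ℤ) ^ ((j : ℕ) + 1) • f (Fin.contractNth j.castSucc (· * ·) b) +
    (-1 : ℤ) ^ (m + 1) • op (b (Fin.last m)) • f (Fin.init b)

/-- `f` is a Hochschild cocycle. -/
def IsCocycle {m : ℕ} {M : Bimod k A} (f : Cochain m M) : Prop := ∀ b, hochD f b = 0

/-- The identification `A^{⊗ 1} = A`. -/
def toA : T k A 0 →ₗ[k] A := LinearMap.id

/-- The map `A^{⊗ m} ⊗ A → M`, `b ⊗ c ↦ f(b) c`. -/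
def evalR {M : Bimod k A} : ∀ m : ℕ, Cochain m M →ₗ[k] (T k A m →ₗ[k] M)
  | 0 =>
    { toFun f :=
        { toFun c := op (toA c) • f ![]
          map_add' x y := by rw [map_add, op_add, add_smul]
          map_smul' c x := by rw [map_smul, op_smul, smul_assoc, RingHom.id_apply] }
      map_add' f g := LinearMap.ext fun x => smul_add (op (toA x)) (f ![]) (g ![])
      map_smul' c f := LinearMap.ext fun x => smul_comm (op (toA x)) c (f ![]) }
  | m + 1 =>
    { toFun f := liftT (evalR m ∘ₗ f.curryLeft)
      map_add' f g := T_hom_ext fun a x => by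
        simp only [LinearMap.add_apply, liftT_consT, LinearMap.comp_apply]
        rw [← LinearMap.add_apply, ← map_add]
        rfl
      map_smul' c f := T_hom_ext fun a x => by
        simp only [LinearMap.smul_apply, liftT_consT, LinearMap.comp_apply, RingHom.id_apply]
        rw [← LinearMap.smul_apply, ← map_smul]
        rfl }

lemma evalR_cons {M : Bimod k A} {m : ℕ} (f : Cochain (m + 1) M) (a : A) (x : T k A m) :
    evalR (m + 1) f (consT m a x) = evalR m (f.curryLeft a) x :=
  liftT_consT (evalR m ∘ₗ f.curryLeft) a x

lemma evalR_pure {M : Bimod k A} : ∀ {m : ℕ} (f : Cochain m M) (b : Fin (m + 1) → A),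
    evalR m f (pure m b) = op (b (Fin.last m)) • f (Fin.init b)
  | 0, f, b => by
      change op (b 0) • f ![] = op (b 0) • f _
      congr 2
      exact Subsingleton.elim _ _
  | m + 1, f, b => by
      change evalR (m + 1) f (consT m _ _) = _
      rw [evalR_cons, evalR_pure, MultilinearMap.curryLeft_apply]
      congr 2
      ext i
      refine Fin.cases ?_ (fun i => ?_) i <;> rfl

lemma isRight_evalR {M : Bimod k A} : ∀ {m : ℕ} (f : Cochain m M), IsRight (evalR m f)
  | 0, f => fun a x => by
      change op (toA x * a) • f ![] = op a • op (toA x) • f ![]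
      rw [op_mul, mul_smul]
  | m + 1, f => isRight_of_cons (M := T k A m) _ fun a b x => by
      have h1 := evalR_cons f b (op a • x)
      have h2 := evalR_cons f b x
      have h3 := isRight_evalR (f.curryLeft b) a x
      exact h1.trans (h3.trans (congrArg (op a • ·) h2.symm))

/-- The bimodule map `A ⊗ A^{⊗ m} ⊗ A → M`, `a ⊗ b ⊗ c ↦ a f(b) c`, of a cochain. -/
def biext {m : ℕ} {M : Bimod k A} (f : Cochain m M) : T k A (m + 1) →ₗ[k] M :=
  M.act ∘ₗ tensMap (evalR m f)

lemma biext_cons {m : ℕ} {M : Bimod k A} (f : Cochain m M) (a : A) (x : T k A m) :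
    biext f (consT m a x) = a • evalR m f x := by
  change M.act (tensMap _ ((T k A m).cons a x)) = _
  rw [tensMap_cons, Bimod.act_cons]

lemma biext_pure {m : ℕ} {M : Bimod k A} (f : Cochain m M) (b : Fin (m + 2) → A) :
    biext f (pure (m + 1) b) =
      b 0 • op (b (Fin.last (m + 1))) • f (fun i => b i.castSucc.succ) := by
  change biext f (consT m _ _) = _
  rw [biext_cons, evalR_pure]
  rfl

lemma isBimodMap_biext {m : ℕ} {M : Bimod k A} (f : Cochain m M) : IsBimodMap (biext f) :=
  (isBimodMap_act M).comp ⟨isLeft_tensMap _, isRight_tensMap (isRight_evalR f)⟩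

lemma contractNth_first {m : ℕ} (b : Fin (m + 3) → A) :
    Fin.contractNth (Fin.castSucc 0) (· * ·) b 0 = b 0 * b (Fin.castSucc 0).succ ∧
    Fin.contractNth (Fin.castSucc 0) (· * ·) b (Fin.last (m + 1)) = b (Fin.last (m + 2)) ∧
    (fun i : Fin m => Fin.contractNth (Fin.castSucc 0) (· * ·) b i.castSucc.succ) =
      Fin.tail fun i => b i.castSucc.succ := by
  refine ⟨by simp [Fin.contractNth], by simp [Fin.contractNth], ?_⟩
  ext i
  simp [Fin.contractNth, Fin.tail]

lemma contractNth_middle {m : ℕ} (b : Fin (m + 3) → A) (j : Fin m) :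
    Fin.contractNth j.castSucc.succ.castSucc (· * ·) b 0 = b 0 ∧
    Fin.contractNth j.castSucc.succ.castSucc (· * ·) b (Fin.last (m + 1)) = b (Fin.last (m + 2)) ∧
    (fun i : Fin m => Fin.contractNth j.castSucc.succ.castSucc (· * ·) b i.castSucc.succ) =
      Fin.contractNth j.castSucc (· * ·) fun i => b i.castSucc.succ := by
  have hj := j.2
  refine ⟨by simp [Fin.contractNth], ?_, ?_⟩
  · have h2 : ¬ (m + 1 < (j : ℕ) + 1) := by omega
    have h3 : ¬ (m + 1 = (j : ℕ) + 1) := by omega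
    simp only [Fin.contractNth, Fin.val_last, Fin.val_castSucc, Fin.val_succ, h2, h3, if_false,
      Fin.succ_last]
  · ext i
    simp [Fin.contractNth]

lemma contractNth_final {m : ℕ} (b : Fin (m + 3) → A) :
    Fin.contractNth (Fin.last m).succ.castSucc (· * ·) b 0 = b 0 ∧
    Fin.contractNth (Fin.last m).succ.castSucc (· * ·) b (Fin.last (m + 1)) =
      b (Fin.last m).castSucc.succ * b (Fin.last (m + 2)) ∧
    (fun i : Fin m => Fin.contractNth (Fin.last m).succ.castSucc (· * ·) b i.castSucc.succ) =
      Fin.init fun i => b i.castSucc.succ := by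
  refine ⟨by simp [Fin.contractNth], ?_, ?_⟩
  · simp [Fin.contractNth]
    rfl
  · ext i
    simp [Fin.contractNth, Fin.init]

lemma biext_dT {m : ℕ} {M : Bimod k A} {f : Cochain m M} (hf : IsCocycle f) :
    biext f ∘ₗ dT k A (m + 1) = 0 := T_hom_ext_pure fun b => by
  have h := congrArg (fun x => b 0 • op (b (Fin.last (m + 2))) • x) (hf fun i => b i.castSucc.succ)
  simp only [hochD, smul_add, smul_zero] at h
  rw [LinearMap.comp_apply, dT_pure, map_sum, Fin.sum_univ_succ, Fin.sum_univ_castSucc,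
    LinearMap.zero_apply, ← h, ← add_assoc]
  congr 1
  · congr 1
    · obtain ⟨h0, h1, h2⟩ := contractNth_first b
      rw [map_zsmul, biext_pure, h0, h1, h2]
      simp only [Fin.val_zero, pow_zero, one_smul]
      rw [smul_comm (op (b (Fin.last (m + 2)))), ← mul_smul]
    · rw [Finset.smul_sum, Finset.smul_sum]
      refine Finset.sum_congr rfl fun j _ => ?_
      obtain ⟨h0, h1, h2⟩ := contractNth_middle b j
      rw [map_zsmul, biext_pure, smul_comm (op _) ((-1 : ℤ) ^ _), smul_comm (b 0) ((-1 : ℤ) ^ _),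
        h0, h1, h2]
      rfl
  · obtain ⟨h0, h1, h2⟩ := contractNth_final b
    rw [map_zsmul, biext_pure, smul_comm (op _) ((-1 : ℤ) ^ _), smul_comm (b 0) ((-1 : ℤ) ^ _),
      ← mul_smul (op _) (op _), ← op_mul, h0, h1, h2]
    rfl


/-! ### Splitting and joining tensors -/

/-- Transport along an equality of tensor lengths. -/
def castT {a b : ℕ} : a = b → (T k A a →ₗ[k] T k A b)
  | rfl => LinearMap.id

@[simp] lemma castT_rfl {a : ℕ} (x : T k A a) : castT (k := k) (A := A) (rfl : a = a) x = x := rfl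

lemma castT_consT {a b : ℕ} (h : a = b) (h' : a + 1 = b + 1) (c : A) (x : T k A a) :
    castT h' (consT a c x) = consT b c (castT h x) := by
  subst h
  rfl

lemma isBimodMap_castT {a b : ℕ} (h : a = b) :
    IsBimodMap (castT h : T k A a →ₗ[k] T k A b) := by
  subst h
  exact ⟨fun _ _ => rfl, fun _ _ => rfl⟩

lemma dT_castT {a b : ℕ} (h : a = b) (h' : a + 1 = b + 1) :
    dT k A b ∘ₗ castT h' = castT h ∘ₗ dT k A a := by
  subst h
  rfl

/-- Deconcatenation `A^{⊗ (s+m+2)} → A^{⊗ (m+1)} ⊗ A^{⊗ (s+1)}`. -/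
def splitT : ∀ m s : ℕ, T k A (s + m + 1) →ₗ[k] T k A m ⊗[k] T k A s
  | 0, s => liftT (TensorProduct.mk k (T k A 0) (T k A s) : A →ₗ[k] _)
  | m + 1, s => liftT ((LinearMap.rTensorHom (T k A s) ∘ₗ consT m).compl₂ (splitT m s))

/-- Concatenation `A^{⊗ (p+1)} ⊗ A^{⊗ (s+1)} → A^{⊗ (s+p+2)}`. -/
def concatT : ∀ p s : ℕ, T k A p →ₗ[k] T k A s →ₗ[k] T k A (s + p + 1)
  | 0, s => (consT s : A →ₗ[k] _)
  | p + 1, s => liftT (LinearMap.mk₂ k (fun a x => consT (s + p + 1) a ∘ₗ concatT p s x)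
      (fun a b x => by ext; simp) (fun c a x => by ext; simp)
      (fun a x y => by ext; simp) (fun c a x => by ext; simp))

/-- Appending a factor on the right, `x ⊗ b`. -/
def snoc : ∀ m : ℕ, T k A m →ₗ[k] A →ₗ[k] T k A (m + 1)
  | 0 => (consT 0 : A →ₗ[k] A →ₗ[k] _)
  | m + 1 => liftT (LinearMap.mk₂ k (fun a x => consT (m + 1) a ∘ₗ snoc m x)
      (fun a b x => by ext; simp) (fun c a x => by ext; simp)
      (fun a x y => by ext; simp) (fun c a x => by ext; simp))

lemma splitT_zero (s : ℕ) (a : A) (x : T k A s) :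
    splitT 0 s (consT s a x) = (show T k A 0 from a) ⊗ₜ x := liftT_consT _ a x

lemma splitT_succ (m s : ℕ) (a : A) (x : T k A (s + m + 1)) :
    splitT (m + 1) s (consT (s + m + 1) a x) =
      LinearMap.rTensor (T k A s) (consT m a) (splitT m s x) :=
  liftT_consT _ a x

lemma concatT_zero (s : ℕ) (a : T k A 0) (y : T k A s) :
    concatT 0 s a y = consT s (toA a) y := rfl

lemma concatT_succ (p s : ℕ) (a : A) (x : T k A p) (y : T k A s) :
    concatT (p + 1) s (consT p a x) y = consT (s + p + 1) a (concatT p s x y) := by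
  exact LinearMap.congr_fun (liftT_consT _ a x) y

lemma snoc_zero (a : T k A 0) (b : A) : snoc 0 a b = consT 0 (toA a) (show T k A 0 from b) := rfl

lemma snoc_succ (m : ℕ) (a : A) (x : T k A m) (b : A) :
    snoc (m + 1) (consT m a x) b = consT (m + 1) a (snoc m x b) := by
  exact LinearMap.congr_fun (liftT_consT _ a x) b

/-- Induction on the length and linearity: a property of `x : A^{⊗ (n+2)}` follows from pure
tensors. -/
@[elab_as_elim]
lemma consT_induction {n : ℕ} {P : T k A (n + 1) → Prop} (x : T k A (n + 1))
    (h0 : P 0) (ha : ∀ x y, P x → P y → P (x + y)) (hc : ∀ a x, P (consT n a x)) : P x :=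
  TensorProduct.induction_on (motive := P) (x : A ⊗[k] T k A n) h0 hc ha

lemma snoc_smul : ∀ (m : ℕ) (a b : A) (x : T k A m), snoc m (a • x) b = a • snoc m x b
  | 0, a, b, x => rfl
  | m + 1, a, b, x => by
      refine consT_induction x ?_ (fun x y hx hy => ?_) fun c x => ?_
      · simp only [map_zero, smul_zero, LinearMap.zero_apply, add_zero]
      · rw [smul_add, map_add, LinearMap.add_apply, hx, hy, map_add, LinearMap.add_apply, smul_add]
      · rw [smul_consT, snoc_succ, snoc_succ, smul_consT]

lemma snoc_mul : ∀ (m : ℕ) (a b : A) (x : T k A m), snoc m x (b * a) = op a • snoc m x b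
  | 0, a, b, x => rfl
  | m + 1, a, b, x => by
      refine consT_induction x ?_ (fun x y hx hy => ?_) fun c x => ?_
      · simp only [map_zero, smul_zero, LinearMap.zero_apply, add_zero]
      · rw [map_add, LinearMap.add_apply, LinearMap.add_apply, hx, hy, smul_add]
      · rw [snoc_succ, snoc_succ, snoc_mul, op_smul_consT]

lemma dT_snoc : ∀ (m : ℕ) (x : T k A (m + 1)) (b : A), dT k A (m + 1) (snoc (m + 1) x b) =
    snoc m (dT k A m x) b + (-1 : ℤ) ^ (m + 1) • op b • x
  | 0, x, b => by
      refine consT_induction x ?_ (fun x y hx hy => ?_) fun c x => ?_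
      · simp only [map_zero, smul_zero, LinearMap.zero_apply, add_zero]
      · rw [map_add, LinearMap.add_apply, map_add, hx, hy]
        simp only [map_add, LinearMap.add_apply, smul_add]
        abel
      · rw [snoc_succ, dT_cons, dT_zero, snoc_smul, snoc_zero, dT_zero, op_smul_consT]
        simp only [zero_add, pow_one, neg_smul, one_smul, ← sub_eq_add_neg]
        rfl
  | m + 1, x, b => by
      refine consT_induction x ?_ (fun x y hx hy => ?_) fun c x => ?_
      · simp only [map_zero, smul_zero, LinearMap.zero_apply, add_zero]
      · rw [map_add, LinearMap.add_apply, map_add, hx, hy]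
        simp only [map_add, LinearMap.add_apply, smul_add]
        abel
      · rw [snoc_succ, dT_cons, dT_snoc, dT_cons, map_sub, LinearMap.sub_apply, snoc_smul,
          snoc_succ, map_add, op_smul_consT, map_zsmul, pow_succ _ (m + 1), mul_neg_one, neg_smul]
        abel

lemma splitT_smul : ∀ (m s : ℕ) (a : A) (x : T k A (s + m + 1)), splitT m s (a • x) =
    LinearMap.rTensor (T k A s) (Algebra.lsmul k k (T k A m) a) (splitT m s x)
  | 0, s, a, x => by
      refine consT_induction x ?_ (fun x y hx hy => ?_) fun c x => ?_
      · simp only [map_zero, smul_zero, LinearMap.zero_apply, add_zero]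
      · rw [smul_add, map_add, hx, hy, map_add, map_add]
      · rw [smul_consT, splitT_zero, splitT_zero]
        rfl
  | m + 1, s, a, x => by
      refine consT_induction x ?_ (fun x y hx hy => ?_) fun c x => ?_
      · simp only [map_zero, smul_zero, LinearMap.zero_apply, add_zero]
      · rw [smul_add, map_add, hx, hy, map_add, map_add]
      · have h1 := splitT_succ m s (a * c) x
        have h2 := splitT_succ m s c x
        refine (h1.trans ?_).trans (congrArg _ h2.symm)
        generalize splitT m s x = w
        rw [← LinearMap.comp_apply, ← LinearMap.rTensor_comp]
        rfl

lemma splitT_op_smul : ∀ (m s : ℕ) (a : A) (x : T k A (s + m + 1)), splitT m s (op a • x) =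
    LinearMap.lTensor (T k A m) (Algebra.lsmul k k (T k A s) (op a)) (splitT m s x)
  | 0, s, a, x => by
      refine consT_induction x ?_ (fun x y hx hy => ?_) fun c x => ?_
      · simp only [map_zero, smul_zero, LinearMap.zero_apply, add_zero]
      · rw [smul_add, map_add, hx, hy, map_add, map_add]
      · rw [op_smul_consT, splitT_zero, splitT_zero]
        rfl
  | m + 1, s, a, x => by
      refine consT_induction x ?_ (fun x y hx hy => ?_) fun c x => ?_
      · simp only [map_zero, smul_zero, LinearMap.zero_apply, add_zero]
      · rw [smul_add, map_add, hx, hy, map_add, map_add]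
      · have h1 := splitT_succ m s c (op a • x)
        have h2 := splitT_succ m s c x
        refine (h1.trans ?_).trans (congrArg _ h2.symm)
        rw [splitT_op_smul]
        generalize splitT m s x = w
        rw [← LinearMap.comp_apply, ← LinearMap.comp_apply,
          LinearMap.rTensor_comp_lTensor, LinearMap.lTensor_comp_rTensor]

lemma concatT_smul : ∀ (p s : ℕ) (a : A) (x : T k A p) (y : T k A s),
    concatT p s (a • x) y = a • concatT p s x y
  | 0, s, a, x, y => rfl
  | p + 1, s, a, x, y => by
      refine consT_induction x ?_ (fun x z hx hz => ?_) fun c x => ?_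
      · simp only [map_zero, smul_zero, LinearMap.zero_apply, add_zero]
      · rw [smul_add, map_add, LinearMap.add_apply, hx, hz, map_add, LinearMap.add_apply, smul_add]
      · rw [smul_consT, concatT_succ, concatT_succ]
        rfl

lemma concatT_op_smul : ∀ (p s : ℕ) (a : A) (x : T k A p) (y : T k A s),
    concatT p s x (op a • y) = op a • concatT p s x y
  | 0, s, a, x, y => rfl
  | p + 1, s, a, x, y => by
      refine consT_induction x ?_ (fun x z hx hz => ?_) fun c x => ?_
      · simp only [map_zero, smul_zero, LinearMap.zero_apply, add_zero]
      · rw [map_add, LinearMap.add_apply, hx, hz, LinearMap.add_apply, smul_add]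
      · rw [concatT_succ, concatT_succ, concatT_op_smul]
        rfl

/-- Deconcatenation is compatible with the bar differential. -/
lemma splitT_dT : ∀ (m s : ℕ) (z : T k A (s + m + 1 + 1)), splitT m s (dT k A (s + m + 1) z) =
    LinearMap.rTensor (T k A s) (dT k A m) (splitT (m + 1) s z) +
      (-1 : ℤ) ^ (m + 1) • LinearMap.lTensor (T k A m) (dT k A s)
        (splitT m (s + 1) (castT (by omega) z))
  | 0, s, z => by
      refine consT_induction z ?_ (fun x y hx hy => ?_) fun a x => ?_
      · simp only [map_zero, smul_zero, LinearMap.zero_apply, add_zero]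
      · simp only [map_add, hx, hy, smul_add]
        abel
      · refine consT_induction x ?_ (fun x y hx hy => ?_) fun b x => ?_
        · simp only [map_zero, smul_zero, LinearMap.zero_apply, add_zero]
        · simp only [map_add, hx, hy, smul_add]
          abel
        · have h1 := splitT_succ 0 s a (consT s b x)
          have h2 := dT_cons s a (consT s b x)
          have h3 := splitT_zero s (a * b) x
          have h4 := splitT_zero s a (dT k A s (consT s b x))
          have h5 := splitT_zero (s + 1) a (consT s b x)
          change splitT 0 s (dT k A (s + 1) (consT (s + 1) a (consT s b x))) =
            LinearMap.rTensor (T k A s) (dT k A 0)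
              (splitT (0 + 1) s (consT (s + 0 + 1) a (consT s b x))) +
            (-1 : ℤ) ^ (0 + 1) • LinearMap.lTensor (T k A 0) (dT k A s)
              (splitT 0 (s + 1) (consT (s + 1) a (consT s b x)))
          rw [h1, h2, h5, splitT_zero, smul_consT]
          refine (map_sub (splitT 0 s) _ _).trans ?_
          rw [h3, h4]
          simp only [LinearMap.rTensor_tmul, LinearMap.lTensor_tmul, dT_zero, zero_add, pow_one,
            neg_smul, one_smul, ← sub_eq_add_neg]
          rfl
  | m + 1, s, z => by
      refine consT_induction z ?_ (fun x y hx hy => ?_) fun a x => ?_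
      · simp only [map_zero, smul_zero, LinearMap.zero_apply, add_zero]
      · simp only [map_add, hx, hy, smul_add]
        abel
      · have h1 := splitT_succ (m + 1) s a x
        have h2 := dT_cons (s + m + 1) a x
        have h3 := splitT_succ m s a (dT k A (s + m + 1) x)
        have h5 := splitT_succ m (s + 1) a (castT (by omega) x)
        have h6 : castT (by omega : s + (m + 1) + 1 + 1 = s + 1 + (m + 1) + 1)
          (consT (s + m + 1 + 1) a x) =
          consT (s + 1 + m + 1) a (castT (by omega) x) := castT_consT _ _ _ _
        refine (congrArg (splitT (m + 1) s) h2).trans ?_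
        refine (map_sub (splitT (m + 1) s) _ _).trans ?_
        refine Eq.trans ?_ (congrArg₂ (fun u v => LinearMap.rTensor (T k A s) (dT k A (m + 1)) u +
          (-1 : ℤ) ^ (m + 1 + 1) • LinearMap.lTensor (T k A (m + 1)) (dT k A s)
            (splitT (m + 1) (s + 1) v)) h1.symm h6.symm)
        refine Eq.trans ?_ (congrArg (fun u => _ +
          (-1 : ℤ) ^ (m + 1 + 1) • LinearMap.lTensor (T k A (m + 1)) (dT k A s) u) h5.symm)
        have h7 := splitT_smul (m + 1) s a x
        refine (congrArg₂ (fun u v => u - v) h7 (h3.trans (congrArg _ (splitT_dT m s x)))).trans ?_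
        generalize splitT m (s + 1) (castT _ x) = w
        generalize splitT (m + 1) s x = w'
        have e1 : LinearMap.rTensor (T k A s) (dT k A (m + 1))
            (LinearMap.rTensor (T k A s) (consT (m + 1) a) w') =
            LinearMap.rTensor (T k A s) (Algebra.lsmul k k (T k A (m + 1)) a) w' -
            LinearMap.rTensor (T k A s) (consT m a) (LinearMap.rTensor (T k A s) (dT k A m) w') := by
          rw [← LinearMap.comp_apply, ← LinearMap.comp_apply (LinearMap.rTensor (T k A s) _),
            ← LinearMap.rTensor_comp, ← LinearMap.rTensor_comp, ← LinearMap.sub_apply,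
            ← LinearMap.rTensor_sub]
          refine LinearMap.congr_fun (congrArg _ (LinearMap.ext fun x => ?_)) w'
          exact dT_cons m a x
        have e2 : LinearMap.lTensor (T k A (m + 1)) (dT k A s)
            (LinearMap.rTensor (T k A (s + 1)) (consT m a) w) =
            LinearMap.rTensor (T k A s) (consT m a) (LinearMap.lTensor (T k A m) (dT k A s) w) := by
          rw [← LinearMap.comp_apply, ← LinearMap.comp_apply,
            LinearMap.rTensor_comp_lTensor, LinearMap.lTensor_comp_rTensor]
        rw [e1, e2, map_add, map_zsmul, pow_succ _ (m + 1), mul_neg_one, neg_smul]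
        abel


/-- Coassociativity of deconcatenation, tested against bilinear maps. -/
lemma splitT_coassoc : ∀ (m s : ℕ) {Z : Type u} [AddCommGroup Z] [Module k Z]
    (φ : T k A (m + 1) →ₗ[k] T k A s →ₗ[k] Z) (ψ : T k A m →ₗ[k] T k A (s + 1) →ₗ[k] Z)
    (_ : ∀ x b y, ψ x (consT s b y) = φ (snoc m x b) y) (z : T k A (s + m + 1 + 1)),
    TensorProduct.lift φ (splitT (m + 1) s z) =
      TensorProduct.lift ψ (splitT m (s + 1) (castT (by omega) z))
  | 0, s, _, _, _, φ, ψ, h, z => by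
      refine consT_induction z ?_ (fun x y hx hy => ?_) fun a x => ?_
      · simp only [map_zero]
      · simp only [map_add, hx, hy]
      · refine consT_induction x ?_ (fun x y hx hy => ?_) fun b x => ?_
        · simp only [map_zero]
        · simp only [map_add, hx, hy]
        · have h1 := splitT_succ 0 s a (consT s b x)
          have h2 := splitT_zero (s + 1) a (consT s b x)
          refine (congrArg _ h1).trans (Eq.trans ?_ (congrArg _ h2.symm))
          rw [splitT_zero, LinearMap.rTensor_tmul, TensorProduct.lift.tmul,
            TensorProduct.lift.tmul, h]
          rfl
  | m + 1, s, _, _, _, φ, ψ, h, z => by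
      refine consT_induction z ?_ (fun x y hx hy => ?_) fun a x => ?_
      · simp only [map_zero]
      · simp only [map_add, hx, hy]
      · have h1 := splitT_succ (m + 1) s a x
        have h5 := splitT_succ m (s + 1) a (castT (by omega) x)
        have h6 : castT (by omega : s + (m + 1) + 1 + 1 = s + 1 + (m + 1) + 1)
          (consT (s + m + 1 + 1) a x) =
          consT (s + 1 + m + 1) a (castT (by omega) x) := castT_consT _ _ _ _
        refine (congrArg _ h1).trans (Eq.trans ?_ (congrArg (fun u =>
          TensorProduct.lift ψ (splitT (m + 1) (s + 1) u)) h6.symm))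
        refine Eq.trans ?_ (congrArg _ h5.symm)
        have ih := splitT_coassoc m s (φ ∘ₗ consT (m + 1) a) (ψ ∘ₗ consT m a) (fun x b y => by
          rw [LinearMap.comp_apply, h, snoc_succ, LinearMap.comp_apply]) x
        generalize splitT m (s + 1) (castT _ x) = w at ih ⊢
        generalize splitT (m + 1) s x = w' at ih ⊢
        rw [← LinearMap.comp_apply (TensorProduct.lift φ),
          ← LinearMap.comp_apply (TensorProduct.lift ψ)]
        refine Eq.trans (LinearMap.congr_fun ?_ w') (ih.trans (LinearMap.congr_fun ?_ w))
        · exact TensorProduct.ext' fun _ _ => rfl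
        · exact TensorProduct.ext' fun _ _ => rfl

/-- The part of the differential of a concatenation that involves the differential of the left
factor. -/
def concatLeft : ∀ p s : ℕ, T k A p → T k A (s + 1) → T k A (s + p + 1)
  | 0, _, _, _ => 0
  | q + 1, s, x, y => castT (by omega) (concatT q (s + 1) (dT k A q x) y)

lemma dT_concatT : ∀ (p s : ℕ) (x : T k A p) (b : A) (y : T k A s),
    dT k A (s + p + 1) (castT (by omega) (concatT p (s + 1) x (consT s b y))) =
      concatLeft p s x (consT s b y) + (-1 : ℤ) ^ p • concatT p s (op b • x) y +
        (-1 : ℤ) ^ (p + 1) • concatT p s x (dT k A s (consT s b y))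
  | 0, s, x, b, y => by
      refine (dT_cons s (toA x) (consT s b y)).trans ?_
      rw [smul_consT]
      simp only [concatLeft, zero_add, pow_zero, pow_one, one_smul, neg_smul, ← sub_eq_add_neg]
      rfl
  | p + 1, s, x, b, y => by
      refine consT_induction x ?_ (fun x z hx hz => ?_) fun a x => ?_
      · simp only [concatLeft, map_zero, smul_zero, LinearMap.zero_apply, add_zero]
      · simp only [concatLeft, map_add, smul_add, LinearMap.add_apply] at hx hz ⊢
        rw [hx, hz]
        abel
      · rw [concatT_succ]
        have h6 : castT (by omega : s + 1 + (p + 1) + 1 = s + (p + 1) + 1 + 1)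
          (consT (s + 1 + p + 1) a (concatT p (s + 1) x (consT s b y))) =
          consT (s + p + 1 + 1) a (castT (by omega) (concatT p (s + 1) x (consT s b y))) :=
          castT_consT _ _ _ _
        refine (congrArg _ h6).trans ((dT_cons _ _ _).trans ?_)
        refine (congrArg (fun u => a • castT (by omega) (concatT p (s + 1) x (consT s b y)) -
          consT (s + p + 1) a u) (dT_concatT p s x b y)).trans ?_
        rw [op_smul_consT, concatT_succ, concatT_succ]
        have h7 : concatLeft (p + 1) s (consT p a x) (consT s b y) =
            a • castT (by omega) (concatT p (s + 1) x (consT s b y)) -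
              consT (s + p + 1) a (concatLeft p s x (consT s b y)) := by
          cases p with
          | zero =>
            change castT _ (concatT 0 (s + 1) (dT k A 0 _) _) = _
            rw [dT_zero, concatT_smul, (isBimodMap_castT _).1]
            simp only [concatLeft, map_zero, sub_zero]
          | succ q =>
            change castT _ (concatT (q + 1) (s + 1) (dT k A (q + 1) _) _) = _
            rw [dT_cons, map_sub, LinearMap.sub_apply, map_sub, concatT_smul,
              (isBimodMap_castT _).1, concatT_succ]
            congr 1
            exact castT_consT _ _ _ _
        rw [h7]
        simp only [map_add, map_zsmul, map_neg, pow_succ _ (p + 1), pow_succ _ p, mul_neg_one,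
          neg_smul, neg_neg]
        abel

lemma concatLeft_omIncl (p s : ℕ) (x : Om k A p) (y : T k A (s + 1)) :
    concatLeft p s (omIncl k A p x) y = 0 := by
  cases p with
  | zero => rfl
  | succ q =>
    rw [concatLeft, dT_omIncl, map_zero, LinearMap.zero_apply, map_zero]

/-- `x ↦ x ⊗ 1`. -/
def snocOne (m : ℕ) : T k A m →ₗ[k] T k A (m + 1) := (snoc m).flip 1

lemma apply_snoc {m : ℕ} {M : Bimod k A} {φ : T k A (m + 1) →ₗ[k] M} (h : IsRight φ)
    (x : T k A m) (b : A) : φ (snoc m x b) = op b • φ (snocOne m x) := by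
  rw [← h, snocOne, LinearMap.flip_apply, ← snoc_mul, one_mul]

lemma apply_snocOne_dT {m : ℕ} {M : Bimod k A} {φ : T k A (m + 1) →ₗ[k] M}
    (h : φ ∘ₗ dT k A (m + 1) = 0) (x : T k A (m + 1)) :
    φ (snocOne m (dT k A m x)) = (-1 : ℤ) ^ m • φ x := by
  have h1 := dT_snoc m x 1
  have h2 := LinearMap.congr_fun h (snoc (m + 1) x 1)
  rw [LinearMap.comp_apply, h1, map_add, LinearMap.zero_apply, map_zsmul, op_one, one_smul,
    pow_succ, mul_neg_one, neg_smul, ← sub_eq_add_neg, sub_eq_zero] at h2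
  exact h2

lemma apply_consT_dT {m : ℕ} {M : Bimod k A} {φ : T k A (m + 1) →ₗ[k] M}
    (h : φ ∘ₗ dT k A (m + 1) = 0) (x : T k A (m + 1)) :
    φ (consT m 1 (dT k A m x)) = φ x := by
  have h2 := LinearMap.congr_fun h (consT (m + 1) 1 x)
  rw [LinearMap.comp_apply, dT_cons, map_sub, LinearMap.zero_apply, one_smul, sub_eq_zero] at h2
  exact h2.symm

/-! ### The two lifts of a Hochschild cocycle -/

section Lifts

variable {m p : ℕ}

/-- `a₁ ⊗ ⋯ ⊗ a_{m+s+2} ↦ a₁ f(a₂, …, a_{m+1}) ⊗ a_{m+2} ⊗ ⋯ ⊗ a_{m+s+2}`. -/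
def leftLift (f : Cochain m (Om k A p)) (s : ℕ) : T k A (s + m + 1) →ₗ[k] T k A (s + p + 1) :=
  TensorProduct.lift (concatT p s ∘ₗ omIncl k A p ∘ₗ biext f ∘ₗ snocOne m) ∘ₗ splitT m s

lemma isBimodMap_leftLift (f : Cochain m (Om k A p)) (s : ℕ) : IsBimodMap (leftLift f s) := by
  constructor
  · intro a x
    rw [leftLift, LinearMap.comp_apply, splitT_smul, LinearMap.comp_apply]
    generalize splitT m s x = w
    induction w with
    | zero => simp only [map_zero, smul_zero]
    | add x y hx hy => simp only [map_add, smul_add, hx, hy]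
    | tmul x y =>
      rw [LinearMap.rTensor_tmul, TensorProduct.lift.tmul, TensorProduct.lift.tmul]
      simp only [LinearMap.comp_apply, snocOne, LinearMap.flip_apply]
      change concatT p s (omIncl k A p (biext f (snoc m (a • x) 1))) y = _
      rw [snoc_smul, (isBimodMap_biext f).1, (isBimodMap_omIncl p).1, concatT_smul]
  · intro a x
    rw [leftLift, LinearMap.comp_apply, splitT_op_smul, LinearMap.comp_apply]
    generalize splitT m s x = w
    induction w with
    | zero => simp only [map_zero, smul_zero]
    | add x y hx hy => simp only [map_add, smul_add, hx, hy]
    | tmul x y =>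
      rw [LinearMap.lTensor_tmul, TensorProduct.lift.tmul, TensorProduct.lift.tmul]
      exact concatT_op_smul _ _ _ _ _

lemma dT_leftLift {f : Cochain m (Om k A p)} (hf : IsCocycle f) (s : ℕ)
    (z : T k A (s + m + 1 + 1)) :
    dT k A (s + p + 1) (castT (by omega) (leftLift f (s + 1) (castT (by omega) z))) =
      (-1 : ℤ) ^ (m + p) • leftLift f s (dT k A (s + m + 1) z) := by
  let G : T k A m →ₗ[k] T k A p := omIncl k A p ∘ₗ biext f ∘ₗ snocOne m
  let c : T k A (s + 1 + p + 1) →ₗ[k] T k A (s + p + 1) :=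
    dT k A (s + p + 1) ∘ₗ castT (by omega)
  let χ : T k A m →ₗ[k] T k A (s + 1) →ₗ[k] T k A (s + p + 1) :=
    (concatT p s ∘ₗ G).compl₂ (dT k A s)
  let ω : T k A m →ₗ[k] T k A (s + 1) →ₗ[k] T k A (s + p + 1) :=
    (concatT p (s + 1) ∘ₗ G).compr₂ c
  have hsq : ((-1 : ℤ) ^ (m + p)) * ((-1 : ℤ) ^ (m + p)) = 1 := by
    rw [← pow_add, Even.neg_one_pow ⟨m + p, rfl⟩]
  have key := splitT_coassoc m s (Z := T k A (s + p + 1)) (concatT p s ∘ₗ G ∘ₗ dT k A m)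
    ((-1 : ℤ) ^ (m + p) • ω - (-1 : ℤ) ^ (m + 1) • χ) (fun x b y => by
      have h1 := dT_concatT p s (G x) b y
      rw [show concatLeft p s (G x) (consT s b y) = 0 from concatLeft_omIncl p s _ _,
        zero_add] at h1
      have h2 : ω x (consT s b y) = _ := h1
      have h3 : G (dT k A m (snoc m x b)) = (-1 : ℤ) ^ m • op b • G x := by
        change omIncl k A p (biext f (snocOne m (dT k A m (snoc m x b)))) =
          (-1 : ℤ) ^ m • op b • omIncl k A p (biext f (snocOne m x))
        rw [apply_snocOne_dT (biext_dT hf), apply_snoc (isBimodMap_biext f).2, map_zsmul,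
          (isBimodMap_omIncl p).2]
      change (-1 : ℤ) ^ (m + p) • ω x (consT s b y) - (-1 : ℤ) ^ (m + 1) • χ x (consT s b y) =
        concatT p s (G (dT k A m (snoc m x b))) y
      rw [h2, h3, map_zsmul, LinearMap.smul_apply]
      change _ - (-1 : ℤ) ^ (m + 1) • concatT p s (G x) (dT k A s (consT s b y)) = _
      rw [smul_add, ← mul_smul, ← mul_smul]
      have e1 : (-1 : ℤ) ^ (m + p) * (-1) ^ p = (-1) ^ m := by
        rw [← pow_add, add_assoc, pow_add, Even.neg_one_pow ⟨p, rfl⟩, mul_one]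
      have e2 : (-1 : ℤ) ^ (m + p) * (-1) ^ (p + 1) = (-1) ^ (m + 1) := by
        rw [pow_succ _ p, ← mul_assoc, e1, pow_succ]
      rw [e1, e2, add_sub_cancel_right]) z
  have hs := splitT_dT m s z
  change c (TensorProduct.lift (concatT p (s + 1) ∘ₗ G) (splitT m (s + 1) (castT _ z))) =
    (-1 : ℤ) ^ (m + p) • TensorProduct.lift (concatT p s ∘ₗ G) (splitT m s (dT k A (s + m + 1) z))
  rw [hs, map_add, map_zsmul]
  generalize splitT m (s + 1) (castT _ z) = w at key ⊢
  generalize splitT (m + 1) s z = w' at key ⊢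
  have a1 : ∀ w', TensorProduct.lift (concatT p s ∘ₗ G) (LinearMap.rTensor (T k A s) (dT k A m) w') =
      TensorProduct.lift (concatT p s ∘ₗ G ∘ₗ dT k A m) w' := fun w' => by
    induction w' with
    | zero => simp only [map_zero]
    | tmul x y => rfl
    | add x y hx hy => simp only [map_add, hx, hy]
  have a2 : ∀ w, TensorProduct.lift (concatT p s ∘ₗ G) (LinearMap.lTensor (T k A m) (dT k A s) w) =
      TensorProduct.lift χ w := fun w => by
    induction w with
    | zero => simp only [map_zero]
    | tmul x y => rfl
    | add x y hx hy => simp only [map_add, hx, hy]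
  have a3 : ∀ w, c (TensorProduct.lift (concatT p (s + 1) ∘ₗ G) w) = TensorProduct.lift ω w := fun w => by
    induction w with
    | zero => simp only [map_zero]
    | tmul x y => rfl
    | add x y hx hy => simp only [map_add, hx, hy]
  have a4 : TensorProduct.lift ((-1 : ℤ) ^ (m + p) • ω - (-1 : ℤ) ^ (m + 1) • χ) w =
      (-1 : ℤ) ^ (m + p) • TensorProduct.lift ω w -
        (-1 : ℤ) ^ (m + 1) • TensorProduct.lift χ w := by
    refine LinearMap.congr_fun (f := TensorProduct.lift _)
      (g := (-1 : ℤ) ^ (m + p) • TensorProduct.lift ω -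
        (-1 : ℤ) ^ (m + 1) • TensorProduct.lift χ) (TensorProduct.ext' fun x y => ?_) w
    simp only [TensorProduct.lift.tmul, LinearMap.sub_apply, LinearMap.smul_apply]
  rw [a1, a2, a3, key, a4, sub_add_cancel, ← mul_smul, hsq, one_smul]

/-- `id^{⊗ s} ⊗ F` for `F : A^{⊗ (m+1)} → A^{⊗ (p+1)}`. -/
def whiskT (F : T k A m →ₗ[k] T k A p) : ∀ s : ℕ, T k A (m + s) →ₗ[k] T k A (p + s)
  | 0 => F
  | s + 1 => tensMap (whiskT F s)

/-- `a₁ ⊗ ⋯ ⊗ a_{m+s+2} ↦ a₁ ⊗ ⋯ ⊗ a_{s+1} ⊗ f(a_{s+2}, …, a_{s+m+1}) a_{s+m+2}`. -/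
def rightLift (f : Cochain m (Om k A p)) (s : ℕ) : T k A (m + s + 1) →ₗ[k] T k A (p + s + 1) :=
  whiskT (omIncl k A p ∘ₗ evalR m f) (s + 1)

lemma whiskT_cons (F : T k A m →ₗ[k] T k A p) (s : ℕ) (a : A) (x : T k A (m + s)) :
    whiskT F (s + 1) (consT (m + s) a x) = consT (p + s) a (whiskT F s x) :=
  tensMap_cons _ _ _

lemma isRight_whiskT {F : T k A m →ₗ[k] T k A p} (h : IsRight F) : ∀ s, IsRight (whiskT F s)
  | 0 => h
  | s + 1 => isRight_tensMap (isRight_whiskT h s)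

lemma isBimodMap_rightLift (f : Cochain m (Om k A p)) (s : ℕ) : IsBimodMap (rightLift f s) :=
  ⟨isLeft_tensMap _, isRight_whiskT ((isBimodMap_omIncl p).2.comp (isRight_evalR f)) (s + 1)⟩

lemma evalR_dT {f : Cochain m (Om k A p)} (hf : IsCocycle f) (x : T k A (m + 1)) :
    evalR m f (dT k A m x) = biext f x := by
  have := apply_consT_dT (biext_dT hf) x
  rwa [biext_cons, one_smul] at this

lemma dT_consT_omIncl (a : A) (y : Om k A p) :
    dT k A p (consT p a (omIncl k A p y)) = a • omIncl k A p y := by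
  cases p with
  | zero => exact dT_zero _ _
  | succ q => rw [dT_cons, dT_omIncl, map_zero, sub_zero]

lemma dT_whiskT {f : Cochain m (Om k A p)} (hf : IsCocycle f) : ∀ s : ℕ,
    dT k A (p + s) ∘ₗ whiskT (omIncl k A p ∘ₗ evalR m f) (s + 1) =
      whiskT (omIncl k A p ∘ₗ evalR m f) s ∘ₗ dT k A (m + s)
  | 0 => T_hom_ext fun a x => by
      change dT k A p (consT p a (omIncl k A p (evalR m f x))) =
        omIncl k A p (evalR m f (dT k A m (consT m a x)))
      rw [dT_consT_omIncl, evalR_dT hf, biext_cons, (isBimodMap_omIncl p).1]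
  | s + 1 => T_hom_ext fun a x => by
      have ih := LinearMap.congr_fun (dT_whiskT hf s) x
      refine (congrArg (dT k A (p + s + 1)) (whiskT_cons (omIncl k A p ∘ₗ evalR m f) (s + 1) a
        x)).trans ?_
      refine (dT_cons (p + s) a _).trans ?_
      have h1 := dT_cons (m + s) a x
      refine Eq.trans ?_ (congrArg (whiskT (omIncl k A p ∘ₗ evalR m f) (s + 1)) h1).symm
      rw [map_sub]
      refine congrArg₂ (fun u v => u - v) ?_ ?_
      · exact ((isBimodMap_rightLift f s).1 a x).symm
      · refine Eq.trans ?_ (whiskT_cons _ s a _).symm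
        exact congrArg _ ih

/-- The component `θ₁(f) : Bar_{m+s}(A) → Bar_s(Ω^p(A))` of the first lift. -/
def theta1 (f : Cochain m (Om k A p)) (s : ℕ) : T k A (m + s + 1) →ₗ[k] T k A (p + s + 1) :=
  (((p : ℤ) + 1 + ((m : ℤ) - p - 1) * s).negOnePow : ℤ) •
    (castT (by omega) ∘ₗ leftLift f s ∘ₗ castT (by omega))

/-- The component `θ₂(f) : Bar_{m+s}(A) → Bar_s(Ω^p(A))` of the second lift. -/
def theta2 (f : Cochain m (Om k A p)) (s : ℕ) : T k A (m + s + 1) →ₗ[k] T k A (p + s + 1) :=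
  (((s : ℤ) + 1).negOnePow : ℤ) • rightLift f s

lemma isBimodMap_theta1 (f : Cochain m (Om k A p)) (s : ℕ) : IsBimodMap (theta1 f s) :=
  ((isBimodMap_castT _).comp ((isBimodMap_leftLift f s).comp (isBimodMap_castT _))).zsmul _

lemma isBimodMap_theta2 (f : Cochain m (Om k A p)) (s : ℕ) : IsBimodMap (theta2 f s) :=
  (isBimodMap_rightLift f s).zsmul _

lemma theta2_anticomm {f : Cochain m (Om k A p)} (hf : IsCocycle f) (s : ℕ) :
    theta2 f s ∘ₗ dT k A (m + s + 1) = -(dT k A (p + s + 1) ∘ₗ theta2 f (s + 1)) := by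
  have h := dT_whiskT hf (s + 1)
  rw [theta2, theta2, LinearMap.smul_comp, LinearMap.comp_smul]
  have h' : dT k A (p + s + 1) ∘ₗ rightLift f (s + 1) = rightLift f s ∘ₗ dT k A (m + s + 1) := h
  rw [h', Nat.cast_succ, Int.negOnePow_succ ((s : ℤ) + 1), Units.val_neg, neg_smul, neg_neg]

lemma castT_castT {a b c : ℕ} (h : a = b) (h' : b = c) (x : T k A a) :
    castT h' (castT h x) = castT (h.trans h') x := by
  subst h
  subst h'
  rfl

lemma theta1_anticomm {f : Cochain m (Om k A p)} (hf : IsCocycle f) (s : ℕ) :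
    theta1 f s ∘ₗ dT k A (m + s + 1) = -(dT k A (p + s + 1) ∘ₗ theta1 f (s + 1)) := by
  ext z
  have h := dT_leftLift hf s (castT (by omega) z)
  have h1 := LinearMap.congr_fun (dT_castT (k := k) (A := A)
    (by omega : m + s + 1 = s + m + 1) (by omega)) z
  have h2 := LinearMap.congr_fun (dT_castT (k := k) (A := A)
    (by omega : s + p + 1 = p + s + 1) (by omega))
    (castT (by omega) (leftLift f (s + 1) (castT (by omega) z)))
  rw [LinearMap.comp_apply, LinearMap.comp_apply] at h1 h2
  rw [castT_castT] at h2 h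
  rw [h] at h2
  simp only [theta1, LinearMap.comp_apply, LinearMap.smul_apply, LinearMap.neg_apply, map_zsmul]
  rw [← h1, h2, map_zsmul, ← mul_smul, ← neg_smul]
  congr 1
  have e : (p : ℤ) + 1 + ((m : ℤ) - p - 1) * ((s + 1 : ℕ) : ℤ) =
    ((p : ℤ) + 1 + ((m : ℤ) - p - 1) * s) + ((m + p : ℕ) - 2 * p - 1) := by
    push_cast
    ring
  rw [e, Int.negOnePow_add _ ((m + p : ℕ) - 2 * (p : ℤ) - 1), Int.negOnePow_sub, Int.negOnePow_sub, Int.negOnePow_two_mul,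
    Int.negOnePow_one]
  generalize ((p : ℤ) + 1 + ((m : ℤ) - p - 1) * s).negOnePow = E
  have e3 : (((m + p : ℕ) : ℤ).negOnePow : ℤ) = (-1) ^ (m + p) := by
    rw [Int.negOnePow_def, zpow_natCast, Units.val_pow_eq_pow_val, Units.val_neg, Units.val_one]
  rw [Units.val_mul, Units.val_mul, Units.val_mul, e3, Units.val_neg, Units.val_one, mul_one]
  have hsq : ((-1 : ℤ) ^ (m + p)) * ((-1 : ℤ) ^ (m + p)) = 1 := by
    rw [← pow_add, Even.neg_one_pow ⟨m + p, rfl⟩]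
  linear_combination (-(E : ℤ)) * hsq

end Lifts


/-! ### Tensor products over `A` -/

/-- The action on a quotient induced by an action preserving the submodule. -/
def quotEnd {B V : Type*} [Ring B] [Algebra k B] [AddCommGroup V] [Module k V]
    (S : Submodule k V) (l : B →ₐ[k] Module.End k V) (h : ∀ b, S ≤ S.comap (l b)) :
    B →ₐ[k] Module.End k (V ⧸ S) :=
  AlgHom.ofLinearMap
    { toFun b := S.mapQ S (l b) (h b)
      map_add' a b := Submodule.linearMap_qext _ (LinearMap.ext fun x => by
        simp [Submodule.mapQ_apply])
      map_smul' c b := Submodule.linearMap_qext _ (LinearMap.ext fun x => by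
        simp [Submodule.mapQ_apply]) }
    (Submodule.linearMap_qext _ (LinearMap.ext fun x => by simp [Submodule.mapQ_apply]))
    (fun a b => Submodule.linearMap_qext _ (LinearMap.ext fun x => by simp [Submodule.mapQ_apply]))

lemma quotEnd_mk {B V : Type*} [Ring B] [Algebra k B] [AddCommGroup V] [Module k V]
    (S : Submodule k V) (l : B →ₐ[k] Module.End k V) (h : ∀ b, S ≤ S.comap (l b)) (b : B) (x : V) :
    quotEnd S l h b (S.mkQ x) = S.mkQ (l b x) := rfl

/-- The left action of `A` on `M ⊗ N` through `M`. -/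
def leftEnd (M N : Bimod k A) : A →ₐ[k] Module.End k (M ⊗[k] N) :=
  AlgHom.ofLinearMap ((LinearMap.rTensorHom N).comp (Algebra.lsmul k k M).toLinearMap)
    (TensorProduct.ext' fun x y => by simp)
    (fun a b => TensorProduct.ext' fun x y => by simp)

/-- The right action of `A` on `M ⊗ N` through `N`. -/
def rightEnd (M N : Bimod k A) : Aᵐᵒᵖ →ₐ[k] Module.End k (M ⊗[k] N) :=
  AlgHom.ofLinearMap ((LinearMap.lTensorHom M).comp (Algebra.lsmul k k N).toLinearMap)
    (TensorProduct.ext' fun x y => by simp)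
    (fun a b => TensorProduct.ext' fun x y => by simp)

@[simp] lemma leftEnd_tmul {M N : Bimod k A} (a : A) (x : M) (y : N) :
    leftEnd M N a (x ⊗ₜ y) = (a • x) ⊗ₜ y := rfl

@[simp] lemma rightEnd_tmul {M N : Bimod k A} (a : Aᵐᵒᵖ) (x : M) (y : N) :
    rightEnd M N a (x ⊗ₜ y) = x ⊗ₜ (a • y) := rfl

/-- The submodule of `M ⊗ N` generated by all `x a ⊗ y - x ⊗ a y`. -/
def balRel (M N : Bimod k A) : Submodule k (M ⊗[k] N) :=
  Submodule.span k {w | ∃ (a : A) (x : M) (y : N), w = (op a • x) ⊗ₜ y - x ⊗ₜ (a • y)}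

/-- The bimodule `M ⊗_A N`. -/
def Bimod.bal (M N : Bimod k A) : Bimod k A :=
  Bimod.ofEnd ((M ⊗[k] N) ⧸ balRel M N)
    (quotEnd _ (leftEnd M N) fun b => Submodule.span_le.2 (by
      rintro _ ⟨a, x, y, rfl⟩
      refine Submodule.subset_span ⟨a, b • x, y, ?_⟩
      rw [map_sub, leftEnd_tmul, leftEnd_tmul, smul_comm]))
    (quotEnd _ (rightEnd M N) fun b => Submodule.span_le.2 (by
      rintro _ ⟨a, x, y, rfl⟩
      refine Submodule.subset_span ⟨a, x, b • y, ?_⟩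
      rw [map_sub, rightEnd_tmul, rightEnd_tmul, smul_comm]))
    (fun a b x => by
      obtain ⟨x, rfl⟩ := Submodule.mkQ_surjective _ x
      change (balRel M N).mkQ (leftEnd M N a (rightEnd M N b x)) =
        (balRel M N).mkQ (rightEnd M N b (leftEnd M N a x))
      congr 1
      induction x with
      | zero => simp
      | tmul x y => simp
      | add x y hx hy => simp only [map_add, hx, hy])

/-- The tensor `x ⊗ y` in `M ⊗_A N`. -/
def balMk (M N : Bimod k A) : M →ₗ[k] N →ₗ[k] M.bal N :=
  (TensorProduct.mk k M N).compr₂ (balRel M N).mkQ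

lemma balMk_balanced {M N : Bimod k A} (a : A) (x : M) (y : N) :
    balMk M N (op a • x) y = balMk M N x (a • y) := by
  refine (Submodule.Quotient.eq _).2 (Submodule.subset_span ⟨a, x, y, rfl⟩)

lemma smul_balMk {M N : Bimod k A} (a : A) (x : M) (y : N) :
    balMk M N (a • x) y = a • balMk M N x y := rfl

lemma op_smul_balMk {M N : Bimod k A} (a : A) (x : M) (y : N) :
    balMk M N x (op a • y) = op a • balMk M N x y := rfl

/-- For `φ` on `A^{⊗ (i+2)}` and `ψ` on `A^{⊗ (j+2)}`, the map
`a₁ ⊗ ⋯ ⊗ a_{i+j+2} ↦ φ(a₁ ⊗ ⋯ ⊗ a_{i+1} ⊗ 1) ⊗_A ψ(1 ⊗ a_{i+2} ⊗ ⋯ ⊗ a_{i+j+2})`. -/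
def cupT {M N : Bimod k A} (i j : ℕ) (φ : T k A (i + 1) →ₗ[k] M) (ψ : T k A (j + 1) →ₗ[k] N) :
    T k A (j + i + 1) →ₗ[k] M.bal N :=
  TensorProduct.lift ((balMk M N).compl₁₂ (φ ∘ₗ snocOne i) (ψ ∘ₗ consT j 1)) ∘ₗ splitT i j

lemma isBimodMap_cupT {M N : Bimod k A} {i j : ℕ} {φ : T k A (i + 1) →ₗ[k] M}
    {ψ : T k A (j + 1) →ₗ[k] N} (hφ : IsBimodMap φ) (hψ : IsBimodMap ψ) :
    IsBimodMap (cupT i j φ ψ) := by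
  constructor
  · intro a x
    rw [cupT, LinearMap.comp_apply, splitT_smul, LinearMap.comp_apply]
    generalize splitT i j x = w
    induction w with
    | zero => simp only [map_zero, smul_zero]
    | add x y hx hy => simp only [map_add, smul_add, hx, hy]
    | tmul x y =>
      rw [LinearMap.rTensor_tmul, TensorProduct.lift.tmul, TensorProduct.lift.tmul]
      change balMk M N (φ (snoc i (a • x) 1)) _ = a • balMk M N (φ (snoc i x 1)) _
      rw [snoc_smul, hφ.1, smul_balMk]
  · intro a x
    rw [cupT, LinearMap.comp_apply, splitT_op_smul, LinearMap.comp_apply]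
    generalize splitT i j x = w
    induction w with
    | zero => simp only [map_zero, smul_zero]
    | add x y hx hy => simp only [map_add, smul_add, hx, hy]
    | tmul x y =>
      rw [LinearMap.lTensor_tmul, TensorProduct.lift.tmul, TensorProduct.lift.tmul]
      change balMk M N _ (ψ (op a • consT j 1 y)) = op a • balMk M N _ (ψ (consT j 1 y))
      rw [hψ.2, op_smul_balMk]

lemma cupT_dT {M N : Bimod k A} {i j : ℕ} {φ : T k A (i + 1) →ₗ[k] M}
    {ψ : T k A (j + 1) →ₗ[k] N} (hφ : IsBimodMap φ) (hψ : IsBimodMap ψ)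
    (hφ0 : φ ∘ₗ dT k A (i + 1) = 0) (hψ0 : ψ ∘ₗ dT k A (j + 1) = 0) :
    cupT i j φ ψ ∘ₗ dT k A (j + i + 1) = 0 := by
  ext z
  have key := splitT_coassoc i j (Z := M.bal N)
    ((balMk M N).compl₁₂ φ (ψ ∘ₗ consT j 1))
    ((balMk M N).compl₁₂ (φ ∘ₗ snocOne i) ψ) (fun x b y => by
      change balMk M N (φ (snocOne i x)) (ψ (consT j b y)) =
        balMk M N (φ (snoc i x b)) (ψ (consT j 1 y))
      rw [apply_snoc hφ.2, balMk_balanced, ← hψ.1, smul_consT, mul_one]) z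
  have hs := splitT_dT i j z
  rw [cupT, LinearMap.comp_apply, LinearMap.comp_apply, hs, map_add, map_zsmul]
  have a1 : ∀ w', TensorProduct.lift ((balMk M N).compl₁₂ (φ ∘ₗ snocOne i) (ψ ∘ₗ consT j 1))
      (LinearMap.rTensor (T k A j) (dT k A i) w') =
      (-1 : ℤ) ^ i • TensorProduct.lift ((balMk M N).compl₁₂ φ (ψ ∘ₗ consT j 1)) w' := fun w' => by
    induction w' with
    | zero => simp only [map_zero, smul_zero]
    | add x y hx hy => simp only [map_add, smul_add, hx, hy]
    | tmul x y =>
      rw [LinearMap.rTensor_tmul, TensorProduct.lift.tmul, TensorProduct.lift.tmul]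
      change balMk M N (φ (snocOne i (dT k A i x))) _ = _ • balMk M N (φ x) _
      rw [apply_snocOne_dT hφ0, map_zsmul, LinearMap.smul_apply]
  have a2 : ∀ w, TensorProduct.lift ((balMk M N).compl₁₂ (φ ∘ₗ snocOne i) (ψ ∘ₗ consT j 1))
      (LinearMap.lTensor (T k A i) (dT k A j) w) =
      TensorProduct.lift ((balMk M N).compl₁₂ (φ ∘ₗ snocOne i) ψ) w := fun w => by
    induction w with
    | zero => simp only [map_zero, smul_zero]
    | add x y hx hy => simp only [map_add, smul_add, hx, hy]
    | tmul x y =>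
      rw [LinearMap.lTensor_tmul, TensorProduct.lift.tmul, TensorProduct.lift.tmul]
      change balMk M N _ (ψ (consT j 1 (dT k A j y))) = balMk M N _ (ψ y)
      rw [apply_consT_dT hψ0]
  rw [a1, a2, key, pow_succ, mul_neg_one, neg_smul, add_neg_cancel, LinearMap.zero_apply]


/-! ### Differential graded modules over `A^op ⊗ A ⊗ R`, where `R = k[ε]/(ε²)` -/

/-- A differential graded right module over `A^op ⊗ A ⊗ R_n`, where `R_n = k[ε]/(ε²)` with `ε` of
degree `n` and with zero differential. Homological grading is used. Such a module is a complex of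
bimodules with the operator `e : x ↦ x ε` of degree `n`, where `(x ε) ε = 0` and
`d (x ε) = (d x) ε`. The maps `d i j` and `e i j` are zero unless `j = i - 1`, respectively
`j = i + n`. -/
structure DGMod (k : Type v) (A : Type u) [CommRing k] [Ring A] [Algebra k A] (n : ℤ) where
  X : ℤ → Bimod k A
  d : ∀ i j, X i →ₗ[k] X j
  isBimodMap_d : ∀ i j, IsBimodMap (d i j)
  d_shape : ∀ i j, j + 1 ≠ i → d i j = 0
  d_d : ∀ i j l x, d j l (d i j x) = 0
  e : ∀ i j, X i →ₗ[k] X j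
  isBimodMap_e : ∀ i j, IsBimodMap (e i j)
  e_shape : ∀ i j, i + n ≠ j → e i j = 0
  e_e : ∀ i j l x, e j l (e i j x) = 0
  d_e : ∀ i j i' j', i + n = i' → j + n = j' → ∀ x, d i' j' (e i i' x) = e j j' (d i j x)

namespace DGMod

variable {n : ℤ}

/-- Morphisms of differential graded modules. -/
@[ext] structure Hom (M N : DGMod k A n) where
  f : ∀ i, M.X i →ₗ[k] N.X i
  isBimodMap_f : ∀ i, IsBimodMap (f i)
  comm_d : ∀ i j x, f j (M.d i j x) = N.d i j (f i x)
  comm_e : ∀ i j x, f j (M.e i j x) = N.e i j (f i x)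

instance : CategoryTheory.Category (DGMod k A n) where
  Hom := Hom
  id M :=
    { f := fun _ => LinearMap.id
      isBimodMap_f := fun _ => ⟨fun _ _ => rfl, fun _ _ => rfl⟩
      comm_d := fun _ _ _ => rfl
      comm_e := fun _ _ _ => rfl }
  comp φ ψ :=
    { f := fun i => ψ.f i ∘ₗ φ.f i
      isBimodMap_f := fun i => (ψ.isBimodMap_f i).comp (φ.isBimodMap_f i)
      comm_d := fun i j x => by
        rw [LinearMap.comp_apply, φ.comm_d, ψ.comm_d, LinearMap.comp_apply]
      comm_e := fun i j x => by
        rw [LinearMap.comp_apply, φ.comm_e, ψ.comm_e, LinearMap.comp_apply] }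

/-- `φ` is an `R_n`-relative quasi-isomorphism: its restriction to `R_n` is a homotopy equivalence.
That is, there are a morphism `g` of differential graded `R_n`-modules in the other direction and
`R_n`-linear homotopies `h`, `h'` of degree one from `g φ` and `φ g` to the identities; none of these
needs to be compatible with the actions of `A`. -/
def IsRelQuasiIso {M N : DGMod k A n} (φ : Hom M N) : Prop :=
  ∃ (g : ∀ i, N.X i →ₗ[k] M.X i) (h : ∀ i j, M.X i →ₗ[k] M.X j) (h' : ∀ i j, N.X i →ₗ[k] N.X j),
    (∀ i j x, g j (N.d i j x) = M.d i j (g i x)) ∧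
    (∀ i j x, g j (N.e i j x) = M.e i j (g i x)) ∧
    (∀ i i' x, h i' (i' + 1) (M.e i i' x) = M.e (i + 1) (i' + 1) (h i (i + 1) x)) ∧
    (∀ i i' x, h' i' (i' + 1) (N.e i i' x) = N.e (i + 1) (i' + 1) (h' i (i + 1) x)) ∧
    (∀ i x, x - g i (φ.f i x) = M.d (i + 1) i (h i (i + 1) x) + h (i - 1) i (M.d i (i - 1) x)) ∧
    (∀ i x, x - φ.f i (g i x) = N.d (i + 1) i (h' i (i + 1) x) + h' (i - 1) i (N.d i (i - 1) x))

variable (k A n) in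
/-- The class of `R_n`-relative quasi-isomorphisms. -/
def relQuasiIso : CategoryTheory.MorphismProperty (DGMod k A n) := fun _ _ φ => IsRelQuasiIso φ

variable (k A n) in
/-- The `R_n`-relative derived category of `A^op ⊗ A ⊗ R_n`: the category of differential graded
modules with all `R_n`-relative quasi-isomorphisms formally inverted. -/
abbrev RelDerived := (relQuasiIso k A n).Localization

/-! ### The tensor product over `A ⊗ R_n` -/

section Tensor

/-- The action on a direct sum. -/
def sumEnd {B ι : Type*} [DecidableEq ι] [Ring B] [Algebra k B] {V : ι → Type*}
    [∀ i, AddCommGroup (V i)] [∀ i, Module k (V i)] (l : ∀ i, B →ₐ[k] Module.End k (V i)) :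
    B →ₐ[k] Module.End k (⨁ i, V i) :=
  AlgHom.ofLinearMap
    { toFun b := DirectSum.lmap fun i => l i b
      map_add' a b := DirectSum.linearMap_ext _ fun i => LinearMap.ext fun x => by simp
      map_smul' c b := DirectSum.linearMap_ext _ fun i => LinearMap.ext fun x => by simp }
    (DirectSum.linearMap_ext _ fun i => LinearMap.ext fun x => by simp)
    (fun a b => DirectSum.linearMap_ext _ fun i => LinearMap.ext fun x => by simp)

variable (M N : DGMod k A n) (l : ℤ)

/-- The degree `l` part of `M ⊗ N`. -/
abbrev PreTens : Type u := ⨁ q : {q : ℤ × ℤ // q.1 + q.2 = l}, (M.X q.1.1 ⊗[k] N.X q.1.2)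

/-- The tensor `x ⊗ y` in the degree `l = i + j` part of `M ⊗ N`. -/
def preMk {i j : ℤ} (h : i + j = l) : M.X i →ₗ[k] N.X j →ₗ[k] PreTens M N l :=
  (TensorProduct.mk k (M.X i) (N.X j)).compr₂
    (DirectSum.lof k {q : ℤ × ℤ // q.1 + q.2 = l} (fun q => M.X q.1.1 ⊗[k] N.X q.1.2) ⟨(i, j), h⟩)

/-- The relations `x a ⊗ y = x ⊗ a y` and `x ε ⊗ y = x ⊗ ε y`, where the left action of `ε` on
`y` of degree `j` is `ε y = (-1)^{n j} y ε`. -/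
def tensRel : Submodule k (PreTens M N l) :=
  Submodule.span k
    ({w | ∃ (i j : ℤ) (h : i + j = l) (a : A) (x : M.X i) (y : N.X j),
        w = preMk M N l h (op a • x) y - preMk M N l h x (a • y)} ∪
     {w | ∃ (i j i' j' : ℤ) (h : i' + j = l) (h' : i + j' = l) (_ : i + n = i') (x : M.X i)
        (y : N.X j),
        w = preMk M N l h (M.e i i' x) y -
          ((n * j).negOnePow : ℤ) • preMk M N l h' x (N.e j j' y)})

variable {M N l} in
lemma preTens_hom_ext {Z : Type*} [AddCommGroup Z] [Module k Z] {φ ψ : PreTens M N l →ₗ[k] Z}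
    (H : ∀ (i j : ℤ) (h : i + j = l) x y, φ (preMk M N l h x y) = ψ (preMk M N l h x y)) : φ = ψ :=
  DirectSum.linearMap_ext _ fun ⟨⟨i, j⟩, h⟩ => TensorProduct.ext' fun x y => H i j h x y

/-- The left action of `A` on `M ⊗ N`. -/
def preLeft : A →ₐ[k] Module.End k (PreTens M N l) := sumEnd fun q => leftEnd (M.X q.1.1) (N.X q.1.2)

/-- The right action of `A` on `M ⊗ N`. -/
def preRight : Aᵐᵒᵖ →ₐ[k] Module.End k (PreTens M N l) :=
  sumEnd fun q => rightEnd (M.X q.1.1) (N.X q.1.2)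

lemma preLeft_mk {i j : ℤ} (h : i + j = l) (a : A) (x : M.X i) (y : N.X j) :
    preLeft M N l a (preMk M N l h x y) = preMk M N l h (a • x) y :=
  DirectSum.lmap_lof _ _ _

lemma preRight_mk {i j : ℤ} (h : i + j = l) (a : Aᵐᵒᵖ) (x : M.X i) (y : N.X j) :
    preRight M N l a (preMk M N l h x y) = preMk M N l h x (a • y) :=
  DirectSum.lmap_lof _ _ _

lemma preLeft_preRight (a : A) (b : Aᵐᵒᵖ) (x : PreTens M N l) :
    preLeft M N l a (preRight M N l b x) = preRight M N l b (preLeft M N l a x) :=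
  LinearMap.congr_fun (f := preLeft M N l a ∘ₗ preRight M N l b)
    (g := preRight M N l b ∘ₗ preLeft M N l a) (preTens_hom_ext fun i j h x y => by
      rw [LinearMap.comp_apply, LinearMap.comp_apply, preLeft_mk, preRight_mk, preRight_mk,
        preLeft_mk]) x

lemma tensRel_preLeft (b : A) : tensRel M N l ≤ (tensRel M N l).comap (preLeft M N l b) :=
  Submodule.span_le.2 (by
    rintro _ (⟨i, j, h, a, x, y, rfl⟩ | ⟨i, j, i', j', h, h', hi, x, y, rfl⟩)
    · refine Submodule.subset_span (Or.inl ⟨i, j, h, a, b • x, y, ?_⟩)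
      rw [map_sub, preLeft_mk, preLeft_mk, smul_comm]
    · refine Submodule.subset_span (Or.inr ⟨i, j, i', j', h, h', hi, b • x, y, ?_⟩)
      rw [map_sub, map_zsmul, preLeft_mk, preLeft_mk, (M.isBimodMap_e i i').1])

lemma tensRel_preRight (b : Aᵐᵒᵖ) : tensRel M N l ≤ (tensRel M N l).comap (preRight M N l b) :=
  Submodule.span_le.2 (by
    rintro _ (⟨i, j, h, a, x, y, rfl⟩ | ⟨i, j, i', j', h, h', hi, x, y, rfl⟩)
    · refine Submodule.subset_span (Or.inl ⟨i, j, h, a, x, b • y, ?_⟩)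
      rw [map_sub, preRight_mk, preRight_mk, smul_comm]
    · refine Submodule.subset_span (Or.inr ⟨i, j, i', j', h, h', hi, x, b • y, ?_⟩)
      have := (N.isBimodMap_e j j').2 b.unop y
      rw [op_unop] at this
      rw [map_sub, map_zsmul, preRight_mk, preRight_mk, this])

/-- The degree `l` part of `M ⊗_{A ⊗ R_n} N`, as a bimodule. -/
def tensX : Bimod k A :=
  Bimod.ofEnd (PreTens M N l ⧸ tensRel M N l)
    (quotEnd _ (preLeft M N l) (tensRel_preLeft M N l))
    (quotEnd _ (preRight M N l) (tensRel_preRight M N l))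
    (fun a b x => by
      obtain ⟨x, rfl⟩ := Submodule.mkQ_surjective _ x
      exact congrArg (tensRel M N l).mkQ (preLeft_preRight M N l a b x))

/-- The tensor `x ⊗ y` in the degree `l = i + j` part of `M ⊗_{A ⊗ R_n} N`. -/
def tmk {i j : ℤ} (h : i + j = l) : M.X i →ₗ[k] N.X j →ₗ[k] tensX M N l :=
  (preMk M N l h).compr₂ (tensRel M N l).mkQ

variable {M N l}

lemma tmk_op_smul {i j : ℤ} (h : i + j = l) (a : A) (x : M.X i) (y : N.X j) :
    tmk M N l h (op a • x) y = tmk M N l h x (a • y) :=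
  (Submodule.Quotient.eq _).2 (Submodule.subset_span (Or.inl ⟨i, j, h, a, x, y, rfl⟩))

lemma tmk_e {i j i' j' : ℤ} (h : i' + j = l) (h' : i + j' = l) (hi : i + n = i')
    (x : M.X i) (y : N.X j) :
    tmk M N l h (M.e i i' x) y = ((n * j).negOnePow : ℤ) • tmk M N l h' x (N.e j j' y) := by
  refine Eq.trans ((Submodule.Quotient.eq _).2 (Submodule.subset_span
    (Or.inr ⟨i, j, i', j', h, h', hi, x, y, rfl⟩))) ?_
  exact map_zsmul (tensRel M N l).mkQ _ _

lemma smul_tmk {i j : ℤ} (h : i + j = l) (a : A) (x : M.X i) (y : N.X j) :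
    a • tmk M N l h x y = tmk M N l h (a • x) y :=
  congrArg (tensRel M N l).mkQ (preLeft_mk M N l h a x y)

lemma op_smul_tmk {i j : ℤ} (h : i + j = l) (a : A) (x : M.X i) (y : N.X j) :
    op a • tmk M N l h x y = tmk M N l h x (op a • y) :=
  congrArg (tensRel M N l).mkQ (preRight_mk M N l h (op a) x y)

lemma tens_hom_ext {Z : Type*} [AddCommGroup Z] [Module k Z] {φ ψ : tensX M N l →ₗ[k] Z}
    (H : ∀ (i j : ℤ) (h : i + j = l) x y, φ (tmk M N l h x y) = ψ (tmk M N l h x y)) : φ = ψ :=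
  Submodule.linearMap_qext _ (preTens_hom_ext H)

/-- The linear map on `⨁ M_i ⊗ N_j` given by a family of bilinear maps. -/
def preDesc {Z : Type*} [AddCommGroup Z] [Module k Z]
    (Φ : ∀ i j : ℤ, i + j = l → M.X i →ₗ[k] N.X j →ₗ[k] Z) : PreTens M N l →ₗ[k] Z :=
  DirectSum.toModule k {q : ℤ × ℤ // q.1 + q.2 = l} Z
    fun q => TensorProduct.lift (Φ q.1.1 q.1.2 q.2)

lemma preDesc_mk {Z : Type*} [AddCommGroup Z] [Module k Z]
    (Φ : ∀ i j : ℤ, i + j = l → M.X i →ₗ[k] N.X j →ₗ[k] Z) {i j : ℤ} (h : i + j = l)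
    (x : M.X i) (y : N.X j) : preDesc Φ (preMk M N l h x y) = Φ i j h x y :=
  (DirectSum.toModule_lof (M := fun q : {q : ℤ × ℤ // q.1 + q.2 = l} => M.X q.1.1 ⊗[k] N.X q.1.2)
    (φ := fun q => TensorProduct.lift (Φ q.1.1 q.1.2 q.2)) k ⟨(i, j), h⟩ (x ⊗ₜ y)).trans
    (TensorProduct.lift.tmul x y)

/-- The linear map out of `M ⊗_{A ⊗ R_n} N` given by a family of balanced bilinear maps. -/
def tensDesc {Z : Type*} [AddCommGroup Z] [Module k Z]
    (Φ : ∀ i j : ℤ, i + j = l → M.X i →ₗ[k] N.X j →ₗ[k] Z)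
    (hA : ∀ (i j : ℤ) (h : i + j = l) (a : A) x y, Φ i j h (op a • x) y = Φ i j h x (a • y))
    (he : ∀ (i j i' j' : ℤ) (h : i' + j = l) (h' : i + j' = l) (_ : i + n = i') x y,
      Φ i' j h (M.e i i' x) y = ((n * j).negOnePow : ℤ) • Φ i j' h' x (N.e j j' y)) :
    tensX M N l →ₗ[k] Z :=
  (tensRel M N l).liftQ (preDesc Φ) <| Submodule.span_le.2 <| by
    rintro _ (⟨i, j, h, a, x, y, rfl⟩ | ⟨i, j, i', j', h, h', hi, x, y, rfl⟩)
    · refine LinearMap.mem_ker.2 ?_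
      rw [map_sub, preDesc_mk, preDesc_mk, hA, sub_self]
    · refine LinearMap.mem_ker.2 ?_
      rw [map_sub, map_zsmul, preDesc_mk, preDesc_mk, he i j i' j' h h' hi, sub_self]

@[simp] lemma tensDesc_tmk {Z : Type*} [AddCommGroup Z] [Module k Z]
    (Φ : ∀ i j : ℤ, i + j = l → M.X i →ₗ[k] N.X j →ₗ[k] Z) (hA) (he) {i j : ℤ} (h : i + j = l)
    (x : M.X i) (y : N.X j) : tensDesc Φ hA he (tmk M N l h x y) = Φ i j h x y :=
  preDesc_mk Φ h x y

end Tensor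

end DGMod


namespace DGMod

variable {n : ℤ}

section TensorModule

variable (M N : DGMod k A n)

lemma isBimodMap_tensDesc {M N : DGMod k A n} {l : ℤ} {Z : Bimod k A}
    {φ : tensX M N l →ₗ[k] Z}
    (hl : ∀ (i j : ℤ) (h : i + j = l) (a : A) x y,
      φ (tmk M N l h (a • x) y) = a • φ (tmk M N l h x y))
    (hr : ∀ (i j : ℤ) (h : i + j = l) (a : A) x y,
      φ (tmk M N l h x (op a • y)) = op a • φ (tmk M N l h x y)) : IsBimodMap φ :=
  ⟨(isLeft_iff φ).2 fun a => tens_hom_ext fun i j h x y =>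
      (congrArg φ (smul_tmk h a x y)).trans (hl i j h a x y),
    (isRight_iff φ).2 fun a => tens_hom_ext fun i j h x y =>
      (congrArg φ (op_smul_tmk h a x y)).trans (hr i j h a x y)⟩

/-- The differential `x ⊗ y ↦ d x ⊗ y + (-1)^i x ⊗ d y`, where `x` has degree `i`. -/
def tensD {l l' : ℤ} (hl : l' + 1 = l) : tensX M N l →ₗ[k] tensX M N l' :=
  tensDesc
    (fun i j h =>
      (tmk M N l' (show (i - 1) + j = l' by omega)) ∘ₗ M.d i (i - 1) +
      (i.negOnePow : ℤ) • (tmk M N l' (show i + (j - 1) = l' by omega)).compl₂ (N.d j (j - 1)))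
    (fun i j h a x y => by
      simp only [LinearMap.add_apply, LinearMap.smul_apply, LinearMap.comp_apply,
        LinearMap.compl₂_apply]
      rw [(M.isBimodMap_d _ _).2, tmk_op_smul, tmk_op_smul, (N.isBimodMap_d _ _).1])
    (fun i j i' j' h h' hi x y => by
      subst hi
      obtain rfl : j' = j + n := by omega
      simp only [LinearMap.add_apply, LinearMap.smul_apply, LinearMap.comp_apply,
        LinearMap.compl₂_apply]
      rw [M.d_e i (i - 1) (i + n) (i + n - 1) rfl (by omega),
        N.d_e j (j - 1) (j + n) (j + n - 1) rfl (by omega),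
        tmk_e (j' := j + n) _ (by omega) (by omega),
        tmk_e (j' := j + n - 1) _ (by omega) rfl,
        smul_add, smul_smul, smul_smul]
      congr 2
      rw [← Units.val_mul, ← Units.val_mul, ← Int.negOnePow_add, ← Int.negOnePow_add]
      congr 2
      ring)

lemma tensD_tmk {l l' : ℤ} (hl : l' + 1 = l) {i j i' j' : ℤ} (h : i + j = l) (h₁ : i' + j = l')
    (h₂ : i + j' = l') (x : M.X i) (y : N.X j) :
    tensD M N hl (tmk M N l h x y) =
      tmk M N l' h₁ (M.d i i' x) y + (i.negOnePow : ℤ) • tmk M N l' h₂ x (N.d j j' y) := by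
  obtain rfl : i' = i - 1 := by omega
  obtain rfl : j' = j - 1 := by omega
  exact tensDesc_tmk _ _ _ h x y

/-- The action `(x ⊗ y) ε = x ⊗ y ε`. -/
def tensE {l l' : ℤ} (hl : l + n = l') : tensX M N l →ₗ[k] tensX M N l' :=
  tensDesc
    (fun i j h => (tmk M N l' (show i + (j + n) = l' by omega)).compl₂ (N.e j (j + n)))
    (fun i j h a x y => by
      simp only [LinearMap.compl₂_apply]
      rw [tmk_op_smul, (N.isBimodMap_e _ _).1])
    (fun i j i' j' h h' hi x y => by
      simp only [LinearMap.compl₂_apply]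
      rw [tmk_e (j' := j + n + n) _ (by omega) hi, N.e_e, N.e_e]
      simp)

lemma tensE_tmk {l l' : ℤ} (hl : l + n = l') {i j j' : ℤ} (h : i + j = l) (h' : i + j' = l')
    (x : M.X i) (y : N.X j) :
    tensE M N hl (tmk M N l h x y) = tmk M N l' h' x (N.e j j' y) := by
  obtain rfl : j' = j + n := by omega
  exact tensDesc_tmk _ _ _ h x y

lemma isBimodMap_tensD {l l' : ℤ} (hl : l' + 1 = l) : IsBimodMap (tensD M N hl) :=
  isBimodMap_tensDesc
    (fun i j h a x y => by
      rw [tensD_tmk M N hl (i' := i - 1) (j' := j - 1) h (by omega) (by omega),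
        tensD_tmk M N hl (i' := i - 1) (j' := j - 1) h (by omega) (by omega),
        (M.isBimodMap_d _ _).1, smul_add, smul_comm a, smul_tmk, smul_tmk])
    (fun i j h a x y => by
      rw [tensD_tmk M N hl (i' := i - 1) (j' := j - 1) h (by omega) (by omega),
        tensD_tmk M N hl (i' := i - 1) (j' := j - 1) h (by omega) (by omega),
        (N.isBimodMap_d _ _).2, smul_add, smul_comm (op a), op_smul_tmk, op_smul_tmk])

lemma isBimodMap_tensE {l l' : ℤ} (hl : l + n = l') : IsBimodMap (tensE M N hl) :=
  isBimodMap_tensDesc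
    (fun i j h a x y => by
      rw [tensE_tmk M N hl (j' := j + n) h (by omega), tensE_tmk M N hl (j' := j + n) h (by omega),
        smul_tmk])
    (fun i j h a x y => by
      rw [tensE_tmk M N hl (j' := j + n) h (by omega), tensE_tmk M N hl (j' := j + n) h (by omega),
        (N.isBimodMap_e _ _).2, op_smul_tmk])

lemma tensD_tensD {l l' l'' : ℤ} (h₁ : l' + 1 = l) (h₂ : l'' + 1 = l') (z : tensX M N l) :
    tensD M N h₂ (tensD M N h₁ z) = 0 := by
  refine LinearMap.congr_fun (f := tensD M N h₂ ∘ₗ tensD M N h₁) (g := 0)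
    (tens_hom_ext fun i j h x y => ?_) z
  rw [LinearMap.comp_apply, LinearMap.zero_apply,
    tensD_tmk M N h₁ (i' := i - 1) (j' := j - 1) h (by omega) (by omega), map_add, map_zsmul,
    tensD_tmk M N h₂ (i' := i - 1 - 1) (j' := j - 1) _ (by omega) (by omega),
    tensD_tmk M N h₂ (i' := i - 1) (j' := j - 1 - 1) _ (by omega) (by omega), M.d_d, N.d_d,
    map_zero, LinearMap.zero_apply, zero_add, map_zero, smul_zero, add_zero, ← add_smul,
    Int.negOnePow_sub, Int.negOnePow_one]
  simp

lemma tensD_tensE {l l' r r' : ℤ} (h₁ : l' + 1 = l) (h₂ : l + n = r) (h₃ : r' + 1 = r)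
    (h₄ : l' + n = r') (z : tensX M N l) :
    tensD M N h₃ (tensE M N h₂ z) = tensE M N h₄ (tensD M N h₁ z) := by
  refine LinearMap.congr_fun (f := tensD M N h₃ ∘ₗ tensE M N h₂)
    (g := tensE M N h₄ ∘ₗ tensD M N h₁) (tens_hom_ext fun i j h x y => ?_) z
  rw [LinearMap.comp_apply, LinearMap.comp_apply,
    tensD_tmk M N h₁ (i' := i - 1) (j' := j - 1) h (by omega) (by omega), map_add, map_zsmul,
    tensE_tmk M N h₂ (j' := j + n) h (by omega),
    tensD_tmk M N h₃ (i' := i - 1) (j' := j + n - 1) _ (by omega) (by omega),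
    tensE_tmk M N h₄ (j' := j + n) _ (by omega),
    tensE_tmk M N h₄ (j' := j + n - 1) _ (by omega),
    N.d_e j (j - 1) (j + n) (j + n - 1) rfl (by omega)]

lemma tensE_tensE {l l' l'' : ℤ} (h₁ : l + n = l') (h₂ : l' + n = l'') (z : tensX M N l) :
    tensE M N h₂ (tensE M N h₁ z) = 0 := by
  refine LinearMap.congr_fun (f := tensE M N h₂ ∘ₗ tensE M N h₁) (g := 0)
    (tens_hom_ext fun i j h x y => ?_) z
  rw [LinearMap.comp_apply, LinearMap.zero_apply,
    tensE_tmk M N h₁ (j' := j + n) h (by omega),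
    tensE_tmk M N h₂ (j' := j + n + n) _ (by omega), N.e_e, map_zero]

/-- The tensor product `M ⊗_{A ⊗ R_n} N` of two differential graded modules over
`A^op ⊗ A ⊗ R_n`. It is formed with the right `A`-module structure of `M` and the left `A`-module
structure of `N`. -/
def tens : DGMod k A n where
  X := tensX M N
  d l l' := if h : l' + 1 = l then tensD M N h else 0
  isBimodMap_d l l' := by
    split_ifs with h
    · exact isBimodMap_tensD M N h
    · exact IsBimodMap.zero
  d_shape l l' h := dif_neg h
  d_d l l' l'' z := by
    by_cases h₁ : l' + 1 = l
    · by_cases h₂ : l'' + 1 = l'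
      · rw [dif_pos h₁, dif_pos h₂, tensD_tensD]
      · rw [dif_neg h₂, LinearMap.zero_apply]
    · rw [dif_neg h₁, LinearMap.zero_apply, map_zero]
  e l l' := if h : l + n = l' then tensE M N h else 0
  isBimodMap_e l l' := by
    split_ifs with h
    · exact isBimodMap_tensE M N h
    · exact IsBimodMap.zero
  e_shape l l' h := dif_neg h
  e_e l l' l'' z := by
    by_cases h₁ : l + n = l'
    · by_cases h₂ : l' + n = l''
      · rw [dif_pos h₁, dif_pos h₂, tensE_tensE]
      · rw [dif_neg h₂, LinearMap.zero_apply]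
    · rw [dif_neg h₁, LinearMap.zero_apply, map_zero]
  d_e l l' r r' h h' z := by
    rw [dif_pos h, dif_pos h']
    by_cases h₁ : l' + 1 = l
    · rw [dif_pos h₁, dif_pos (show r' + 1 = r by omega), tensD_tensE]
    · rw [dif_neg h₁, dif_neg (show ¬ r' + 1 = r by omega), LinearMap.zero_apply,
        LinearMap.zero_apply, map_zero]

lemma tens_d {l l' : ℤ} (h : l' + 1 = l) : (tens M N).d l l' = tensD M N h := dif_pos h

lemma tens_e {l l' : ℤ} (h : l + n = l') : (tens M N).e l l' = tensE M N h := dif_pos h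

variable {M} in
/-- The map `φ ⊗ N`. -/
def tensMapX {M' : DGMod k A n} (φ : Hom M M') (l : ℤ) : tensX M N l →ₗ[k] tensX M' N l :=
  tensDesc (fun i j h => tmk M' N l h ∘ₗ φ.f i)
    (fun i j h a x y => by
      simp only [LinearMap.comp_apply]
      rw [(φ.isBimodMap_f i).2, tmk_op_smul])
    (fun i j i' j' h h' hi x y => by
      simp only [LinearMap.comp_apply]
      rw [φ.comm_e, tmk_e _ h' hi])

variable {M} in
lemma tensMapX_tmk {M' : DGMod k A n} (φ : Hom M M') {l i j : ℤ} (h : i + j = l) (x : M.X i)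
    (y : N.X j) : tensMapX N φ l (tmk M N l h x y) = tmk M' N l h (φ.f i x) y :=
  tensDesc_tmk _ _ _ h x y

variable {M} in
lemma isBimodMap_tensMapX {M' : DGMod k A n} (φ : Hom M M') (l : ℤ) :
    IsBimodMap (tensMapX N φ l) :=
  isBimodMap_tensDesc
    (fun i j h a x y => by
      rw [tensMapX_tmk, tensMapX_tmk, (φ.isBimodMap_f i).1, smul_tmk])
    (fun i j h a x y => by
      rw [tensMapX_tmk, tensMapX_tmk, op_smul_tmk])

variable {M} in
/-- The morphism `φ ⊗ N : M ⊗ N → M' ⊗ N`. -/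
def tensHom {M' : DGMod k A n} (φ : Hom M M') : Hom (tens M N) (tens M' N) where
  f := tensMapX N φ
  isBimodMap_f := isBimodMap_tensMapX N φ
  comm_d l l' z := by
    by_cases hl : l' + 1 = l
    · rw [tens_d _ _ hl, tens_d _ _ hl]
      refine LinearMap.congr_fun (f := tensMapX N φ l' ∘ₗ tensD M N hl)
        (g := tensD M' N hl ∘ₗ tensMapX N φ l) (tens_hom_ext fun i j h x y => ?_) z
      rw [LinearMap.comp_apply, LinearMap.comp_apply, tensMapX_tmk,
        tensD_tmk M N hl (i' := i - 1) (j' := j - 1) h (by omega) (by omega),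
        tensD_tmk M' N hl (i' := i - 1) (j' := j - 1) h (by omega) (by omega), map_add, map_zsmul,
        tensMapX_tmk, tensMapX_tmk, φ.comm_d]
    · rw [(tens M N).d_shape _ _ hl, (tens M' N).d_shape _ _ hl, LinearMap.zero_apply,
        LinearMap.zero_apply]
      exact map_zero (tensMapX N φ l')
  comm_e l l' z := by
    by_cases hl : l + n = l'
    · rw [tens_e _ _ hl, tens_e _ _ hl]
      refine LinearMap.congr_fun (f := tensMapX N φ l' ∘ₗ tensE M N hl)
        (g := tensE M' N hl ∘ₗ tensMapX N φ l) (tens_hom_ext fun i j h x y => ?_) z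
      rw [LinearMap.comp_apply, LinearMap.comp_apply, tensMapX_tmk,
        tensE_tmk M N hl (j' := j + n) h (by omega),
        tensE_tmk M' N hl (j' := j + n) h (by omega), tensMapX_tmk]
    · rw [(tens M N).e_shape _ _ hl, (tens M' N).e_shape _ _ hl, LinearMap.zero_apply,
        LinearMap.zero_apply]
      exact map_zero (tensMapX N φ l')

/-- The functor `M ↦ M ⊗_{A ⊗ R_n} N`. -/
def tensorRight : CategoryTheory.Functor (DGMod k A n) (DGMod k A n) where
  obj M := tens M N
  map φ := tensHom N φ
  map_id _ := Hom.ext (funext fun _ => tens_hom_ext fun _ _ h x y => tensMapX_tmk N _ h x y)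
  map_comp φ ψ := Hom.ext (funext fun l => tens_hom_ext fun _ _ h x y =>
    (tensMapX_tmk N _ h x y).trans ((tensMapX_tmk N ψ h _ y).symm.trans
      (congrArg (tensMapX N ψ l) (tensMapX_tmk N φ h x y).symm)))

end TensorModule

end DGMod


/-! ### The modules `C(θ₁(f))`, `C(θ₂(f))` and `C₆(f, g)` -/

/-- The product of a family of bimodules. -/
def Bimod.pi {ι : Type} (P : ι → Bimod k A) : Bimod k A where
  carrier := ∀ i, P i

/-- The direct sum of two bimodules. -/
def Bimod.prod (M N : Bimod k A) : Bimod k A where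
  carrier := M × N

/-- The map of products `x ↦ (φ_b (x_{σ b}))_b`. -/
def piMap {ι κ : Type} {P : ι → Bimod k A} {Q : κ → Bimod k A} (σ : κ → ι)
    (φ : ∀ b, P (σ b) →ₗ[k] Q b) : Bimod.pi P →ₗ[k] Bimod.pi Q :=
  LinearMap.pi fun b => φ b ∘ₗ LinearMap.proj (φ := fun i => (P i).carrier) (σ b)

lemma piMap_apply {ι κ : Type} {P : ι → Bimod k A} {Q : κ → Bimod k A} (σ : κ → ι)
    (φ : ∀ b, P (σ b) →ₗ[k] Q b) (x : Bimod.pi P) (b : κ) : piMap σ φ x b = φ b (x (σ b)) := rfl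

lemma isBimodMap_piMap {ι κ : Type} {P : ι → Bimod k A} {Q : κ → Bimod k A} {σ : κ → ι}
    {φ : ∀ b, P (σ b) →ₗ[k] Q b} (h : ∀ b, IsBimodMap (φ b)) : IsBimodMap (piMap σ φ) :=
  ⟨fun a x => funext fun b => (h b).1 a (x (σ b)), fun a x => funext fun b => (h b).2 a (x (σ b))⟩

/-- The map `(x, y) ↦ (α x, β x + γ y)` of direct sums. -/
def prodMap {M N M' N' : Bimod k A} (α : M →ₗ[k] M') (β : M →ₗ[k] N') (γ : N →ₗ[k] N') :
    M.prod N →ₗ[k] M'.prod N' :=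
  LinearMap.prod (α ∘ₗ LinearMap.fst k M N) (β ∘ₗ LinearMap.fst k M N + γ ∘ₗ LinearMap.snd k M N)

lemma prodMap_apply {M N M' N' : Bimod k A} (α : M →ₗ[k] M') (β : M →ₗ[k] N') (γ : N →ₗ[k] N')
    (x : M.prod N) : prodMap α β γ x = (α x.1, β x.1 + γ x.2) := rfl

lemma isBimodMap_prodMap {M N M' N' : Bimod k A} {α : M →ₗ[k] M'} {β : M →ₗ[k] N'}
    {γ : N →ₗ[k] N'} (hα : IsBimodMap α) (hβ : IsBimodMap β) (hγ : IsBimodMap γ) :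
    IsBimodMap (prodMap α β γ) :=
  ⟨fun a x => Prod.ext (hα.1 a x.1)
      ((congrArg₂ (· + ·) (hβ.1 a x.1) (hγ.1 a x.2)).trans (smul_add a _ _).symm),
    fun a x => Prod.ext (hα.2 a x.1)
      ((congrArg₂ (· + ·) (hβ.2 a x.1) (hγ.2 a x.2)).trans (smul_add (op a) _ _).symm)⟩

namespace DGMod

variable {n : ℤ}

/-- The differential graded module `B ⊕ E`, where `d (x, y) = (d x, t x + d y)` for a twisting map
`t` of degree `-1`, and where `(x, y) ε = (0, ρ x)`. -/
def twisted (n : ℤ) (B E : ℤ → Bimod k A) (dB : ∀ i j, j + 1 = i → (B i →ₗ[k] B j))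
    (dE : ∀ i j, j + 1 = i → (E i →ₗ[k] E j)) (t : ∀ i j, j + 1 = i → (B i →ₗ[k] E j))
    (ρ : ∀ i j, i + n = j → (B i →ₗ[k] E j))
    (hdB : ∀ i j h, IsBimodMap (dB i j h)) (hdE : ∀ i j h, IsBimodMap (dE i j h))
    (ht : ∀ i j h, IsBimodMap (t i j h)) (hρ : ∀ i j h, IsBimodMap (ρ i j h))
    (dB_dB : ∀ i j l h h' x, dB j l h' (dB i j h x) = 0)
    (dE_dE : ∀ i j l h h' x, dE j l h' (dE i j h x) = 0)
    (t_dB : ∀ i j l h h' x, t j l h' (dB i j h x) + dE j l h' (t i j h x) = 0)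
    (dE_ρ : ∀ i j i' j' h h' h₁ h₂ x, dE i' j' h' (ρ i i' h₁ x) = ρ j j' h₂ (dB i j h x)) :
    DGMod k A n where
  X i := Bimod.prod (B i) (E i)
  d i j := if h : j + 1 = i then prodMap (dB i j h) (t i j h) (dE i j h) else 0
  isBimodMap_d i j := by
    split_ifs with h
    · exact isBimodMap_prodMap (hdB i j h) (ht i j h) (hdE i j h)
    · exact IsBimodMap.zero
  d_shape i j h := dif_neg h
  d_d i j l x := by
    by_cases h : j + 1 = i
    · by_cases h' : l + 1 = j
      · rw [dif_pos h, dif_pos h']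
        refine Prod.ext (dB_dB i j l h h' x.1) ?_
        change t j l h' (dB i j h x.1) + dE j l h' (t i j h x.1 + dE i j h x.2) = 0
        rw [map_add, dE_dE, add_zero, t_dB]
      · rw [dif_neg h', LinearMap.zero_apply]
    · rw [dif_neg h, LinearMap.zero_apply, map_zero]
  e i j := if h : i + n = j then prodMap 0 (ρ i j h) 0 else 0
  isBimodMap_e i j := by
    split_ifs with h
    · exact isBimodMap_prodMap IsBimodMap.zero (hρ i j h) IsBimodMap.zero
    · exact IsBimodMap.zero
  e_shape i j h := dif_neg h
  e_e i j l x := by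
    by_cases h : i + n = j
    · by_cases h' : j + n = l
      · rw [dif_pos h, dif_pos h']
        refine Prod.ext rfl ?_
        change ρ j l h' 0 + 0 = 0
        rw [map_zero, add_zero]
      · rw [dif_neg h', LinearMap.zero_apply]
    · rw [dif_neg h, LinearMap.zero_apply, map_zero]
  d_e i j i' j' h₁ h₂ x := by
    rw [dif_pos h₁, dif_pos h₂]
    by_cases h : j + 1 = i
    · have h' : j' + 1 = i' := by omega
      rw [dif_pos h, dif_pos h']
      refine Prod.ext (map_zero (dB i' j' h')) ?_
      change t i' j' h' 0 + dE i' j' h' (ρ i i' h₁ x.1 + 0) = ρ j j' h₂ (dB i j h x.1) + 0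
      rw [map_zero, zero_add, add_zero, add_zero, dE_ρ i j i' j' h h']
    · rw [dif_neg h, dif_neg (show ¬ j' + 1 = i' by omega), LinearMap.zero_apply,
        LinearMap.zero_apply, map_zero]

end DGMod

variable (k A) in
/-- The degree `i` part of the bar complex `Bar_*(A)`, which has `A^{⊗ (r+2)}` in degree `r`. -/
def barX (i : ℤ) : Bimod k A :=
  Bimod.pi fun r : {r : ℕ // (r : ℤ) = i} => T k A (r.1 + 1)

variable (k A) in
/-- The differential of `Bar_*(A)`. -/
def barD (i j : ℤ) (h : j + 1 = i) : barX k A i →ₗ[k] barX k A j :=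
  piMap (fun r : {r : ℕ // (r : ℤ) = j} => ⟨r.1 + 1, by have := r.2; push_cast; omega⟩)
    (fun r => dT k A (r.1 + 1))

variable (k A) in
/-- The degree `i` part of the bar resolution `Bar_*(Ω^p(A))` of `Ω^p(A)`, shifted so that it has
`A^{⊗ (p+s+2)}` in degree `s + c`. -/
def barOmX (p : ℕ) (c i : ℤ) : Bimod k A :=
  Bimod.pi fun s : {s : ℕ // (s : ℤ) + c = i} => T k A (p + s.1 + 1)

variable (k A) in
/-- The differential of `Bar_*(Ω^p(A))`. -/
def barOmD (p : ℕ) (c i j : ℤ) (h : j + 1 = i) : barOmX k A p c i →ₗ[k] barOmX k A p c j :=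
  piMap (fun s : {s : ℕ // (s : ℤ) + c = j} => ⟨s.1 + 1, by have := s.2; push_cast; omega⟩)
    (fun s => dT k A (p + s.1 + 1))

lemma dT_dT_apply (n : ℕ) (x : T k A (n + 1 + 1)) : dT k A n (dT k A (n + 1) x) = 0 :=
  LinearMap.congr_fun (dT_dT n) x

variable (k A) in
lemma barD_barD (i j l : ℤ) (h : j + 1 = i) (h' : l + 1 = j) (x : barX k A i) :
    barD k A j l h' (barD k A i j h x) = 0 :=
  funext fun r : {r : ℕ // (r : ℤ) = l} => dT_dT_apply (r.1 + 1)
    (x ⟨r.1 + 1 + 1, by have := r.2; push_cast; omega⟩)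

variable (k A) in
lemma barOmD_barOmD (p : ℕ) (c i j l : ℤ) (h : j + 1 = i) (h' : l + 1 = j)
    (x : barOmX k A p c i) : barOmD k A p c j l h' (barOmD k A p c i j h x) = 0 :=
  funext fun s : {s : ℕ // (s : ℤ) + c = l} => dT_dT_apply (p + s.1 + 1)
    (x ⟨s.1 + 1 + 1, by have := s.2; push_cast; omega⟩)

section Cone

variable {m p : ℕ}

/-- The differential graded module `Bar_*(A) ⊕ Bar_*(Ω^p(A)) ⊗ ε_{m-1}` with the twisting map
`θ : Bar_{m+s}(A) → Bar_s(Ω^p(A)) ⊗ ε_{m-1}`. The element `ε` of degree `m - p - 1` identifies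
`Bar_{p+s}(A)` with `Bar_s(Ω^p(A)) ⊗ ε_{m-1}` and is zero elsewhere. -/
def cone (θ : ∀ s, T k A (m + s + 1) →ₗ[k] T k A (p + s + 1)) (hθ : ∀ s, IsBimodMap (θ s))
    (h : ∀ s, θ s ∘ₗ dT k A (m + s + 1) = -(dT k A (p + s + 1) ∘ₗ θ (s + 1))) :
    DGMod k A ((m : ℤ) - p - 1) :=
  DGMod.twisted _ (barX k A) (barOmX k A p (m - 1)) (barD k A) (barOmD k A p (m - 1))
    (fun i j h => piMap (fun s : {s : ℕ // (s : ℤ) + (m - 1) = j} =>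
        (⟨m + s.1, by have := s.2; push_cast; omega⟩ : {r : ℕ // (r : ℤ) = i}))
      (fun s => θ s.1))
    (fun i j h => piMap (fun s : {s : ℕ // (s : ℤ) + (m - 1) = j} =>
        (⟨p + s.1, by have := s.2; push_cast; omega⟩ : {r : ℕ // (r : ℤ) = i}))
      (fun _ => LinearMap.id))
    (fun _ _ _ => isBimodMap_piMap fun _ => isBimodMap_dT _)
    (fun _ _ _ => isBimodMap_piMap fun _ => isBimodMap_dT _)
    (fun _ _ _ => isBimodMap_piMap fun s => hθ s.1)
    (fun _ _ _ => isBimodMap_piMap fun _ => ⟨fun _ _ => rfl, fun _ _ => rfl⟩)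
    (barD_barD k A) (barOmD_barOmD k A p (m - 1))
    (fun _ _ _ _ _ x => funext fun s =>
      (congrArg (· + _) (LinearMap.congr_fun (h s.1) (x ⟨m + s.1 + 1, _⟩))).trans
        (neg_add_cancel _))
    (fun _ _ _ _ _ _ _ _ _ => rfl)

/-- The differential graded module `C(θ₁(f))`. -/
def Ctheta1 (f : Cochain m (Om k A p)) (hf : IsCocycle f) : DGMod k A ((m : ℤ) - p - 1) :=
  cone (theta1 f) (isBimodMap_theta1 f) (theta1_anticomm hf)

/-- The differential graded module `C(θ₂(f))`. -/
def Ctheta2 (f : Cochain m (Om k A p)) (hf : IsCocycle f) : DGMod k A ((m : ℤ) - p - 1) :=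
  cone (theta2 f) (isBimodMap_theta2 f) (theta2_anticomm hf)

/-- The bimodule `Ω^p(A) ⊗_A Ω^p(A)`, placed in degree `c`. -/
def omOmX (k : Type v) (A : Type u) [CommRing k] [Ring A] [Algebra k A] (p : ℕ) (c i : ℤ) :
    Bimod k A :=
  Bimod.pi fun _ : {_u : Unit // c = i} => (Om k A p).bal (Om k A p)

/-- The map from the degree `i` part of `Bar_*(A)` to the degree `j` part of `Ω^p(A) ⊗_A Ω^p(A)`
(placed in degree `c`) that is given by `φ` on `Bar_r(A)`. -/
def toOmOm {c i j : ℤ} {r : ℕ} (hr : c = j → (r : ℤ) = i)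
    (φ : T k A (r + 1) →ₗ[k] (Om k A p).bal (Om k A p)) : barX k A i →ₗ[k] omOmX k A p c j :=
  piMap (fun u : {_u : Unit // c = j} => (⟨r, hr u.2⟩ : {r : ℕ // (r : ℤ) = i})) (fun _ => φ)

lemma isBimodMap_toOmOm {c i j : ℤ} {r : ℕ} {hr : c = j → (r : ℤ) = i}
    {φ : T k A (r + 1) →ₗ[k] (Om k A p).bal (Om k A p)} (h : IsBimodMap φ) :
    IsBimodMap (toOmOm hr φ) :=
  isBimodMap_piMap (P := fun r : {r : ℕ // (r : ℤ) = i} => T k A (r.1 + 1))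
    (σ := fun u : {_u : Unit // c = j} => (⟨r, hr u.2⟩ : {r : ℕ // (r : ℤ) = i})) fun _ => h

lemma toOmOm_barD {c i j l : ℤ} {r : ℕ} {hr : c = l → (r : ℤ) = j}
    {φ : T k A (r + 1) →ₗ[k] (Om k A p).bal (Om k A p)} (h : φ ∘ₗ dT k A (r + 1) = 0)
    (hj : j + 1 = i) (x : barX k A i) : toOmOm hr φ (barD k A i j hj x) = 0 :=
  funext fun u : {_u : Unit // c = l} => LinearMap.congr_fun h
    (x ⟨r + 1, by have := hr u.2; push_cast; omega⟩)

/-- The differential graded module `Bar_*(A) ⊕ (Ω^p(A) ⊗_A Ω^p(A)) ⊗ ε_{m+p-1}`. The twisting map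
is `f ⊗_A d + d ⊗_A g` with the signs of the Koszul rule; it is applied after
`Δ : Bar_*(A) → Bar_*(A) ⊗_A Bar_*(A)`. The element `ε` acts on `Bar_{2p}(A)` as `d ⊗_A d` after
`Δ`, and it is zero elsewhere. -/
def C6 (f g : Cochain m (Om k A p)) (hf : IsCocycle f) (hg : IsCocycle g) :
    DGMod k A ((m : ℤ) - p - 1) :=
  DGMod.twisted _ (barX k A) (omOmX k A p (m + p - 1)) (barD k A) (fun _ _ _ => 0)
    (fun i j h =>
      -(((m * p : ℤ).negOnePow : ℤ) •
          toOmOm (r := p + m) (by omega) (cupT m p (biext f) (dOm k A p)) +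
        ((p : ℤ).negOnePow : ℤ) •
          toOmOm (r := m + p) (by omega) (cupT p m (dOm k A p) (biext g))))
    (fun i j h => toOmOm (r := p + p) (by omega) (cupT p p (dOm k A p) (dOm k A p)))
    (fun _ _ _ => isBimodMap_piMap fun _ => isBimodMap_dT _)
    (fun _ _ _ => IsBimodMap.zero)
    (fun _ _ _ => (((isBimodMap_toOmOm
          (isBimodMap_cupT (isBimodMap_biext f) (isBimodMap_dOm p))).zsmul _).add
        ((isBimodMap_toOmOm
          (isBimodMap_cupT (isBimodMap_dOm p) (isBimodMap_biext g))).zsmul _)).neg)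
    (fun _ _ _ => isBimodMap_toOmOm (isBimodMap_cupT (isBimodMap_dOm p) (isBimodMap_dOm p)))
    (barD_barD k A)
    (fun _ _ _ _ _ _ => rfl)
    (fun i j l h h' x => by
      rw [LinearMap.zero_apply, add_zero, LinearMap.neg_apply, LinearMap.add_apply,
        LinearMap.smul_apply, LinearMap.smul_apply,
        toOmOm_barD (cupT_dT (isBimodMap_biext f) (isBimodMap_dOm p) (biext_dT hf) (dOm_dT p)),
        toOmOm_barD (cupT_dT (isBimodMap_dOm p) (isBimodMap_biext g) (dOm_dT p) (biext_dT hg)),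
        smul_zero, smul_zero, add_zero, neg_zero])
    (fun i j i' j' h h' h₁ h₂ x => by
      rw [toOmOm_barD (cupT_dT (isBimodMap_dOm p) (isBimodMap_dOm p) (dOm_dT p) (dOm_dT p)),
        LinearMap.zero_apply])

end Cone

section Derived

open CategoryTheory

namespace DGMod

variable {n : ℤ}

/-- The functor from the category of differential graded modules to the `R_n`-relative derived
category that sends `M` to `M ⊗_{A ⊗ R_n} N`. Its total left derived functor, along the
localization functor at the `R_n`-relative quasi-isomorphisms, is the `R_n`-relative derived tensor
product with `N`. -/
noncomputable def tensorRightQ (N : DGMod k A n) : DGMod k A n ⥤ RelDerived k A n :=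
  tensorRight N ⋙ (relQuasiIso k A n).Q

end DGMod

end Derived

end

end SingDef

/-! A relative quasi-isomorphism is a homotopy equivalence over R that may forget A. Tensoring over
A ⊗ R preserves homotopy equivalences whose inverses and homotopies are linear over A on the side
that is tensored (`IsHtpyEquiv.tensHom`, `IsHtpyEquiv.tensHomRight`). The proof therefore produces
one-sided homotopy equivalences, and almost all of them come from one perturbation argument. If H is
a map of degree one on a mapping cone and V = dH + Hd is bijective, then H V⁻¹ is a contraction; and
V is bijective as soon as V - 1 is locally nilpotent. So it is enough to have an approximate inverse
g with approximate homotopies h, h', provided that repeating the error eventually gives zero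
(`isHtpyEquiv_of_coneGen`).

Derived functor. The bar resolution B(M) = M ⊗_A Bar_*(A) is functorial, and its augmentation to M
is a relative quasi-isomorphism (`isRelQuasiIso_barAug`). It turns relative quasi-isomorphisms into
right linear homotopy equivalences (`IsRelQuasiIso.isHtpyEquiv_barHom`): homotopy data that are not
A-linear, applied to the factor M only, become right linear, and they fail to respect the
differential only through terms of smaller bar length. If the right action M ⊗ A → M has a right
linear section that commutes with ε, and with d up to a filtration (`FilteredSplitting`), then B(M)
→ M is itself a right linear homotopy equivalence. This applies to every B(M), filtered by bar
length, and to C(θ₁(f)), filtered by degree. The usual argument with functorial acyclic resolutions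
then gives the total left derived functor and shows that its counit is invertible at C(θ₁(f)).

Identification with C₆. In C(θ) the resolution Bar_*(Ω^p(A)) may be replaced by Ω^p(A) itself,
giving the smaller module `cocycleData` in which f appears as the twisting map. The contraction
inserts 1 on the left for θ₁, which is right linear, and on the right for θ₂, which is left linear,
so both factors of the tensor product can be replaced. In the tensor product of the two small
modules every element of Ω^p(A) is of the form x ε. Moving ε across the tensor sign shows that Ω^p ⊗
Ω^p dies because ε² = 0, and that the mixed summands Ω^p ⊗ Bar and Bar ⊗ Ω^p collapse to a single
copy of Ω^p ⊗_A Ω^p. Hence this tensor product is isomorphic to Bar ⊗_A Bar ⊕ Ω^p ⊗_A Ω^p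
(`prodComparison`).

Finally the diagonal Δ : Bar → Bar ⊗_A Bar carries the structure maps of C₆ to those of this module
(`cross_barDiag`). It is split by the contraction μ ⊗ 1, whose kernel is acyclic. That the resulting
morphism is a homotopy equivalence over R is where the field is used: a complex over R is
contractible when both it and the image of ε are acyclic (`contractible_of_acyclic`). For the cone
of this morphism the second condition holds because ε maps onto Ω^p ⊗_A Ω^p already in C₆. -/

namespace SingDef

section

variable {k : Type v} {A : Type u} [CommRing k] [Ring A] [Algebra k A]

/-! ### Linearity on a chosen side -/

/-- The actions of `A` with which a linear map is required to be compatible. -/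
inductive Side
  | none
  | left
  | right

/-- Compatibility with the actions of `A` on the given side. -/
def Side.Lin : Side → ∀ {M N : Bimod k A}, (M →ₗ[k] N) → Prop
  | .none, _, _, _ => True
  | .left, _, _, φ => IsLeft φ
  | .right, _, _, φ => IsRight φ

namespace Side

variable {M N P : Bimod k A}

lemma lin_of_isBimodMap (S : Side) {φ : M →ₗ[k] N} (h : IsBimodMap φ) : S.Lin φ := by
  cases S
  exacts [trivial, h.1, h.2]

lemma Lin.comp {S : Side} {ψ : N →ₗ[k] P} {φ : M →ₗ[k] N} (hψ : S.Lin ψ) (hφ : S.Lin φ) :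
    S.Lin (ψ ∘ₗ φ) := by
  cases S
  exacts [trivial, IsLeft.comp hψ hφ, IsRight.comp hψ hφ]

lemma Lin.add {S : Side} {ψ φ : M →ₗ[k] N} (hψ : S.Lin ψ) (hφ : S.Lin φ) : S.Lin (ψ + φ) := by
  cases S
  · trivial
  · exact fun a x => by rw [LinearMap.add_apply, LinearMap.add_apply, hψ a, hφ a, smul_add]
  · exact fun a x => by rw [LinearMap.add_apply, LinearMap.add_apply, hψ a, hφ a, smul_add]

lemma Lin.neg {S : Side} {φ : M →ₗ[k] N} (hφ : S.Lin φ) : S.Lin (-φ) := by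
  cases S
  · trivial
  · exact fun a x => by rw [LinearMap.neg_apply, LinearMap.neg_apply, hφ a, smul_neg]
  · exact fun a x => by rw [LinearMap.neg_apply, LinearMap.neg_apply, hφ a, smul_neg]

lemma Lin.sub {S : Side} {ψ φ : M →ₗ[k] N} (hψ : S.Lin ψ) (hφ : S.Lin φ) : S.Lin (ψ - φ) := by
  rw [sub_eq_add_neg]
  exact hψ.add hφ.neg

lemma lin_zero (S : Side) : S.Lin (0 : M →ₗ[k] N) := S.lin_of_isBimodMap IsBimodMap.zero

lemma lin_id (S : Side) : S.Lin (LinearMap.id : M →ₗ[k] M) :=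
  S.lin_of_isBimodMap ⟨fun _ _ => rfl, fun _ _ => rfl⟩

lemma Lin.zsmul {S : Side} (c : ℤ) {φ : M →ₗ[k] N} (hφ : S.Lin φ) : S.Lin (c • φ) := by
  cases S
  · trivial
  · exact fun a x => by rw [LinearMap.smul_apply, LinearMap.smul_apply, hφ a, smul_comm]
  · exact fun a x => by rw [LinearMap.smul_apply, LinearMap.smul_apply, hφ a, smul_comm]

/-- A contraction is obtained below by composing with the inverse of a commutator dH + Hd. The
composite has to remain linear on the chosen side. -/
lemma Lin.ofBijective_symm {S : Side} {φ : M →ₗ[k] N} (hφ : S.Lin φ)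
    (h : Function.Bijective φ) : S.Lin (LinearEquiv.ofBijective φ h).symm.toLinearMap := by
  have key : ∀ x, φ ((LinearEquiv.ofBijective φ h).symm x) = x :=
    (LinearEquiv.ofBijective φ h).apply_symm_apply
  cases S
  · trivial
  · exact fun a x => h.1 (((key _).trans (congrArg (a • ·) (key x)).symm).trans (hφ a _).symm)
  · exact fun a x => h.1 (((key _).trans (congrArg (op a • ·) (key x)).symm).trans (hφ a _).symm)

end Side

/-! ### Projections and inclusions of direct sums and products -/

namespace Bimod

/-- The first projection. -/
def fst (M N : Bimod k A) : M.prod N →ₗ[k] M := LinearMap.fst k M N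

/-- The second projection. -/
def snd (M N : Bimod k A) : M.prod N →ₗ[k] N := LinearMap.snd k M N

/-- The map to a direct sum with given components. -/
def pair {Z : Type*} [AddCommGroup Z] [Module k Z] {M N : Bimod k A} (φ : Z →ₗ[k] M)
    (ψ : Z →ₗ[k] N) : Z →ₗ[k] M.prod N := LinearMap.prod φ ψ

/-- The first inclusion. -/
def inl (M N : Bimod k A) : M →ₗ[k] M.prod N := LinearMap.inl k M N

/-- The second inclusion. -/
def inr (M N : Bimod k A) : N →ₗ[k] M.prod N := LinearMap.inr k M N

variable {M N : Bimod k A} {Z : Type*} [AddCommGroup Z] [Module k Z]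

@[simp] lemma fst_inr (x : N) : fst M N (inr M N x) = 0 := rfl

@[simp] lemma snd_inr (x : N) : snd M N (inr M N x) = x := rfl

lemma prod_ext {x y : M.prod N} (h₁ : fst M N x = fst M N y) (h₂ : snd M N x = snd M N y) :
    x = y := Prod.ext h₁ h₂

lemma isBimodMap_fst : IsBimodMap (fst M N) := ⟨fun _ _ => rfl, fun _ _ => rfl⟩

lemma isBimodMap_snd : IsBimodMap (snd M N) := ⟨fun _ _ => rfl, fun _ _ => rfl⟩

lemma isBimodMap_inl : IsBimodMap (inl M N) :=
  ⟨fun a _ => Prod.ext rfl (smul_zero a).symm, fun a _ => Prod.ext rfl (smul_zero (op a)).symm⟩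

lemma isBimodMap_inr : IsBimodMap (inr M N) :=
  ⟨fun a _ => Prod.ext (smul_zero a).symm rfl, fun a _ => Prod.ext (smul_zero (op a)).symm rfl⟩

lemma lin_pair {P : Bimod k A} {S : Side} {φ : P →ₗ[k] M} {ψ : P →ₗ[k] N} (hφ : S.Lin φ)
    (hψ : S.Lin ψ) : S.Lin (pair φ ψ) := by
  cases S
  · trivial
  · exact fun a x => prod_ext (hφ a x) (hψ a x)
  · exact fun a x => prod_ext (hφ a x) (hψ a x)

lemma isBimodMap_pair {P : Bimod k A} {φ : P →ₗ[k] M} {ψ : P →ₗ[k] N} (hφ : IsBimodMap φ)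
    (hψ : IsBimodMap ψ) : IsBimodMap (pair φ ψ) :=
  ⟨lin_pair (S := .left) hφ.1 hψ.1, lin_pair (S := .right) hφ.2 hψ.2⟩

variable {ι : Type} {P : ι → Bimod k A}

/-- The projection of a product. -/
def proj (P : ι → Bimod k A) (i : ι) : Bimod.pi P →ₗ[k] P i :=
  LinearMap.proj (φ := fun i => (P i).carrier) i

/-- The map to a product with given components. -/
def piLift (φ : ∀ i, Z →ₗ[k] P i) : Z →ₗ[k] Bimod.pi P := LinearMap.pi φ

lemma proj_piMap {κ : Type} {Q : κ → Bimod k A} (σ : κ → ι)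
    (φ : ∀ b, P (σ b) →ₗ[k] Q b) (x : Bimod.pi P) (b : κ) :
    proj Q b (piMap σ φ x) = φ b (proj P (σ b) x) := rfl

lemma pi_ext {x y : Bimod.pi P} (h : ∀ i, proj P i x = proj P i y) : x = y := funext h

lemma isBimodMap_proj (i : ι) : IsBimodMap (proj P i) := ⟨fun _ _ => rfl, fun _ _ => rfl⟩

lemma lin_piLift {Q : Bimod k A} {S : Side} {φ : ∀ i, Q →ₗ[k] P i} (h : ∀ i, S.Lin (φ i)) :
    S.Lin (piLift φ) := by
  cases S
  · trivial
  · exact fun a x => pi_ext fun i => h i a x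
  · exact fun a x => pi_ext fun i => h i a x

lemma isBimodMap_piLift {Q : Bimod k A} {φ : ∀ i, Q →ₗ[k] P i} (h : ∀ i, IsBimodMap (φ i)) :
    IsBimodMap (piLift φ) :=
  ⟨lin_piLift (S := .left) fun i => (h i).1, lin_piLift (S := .right) fun i => (h i).2⟩

/-- The inclusion of the only factor of a product. -/
def single [Subsingleton ι] (P : ι → Bimod k A) (i : ι) : P i →ₗ[k] Bimod.pi P :=
  piLift fun j => Subsingleton.elim i j ▸ LinearMap.id

@[simp] lemma proj_single [Subsingleton ι] (i : ι) (x : P i) : proj P i (single P i x) = x := rfl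

/-- The index types that occur, such as {r : ℕ // (r : ℤ) = i}, have at most one element, so a
product over them is either its only factor or zero. Graded pieces are written in this way to avoid
transport along equalities of degrees. -/
lemma single_proj [Subsingleton ι] (i : ι) (x : Bimod.pi P) : single P i (proj P i x) = x :=
  pi_ext fun j => by
    obtain rfl := Subsingleton.elim i j
    rfl

lemma isBimodMap_single [Subsingleton ι] (i : ι) : IsBimodMap (single P i) :=
  isBimodMap_piLift fun j => by
    obtain rfl := Subsingleton.elim i j
    exact ⟨fun _ _ => rfl, fun _ _ => rfl⟩

open Classical in
/-- The map out of a product with at most one factor that is given on this factor. -/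
noncomputable def piDesc (φ : ∀ i, P i →ₗ[k] Z) : Bimod.pi P →ₗ[k] Z :=
  if h : Nonempty ι then φ h.some ∘ₗ proj P h.some else 0

lemma piDesc_apply [Subsingleton ι] (φ : ∀ i, P i →ₗ[k] Z) (i : ι) (x : Bimod.pi P) :
    piDesc φ x = φ i (proj P i x) := by
  have h : Nonempty ι := ⟨i⟩
  rw [piDesc, dif_pos h, Subsingleton.elim h.some i]
  rfl

lemma pi_eq_zero [h : IsEmpty ι] (x : Bimod.pi P) : x = 0 := pi_ext fun i => h.elim i

end Bimod

/-! ### Unipotent endomorphisms -/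

section Unipotent

variable {E : Type*} [AddCommGroup E] [Module k E] (V : Module.End k E)

/-- The maximal generalized eigenspace for the eigenvalue 1 consists of the vectors killed by some
power of V - 1. Membership is always checked through this step: it suffices to treat the error V z -
z, which in the applications is smaller in some order. -/
lemma mem_maxGenEigenspace_one_of_sub {z : E} (h : V z - z ∈ V.maxGenEigenspace 1) :
    z ∈ V.maxGenEigenspace 1 := by
  rw [Module.End.mem_maxGenEigenspace] at h ⊢
  obtain ⟨j, hj⟩ := h
  refine ⟨j + 1, ?_⟩
  rw [pow_succ, Module.End.mul_apply]
  simpa using hj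

/-- An endomorphism `V` for which `V - 1` is locally nilpotent is bijective. -/
lemma bijective_of_maxGenEigenspace_one (h : ∀ z, z ∈ V.maxGenEigenspace 1) :
    Function.Bijective V := by
  have key : ∀ z, ∃ j : ℕ, ((V - 1) ^ j) z = 0 := fun z => by
    simpa using (Module.End.mem_maxGenEigenspace V 1 z).1 (h z)
  have happ : ∀ z, (V - 1) z = V z - z := fun z => rfl
  refine ⟨(injective_iff_map_eq_zero V).2 fun z hz => ?_, fun z => ?_⟩
  -- If V z = 0, then (V - 1) z = -z, so the exponent with which V - 1 kills z can be lowered until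
  -- it is 0.
  · obtain ⟨j, hj⟩ := key z
    induction j with
    | zero => exact hj
    | succ j ih =>
      refine ih ?_
      rw [pow_succ, Module.End.mul_apply, happ, hz, zero_sub, map_neg, neg_eq_zero] at hj
      exact hj
  · obtain ⟨j, hj⟩ := key z
    induction j generalizing z with
    | zero => exact ⟨0, by simpa using hj.symm⟩
    | succ j ih =>
      rw [pow_succ, Module.End.mul_apply] at hj
      -- If V y = (V - 1) z, then V (z - y) = z.
      obtain ⟨y, hy⟩ := ih _ hj
      exact ⟨z - y, by rw [map_sub, hy, happ]; abel⟩

end Unipotent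

namespace DGMod

variable {n : ℤ}

/-! ### Contractions and homotopy equivalences -/

/-- There is an `R_n`-linear contraction that is compatible with the actions of `A` on the given
side. -/
def Contractible (S : Side) (K : DGMod k A n) : Prop :=
  ∃ H : ∀ i j, K.X i →ₗ[k] K.X j, (∀ i j, S.Lin (H i j)) ∧
    (∀ i j i' j', i + 1 = j → i + n = i' → j + n = j' → ∀ x,
      H i' j' (K.e i i' x) = K.e j j' (H i j x)) ∧
    ∀ i j l, i + 1 = j → l + 1 = i → ∀ x, K.d j i (H i j x) + H l i (K.d i l x) = x

/-- `φ` has a homotopy inverse in the category of differential graded modules over `R_n` and over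
`A` acting on the given side. -/
def IsHtpyEquiv (S : Side) {M N : DGMod k A n} (φ : Hom M N) : Prop :=
  ∃ (g : ∀ i, N.X i →ₗ[k] M.X i) (h : ∀ i j, M.X i →ₗ[k] M.X j) (h' : ∀ i j, N.X i →ₗ[k] N.X j),
    (∀ i, S.Lin (g i)) ∧ (∀ i j, S.Lin (h i j)) ∧ (∀ i j, S.Lin (h' i j)) ∧
    (∀ i j x, g j (N.d i j x) = M.d i j (g i x)) ∧
    (∀ i j x, g j (N.e i j x) = M.e i j (g i x)) ∧
    (∀ i i' x, h i' (i' + 1) (M.e i i' x) = M.e (i + 1) (i' + 1) (h i (i + 1) x)) ∧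
    (∀ i i' x, h' i' (i' + 1) (N.e i i' x) = N.e (i + 1) (i' + 1) (h' i (i + 1) x)) ∧
    (∀ i x, x - g i (φ.f i x) = M.d (i + 1) i (h i (i + 1) x) + h (i - 1) i (M.d i (i - 1) x)) ∧
    (∀ i x, x - φ.f i (g i x) = N.d (i + 1) i (h' i (i + 1) x) + h' (i - 1) i (N.d i (i - 1) x))

lemma IsHtpyEquiv.isRelQuasiIso {S : Side} {M N : DGMod k A n} {φ : Hom M N}
    (h : IsHtpyEquiv S φ) : IsRelQuasiIso φ := by
  obtain ⟨g, h, h', -, -, -, H⟩ := h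
  exact ⟨g, h, h', H⟩

lemma isRelQuasiIso_of_bijective {M N : DGMod k A n} (φ : Hom M N)
    (h : ∀ i, Function.Bijective (φ.f i)) : IsRelQuasiIso φ := by
  let E := fun i => LinearEquiv.ofBijective (φ.f i) (h i)
  have e₁ : ∀ i x, φ.f i ((E i).symm x) = x := fun i => (E i).apply_symm_apply
  have e₂ : ∀ i x, (E i).symm (φ.f i x) = x := fun i => (E i).symm_apply_apply
  refine ⟨fun i => (E i).symm.toLinearMap, fun _ _ => 0, fun _ _ => 0, fun i j x => ?_,
    fun i j x => ?_, fun i i' x => ?_, fun i i' x => ?_, fun i x => ?_, fun i x => ?_⟩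
  · refine (h j).1 ?_
    rw [φ.comm_d]
    exact (e₁ _ _).trans (congrArg _ (e₁ _ _).symm)
  · refine (h j).1 ?_
    rw [φ.comm_e]
    exact (e₁ _ _).trans (congrArg _ (e₁ _ _).symm)
  · simp
  · simp
  · simpa [sub_eq_zero] using (e₂ i x).symm
  · simpa [sub_eq_zero] using (e₁ i x).symm

section Unipotent

variable (K : DGMod k A n) (H : ∀ i j, K.X i →ₗ[k] K.X j)

/-- The commutator `d H + H d` of a map of degree one with the differential. -/
def boundary (i : ℤ) : Module.End k (K.X i) :=
  K.d (i + 1) i ∘ₗ H i (i + 1) + H (i - 1) i ∘ₗ K.d i (i - 1)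

lemma boundary_apply {i j l : ℤ} (hj : i + 1 = j) (hl : l + 1 = i) (x : K.X i) :
    boundary K H i x = K.d j i (H i j x) + H l i (K.d i l x) := by
  subst hj
  obtain rfl : l = i - 1 := by omega
  rfl

variable {K H}

/-- A map of degree one whose commutator with the differential is bijective can be corrected to a
contraction. -/
lemma contractible_of_bijective {S : Side} (hS : ∀ i j, S.Lin (H i j))
    (he : ∀ i j i' j', i + 1 = j → i + n = i' → j + n = j' → ∀ x,
      H i' j' (K.e i i' x) = K.e j j' (H i j x))
    (hb : ∀ i, Function.Bijective (boundary K H i)) : Contractible S K := by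
  let E := fun i => LinearEquiv.ofBijective (boundary K H i) (hb i)
  have e₁ : ∀ i x, boundary K H i ((E i).symm x) = x := fun i => (E i).apply_symm_apply
  -- With V = dH + Hd, both V d and d V equal d H d. Hence V⁻¹ commutes with d.
  have hd : ∀ i l, l + 1 = i → ∀ x, (E l).symm (K.d i l x) = K.d i l ((E i).symm x) :=
    fun i l h x => by
      refine (hb l).1 ((e₁ _ _).trans ?_)
      rw [boundary_apply K H h (show l - 1 + 1 = l by omega), K.d_d, map_zero, add_zero]
      conv_lhs => rw [← e₁ i x]
      rw [boundary_apply K H rfl h, map_add, K.d_d, zero_add]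
  -- V commutes with ε since H and d do, and therefore so does V⁻¹.
  have hE : ∀ i i', i + n = i' → ∀ x, (E i').symm (K.e i i' x) = K.e i i' ((E i).symm x) :=
    fun i i' h x => by
      refine (hb i').1 ((e₁ _ _).trans ?_)
      rw [boundary_apply K H (j := i' + 1) rfl (show i' - 1 + 1 = i' by omega),
        he i (i + 1) i' (i' + 1) rfl h (by omega),
        K.d_e (i + 1) i (i' + 1) i' (by omega) h,
        K.d_e i (i - 1) i' (i' - 1) h (by omega),
        he (i - 1) i (i' - 1) i' (by omega) (by omega) h, ← map_add,
        ← boundary_apply K H rfl (show i - 1 + 1 = i by omega), e₁]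
  -- The contraction is H V⁻¹: as V⁻¹ commutes with d, one gets d H V⁻¹ + H V⁻¹ d = V V⁻¹ = 1.
  refine ⟨fun i j => H i j ∘ₗ (E i).symm.toLinearMap, fun i j => (hS i j).comp ?_,
    fun i j i' j' hj hi hj' x => ?_, fun i j l hj hl x => ?_⟩
  · refine Side.Lin.ofBijective_symm (Side.Lin.add (Side.Lin.comp ?_ (hS _ _))
      (Side.Lin.comp (hS _ _) ?_)) (hb i)
    · exact S.lin_of_isBimodMap (K.isBimodMap_d _ _)
    · exact S.lin_of_isBimodMap (K.isBimodMap_d _ _)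
  · change H i' j' ((E i').symm (K.e i i' x)) = K.e j j' (H i j ((E i).symm x))
    rw [hE i i' hi, he i j i' j' hj hi hj']
  · change K.d j i (H i j ((E i).symm x)) + H l i ((E l).symm (K.d i l x)) = x
    rw [hd i l hl, ← boundary_apply K H hj hl, e₁]

end Unipotent

/-! ### The mapping cone -/

section MappingCone

variable {M N : DGMod k A n} (φ : Hom M N)

/-- The factor of the mapping cone in degree `l` that comes from the source. -/
def shiftX (M : DGMod k A n) (l : ℤ) : Bimod k A :=
  Bimod.pi fun j : {j : ℤ // j + 1 = l} => M.X j.1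

/-- The component in degree `j = l - 1`. -/
def shiftProj (M : DGMod k A n) {j l : ℤ} (h : j + 1 = l) : shiftX M l →ₗ[k] M.X j :=
  Bimod.proj (fun j : {j : ℤ // j + 1 = l} => M.X j.1) ⟨j, h⟩

instance (l : ℤ) : Subsingleton {j : ℤ // j + 1 = l} :=
  ⟨fun a b => Subtype.ext (by have := a.2; have := b.2; omega)⟩

/-- The inclusion of the component in degree `j = l - 1`. -/
def shiftSingle (M : DGMod k A n) {j l : ℤ} (h : j + 1 = l) : M.X j →ₗ[k] shiftX M l :=
  Bimod.single (fun j : {j : ℤ // j + 1 = l} => M.X j.1) ⟨j, h⟩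

lemma shift_ext {l : ℤ} {x y : shiftX M l} {j : ℤ} (h : j + 1 = l)
    (hxy : shiftProj M h x = shiftProj M h y) : x = y :=
  Bimod.pi_ext fun i => by
    obtain rfl := Subsingleton.elim (⟨j, h⟩ : {j : ℤ // j + 1 = l}) i
    exact hxy

lemma isBimodMap_shiftProj {j l : ℤ} (h : j + 1 = l) : IsBimodMap (shiftProj M h) :=
  Bimod.isBimodMap_proj _

lemma isBimodMap_shiftSingle {j l : ℤ} (h : j + 1 = l) : IsBimodMap (shiftSingle M h) :=
  Bimod.isBimodMap_single (P := fun j : {j : ℤ // j + 1 = l} => M.X j.1) _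

/-- The differential `(y, x) ↦ (d y + φ x, -d x)`. -/
def mappingConeD {l l' : ℤ} (h : l' + 1 = l) :
    (N.X l).prod (shiftX M l) →ₗ[k] (N.X l').prod (shiftX M l') :=
  Bimod.pair (N.d l l' ∘ₗ Bimod.fst _ _ + φ.f l' ∘ₗ shiftProj M h ∘ₗ Bimod.snd _ _)
    (Bimod.piLift fun j => -(M.d l' j.1 ∘ₗ shiftProj M h ∘ₗ Bimod.snd _ _))

/-- The action `(y, x) ε = (y ε, x ε)`. -/
def mappingConeE (M N : DGMod k A n) {l l' : ℤ} (h : l + n = l') :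
    (N.X l).prod (shiftX M l) →ₗ[k] (N.X l').prod (shiftX M l') :=
  Bimod.pair (N.e l l' ∘ₗ Bimod.fst _ _)
    (Bimod.piLift fun j => M.e (j.1 - n) j.1 ∘ₗ
      shiftProj M (show j.1 - n + 1 = l by have := j.2; omega) ∘ₗ Bimod.snd _ _)

/-- The mapping cone of a morphism. -/
def mappingCone : DGMod k A n where
  X l := (N.X l).prod (shiftX M l)
  d l l' := if h : l' + 1 = l then mappingConeD φ h else 0
  isBimodMap_d l l' := by
    split_ifs with h
    · exact Bimod.isBimodMap_pair
        (((N.isBimodMap_d _ _).comp Bimod.isBimodMap_fst).add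
          ((φ.isBimodMap_f _).comp ((isBimodMap_shiftProj h).comp Bimod.isBimodMap_snd)))
        (Bimod.isBimodMap_piLift fun j =>
          ((M.isBimodMap_d _ _).comp ((isBimodMap_shiftProj h).comp Bimod.isBimodMap_snd)).neg)
    · exact IsBimodMap.zero
  d_shape l l' h := dif_neg h
  d_d l l' l'' z := by
    by_cases h : l' + 1 = l
    · by_cases h' : l'' + 1 = l'
      · rw [dif_pos h, dif_pos h']
        refine Bimod.prod_ext ?_ (Bimod.pi_ext fun j => ?_)
        · change N.d l' l'' (N.d l l' _ + φ.f l' _) + φ.f l'' (-M.d l' l'' _) = 0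
          rw [map_add, N.d_d, zero_add, map_neg, φ.comm_d, add_neg_cancel]
        · change -M.d l'' j.1 (-M.d l' l'' _) = 0
          rw [map_neg, M.d_d, neg_zero, neg_zero]
      · rw [dif_neg h', LinearMap.zero_apply]
    · rw [dif_neg h, LinearMap.zero_apply, map_zero]
  e l l' := if h : l + n = l' then mappingConeE M N h else 0
  isBimodMap_e l l' := by
    split_ifs with h
    · exact Bimod.isBimodMap_pair ((N.isBimodMap_e _ _).comp Bimod.isBimodMap_fst)
        (Bimod.isBimodMap_piLift fun j => (M.isBimodMap_e _ _).comp
          ((isBimodMap_shiftProj _).comp Bimod.isBimodMap_snd))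
    · exact IsBimodMap.zero
  e_shape l l' h := dif_neg h
  e_e l l' l'' z := by
    by_cases h : l + n = l'
    · by_cases h' : l' + n = l''
      · rw [dif_pos h, dif_pos h']
        refine Bimod.prod_ext ?_ (Bimod.pi_ext fun j => ?_)
        · exact N.e_e _ _ _ _
        · exact M.e_e _ _ _ _
      · rw [dif_neg h', LinearMap.zero_apply]
    · rw [dif_neg h, LinearMap.zero_apply, map_zero]
  d_e i j i' j' h₁ h₂ z := by
    rw [dif_pos h₁, dif_pos h₂]
    by_cases h : j + 1 = i
    · have h' : j' + 1 = i' := by omega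
      rw [dif_pos h, dif_pos h']
      subst h₂
      obtain rfl : i' = j + 1 + n := by omega
      subst h
      refine Bimod.prod_ext ?_ (Bimod.pi_ext fun r => ?_)
      · obtain ⟨y, x⟩ := z
        change N.d (j + 1 + n) (j + n) (N.e (j + 1) (j + 1 + n) y) + φ.f (j + n)
          (M.e (j + n - n) (j + n) (shiftProj M _ x)) = N.e j (j + n) (N.d (j + 1) j y + φ.f j
          (shiftProj M _ x))
        -- The degrees j + n - n and j agree, but not by definition. Quantifying over r makes a
        -- substitution possible.
        have : ∀ (r : ℤ) (hr : r = j) (h), M.e r (j + n) (shiftProj M (l := j + 1) h x) =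
            M.e j (j + n) (shiftProj M rfl x) := by
          rintro _ rfl _
          rfl
        rw [this _ (by omega), N.d_e (j + 1) j (j + 1 + n) (j + n) rfl rfl, φ.comm_e, map_add]
      · obtain ⟨y, x⟩ := z
        obtain ⟨r, hr⟩ := r
        change -M.d (j + n) r (M.e (j + n - n) (j + n) (shiftProj M _ x)) =
          M.e (r - n) r (-M.d j (r - n) (shiftProj M _ x))
        have : ∀ (r : ℤ) (hr : r = j) (h), M.e r (j + n) (shiftProj M (l := j + 1) h x) =
            M.e j (j + n) (shiftProj M rfl x) := by
          rintro _ rfl _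
          rfl
        rw [this _ (by omega), M.d_e j (r - n) (j + n) r rfl (by omega), map_neg]
    · rw [dif_neg h, dif_neg (show ¬ j' + 1 = i' by omega), LinearMap.zero_apply,
        LinearMap.zero_apply, map_zero]

namespace mappingCone

/-- The component in the target. -/
def fst (l : ℤ) : (mappingCone φ).X l →ₗ[k] N.X l := Bimod.fst _ _

/-- The component in the source. -/
def snd {j l : ℤ} (h : j + 1 = l) : (mappingCone φ).X l →ₗ[k] M.X j :=
  shiftProj M h ∘ₗ Bimod.snd _ _

/-- The inclusion of the target. -/
def inl (l : ℤ) : N.X l →ₗ[k] (mappingCone φ).X l := Bimod.inl _ _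

/-- The inclusion of the source. -/
def inr {j l : ℤ} (h : j + 1 = l) : M.X j →ₗ[k] (mappingCone φ).X l :=
  Bimod.inr _ _ ∘ₗ shiftSingle M h

lemma isBimodMap_fst (l : ℤ) : IsBimodMap (fst φ l) := Bimod.isBimodMap_fst

lemma isBimodMap_snd {j l : ℤ} (h : j + 1 = l) : IsBimodMap (snd φ h) :=
  (isBimodMap_shiftProj h).comp Bimod.isBimodMap_snd

lemma isBimodMap_inl (l : ℤ) : IsBimodMap (inl φ l) := Bimod.isBimodMap_inl

lemma isBimodMap_inr {j l : ℤ} (h : j + 1 = l) : IsBimodMap (inr φ h) :=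
  Bimod.isBimodMap_inr.comp (isBimodMap_shiftSingle h)

@[simp] lemma fst_inl (l : ℤ) (y : N.X l) : fst φ l (inl φ l y) = y := rfl

@[simp] lemma snd_inl {j l : ℤ} (h : j + 1 = l) (y : N.X l) : snd φ h (inl φ l y) = 0 := rfl

@[simp] lemma fst_inr {j l : ℤ} (h : j + 1 = l) (x : M.X j) : fst φ l (inr φ h x) = 0 := rfl

@[simp] lemma snd_inr {j l : ℤ} (h : j + 1 = l) (x : M.X j) : snd φ h (inr φ h x) = x := rfl

variable {φ}

lemma ext {j l : ℤ} (h : j + 1 = l) {z z' : (mappingCone φ).X l} (h₁ : fst φ l z = fst φ l z')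
    (h₂ : snd φ h z = snd φ h z') : z = z' :=
  Bimod.prod_ext h₁ (shift_ext h h₂)

lemma eq_add {j l : ℤ} (h : j + 1 = l) (z : (mappingCone φ).X l) :
    z = inl φ l (fst φ l z) + inr φ h (snd φ h z) :=
  ext h (by rw [map_add, fst_inl, fst_inr, add_zero]) (by rw [map_add, snd_inl, snd_inr, zero_add])

lemma d_eq {l l' : ℤ} (h : l' + 1 = l) : (mappingCone φ).d l l' = mappingConeD φ h := dif_pos h

lemma e_eq {l l' : ℤ} (h : l + n = l') : (mappingCone φ).e l l' = mappingConeE M N h := dif_pos h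

lemma fst_d {l l' : ℤ} (h : l' + 1 = l) (z : (mappingCone φ).X l) :
    fst φ l' ((mappingCone φ).d l l' z) = N.d l l' (fst φ l z) + φ.f l' (snd φ h z) := by
  rw [d_eq h]
  rfl

lemma snd_d {j l l' : ℤ} (h : l' + 1 = l) (h' : j + 1 = l') (z : (mappingCone φ).X l) :
    snd φ h' ((mappingCone φ).d l l' z) = -M.d l' j (snd φ h z) := by
  rw [d_eq h]
  rfl

lemma fst_e {l l' : ℤ} (h : l + n = l') (z : (mappingCone φ).X l) :
    fst φ l' ((mappingCone φ).e l l' z) = N.e l l' (fst φ l z) := by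
  rw [e_eq h]
  rfl

lemma snd_e {j j' l l' : ℤ} (h : l + n = l') (hj : j + 1 = l) (hj' : j' + 1 = l')
    (z : (mappingCone φ).X l) :
    snd φ hj' ((mappingCone φ).e l l' z) = M.e j j' (snd φ hj z) := by
  rw [e_eq h]
  obtain rfl : j = j' - n := by omega
  rfl

lemma d_inl {l l' : ℤ} (h : l' + 1 = l) (y : N.X l) :
    (mappingCone φ).d l l' (inl φ l y) = inl φ l' (N.d l l' y) :=
  ext (show l' - 1 + 1 = l' by omega) (by simp [fst_d h]) (by simp [snd_d h])

lemma d_inr {j l l' : ℤ} (h : l' + 1 = l) (h' : j + 1 = l') (x : M.X l') :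
    (mappingCone φ).d l l' (inr φ h x) = inl φ l' (φ.f l' x) - inr φ h' (M.d l' j x) :=
  ext h' (by simp [fst_d h]) (by simp [snd_d h])

lemma e_inl {l l' : ℤ} (h : l + n = l') (y : N.X l) :
    (mappingCone φ).e l l' (inl φ l y) = inl φ l' (N.e l l' y) :=
  ext (show l' - 1 + 1 = l' by omega) (by simp [fst_e h])
    (by simp [snd_e h (show l - 1 + 1 = l by omega)])

lemma e_inr {j j' l l' : ℤ} (h : l + n = l') (hj : j + 1 = l) (hj' : j' + 1 = l') (x : M.X j) :
    (mappingCone φ).e l l' (inr φ hj x) = inr φ hj' (M.e j j' x) :=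
  ext hj' (by simp [fst_e h]) (by simp [snd_e h hj])

end mappingCone

/-- A morphism with a contractible mapping cone is a homotopy equivalence. -/
lemma isHtpyEquiv_of_contractible {S : Side} (h : Contractible S (mappingCone φ)) :
    IsHtpyEquiv S φ := by
  obtain ⟨H, hS, he, hd⟩ := h
  have lin := fun {P Q : Bimod k A} {ψ : P →ₗ[k] Q} (h : IsBimodMap ψ) => S.lin_of_isBimodMap h
  -- These are three blocks of the contraction H, with target N and source M. In dH + Hd = 1 the
  -- block from N to M says that g is a chain map, and the two diagonal blocks are the homotopy
  -- identities. The minus sign at the homotopy on M compensates the differential -d on this summand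
  -- of the cone.
  refine ⟨fun i => mappingCone.snd φ rfl ∘ₗ H i (i + 1) ∘ₗ mappingCone.inl φ i,
    fun i j => -(mappingCone.snd φ rfl ∘ₗ H (i + 1) (j + 1) ∘ₗ mappingCone.inr φ rfl),
    fun i j => mappingCone.fst φ j ∘ₗ H i j ∘ₗ mappingCone.inl φ i, fun i => ?_, fun i j => ?_,
    fun i j => ?_, fun i j x => ?_, fun i j x => ?_, fun i j x => ?_, fun i j x => ?_,
    fun i x => ?_, fun i x => ?_⟩
  · exact (lin (mappingCone.isBimodMap_snd φ _)).comp
      ((hS _ _).comp (lin (mappingCone.isBimodMap_inl φ _)))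
  · exact ((lin (mappingCone.isBimodMap_snd φ _)).comp
      ((hS _ _).comp (lin (mappingCone.isBimodMap_inr φ _)))).neg
  · exact (lin (mappingCone.isBimodMap_fst φ _)).comp
      ((hS _ _).comp (lin (mappingCone.isBimodMap_inl φ _)))
  · by_cases hj : j + 1 = i
    · subst hj
      have := congrArg (mappingCone.snd φ rfl) (hd (j + 1) (j + 1 + 1) j rfl rfl
        (mappingCone.inl φ _ x))
      rw [mappingCone.d_inl rfl, map_add, mappingCone.snd_d rfl rfl, mappingCone.snd_inl,
        neg_add_eq_zero] at this
      exact this.symm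
    · simp [N.d_shape _ _ hj, M.d_shape _ _ hj]
  · by_cases hj : i + n = j
    · simp only [LinearMap.comp_apply]
      rw [← mappingCone.e_inl hj, he i (i + 1) j (j + 1) rfl hj (by omega),
        mappingCone.snd_e (by omega) rfl]
    · simp [N.e_shape _ _ hj, M.e_shape _ _ hj]
  · by_cases hj : i + n = j
    · simp only [LinearMap.comp_apply, LinearMap.neg_apply, map_neg]
      rw [← mappingCone.e_inr (by omega) rfl, he (i + 1) (i + 1 + 1) (j + 1) (j + 1 + 1) rfl
        (by omega) (by omega), mappingCone.snd_e (by omega) rfl]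
    · simp [M.e_shape _ _ hj, M.e_shape _ _ (show i + 1 + n ≠ j + 1 by omega)]
  · by_cases hj : i + n = j
    · simp only [LinearMap.comp_apply]
      rw [← mappingCone.e_inl hj, he i (i + 1) j (j + 1) rfl hj (by omega),
        mappingCone.fst_e (by omega)]
    · simp [N.e_shape _ _ hj, N.e_shape _ _ (show i + 1 + n ≠ j + 1 by omega)]
  · have := congrArg (mappingCone.snd φ rfl) (hd (i + 1) (i + 1 + 1) i rfl rfl
      (mappingCone.inr φ rfl x))
    rw [mappingCone.d_inr rfl (show i - 1 + 1 = i by omega), map_add, mappingCone.snd_d rfl rfl,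
      mappingCone.snd_inr, map_sub, map_sub] at this
    simp only [LinearMap.comp_apply, LinearMap.neg_apply, map_neg]
    -- This identifies the degrees i and i - 1 + 1, in which the same term appears in two shapes.
    have e : ∀ (r : ℤ) (hr : r = i) (h : i - 1 + 1 = r) y,
        mappingCone.snd φ rfl (H r (i + 1) (mappingCone.inr φ h y)) =
        mappingCone.snd φ rfl (H (i - 1 + 1) (i + 1) (mappingCone.inr φ rfl y)) := by
      rintro r hr rfl y
      rfl
    rw [e i rfl] at this
    nth_rewrite 1 [← this]
    abel
  · have := congrArg (mappingCone.fst φ i) (hd i (i + 1) (i - 1) rfl (by omega)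
      (mappingCone.inl φ _ x))
    rw [mappingCone.d_inl (by omega), map_add, mappingCone.fst_d rfl, mappingCone.fst_inl] at this
    simp only [LinearMap.comp_apply]
    nth_rewrite 1 [← this]
    abel

end MappingCone

end DGMod

end

end SingDef

namespace SingDef

section

variable {k : Type v} {A : Type u} [CommRing k] [Ring A] [Algebra k A]

namespace DGMod

variable {n : ℤ}

/-! ### Tensor products of homotopy equivalences -/

section Tensor

variable (M N : DGMod k A n)

/-- The tensor `x ⊗ y`, as an element of the differential graded module `M ⊗ N`. -/
def tmul {l i j : ℤ} (h : i + j = l) : M.X i →ₗ[k] N.X j →ₗ[k] (tens M N).X l := tmk M N l h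

lemma tens_d_tmul {l l' i j i' j' : ℤ} (hl : l' + 1 = l) (h : i + j = l) (h₁ : i' + j = l')
    (h₂ : i + j' = l') (x : M.X i) (y : N.X j) :
    (tens M N).d l l' (tmul M N h x y) =
      tmul M N h₁ (M.d i i' x) y + (i.negOnePow : ℤ) • tmul M N h₂ x (N.d j j' y) :=
  (LinearMap.congr_fun (tens_d M N hl) _).trans (tensD_tmk M N hl h h₁ h₂ x y)

lemma tens_e_tmul {l l' i j j' : ℤ} (hl : l + n = l') (h : i + j = l) (h' : i + j' = l')
    (x : M.X i) (y : N.X j) :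
    (tens M N).e l l' (tmul M N h x y) = tmul M N h' x (N.e j j' y) :=
  (LinearMap.congr_fun (tens_e M N hl) _).trans (tensE_tmk M N hl h h' x y)

variable {M N}

lemma tmul_op_smul {l i j : ℤ} (h : i + j = l) (a : A) (x : M.X i) (y : N.X j) :
    tmul M N h (op a • x) y = tmul M N h x (a • y) := tmk_op_smul h a x y

lemma tmul_e {l i j i' j' : ℤ} (h : i' + j = l) (h' : i + j' = l) (hi : i + n = i')
    (x : M.X i) (y : N.X j) :
    tmul M N h (M.e i i' x) y = ((n * j).negOnePow : ℤ) • tmul M N h' x (N.e j j' y) :=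
  tmk_e h h' hi x y

lemma smul_tmul {l i j : ℤ} (h : i + j = l) (a : A) (x : M.X i) (y : N.X j) :
    a • tmul M N h x y = tmul M N h (a • x) y := smul_tmk h a x y

lemma op_smul_tmul {l i j : ℤ} (h : i + j = l) (a : A) (x : M.X i) (y : N.X j) :
    op a • tmul M N h x y = tmul M N h x (op a • y) := op_smul_tmk h a x y

lemma tensHom_tmul {M' : DGMod k A n} (φ : Hom M M') {l i j : ℤ} (h : i + j = l) (x : M.X i)
    (y : N.X j) : (tensHom N φ).f l (tmul M N h x y) = tmul M' N h (φ.f i x) y :=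
  tensMapX_tmk N φ h x y

/-- Linear maps out of a tensor product agree if they agree on all `x ⊗ y`. -/
lemma tens_congr {Z : Type*} [AddCommGroup Z] [Module k Z] {l : ℤ} (φ ψ : (tens M N).X l →ₗ[k] Z)
    (H : ∀ (i j : ℤ) (h : i + j = l) x y, φ (tmul M N h x y) = ψ (tmul M N h x y))
    (z : (tens M N).X l) : φ z = ψ z :=
  LinearMap.congr_fun (tens_hom_ext (M := M) (N := N) (φ := φ) (ψ := ψ) H) z

/-- The linear map out of `M ⊗ N` given by a family of balanced bilinear maps. -/
def tensLift {Z : Type*} [AddCommGroup Z] [Module k Z] {l : ℤ}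
    (Φ : ∀ i j : ℤ, i + j = l → M.X i →ₗ[k] N.X j →ₗ[k] Z)
    (hA : ∀ (i j : ℤ) (h : i + j = l) (a : A) x y, Φ i j h (op a • x) y = Φ i j h x (a • y))
    (he : ∀ (i j i' j' : ℤ) (h : i' + j = l) (h' : i + j' = l) (_ : i + n = i') x y,
      Φ i' j h (M.e i i' x) y = ((n * j).negOnePow : ℤ) • Φ i j' h' x (N.e j j' y)) :
    (tens M N).X l →ₗ[k] Z :=
  tensDesc Φ hA he

lemma tensLift_tmul {Z : Type*} [AddCommGroup Z] [Module k Z] {l : ℤ}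
    (Φ : ∀ i j : ℤ, i + j = l → M.X i →ₗ[k] N.X j →ₗ[k] Z) (hA) (he) {i j : ℤ} (h : i + j = l)
    (x : M.X i) (y : N.X j) : tensLift Φ hA he (tmul M N h x y) = Φ i j h x y :=
  tensDesc_tmk Φ hA he h x y

lemma isBimodMap_of_tmul {l : ℤ} {Z : Bimod k A} {φ : (tens M N).X l →ₗ[k] Z}
    (hl : ∀ (i j : ℤ) (h : i + j = l) (a : A) x y,
      φ (tmul M N h (a • x) y) = a • φ (tmul M N h x y))
    (hr : ∀ (i j : ℤ) (h : i + j = l) (a : A) x y,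
      φ (tmul M N h x (op a • y)) = op a • φ (tmul M N h x y)) : IsBimodMap φ :=
  isBimodMap_tensDesc (M := M) (N := N) (φ := φ) hl hr

end Tensor

section TensorLeft

variable {M M' : DGMod k A n} (N : DGMod k A n) {c : ℤ}

/-- The map `x ⊗ y ↦ u x ⊗ y` for a family `u` of degree `c` that is linear over `A` acting on the
right and over `R_n`. -/
def tensLeft (u : ∀ i j, i + c = j → (M.X i →ₗ[k] M'.X j)) (hu : ∀ i j h, IsRight (u i j h))
    (he : ∀ i j i' j' h h', i + n = i' → j + n = j' → ∀ x,
      u i' j' h' (M.e i i' x) = M'.e j j' (u i j h x))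
    (l l' : ℤ) : (tens M N).X l →ₗ[k] (tens M' N).X l' :=
  if hl : l + c = l' then tensLift (fun i j h => tmul M' N (show i + c + j = l' by omega) ∘ₗ u i (i + c) rfl)
    (fun i j h a x y => by
      rw [LinearMap.comp_apply, LinearMap.comp_apply, hu, tmul_op_smul])
    (fun i j i' j' h h' hi x y => by
      rw [LinearMap.comp_apply, LinearMap.comp_apply,
        he i (i + c) i' (i' + c) rfl rfl hi (by omega), tmul_e _ _ (by omega)])
  else 0

variable {u : ∀ i j, i + c = j → (M.X i →ₗ[k] M'.X j)} {hu : ∀ i j h, IsRight (u i j h)}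
    {he : ∀ i j i' j' h h', i + n = i' → j + n = j' → ∀ x,
      u i' j' h' (M.e i i' x) = M'.e j j' (u i j h x)}

lemma tensLeft_tmul {l l' i j i' : ℤ} (h : i + j = l) (hi : i + c = i')
    (h' : i' + j = l') (x : M.X i) (y : N.X j) :
    tensLeft N u hu he l l' (tmul M N h x y) = tmul M' N h' (u i i' hi x) y := by
  subst hi
  rw [tensLeft, dif_pos (show l + c = l' by omega)]
  exact tensLift_tmul _ _ _ h x y

lemma tensLeft_e {l l' r r' : ℤ} (hl : l + c = l') (hr : r + c = r') (h : l + n = r)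
    (z : (tens M N).X l) :
    tensLeft N u hu he r r' ((tens M N).e l r z) =
      (tens M' N).e l' r' (tensLeft N u hu he l l' z) :=
  tens_congr (tensLeft N u hu he r r' ∘ₗ (tens M N).e l r)
    ((tens M' N).e l' r' ∘ₗ tensLeft N u hu he l l') (fun i j hij x y => by
      rw [LinearMap.comp_apply, LinearMap.comp_apply,
        tens_e_tmul M N h hij (show i + (j + n) = r by omega),
        tensLeft_tmul N _ rfl (show i + c + (j + n) = r' by omega),
        tensLeft_tmul N _ rfl (show i + c + j = l' by omega),
        tens_e_tmul M' N (by omega) _ (show i + c + (j + n) = r' by omega)]) z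

end TensorLeft

/-- Reindexing of a family of maps of degree zero. -/
def degZero {M M' : DGMod k A n} (g : ∀ i, M.X i →ₗ[k] M'.X i) (i j : ℤ) (h : i + 0 = j) :
    M.X i →ₗ[k] M'.X j :=
  ((add_zero i).symm.trans h) ▸ g i

lemma degZero_apply {M M' : DGMod k A n} (g : ∀ i, M.X i →ₗ[k] M'.X i) (i : ℤ)
    (h : i + 0 = i) (x : M.X i) : degZero g i i h x = g i x := rfl

/-- The tensor relation involves only the right action of A on the first factor, so right linear
data g, h, h' induce g ⊗ 1, h ⊗ 1, h' ⊗ 1. No signs are needed, because these maps are applied from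
the left and ε acts from the right. Since g need not be left linear, the result is an equivalence
over R only. -/
lemma IsHtpyEquiv.tensHom {M M' : DGMod k A n} {φ : Hom M M'} (H : IsHtpyEquiv .right φ)
    (N : DGMod k A n) : IsRelQuasiIso (tensHom N φ) := by
  obtain ⟨g, h, h', hg, hh, hh', gd, ge, he, he', H₁, H₂⟩ := H
  replace hh : ∀ i j, IsRight (h i j) := hh
  replace hh' : ∀ i j, IsRight (h' i j) := hh'
  have Hg : ∀ i j i₀, IsRight (degZero g i j i₀) := by
    intro i j i₀
    obtain rfl : i = j := by omega
    exact hg i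
  have Eg : ∀ i j i' j' h h', i + n = i' → j + n = j' → ∀ x,
      degZero g i' j' h' (M'.e i i' x) = M.e j j' (degZero g i j h x) := by
    intro i j i' j' hij hij' hi hj x
    obtain rfl : i = j := by omega
    obtain rfl : i' = j' := by omega
    exact ge _ _ x
  have Eh : ∀ i j i' j', i + 1 = j → i' + 1 = j' → i + n = i' → j + n = j' → ∀ x,
      h i' j' (M.e i i' x) = M.e j j' (h i j x) := by
    rintro i j i' j' rfl rfl hi hj x
    exact he i i' x
  have Eh' : ∀ i j i' j', i + 1 = j → i' + 1 = j' → i + n = i' → j + n = j' → ∀ x,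
      h' i' j' (M'.e i i' x) = M'.e j j' (h' i j x) := by
    rintro i j i' j' rfl rfl hi hj x
    exact he' i i' x
  refine ⟨fun l => tensLeft N (degZero g) Hg Eg l l,
    fun l l' => tensLeft N (fun i j _ => h i j) (fun i j _ => hh i j) Eh l l',
    fun l l' => tensLeft N (fun i j _ => h' i j) (fun i j _ => hh' i j) Eh' l l',
    fun l l' z => ?_, fun l l' z => ?_, fun l l' z => ?_, fun l l' z => ?_, fun l z => ?_,
    fun l z => ?_⟩
  · by_cases hl : l' + 1 = l
    · refine tens_congr (tensLeft N (degZero g) Hg Eg l' l' ∘ₗ (tens M' N).d l l')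
        ((tens M N).d l l' ∘ₗ tensLeft N (degZero g) Hg Eg l l) (fun i j hij x y => ?_) z
      rw [LinearMap.comp_apply, LinearMap.comp_apply,
        tens_d_tmul M' N (i' := i - 1) (j' := j - 1) hl hij (by omega) (by omega), map_add,
        map_zsmul, tensLeft_tmul N _ (add_zero _) (show i - 1 + j = l' by omega),
        tensLeft_tmul N _ (add_zero _) (show i + (j - 1) = l' by omega),
        tensLeft_tmul N _ (add_zero _) hij,
        tens_d_tmul M N (i' := i - 1) (j' := j - 1) hl hij (by omega) (by omega), degZero_apply,
        degZero_apply, gd]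
    · rw [(tens M' N).d_shape _ _ hl, (tens M N).d_shape _ _ hl, LinearMap.zero_apply,
        LinearMap.zero_apply]
      exact map_zero _
  · by_cases hl : l + n = l'
    · exact tensLeft_e N (add_zero l) (add_zero l') hl z
    · rw [(tens M' N).e_shape _ _ hl, (tens M N).e_shape _ _ hl, LinearMap.zero_apply,
        LinearMap.zero_apply]
      exact map_zero _
  · by_cases hl : l + n = l'
    · exact tensLeft_e N rfl rfl hl z
    · rw [(tens M N).e_shape _ _ hl, (tens M N).e_shape _ _ (show l + 1 + n ≠ l' + 1 by omega),
        LinearMap.zero_apply, LinearMap.zero_apply]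
      exact map_zero _
  · by_cases hl : l + n = l'
    · exact tensLeft_e N rfl rfl hl z
    · rw [(tens M' N).e_shape _ _ hl, (tens M' N).e_shape _ _ (show l + 1 + n ≠ l' + 1 by omega),
        LinearMap.zero_apply, LinearMap.zero_apply]
      exact map_zero _
  -- On x ⊗ y with x of degree i, the terms h x ⊗ d y of dh and hd have the signs (-1)^(i+1) and
  -- (-1)^i and cancel. What is left is (d h x + h d x) ⊗ y.
  · refine tens_congr (LinearMap.id - tensLeft N (degZero g) Hg Eg l l ∘ₗ (DGMod.tensHom N φ).f l)
      ((tens M N).d (l + 1) l ∘ₗ tensLeft N (fun i j _ => h i j) (fun i j _ => hh i j) Eh l (l + 1) +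
        tensLeft N (fun i j _ => h i j) (fun i j _ => hh i j) Eh (l - 1) l ∘ₗ
          (tens M N).d l (l - 1)) (fun i j hij x y => ?_) z
    rw [LinearMap.sub_apply, LinearMap.add_apply, LinearMap.comp_apply, LinearMap.comp_apply,
      LinearMap.comp_apply, LinearMap.id_apply, tensHom_tmul, tensLeft_tmul N _ (add_zero _) hij,
      degZero_apply, tensLeft_tmul N _ rfl (show i + 1 + j = l + 1 by omega),
      tens_d_tmul M N (i' := i) (j' := j - 1) rfl (by omega) hij (by omega),
      tens_d_tmul M N (i' := i - 1) (j' := j - 1) (by omega) hij (by omega) (by omega), map_add, map_zsmul,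
      tensLeft_tmul N _ (show i - 1 + 1 = i by omega) hij,
      tensLeft_tmul N _ rfl (show i + 1 + (j - 1) = l by omega), ← LinearMap.sub_apply,
      ← map_sub, H₁, map_add, LinearMap.add_apply, Int.negOnePow_succ]
    simp only [Units.val_neg, neg_smul]
    abel
  · refine tens_congr (LinearMap.id - (DGMod.tensHom N φ).f l ∘ₗ tensLeft N (degZero g) Hg Eg l l)
      ((tens M' N).d (l + 1) l ∘ₗ tensLeft N (fun i j _ => h' i j) (fun i j _ => hh' i j) Eh' l (l + 1) +
        tensLeft N (fun i j _ => h' i j) (fun i j _ => hh' i j) Eh' (l - 1) l ∘ₗ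
          (tens M' N).d l (l - 1)) (fun i j hij x y => ?_) z
    rw [LinearMap.sub_apply, LinearMap.add_apply, LinearMap.comp_apply, LinearMap.comp_apply,
      LinearMap.comp_apply, LinearMap.id_apply, tensLeft_tmul N _ (add_zero _) hij, tensHom_tmul,
      degZero_apply, tensLeft_tmul N _ rfl (show i + 1 + j = l + 1 by omega),
      tens_d_tmul M' N (i' := i) (j' := j - 1) rfl (by omega) hij (by omega),
      tens_d_tmul M' N (i' := i - 1) (j' := j - 1) (by omega) hij (by omega) (by omega), map_add, map_zsmul,
      tensLeft_tmul N _ (show i - 1 + 1 = i by omega) hij,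
      tensLeft_tmul N _ rfl (show i + 1 + (j - 1) = l by omega), ← LinearMap.sub_apply,
      ← map_sub, H₂, map_add, LinearMap.add_apply, Int.negOnePow_succ]
    simp only [Units.val_neg, neg_smul]
    abel

section TensorRight

variable (M : DGMod k A n) {N N' : DGMod k A n} {c : ℤ}

/-- The map `x ⊗ y ↦ (-1)^{ci} x ⊗ v y`, where `x` has degree `i`, for a family `v` of degree `c`
that is linear over `A` acting on the left and over `R_n`. -/
def tensRight (v : ∀ i j, i + c = j → (N.X i →ₗ[k] N'.X j)) (hv : ∀ i j h, IsLeft (v i j h))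
    (he : ∀ i j i' j' h h', i + n = i' → j + n = j' → ∀ x,
      v i' j' h' (N.e i i' x) = N'.e j j' (v i j h x))
    (l l' : ℤ) : (tens M N).X l →ₗ[k] (tens M N').X l' :=
  if hl : l + c = l' then tensLift (fun i j h => ((c * i).negOnePow : ℤ) •
      (tmul M N' (show i + (j + c) = l' by omega)).compl₂ (v j (j + c) rfl))
    (fun i j h a x y => by
      rw [LinearMap.smul_apply, LinearMap.smul_apply, LinearMap.smul_apply, LinearMap.smul_apply,
        LinearMap.compl₂_apply, LinearMap.compl₂_apply, hv, tmul_op_smul])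
    (fun i j i' j' h h' hi x y => by
      rw [LinearMap.smul_apply, LinearMap.smul_apply, LinearMap.smul_apply, LinearMap.smul_apply,
        LinearMap.compl₂_apply, LinearMap.compl₂_apply,
        he j (j + c) j' (j' + c) rfl rfl (by omega) (by omega),
        tmul_e (j' := j' + c) _ (by omega) hi,
        smul_smul, smul_smul]
      congr 1
      rw [← Units.val_mul, ← Units.val_mul, ← Int.negOnePow_add, ← Int.negOnePow_add]
      congr 1
      rw [Int.negOnePow_eq_iff]
      subst hi
      -- Replacing x by x ε changes the Koszul sign of v by (-1)^(cn), and replacing y by v y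
      -- changes the sign of the relation for ε by (-1)^(cn). The two exponents thus differ by 2cn.
      exact ⟨c * n, by ring⟩)
  else 0

variable {v : ∀ i j, i + c = j → (N.X i →ₗ[k] N'.X j)} {hv : ∀ i j h, IsLeft (v i j h)}
    {he : ∀ i j i' j' h h', i + n = i' → j + n = j' → ∀ x,
      v i' j' h' (N.e i i' x) = N'.e j j' (v i j h x)}

lemma tensRight_tmul {l l' i j j' : ℤ} (h : i + j = l) (hj : j + c = j')
    (h' : i + j' = l') (x : M.X i) (y : N.X j) :
    tensRight M v hv he l l' (tmul M N h x y) =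
      ((c * i).negOnePow : ℤ) • tmul M N' h' x (v j j' hj y) := by
  subst hj
  rw [tensRight, dif_pos (show l + c = l' by omega)]
  exact tensLift_tmul _ _ _ h x y

lemma tensRight_e {l l' r r' : ℤ} (hl : l + c = l') (hr : r + c = r') (h : l + n = r)
    (z : (tens M N).X l) :
    tensRight M v hv he r r' ((tens M N).e l r z) =
      (tens M N').e l' r' (tensRight M v hv he l l' z) :=
  tens_congr (tensRight M v hv he r r' ∘ₗ (tens M N).e l r)
    ((tens M N').e l' r' ∘ₗ tensRight M v hv he l l') (fun i j hij x y => by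
      rw [LinearMap.comp_apply, LinearMap.comp_apply,
        tens_e_tmul M N h hij (show i + (j + n) = r by omega),
        tensRight_tmul M _ rfl (show i + (j + n + c) = r' by omega),
        tensRight_tmul M _ rfl (show i + (j + c) = l' by omega), map_zsmul,
        tens_e_tmul M N' (by omega) _ (show i + (j + n + c) = r' by omega),
        he j (j + c) (j + n) (j + n + c) rfl rfl rfl (by omega)]) z

end TensorRight

/-- The components of `M ⊗ ψ : M ⊗ N → M ⊗ N'`. -/
def tensMapRight (M : DGMod k A n) {N N' : DGMod k A n} (ψ : Hom N N') (l : ℤ) :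
    (tens M N).X l →ₗ[k] (tens M N').X l :=
  tensLift (fun i j h => (tmul M N' h).compl₂ (ψ.f j))
    (fun i j h a x y => by
      rw [LinearMap.compl₂_apply, LinearMap.compl₂_apply, (ψ.isBimodMap_f j).1, tmul_op_smul])
    (fun i j i' j' h h' hi x y => by
      rw [LinearMap.compl₂_apply, LinearMap.compl₂_apply, ψ.comm_e, tmul_e _ h' hi])

lemma tensMapRight_tmul (M : DGMod k A n) {N N' : DGMod k A n} (ψ : Hom N N') {l i j : ℤ}
    (h : i + j = l) (x : M.X i) (y : N.X j) :
    tensMapRight M ψ l (tmul M N h x y) = tmul M N' h x (ψ.f j y) :=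
  tensLift_tmul (fun i j h => (tmul M N' h).compl₂ (ψ.f j)) _ _ h x y

/-- The morphism `M ⊗ ψ : M ⊗ N → M ⊗ N'`. -/
def tensHomRight (M : DGMod k A n) {N N' : DGMod k A n} (ψ : Hom N N') :
    Hom (tens M N) (tens M N') where
  f := tensMapRight M ψ
  isBimodMap_f l := isBimodMap_of_tmul
    (fun i j h a x y => by
      rw [tensMapRight_tmul, tensMapRight_tmul, smul_tmul])
    (fun i j h a x y => by
      rw [tensMapRight_tmul, tensMapRight_tmul, (ψ.isBimodMap_f j).2, op_smul_tmul])
  comm_d l l' z := by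
    by_cases hl : l' + 1 = l
    · refine tens_congr (tensMapRight M ψ l' ∘ₗ (tens M N).d l l')
        ((tens M N').d l l' ∘ₗ tensMapRight M ψ l) (fun i j hij x y => ?_) z
      rw [LinearMap.comp_apply, LinearMap.comp_apply,
        tens_d_tmul M N (i' := i - 1) (j' := j - 1) hl hij (by omega) (by omega), map_add,
        map_zsmul, tensMapRight_tmul, tensMapRight_tmul, tensMapRight_tmul,
        tens_d_tmul M N' (i' := i - 1) (j' := j - 1) hl hij (by omega) (by omega), ψ.comm_d]
    · rw [(tens M N).d_shape _ _ hl, (tens M N').d_shape _ _ hl, LinearMap.zero_apply,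
        LinearMap.zero_apply]
      exact map_zero _
  comm_e l l' z := by
    by_cases hl : l + n = l'
    · refine tens_congr (tensMapRight M ψ l' ∘ₗ (tens M N).e l l')
        ((tens M N').e l l' ∘ₗ tensMapRight M ψ l) (fun i j hij x y => ?_) z
      rw [LinearMap.comp_apply, LinearMap.comp_apply,
        tens_e_tmul M N (j' := j + n) hl hij (by omega), tensMapRight_tmul, tensMapRight_tmul,
        tens_e_tmul M N' (j' := j + n) hl hij (by omega), ψ.comm_e]
    · rw [(tens M N).e_shape _ _ hl, (tens M N').e_shape _ _ hl, LinearMap.zero_apply,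
        LinearMap.zero_apply]
      exact map_zero _

lemma tensHomRight_tmul (M : DGMod k A n) {N N' : DGMod k A n} (ψ : Hom N N') {l i j : ℤ}
    (h : i + j = l) (x : M.X i) (y : N.X j) :
    (tensHomRight M ψ).f l (tmul M N h x y) = tmul M N' h x (ψ.f j y) :=
  tensMapRight_tmul M ψ h x y

/-- The mirror image of `IsHtpyEquiv.tensHom`. A homotopy of degree one now passes x and acquires
the sign (-1)^i. This cancels the sign (-1)^i of the tensor differential in x ⊗ (d h y + h d y),
while the terms d x ⊗ h y appear twice with opposite signs. -/
lemma IsHtpyEquiv.tensHomRight {N N' : DGMod k A n} {ψ : Hom N N'} (H : IsHtpyEquiv .left ψ)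
    (M : DGMod k A n) : IsRelQuasiIso (tensHomRight M ψ) := by
  obtain ⟨g, h, h', hg, hh, hh', gd, ge, he, he', H₁, H₂⟩ := H
  replace hh : ∀ i j, IsLeft (h i j) := hh
  replace hh' : ∀ i j, IsLeft (h' i j) := hh'
  have Hg : ∀ i j i₀, IsLeft (degZero g i j i₀) := by
    intro i j i₀
    obtain rfl : i = j := by omega
    exact hg i
  have Eg : ∀ i j i' j' h h', i + n = i' → j + n = j' → ∀ x,
      degZero g i' j' h' (N'.e i i' x) = N.e j j' (degZero g i j h x) := by
    intro i j i' j' hij hij' hi hj x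
    obtain rfl : i = j := by omega
    obtain rfl : i' = j' := by omega
    exact ge _ _ x
  have Eh : ∀ i j i' j', i + 1 = j → i' + 1 = j' → i + n = i' → j + n = j' → ∀ x,
      h i' j' (N.e i i' x) = N.e j j' (h i j x) := by
    rintro i j i' j' rfl rfl hi hj x
    exact he i i' x
  have Eh' : ∀ i j i' j', i + 1 = j → i' + 1 = j' → i + n = i' → j + n = j' → ∀ x,
      h' i' j' (N'.e i i' x) = N'.e j j' (h' i j x) := by
    rintro i j i' j' rfl rfl hi hj x
    exact he' i i' x
  have s0 : ∀ i : ℤ, ((0 * i).negOnePow : ℤ) = 1 := fun i => by simp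
  have s1 : ∀ i : ℤ, (i.negOnePow : ℤ) * (i.negOnePow : ℤ) = 1 := fun i => by
    rw [← Units.val_mul, Int.units_mul_self, Units.val_one]
  refine ⟨fun l => tensRight M (degZero g) Hg Eg l l,
    fun l l' => tensRight M (fun i j _ => h i j) (fun i j _ => hh i j) Eh l l',
    fun l l' => tensRight M (fun i j _ => h' i j) (fun i j _ => hh' i j) Eh' l l',
    fun l l' z => ?_, fun l l' z => ?_, fun l l' z => ?_, fun l l' z => ?_, fun l z => ?_,
    fun l z => ?_⟩
  · by_cases hl : l' + 1 = l
    · refine tens_congr (tensRight M (degZero g) Hg Eg l' l' ∘ₗ (tens M N').d l l')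
        ((tens M N).d l l' ∘ₗ tensRight M (degZero g) Hg Eg l l) (fun i j hij x y => ?_) z
      rw [LinearMap.comp_apply, LinearMap.comp_apply,
        tens_d_tmul M N' (i' := i - 1) (j' := j - 1) hl hij (by omega) (by omega), map_add,
        map_zsmul, tensRight_tmul M _ (add_zero _) (show i - 1 + j = l' by omega),
        tensRight_tmul M _ (add_zero _) (show i + (j - 1) = l' by omega),
        tensRight_tmul M _ (add_zero _) hij, s0, s0, one_smul, one_smul, one_smul,
        tens_d_tmul M N (i' := i - 1) (j' := j - 1) hl hij (by omega) (by omega), degZero_apply,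
        degZero_apply, gd]
    · rw [(tens M N').d_shape _ _ hl, (tens M N).d_shape _ _ hl, LinearMap.zero_apply,
        LinearMap.zero_apply]
      exact map_zero _
  · by_cases hl : l + n = l'
    · exact tensRight_e M (add_zero l) (add_zero l') hl z
    · rw [(tens M N').e_shape _ _ hl, (tens M N).e_shape _ _ hl, LinearMap.zero_apply,
        LinearMap.zero_apply]
      exact map_zero _
  · by_cases hl : l + n = l'
    · exact tensRight_e M rfl rfl hl z
    · rw [(tens M N).e_shape _ _ hl, (tens M N).e_shape _ _ (show l + 1 + n ≠ l' + 1 by omega),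
        LinearMap.zero_apply, LinearMap.zero_apply]
      exact map_zero _
  · by_cases hl : l + n = l'
    · exact tensRight_e M rfl rfl hl z
    · rw [(tens M N').e_shape _ _ hl, (tens M N').e_shape _ _ (show l + 1 + n ≠ l' + 1 by omega),
        LinearMap.zero_apply, LinearMap.zero_apply]
      exact map_zero _
  · refine tens_congr (LinearMap.id - tensRight M (degZero g) Hg Eg l l ∘ₗ
        (DGMod.tensHomRight M ψ).f l)
      ((tens M N).d (l + 1) l ∘ₗ tensRight M (fun i j _ => h i j) (fun i j _ => hh i j) Eh l (l + 1) +
        tensRight M (fun i j _ => h i j) (fun i j _ => hh i j) Eh (l - 1) l ∘ₗ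
          (tens M N).d l (l - 1)) (fun i j hij x y => ?_) z
    rw [LinearMap.sub_apply, LinearMap.add_apply, LinearMap.comp_apply, LinearMap.comp_apply,
      LinearMap.comp_apply, LinearMap.id_apply, tensHomRight_tmul,
      tensRight_tmul M _ (add_zero _) hij, s0, one_smul,
      degZero_apply, tensRight_tmul M _ rfl (show i + (j + 1) = l + 1 by omega), map_zsmul,
      tens_d_tmul M N (i' := i - 1) (j' := j) rfl (by omega) (by omega) hij,
      tens_d_tmul M N (i' := i - 1) (j' := j - 1) (by omega) hij (by omega) (by omega), map_add, map_zsmul,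
      tensRight_tmul M _ (show j - 1 + 1 = j by omega) hij,
      tensRight_tmul M _ rfl (show i - 1 + (j + 1) = l by omega), 
      ← map_sub, H₁, map_add, one_mul, one_mul, smul_add, smul_smul, smul_smul, s1, one_smul,
      one_smul, Int.negOnePow_sub, Int.negOnePow_one]
    simp only [mul_neg, mul_one, Units.val_neg, neg_smul]
    abel
  · refine tens_congr (LinearMap.id - (DGMod.tensHomRight M ψ).f l ∘ₗ
        tensRight M (degZero g) Hg Eg l l)
      ((tens M N').d (l + 1) l ∘ₗ tensRight M (fun i j _ => h' i j) (fun i j _ => hh' i j) Eh' l (l + 1) +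
        tensRight M (fun i j _ => h' i j) (fun i j _ => hh' i j) Eh' (l - 1) l ∘ₗ
          (tens M N').d l (l - 1)) (fun i j hij x y => ?_) z
    rw [LinearMap.sub_apply, LinearMap.add_apply, LinearMap.comp_apply, LinearMap.comp_apply,
      LinearMap.comp_apply, LinearMap.id_apply, tensRight_tmul M _ (add_zero _) hij, s0, one_smul,
      tensHomRight_tmul,
      degZero_apply, tensRight_tmul M _ rfl (show i + (j + 1) = l + 1 by omega), map_zsmul,
      tens_d_tmul M N' (i' := i - 1) (j' := j) rfl (by omega) (by omega) hij,
      tens_d_tmul M N' (i' := i - 1) (j' := j - 1) (by omega) hij (by omega) (by omega), map_add, map_zsmul,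
      tensRight_tmul M _ (show j - 1 + 1 = j by omega) hij,
      tensRight_tmul M _ rfl (show i - 1 + (j + 1) = l by omega), 
      ← map_sub, H₂, map_add, one_mul, one_mul, smul_add, smul_smul, smul_smul, s1, one_smul,
      one_smul, Int.negOnePow_sub, Int.negOnePow_one]
    simp only [mul_neg, mul_one, Units.val_neg, neg_smul]
    abel

end DGMod

end

end SingDef

namespace SingDef

section

variable {k : Type v} {A : Type u} [CommRing k] [Ring A] [Algebra k A]

/-- The right action as a linear family of endomorphisms. -/
def Bimod.rmul (M : Bimod k A) : A →ₗ[k] M →ₗ[k] M :=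
  (Algebra.lsmul k k M : Aᵐᵒᵖ →ₐ[k] Module.End k M).toLinearMap ∘ₗ (opLinearEquiv k).toLinearMap

/-- The bilinear map `(x, a ⊗ y) ↦ B (x a, y)`. -/
def shiftMul {M : Bimod k A} {Z : Type*} [AddCommGroup Z] [Module k Z] {q : ℕ}
    (B : M →ₗ[k] T k A q →ₗ[k] Z) : M →ₗ[k] T k A (q + 1) →ₗ[k] Z :=
  (liftT (((LinearMap.llcomp k M M Z).flip ∘ₗ M.rmul).compl₂ B.flip)).flip

lemma shiftMul_consT {M : Bimod k A} {Z : Type*} [AddCommGroup Z] [Module k Z] {q : ℕ}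
    (B : M →ₗ[k] T k A q →ₗ[k] Z) (x : M) (a : A) (y : T k A q) :
    shiftMul B x (consT q a y) = B (op a • x) y := by
  rw [shiftMul, LinearMap.flip_apply, liftT_consT]
  rfl

/-- For q > 0 this follows from d d = 0, for q = 0 it is the definition of the multiplication. The
uniform form saves a case distinction in the proof that the bar resolution is a complex. -/
lemma dT_consT_dT (q : ℕ) (a : A) (y : T k A (q + 1)) :
    dT k A q (consT q a (dT k A q y)) = a • dT k A q y := by
  cases q with
  | zero => exact dT_zero a _
  | succ q => rw [dT_cons, dT_dT_apply, map_zero, sub_zero]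

namespace DGMod

variable {n : ℤ}

/-! ### The bar resolution of a differential graded module -/

section BarRes

variable (M : DGMod k A n)

/-- The degree `l` part of `M ⊗_A Bar_*(A)`, that is the sum of all `M_i ⊗ A^{⊗ (q+1)}` with
`i + q = l`. -/
def barResX (l : ℤ) : Bimod k A :=
  Bimod.ofEnd (⨁ q : {q : ℤ × ℕ // q.1 + q.2 = l}, (M.X q.1.1 ⊗[k] T k A q.1.2))
    (sumEnd fun q => leftEnd (M.X q.1.1) (T k A q.1.2))
    (sumEnd fun q => rightEnd (M.X q.1.1) (T k A q.1.2))
    (fun a b x => by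
      rw [← LinearMap.comp_apply, ← LinearMap.comp_apply]
      refine LinearMap.congr_fun (DirectSum.linearMap_ext _ fun q =>
        TensorProduct.ext' fun x y => ?_) x
      simp [sumEnd])

/-- The element `x ⊗ y`. -/
def bMk {l i : ℤ} {q : ℕ} (h : i + q = l) : M.X i →ₗ[k] T k A q →ₗ[k] barResX M l :=
  (TensorProduct.mk k (M.X i) (T k A q)).compr₂
    (DirectSum.lof k {q : ℤ × ℕ // q.1 + q.2 = l} (fun q => M.X q.1.1 ⊗[k] T k A q.1.2) ⟨(i, q), h⟩)

variable {M}

lemma smul_bMk {l i : ℤ} {q : ℕ} (h : i + q = l) (a : A) (x : M.X i) (y : T k A q) :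
    a • bMk M h x y = bMk M h (a • x) y := DirectSum.lmap_lof _ _ _

lemma op_smul_bMk {l i : ℤ} {q : ℕ} (h : i + q = l) (a : A) (x : M.X i) (y : T k A q) :
    op a • bMk M h x y = bMk M h x (op a • y) := DirectSum.lmap_lof _ _ _

lemma barResX_hom_ext {Z : Type*} [AddCommGroup Z] [Module k Z] {l : ℤ}
    {φ ψ : barResX M l →ₗ[k] Z}
    (H : ∀ (i : ℤ) (q : ℕ) (h : i + q = l) x y, φ (bMk M h x y) = ψ (bMk M h x y)) : φ = ψ :=
  DirectSum.linearMap_ext _ fun ⟨⟨i, q⟩, h⟩ => TensorProduct.ext' fun x y => H i q h x y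

/-- The linear map given by a family of bilinear maps. -/
def bDesc {Z : Type*} [AddCommGroup Z] [Module k Z] {l : ℤ}
    (Φ : ∀ (i : ℤ) (q : ℕ), i + q = l → M.X i →ₗ[k] T k A q →ₗ[k] Z) : barResX M l →ₗ[k] Z :=
  DirectSum.toModule k {q : ℤ × ℕ // q.1 + q.2 = l} Z
    fun q => TensorProduct.lift (Φ q.1.1 q.1.2 q.2)

lemma bDesc_bMk {Z : Type*} [AddCommGroup Z] [Module k Z] {l : ℤ}
    (Φ : ∀ (i : ℤ) (q : ℕ), i + q = l → M.X i →ₗ[k] T k A q →ₗ[k] Z) {i : ℤ} {q : ℕ}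
    (h : i + q = l) (x : M.X i) (y : T k A q) : bDesc Φ (bMk M h x y) = Φ i q h x y :=
  (DirectSum.toModule_lof (M := fun q : {q : ℤ × ℕ // q.1 + q.2 = l} => M.X q.1.1 ⊗[k] T k A q.1.2)
    (φ := fun q => TensorProduct.lift (Φ q.1.1 q.1.2 q.2)) k ⟨(i, q), h⟩ (x ⊗ₜ y)).trans
    (TensorProduct.lift.tmul x y)

lemma isBimodMap_of_bMk {l : ℤ} {Z : Bimod k A} {φ : barResX M l →ₗ[k] Z}
    (hl : ∀ (i : ℤ) (q : ℕ) (h : i + q = l) (a : A) x y,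
      φ (bMk M h (a • x) y) = a • φ (bMk M h x y))
    (hr : ∀ (i : ℤ) (q : ℕ) (h : i + q = l) (a : A) x y,
      φ (bMk M h x (op a • y)) = op a • φ (bMk M h x y)) : IsBimodMap φ :=
  ⟨(isLeft_iff φ).2 fun a => barResX_hom_ext fun i q h x y =>
      (congrArg φ (smul_bMk h a x y)).trans (hl i q h a x y),
    (isRight_iff φ).2 fun a => barResX_hom_ext fun i q h x y =>
      (congrArg φ (op_smul_bMk h a x y)).trans (hr i q h a x y)⟩

lemma isRight_of_bMk {l : ℤ} {Z : Bimod k A} {φ : barResX M l →ₗ[k] Z}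
    (hr : ∀ (i : ℤ) (q : ℕ) (h : i + q = l) (a : A) x y,
      φ (bMk M h x (op a • y)) = op a • φ (bMk M h x y)) : IsRight φ :=
  (isRight_iff φ).2 fun a => barResX_hom_ext fun i q h x y =>
      (congrArg φ (op_smul_bMk h a x y)).trans (hr i q h a x y)

variable (M)

/-- The part `x ⊗ (a ⊗ y) ↦ x a ⊗ y - x ⊗ d (a ⊗ y)` of the differential. -/
def bBeta : ∀ {l i : ℤ} (q : ℕ), i + q = l + 1 → M.X i →ₗ[k] T k A q →ₗ[k] barResX M l
  | _, _, 0, _ => 0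
  | l, i, q + 1, h => shiftMul (bMk M (show i + q = l by push_cast at h; omega)) -
      (bMk M (show i + q = l by push_cast at h; omega)).compl₂ (dT k A q)

variable {M}

lemma bBeta_zero {l i : ℤ} (h : i + (0 : ℕ) = l + 1) (x : M.X i) (y : T k A 0) :
    bBeta M 0 h x y = 0 := rfl

lemma bBeta_succ {l i : ℤ} {q : ℕ} (h : i + (q + 1 : ℕ) = l + 1) (h' : i + q = l) (x : M.X i)
    (a : A) (y : T k A q) : bBeta M (q + 1) h x (consT q a y) =
      bMk M h' (op a • x) y - bMk M h' x (dT k A q (consT q a y)) :=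
  congrArg (· - bMk M h' x (dT k A q (consT q a y))) (shiftMul_consT _ x a y)

lemma bBeta_smul {l i : ℤ} {q : ℕ} (h : i + q = l + 1) (a : A) (x : M.X i) (y : T k A q) :
    bBeta M q h (a • x) y = a • bBeta M q h x y := by
  cases q with
  | zero => rw [bBeta_zero, bBeta_zero, smul_zero]
  | succ q =>
    refine consT_induction y ?_ (fun y y' hy hy' => ?_) fun c y => ?_
    · rw [map_zero, map_zero, smul_zero]
    · rw [map_add, map_add, smul_add, hy, hy']
    · have h' : i + q = l := by push_cast at h; omega
      rw [bBeta_succ h h', bBeta_succ h h', smul_sub, smul_bMk, smul_bMk, smul_comm]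

lemma bBeta_op_smul {l i : ℤ} {q : ℕ} (h : i + q = l + 1) (a : A) (x : M.X i) (y : T k A q) :
    bBeta M q h x (op a • y) = op a • bBeta M q h x y := by
  cases q with
  | zero => rw [bBeta_zero, bBeta_zero, smul_zero]
  | succ q =>
    refine consT_induction y ?_ (fun y y' hy hy' => ?_) fun c y => ?_
    · rw [smul_zero, map_zero, smul_zero]
    · rw [smul_add, map_add, map_add, smul_add, hy, hy']
    · have h' : i + q = l := by push_cast at h; omega
      rw [op_smul_consT, bBeta_succ h h', bBeta_succ h h', smul_sub, op_smul_bMk, op_smul_bMk,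
        ← op_smul_consT, (isBimodMap_dT q).2]

/-- Linear maps that are compatible with the right action and act on the first factor commute with
`bBeta`, up to linear maps `F` and `G` into any module. -/
lemma bBeta_apply_eq {Z : Type*} [AddCommGroup Z] [Module k Z] {N : DGMod k A n} {l l' i j : ℤ}
    {q : ℕ} (h : i + q = l + 1) (h' : j + q = l' + 1) (u : M.X i →ₗ[k] N.X j) (hu : IsRight u)
    (F : barResX M l →ₗ[k] Z) (G : barResX N l' →ₗ[k] Z)
    (H : ∀ (q : ℕ) (h : i + q = l) (h' : j + q = l') x (y : T k A q),
      F (bMk M h x y) = G (bMk N h' (u x) y)) (x : M.X i) (y : T k A q) :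
    F (bBeta M q h x y) = G (bBeta N q h' (u x) y) := by
  cases q with
  | zero => rw [bBeta_zero, bBeta_zero, map_zero, map_zero]
  | succ q =>
    have h₁ : i + q = l := by push_cast at h; omega
    have h₂ : j + q = l' := by push_cast at h'; omega
    refine consT_induction y ?_ (fun y y' hy hy' => ?_) fun c y => ?_
    · simp only [map_zero]
    · simp only [map_add, hy, hy']
    · rw [bBeta_succ h h₁, bBeta_succ h' h₂, map_sub, map_sub, H _ _ h₂, H _ _ h₂, hu]

/-- If a linear map sends all `x ⊗ y` of smaller rank to a submodule, then it sends the
values of `bBeta` there. -/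
lemma bBeta_mem {Z : Type*} [AddCommGroup Z] [Module k Z] {l i : ℤ} {q : ℕ} (h : i + q = l + 1)
    (S : Submodule k Z) (F : barResX M l →ₗ[k] Z)
    (H : ∀ (r : ℕ) (h : i + r = l) x (y : T k A r), r < q → F (bMk M h x y) ∈ S)
    (x : M.X i) (y : T k A q) : F (bBeta M q h x y) ∈ S := by
  cases q with
  | zero => rw [bBeta_zero, map_zero]; exact S.zero_mem
  | succ q =>
    have h₁ : i + q = l := by push_cast at h; omega
    refine consT_induction y ?_ (fun y y' hy hy' => ?_) fun c y => ?_
    · rw [map_zero, map_zero]; exact S.zero_mem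
    · rw [map_add, map_add]; exact S.add_mem hy hy'
    · rw [bBeta_succ h h₁, map_sub]
      exact S.sub_mem (H _ _ _ _ q.lt_succ_self) (H _ _ _ _ q.lt_succ_self)

variable (M)

/-- The differential `d (x ⊗ y) = d x ⊗ y + (-1)^i β (x ⊗ y)`. -/
def barResD {l l' : ℤ} (hl : l' + 1 = l) : barResX M l →ₗ[k] barResX M l' :=
  bDesc fun i q h => bMk M (show i - 1 + q = l' by omega) ∘ₗ M.d i (i - 1) +
    (i.negOnePow : ℤ) • bBeta M q (show i + q = l' + 1 by omega)

/-- The action `(x ⊗ y) ε = (-1)^{nq} x ε ⊗ y`. -/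
def barResE {l l' : ℤ} (hl : l + n = l') : barResX M l →ₗ[k] barResX M l' :=
  bDesc fun i q h => ((n * q).negOnePow : ℤ) •
    (bMk M (show i + n + q = l' by omega) ∘ₗ M.e i (i + n))

variable {M}

lemma barResD_bMk {l l' i i' : ℤ} {q : ℕ} (hl : l' + 1 = l) (h : i + q = l) (h' : i' + q = l')
    (h'' : i + q = l' + 1) (x : M.X i) (y : T k A q) :
    barResD M hl (bMk M h x y) =
      bMk M h' (M.d i i' x) y + (i.negOnePow : ℤ) • bBeta M q h'' x y := by
  obtain rfl : i' = i - 1 := by omega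
  exact bDesc_bMk _ h x y

lemma barResE_bMk {l l' i i' : ℤ} {q : ℕ} (hl : l + n = l') (h : i + q = l) (h' : i' + q = l')
    (x : M.X i) (y : T k A q) :
    barResE M hl (bMk M h x y) = ((n * q).negOnePow : ℤ) • bMk M h' (M.e i i' x) y := by
  obtain rfl : i' = i + n := by omega
  exact bDesc_bMk _ h x y

/-- The differential of M commutes with β because it is right linear, and β β = 0, so the only term
left is β (d x ⊗ y). Together with the signs (-1)^i and (-1)^(i-1) this makes the total differential
square to zero. -/
lemma barResD_bBeta {l l' i i' : ℤ} {q : ℕ} (hl : l' + 1 = l) (h : i + q = l + 1)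
    (h' : i' + q = l' + 1) (x : M.X i) (y : T k A q) :
    barResD M hl (bBeta M q h x y) = bBeta M q h' (M.d i i' x) y := by
  cases q with
  | zero => rw [bBeta_zero, bBeta_zero, map_zero]
  | succ q =>
    have h₁ : i + q = l := by push_cast at h; omega
    have h₂ : i' + q = l' := by push_cast at h'; omega
    refine consT_induction y ?_ (fun y y' hy hy' => ?_) fun a y => ?_
    · simp only [map_zero]
    · simp only [map_add, hy, hy']
    · rw [bBeta_succ h h₁, bBeta_succ h' h₂, map_sub,
        barResD_bMk hl h₁ h₂ (by omega), barResD_bMk hl h₁ h₂ (by omega),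
        (M.isBimodMap_d i i').2, add_sub_add_comm, ← smul_sub, add_eq_left]
      cases q with
      | zero => rw [bBeta_zero, bBeta_zero, sub_zero, smul_zero]
      | succ q =>
        have h₃ : i + q = l' := by push_cast at h₁; omega
        rw [dT_cons, map_sub]
        -- What remains is β β = 0 on x ⊗ a ⊗ y, where d (a ⊗ y) = a y - a ⊗ d y has been expanded.
        suffices H : bBeta M (q + 1) (show i + (q + 1 : ℕ) = l' + 1 by omega) (op a • x) y -
            bBeta M (q + 1) (by omega) x (a • y) +
            bBeta M (q + 1) (by omega) x (consT q a (dT k A q y)) = 0 by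
          rw [sub_sub_eq_add_sub, add_sub_right_comm, H, smul_zero]
        refine consT_induction y ?_ (fun y y' hy hy' => ?_) fun b y => ?_
        · simp only [map_zero, smul_zero, sub_zero, add_zero]
        · simp only [map_add, smul_add]
          rw [← add_zero (0 : barResX M l')]
          nth_rewrite 1 [← hy]
          rw [← hy']
          abel
        · rw [smul_consT, bBeta_succ _ h₃, bBeta_succ _ h₃, bBeta_succ _ h₃, dT_consT_dT,
            ← smul_consT, (isBimodMap_dT q).1, op_mul, mul_smul]
          abel

variable (M)

/-- The bar resolution `M ⊗_A Bar_*(A)` of a differential graded module. -/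
def barRes : DGMod k A n where
  X := barResX M
  d l l' := if h : l' + 1 = l then barResD M h else 0
  isBimodMap_d l l' := by
    split_ifs with hl
    · refine isBimodMap_of_bMk (fun i q h a x y => ?_) (fun i q h a x y => ?_)
      · rw [barResD_bMk hl h (show i - 1 + q = l' by omega) (by omega),
          barResD_bMk hl h (show i - 1 + q = l' by omega) (by omega), (M.isBimodMap_d _ _).1,
          bBeta_smul, smul_add, smul_bMk, smul_comm a]
      · rw [barResD_bMk hl h (show i - 1 + q = l' by omega) (by omega),
          barResD_bMk hl h (show i - 1 + q = l' by omega) (by omega),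
          bBeta_op_smul, smul_add, op_smul_bMk, smul_comm (op a)]
    · exact IsBimodMap.zero
  d_shape l l' h := dif_neg h
  d_d l l' l'' z := by
    by_cases hl : l' + 1 = l
    · by_cases hl' : l'' + 1 = l'
      · rw [dif_pos hl, dif_pos hl']
        refine LinearMap.congr_fun (f := barResD M hl' ∘ₗ barResD M hl) (g := 0)
          (barResX_hom_ext fun i q h x y => ?_) z
        rw [LinearMap.comp_apply, LinearMap.zero_apply,
          barResD_bMk hl h (show i - 1 + q = l' by omega) (by omega), map_add, map_zsmul,
          barResD_bMk hl' _ (show i - 1 - 1 + q = l'' by omega) (by omega), M.d_d, map_zero,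
          LinearMap.zero_apply, zero_add, barResD_bBeta hl' _ (show i - 1 + q = l'' + 1 by omega), Int.negOnePow_sub,
          Int.negOnePow_one, ← add_smul, mul_neg_one, Units.val_neg, neg_add_cancel, zero_smul]
      · rw [dif_neg hl', LinearMap.zero_apply]
    · rw [dif_neg hl, LinearMap.zero_apply, map_zero]
  e l l' := if h : l + n = l' then barResE M h else 0
  isBimodMap_e l l' := by
    split_ifs with hl
    · refine isBimodMap_of_bMk (fun i q h a x y => ?_) (fun i q h a x y => ?_)
      · rw [barResE_bMk hl h (show i + n + q = l' by omega),
          barResE_bMk hl h (show i + n + q = l' by omega), (M.isBimodMap_e _ _).1, ← smul_bMk,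
          smul_comm a]
      · rw [barResE_bMk hl h (show i + n + q = l' by omega),
          barResE_bMk hl h (show i + n + q = l' by omega), ← op_smul_bMk, smul_comm (op a)]
    · exact IsBimodMap.zero
  e_shape l l' h := dif_neg h
  e_e l l' l'' z := by
    by_cases hl : l + n = l'
    · by_cases hl' : l' + n = l''
      · rw [dif_pos hl, dif_pos hl']
        refine LinearMap.congr_fun (f := barResE M hl' ∘ₗ barResE M hl) (g := 0)
          (barResX_hom_ext fun i q h x y => ?_) z
        rw [LinearMap.comp_apply, LinearMap.zero_apply,
          barResE_bMk hl h (show i + n + q = l' by omega), map_zsmul,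
          barResE_bMk hl' _ (show i + n + n + q = l'' by omega), M.e_e, map_zero,
          LinearMap.zero_apply, smul_zero, smul_zero]
      · rw [dif_neg hl', LinearMap.zero_apply]
    · rw [dif_neg hl, LinearMap.zero_apply, map_zero]
  d_e l₁ l₂ l₁' l₂' h₁ h₂ z := by
    by_cases hl : l₂ + 1 = l₁
    · have hl' : l₂' + 1 = l₁' := by omega
      rw [dif_pos h₁, dif_pos h₂, dif_pos hl, dif_pos hl']
      refine LinearMap.congr_fun (f := barResD M hl' ∘ₗ barResE M h₁)
        (g := barResE M h₂ ∘ₗ barResD M hl) (barResX_hom_ext fun i q h x y => ?_) z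
      rw [LinearMap.comp_apply, LinearMap.comp_apply,
        barResD_bMk hl h (show i - 1 + q = l₂ by omega) (by omega), map_add, map_zsmul,
        barResE_bMk h₁ h (show i + n + q = l₁' by omega), map_zsmul,
        barResD_bMk hl' _ (show i - 1 + n + q = l₂' by omega) (by omega),
        barResE_bMk h₂ _ (show i - 1 + n + q = l₂' by omega),
        M.d_e i (i - 1) (i + n) (i - 1 + n) rfl rfl, smul_add]
      congr 1
      cases q with
      | zero => rw [bBeta_zero, bBeta_zero, map_zero, smul_zero, smul_zero, smul_zero]
      | succ q =>
        have h₃ : i + n + q = l₂' := by push_cast at h; omega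
        have := bBeta_apply_eq (N := M) (q := q + 1) (show i + (q + 1 : ℕ) = l₂ + 1 by omega)
          (show i + n + (q + 1 : ℕ) = l₂' + 1 by omega) (M.e i (i + n))
          (M.isBimodMap_e i (i + n)).2 (barResE M h₂) (((n * q).negOnePow : ℤ) • LinearMap.id)
          (fun r hr hr' x y => by
            obtain rfl : r = q := by push_cast at h; omega
            rw [barResE_bMk h₂ hr hr']
            rfl) x y
        rw [this, LinearMap.smul_apply, LinearMap.id_apply, smul_smul, smul_smul]
        congr 1
        rw [← Units.val_mul, ← Units.val_mul, ← Int.negOnePow_add, ← Int.negOnePow_add]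
        congr 1
        rw [Int.negOnePow_eq_iff]
        -- On one side β is applied to x ε, of degree i + n instead of i; on the other side ε passes
        -- a tensor of bar length q instead of q + 1. Each costs (-1)^n.
        exact ⟨n, by push_cast; ring⟩
    · rw [dif_neg hl, dif_neg (show ¬ l₂' + 1 = l₁' by omega), LinearMap.zero_apply,
        LinearMap.zero_apply, map_zero]

end BarRes

end DGMod

end

end SingDef

namespace SingDef

section

variable {k : Type v} {A : Type u} [CommRing k] [Ring A] [Algebra k A]

namespace DGMod

variable {n : ℤ}

/-! ### Homotopy equivalences from approximate data -/

section ConeHomotopy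

variable {M N : DGMod k A n} (φ : Hom M N) (g : ∀ i, N.X i →ₗ[k] M.X i)
  (h : ∀ i j, M.X i →ₗ[k] M.X j) (h' : ∀ i j, N.X i →ₗ[k] N.X j)

/-- The map `(y, x) ↦ (h' y, g y - h x)` of degree one on the mapping cone. -/
def coneHtpy (l l' : ℤ) : (mappingCone φ).X l →ₗ[k] (mappingCone φ).X l' :=
  if hl : l + 1 = l' then
    mappingCone.inl φ l' ∘ₗ h' l l' ∘ₗ mappingCone.fst φ l + mappingCone.inr φ hl ∘ₗ
      (g l ∘ₗ mappingCone.fst φ l - h (l - 1) l ∘ₗ mappingCone.snd φ (sub_add_cancel l 1))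
  else 0

variable {φ g h h'}

lemma coneHtpy_inl {l l' : ℤ} (hl : l + 1 = l') (y : N.X l) :
    coneHtpy φ g h h' l l' (mappingCone.inl φ l y) =
      mappingCone.inl φ l' (h' l l' y) + mappingCone.inr φ hl (g l y) := by
  rw [coneHtpy, dif_pos hl]
  simp

lemma coneHtpy_inr {j l l' : ℤ} (hj : j + 1 = l) (hl : l + 1 = l') (x : M.X j) :
    coneHtpy φ g h h' l l' (mappingCone.inr φ hj x) = -mappingCone.inr φ hl (h j l x) := by
  obtain rfl : j = l - 1 := by omega
  rw [coneHtpy, dif_pos hl]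
  simp

variable (φ g h h') in
/-- The elements of the mapping cone on which the commutator of `coneHtpy` with the differential is
unipotent. -/
noncomputable def coneGen (l : ℤ) : Submodule k ((mappingCone φ).X l) :=
  Module.End.maxGenEigenspace (boundary (mappingCone φ) (coneHtpy φ g h h') l) 1

/-- The element in the hypothesis is V z - z, where V is the commutator of `coneHtpy` with d and z
is y in the target summand. Its two entries measure how far h' is from a homotopy between φ g and
the identity, and how far g is from a chain map. -/
lemma inl_mem_coneGen {j l l' : ℤ} (hj : j + 1 = l) (hl : l + 1 = l') {y : N.X l}
    (H : mappingCone.inl φ l (N.d l' l (h' l l' y) + h' j l (N.d l j y) + φ.f l (g l y) - y) +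
      mappingCone.inr φ hj (g j (N.d l j y) - M.d l j (g l y)) ∈ coneGen φ g h h' l) :
    mappingCone.inl φ l y ∈ coneGen φ g h h' l := by
  refine mem_maxGenEigenspace_one_of_sub _ ?_
  change _ ∈ coneGen φ g h h' l
  convert H using 1
  rw [boundary_apply _ _ hl hj, coneHtpy_inl hl, map_add, mappingCone.d_inl hl,
    mappingCone.d_inr hl hj, mappingCone.d_inl hj, coneHtpy_inl hj]
  simp only [map_add, map_sub]
  abel

/-- Here the error V z - z of an element z of the source summand has the entries h' φ x - φ h x and
the defect of h as a homotopy from g φ to the identity. The first entry lies in the target summand,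
so target elements are usually treated before source elements. -/
lemma inr_mem_coneGen {i j l : ℤ} (hi : i + 1 = j) (hj : j + 1 = l) {x : M.X j}
    (H : mappingCone.inl φ l (h' j l (φ.f j x) - φ.f l (h j l x)) +
      mappingCone.inr φ hj (g j (φ.f j x) + M.d l j (h j l x) + h i j (M.d j i x) - x) ∈
        coneGen φ g h h' l) :
    mappingCone.inr φ hj x ∈ coneGen φ g h h' l := by
  refine mem_maxGenEigenspace_one_of_sub _ ?_
  change _ ∈ coneGen φ g h h' l
  convert H using 1
  rw [boundary_apply _ _ (show l + 1 = l + 1 from rfl) hj, coneHtpy_inr hj rfl, map_neg,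
    mappingCone.d_inr rfl hj, mappingCone.d_inr hj hi, map_sub, coneHtpy_inl hj,
    coneHtpy_inr hi hj]
  simp only [map_add, map_sub]
  abel

/-- Neither must g be a chain map nor must h and h' be homotopies; only linearity and compatibility
with ε are exact requirements. The errors die after finitely many iterations, so V is bijective, and
the genuine inverse is read off from the corrected contraction of the cone. -/
lemma isHtpyEquiv_of_coneGen {S : Side} (hg : ∀ i, S.Lin (g i)) (hh : ∀ i j, S.Lin (h i j))
    (hh' : ∀ i j, S.Lin (h' i j))
    (eg : ∀ i j, i + n = j → ∀ x, g j (N.e i j x) = M.e i j (g i x))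
    (eh : ∀ i j i' j', i + 1 = j → i + n = i' → j + n = j' → ∀ x,
      h i' j' (M.e i i' x) = M.e j j' (h i j x))
    (eh' : ∀ i j i' j', i + 1 = j → i + n = i' → j + n = j' → ∀ x,
      h' i' j' (N.e i i' x) = N.e j j' (h' i j x))
    (gl : ∀ l y, mappingCone.inl φ l y ∈ coneGen φ g h h' l)
    (gr : ∀ j l (hj : j + 1 = l) x, mappingCone.inr φ hj x ∈ coneGen φ g h h' l) :
    IsHtpyEquiv S φ := by
  have lin := fun {P Q : Bimod k A} {ψ : P →ₗ[k] Q} (h : IsBimodMap ψ) => S.lin_of_isBimodMap h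
  refine isHtpyEquiv_of_contractible _ (contractible_of_bijective (H := coneHtpy φ g h h')
    (fun i j => ?_) (fun i j i' j' hj hi hj' z => ?_)
    fun i => bijective_of_maxGenEigenspace_one _ fun z => ?_)
  · rw [coneHtpy]
    split_ifs with hl
    · have h₁ := lin (mappingCone.isBimodMap_fst φ i)
      exact ((lin (mappingCone.isBimodMap_inl φ j)).comp ((hh' i j).comp h₁)).add
        ((lin (mappingCone.isBimodMap_inr φ hl)).comp (((hg i).comp h₁).sub
          ((hh _ _).comp (lin (mappingCone.isBimodMap_snd φ _)))))
    · exact S.lin_zero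
  · have hi₀ : i - 1 + 1 = i := by omega
    have hi₁ : i' - 1 + 1 = i' := by omega
    rw [mappingCone.eq_add hi₀ z]
    simp only [map_add]
    rw [mappingCone.e_inl hi, mappingCone.e_inr hi hi₀ hi₁,
      coneHtpy_inl (show i' + 1 = j' by omega), coneHtpy_inr hi₁ (show i' + 1 = j' by omega),
      coneHtpy_inl hj, coneHtpy_inr hi₀ hj, map_add, map_neg, mappingCone.e_inl hj',
      mappingCone.e_inr hj' hj (show i' + 1 = j' by omega), eg i i' hi,
      eh _ _ _ _ hi₀ (by omega) hi, eh' _ _ _ _ hj hi hj', mappingCone.e_inr hj' hj]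
  · have hi₀ : i - 1 + 1 = i := by omega
    rw [mappingCone.eq_add hi₀ z]
    exact Submodule.add_mem _ (gl _ _) (gr _ _ _ _)

end ConeHomotopy

/-! ### Maps between bar resolutions -/

section BarRes

variable (M : DGMod k A n)

/-- The element `x ⊗ y` of the bar resolution. -/
def bt {l i : ℤ} {q : ℕ} (h : i + q = l) : M.X i →ₗ[k] T k A q →ₗ[k] (barRes M).X l := bMk M h

/-- The part of the differential of the bar resolution that lowers the rank. -/
def bb {l i : ℤ} {q : ℕ} (h : i + q = l + 1) : M.X i →ₗ[k] T k A q →ₗ[k] (barRes M).X l :=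
  bBeta M q h

variable {M}

lemma smul_bt {l i : ℤ} {q : ℕ} (h : i + q = l) (a : A) (x : M.X i) (y : T k A q) :
    a • bt M h x y = bt M h (a • x) y := smul_bMk h a x y

lemma op_smul_bt {l i : ℤ} {q : ℕ} (h : i + q = l) (a : A) (x : M.X i) (y : T k A q) :
    op a • bt M h x y = bt M h x (op a • y) := op_smul_bMk h a x y

lemma bar_congr {Z : Type*} [AddCommGroup Z] [Module k Z] {l : ℤ}
    (φ ψ : (barRes M).X l →ₗ[k] Z)
    (H : ∀ (i : ℤ) (q : ℕ) (h : i + q = l) x y, φ (bt M h x y) = ψ (bt M h x y))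
    (z : (barRes M).X l) : φ z = ψ z :=
  LinearMap.congr_fun (barResX_hom_ext (M := M) (φ := φ) (ψ := ψ) H) z

/-- A submodule that contains the images of all `x ⊗ y` contains all images. -/
lemma bar_mem {Z : Type*} [AddCommGroup Z] [Module k Z] {l : ℤ} (S : Submodule k Z)
    (φ : (barRes M).X l →ₗ[k] Z)
    (H : ∀ (i : ℤ) (q : ℕ) (h : i + q = l) x y, φ (bt M h x y) ∈ S)
    (z : (barRes M).X l) : φ z ∈ S :=
  (Submodule.Quotient.mk_eq_zero S).1 (bar_congr (S.mkQ ∘ₗ φ) 0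
    (fun i q h x y => (Submodule.Quotient.mk_eq_zero S).2 (H i q h x y)) z)

/-- The linear map on the bar resolution given by a family of bilinear maps. -/
def bLift {Z : Type*} [AddCommGroup Z] [Module k Z] {l : ℤ}
    (Φ : ∀ (i : ℤ) (q : ℕ), i + q = l → M.X i →ₗ[k] T k A q →ₗ[k] Z) :
    (barRes M).X l →ₗ[k] Z := bDesc Φ

lemma bLift_bt {Z : Type*} [AddCommGroup Z] [Module k Z] {l : ℤ}
    (Φ : ∀ (i : ℤ) (q : ℕ), i + q = l → M.X i →ₗ[k] T k A q →ₗ[k] Z) {i : ℤ} {q : ℕ}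
    (h : i + q = l) (x : M.X i) (y : T k A q) : bLift Φ (bt M h x y) = Φ i q h x y :=
  bDesc_bMk Φ h x y

lemma isBimodMap_of_bt {l : ℤ} {Z : Bimod k A} {φ : (barRes M).X l →ₗ[k] Z}
    (hl : ∀ (i : ℤ) (q : ℕ) (h : i + q = l) (a : A) x y,
      φ (bt M h (a • x) y) = a • φ (bt M h x y))
    (hr : ∀ (i : ℤ) (q : ℕ) (h : i + q = l) (a : A) x y,
      φ (bt M h x (op a • y)) = op a • φ (bt M h x y)) : IsBimodMap φ :=
  isBimodMap_of_bMk (φ := φ) hl hr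

lemma isRight_of_bt {l : ℤ} {Z : Bimod k A} {φ : (barRes M).X l →ₗ[k] Z}
    (hr : ∀ (i : ℤ) (q : ℕ) (h : i + q = l) (a : A) x y,
      φ (bt M h x (op a • y)) = op a • φ (bt M h x y)) : IsRight φ :=
  isRight_of_bMk (φ := φ) hr

lemma barRes_d_bt {l l' i i' : ℤ} {q : ℕ} (hl : l' + 1 = l) (h : i + q = l) (h' : i' + q = l')
    (h'' : i + q = l' + 1) (x : M.X i) (y : T k A q) :
    (barRes M).d l l' (bt M h x y) =
      bt M h' (M.d i i' x) y + (i.negOnePow : ℤ) • bb M h'' x y :=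
  (LinearMap.congr_fun (dif_pos hl : (barRes M).d l l' = barResD M hl) _).trans
    (barResD_bMk hl h h' h'' x y)

lemma barRes_e_bt {l l' i i' : ℤ} {q : ℕ} (hl : l + n = l') (h : i + q = l) (h' : i' + q = l')
    (x : M.X i) (y : T k A q) :
    (barRes M).e l l' (bt M h x y) = ((n * q).negOnePow : ℤ) • bt M h' (M.e i i' x) y :=
  (LinearMap.congr_fun (dif_pos hl : (barRes M).e l l' = barResE M hl) _).trans
    (barResE_bMk hl h h' x y)

lemma bb_zero {l i : ℤ} (h : i + (0 : ℕ) = l + 1) (x : M.X i) (y : T k A 0) :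
    bb M h x y = 0 := rfl

lemma bb_succ {l i : ℤ} {q : ℕ} (h : i + (q + 1 : ℕ) = l + 1) (h' : i + q = l) (x : M.X i)
    (a : A) (y : T k A q) : bb M h x (consT q a y) =
      bt M h' (op a • x) y - bt M h' x (dT k A q (consT q a y)) := bBeta_succ h h' x a y

lemma bb_apply_eq {Z : Type*} [AddCommGroup Z] [Module k Z] {N : DGMod k A n} {l l' i j : ℤ}
    {q : ℕ} (h : i + q = l + 1) (h' : j + q = l' + 1) (u : M.X i →ₗ[k] N.X j) (hu : IsRight u)
    (F : (barRes M).X l →ₗ[k] Z) (G : (barRes N).X l' →ₗ[k] Z)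
    (H : ∀ (q : ℕ) (h : i + q = l) (h' : j + q = l') x (y : T k A q),
      F (bt M h x y) = G (bt N h' (u x) y)) (x : M.X i) (y : T k A q) :
    F (bb M h x y) = G (bb N h' (u x) y) := bBeta_apply_eq h h' u hu F G H x y

lemma bb_mem {Z : Type*} [AddCommGroup Z] [Module k Z] {l i : ℤ} {q : ℕ} (h : i + q = l + 1)
    (S : Submodule k Z) (F : (barRes M).X l →ₗ[k] Z)
    (H : ∀ (r : ℕ) (h : i + r = l) x (y : T k A r), r < q → F (bt M h x y) ∈ S)
    (x : M.X i) (y : T k A q) : F (bb M h x y) ∈ S := bBeta_mem h S F H x y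

section Map

variable {N : DGMod k A n} {c : ℤ}

/-- The map `x ⊗ y ↦ u x ⊗ y` for a family `u` of degree `c`. -/
def barMap (u : ∀ i j, i + c = j → (M.X i →ₗ[k] N.X j)) (l l' : ℤ) :
    (barRes M).X l →ₗ[k] (barRes N).X l' :=
  if hl : l + c = l' then
    bLift fun i q h => bt N (show i + c + q = l' by omega) ∘ₗ u i (i + c) rfl
  else 0

lemma barMap_bt (u : ∀ i j, i + c = j → (M.X i →ₗ[k] N.X j)) {l l' i j : ℤ} {q : ℕ}
    (h : i + q = l) (hj : i + c = j) (h' : j + q = l') (x : M.X i) (y : T k A q) :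
    barMap u l l' (bt M h x y) = bt N h' (u i j hj x) y := by
  subst hj
  rw [barMap, dif_pos (show l + c = l' by omega)]
  exact bLift_bt _ h x y

lemma isRight_barMap (u : ∀ i j, i + c = j → (M.X i →ₗ[k] N.X j)) (l l' : ℤ) :
    IsRight (barMap u l l') := by
  by_cases hl : l + c = l'
  · refine isRight_of_bt fun i q h a x y => ?_
    rw [barMap_bt u h rfl (show i + c + q = l' by omega),
      barMap_bt u h rfl (show i + c + q = l' by omega), op_smul_bt]
  · rw [barMap, dif_neg hl]
    exact IsBimodMap.zero.2

lemma barMap_e {u : ∀ i j, i + c = j → (M.X i →ₗ[k] N.X j)}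
    (he : ∀ i j i' j' h h', i + n = i' → j + n = j' → ∀ x,
      u i' j' h' (M.e i i' x) = N.e j j' (u i j h x)) {l l' r r' : ℤ} (hl : l + c = l')
    (hr : r + c = r') (h : l + n = r) (z : (barRes M).X l) :
    barMap u r r' ((barRes M).e l r z) = (barRes N).e l' r' (barMap u l l' z) :=
  bar_congr (barMap u r r' ∘ₗ (barRes M).e l r) ((barRes N).e l' r' ∘ₗ barMap u l l')
    (fun i q hi x y => by
      rw [LinearMap.comp_apply, LinearMap.comp_apply,
        barRes_e_bt h hi (show i + n + q = r by omega), map_zsmul,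
        barMap_bt u _ rfl (show i + n + c + q = r' by omega),
        barMap_bt u _ rfl (show i + c + q = l' by omega),
        barRes_e_bt (by omega) _ (show i + n + c + q = r' by omega),
        he i (i + c) (i + n) (i + n + c) rfl rfl rfl (by omega)]) z

end Map

/-- The morphism of bar resolutions induced by a morphism. -/
def barHom {M N : DGMod k A n} (φ : Hom M N) : Hom (barRes M) (barRes N) where
  f l := barMap (degZero φ.f) l l
  isBimodMap_f l := by
    refine ⟨?_, isRight_barMap _ _ _⟩
    refine (isBimodMap_of_bt (fun i q h a x y => ?_) fun i q h a x y =>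
      (congrArg _ (op_smul_bt h a x y)).symm.trans (isRight_barMap _ _ _ _ _)).1
    rw [barMap_bt _ h (add_zero i) h, barMap_bt _ h (add_zero i) h, degZero_apply, degZero_apply,
      (φ.isBimodMap_f i).1, smul_bt]
  comm_d l l' z := by
    by_cases hl : l' + 1 = l
    · refine bar_congr (barMap (degZero φ.f) l' l' ∘ₗ (barRes M).d l l')
        ((barRes N).d l l' ∘ₗ barMap (degZero φ.f) l l) (fun i q h x y => ?_) z
      rw [LinearMap.comp_apply, LinearMap.comp_apply, barMap_bt _ h (add_zero i) h, degZero_apply,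
        barRes_d_bt hl h (show i - 1 + q = l' by omega) (by omega),
        barRes_d_bt hl h (show i - 1 + q = l' by omega) (by omega), map_add, map_zsmul,
        barMap_bt _ _ (add_zero _) (show i - 1 + q = l' by omega), degZero_apply, φ.comm_d]
      congr 2
      exact bb_apply_eq _ (by omega) (φ.f i) (φ.isBimodMap_f i).2 _ LinearMap.id
        (fun q h h' x y => barMap_bt _ h (add_zero i) h x y) x y
    · rw [(barRes M).d_shape _ _ hl, (barRes N).d_shape _ _ hl, LinearMap.zero_apply,
        LinearMap.zero_apply, map_zero]
  comm_e l l' z := by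
    by_cases hl : l + n = l'
    · refine barMap_e (fun i j i' j' h h' hi hj x => ?_) (add_zero l) (add_zero l') hl z
      obtain rfl : i = j := by omega
      obtain rfl : i' = j' := by omega
      exact φ.comm_e _ _ x
    · rw [(barRes M).e_shape _ _ hl, (barRes N).e_shape _ _ hl, LinearMap.zero_apply,
        LinearMap.zero_apply, map_zero]

lemma barHom_bt {M N : DGMod k A n} (φ : Hom M N) {l i : ℤ} {q : ℕ} (h : i + q = l) (x : M.X i)
    (y : T k A q) : (barHom φ).f l (bt M h x y) = bt N h (φ.f i x) y :=
  barMap_bt _ h (add_zero i) h x y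

/-- The right action, as a bilinear map on `M_i` and `A^{⊗ 1}`. -/
def augMul (M : DGMod k A n) (i : ℤ) : M.X i →ₗ[k] T k A 0 →ₗ[k] M.X i := (M.X i).rmul.flip

/-- The components of the augmentation: `x ⊗ a ↦ x a`, and zero on the other summands. -/
def augAux (M : DGMod k A n) {l i : ℤ} : ∀ q : ℕ, i + q = l → M.X i →ₗ[k] T k A q →ₗ[k] M.X l
  | 0, h => augMul M l ∘ₗ degZero (M := M) (M' := M) (fun _ => LinearMap.id) i l h
  | _ + 1, _ => 0

/-- The components of the augmentation of the bar resolution. -/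
def augMap (M : DGMod k A n) (l : ℤ) : (barRes M).X l →ₗ[k] M.X l := bLift fun _ q h => augAux M q h

lemma augMap_zero (M : DGMod k A n) {l : ℤ} (h : l + (0 : ℕ) = l) (x : M.X l) (y : T k A 0) :
    augMap M l (bt M h x y) = op (toA y) • x := bLift_bt _ h x y

lemma augMap_succ (M : DGMod k A n) {l i : ℤ} {q : ℕ} (h : i + (q + 1 : ℕ) = l) (x : M.X i)
    (y : T k A (q + 1)) : augMap M l (bt M h x y) = 0 := bLift_bt _ h x y

/-- For bar length one the two faces of x ⊗ a ⊗ b both give x a b and cancel. For larger bar length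
the augmentation vanishes on every term. -/
lemma augMap_bb (M : DGMod k A n) {l i : ℤ} {q : ℕ} (h : i + q = l + 1) (x : M.X i)
    (y : T k A q) : augMap M l (bb M h x y) = 0 := by
  rcases q with _ | _ | q
  · rw [bb_zero, map_zero]
  · obtain rfl : i = l := by push_cast at h; omega
    refine consT_induction y ?_ (fun y y' hy hy' => ?_) fun a y => ?_
    · simp only [map_zero]
    · simp only [map_add, hy, hy', add_zero]
    · rw [bb_succ h (by simp), map_sub, augMap_zero, augMap_zero, dT_zero, sub_eq_zero, smul_smul]
      rfl
  · refine consT_induction y ?_ (fun y y' hy hy' => ?_) fun a y => ?_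
    · simp only [map_zero]
    · simp only [map_add, hy, hy', add_zero]
    · rw [bb_succ h (by push_cast at h ⊢; omega), map_sub, augMap_succ, augMap_succ, sub_zero]

/-- The augmentation of the bar resolution. -/
def barAug (M : DGMod k A n) : Hom (barRes M) M where
  f := augMap M
  isBimodMap_f l := by
    refine isBimodMap_of_bt (fun i q h a x y => ?_) (fun i q h a x y => ?_)
    · cases q with
      | zero =>
        obtain rfl : i = l := by simpa using h
        rw [augMap_zero, augMap_zero, smul_comm]
      | succ q => rw [augMap_succ, augMap_succ, smul_zero]
    · cases q with
      | zero =>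
        obtain rfl : i = l := by simpa using h
        rw [augMap_zero, augMap_zero, smul_smul]
        rfl
      | succ q => rw [augMap_succ, augMap_succ, smul_zero]
  comm_d l l' z := by
    by_cases hl : l' + 1 = l
    · refine bar_congr (augMap M l' ∘ₗ (barRes M).d l l') (M.d l l' ∘ₗ augMap M l)
        (fun i q h x y => ?_) z
      rw [LinearMap.comp_apply, LinearMap.comp_apply,
        barRes_d_bt hl h (show i - 1 + q = l' by omega) (by omega), map_add, map_zsmul, augMap_bb,
        smul_zero, add_zero]
      cases q with
      | zero =>
        obtain rfl : i = l := by simpa using h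
        obtain rfl : l' = i - 1 := by omega
        rw [augMap_zero, augMap_zero, (M.isBimodMap_d _ _).2]
      | succ q => rw [augMap_succ, augMap_succ, map_zero]
    · rw [(barRes M).d_shape _ _ hl, M.d_shape _ _ hl, LinearMap.zero_apply, LinearMap.zero_apply,
        map_zero]
  comm_e l l' z := by
    by_cases hl : l + n = l'
    · refine bar_congr (augMap M l' ∘ₗ (barRes M).e l l') (M.e l l' ∘ₗ augMap M l)
        (fun i q h x y => ?_) z
      rw [LinearMap.comp_apply, LinearMap.comp_apply,
        barRes_e_bt hl h (show i + n + q = l' by omega), map_zsmul]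
      cases q with
      | zero =>
        obtain rfl : i = l := by simpa using h
        obtain rfl := hl
        rw [augMap_zero, augMap_zero, (M.isBimodMap_e _ _).2]
        simp
      | succ q => rw [augMap_succ, augMap_succ, map_zero, smul_zero]
    · rw [(barRes M).e_shape _ _ hl, M.e_shape _ _ hl, LinearMap.zero_apply, LinearMap.zero_apply,
        map_zero]

lemma barAug_zero (M : DGMod k A n) {l : ℤ} (h : l + (0 : ℕ) = l) (x : M.X l) (y : T k A 0) :
    (barAug M).f l (bt M h x y) = op (toA y) • x := augMap_zero M h x y

lemma barAug_succ (M : DGMod k A n) {l i : ℤ} {q : ℕ} (h : i + (q + 1 : ℕ) = l) (x : M.X i)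
    (y : T k A (q + 1)) : (barAug M).f l (bt M h x y) = 0 := augMap_succ M h x y

lemma barAug_naturality {M N : DGMod k A n} (φ : Hom M N) (l : ℤ) (z : (barRes M).X l) :
    (barAug N).f l ((barHom φ).f l z) = φ.f l ((barAug M).f l z) :=
  bar_congr ((barAug N).f l ∘ₗ (barHom φ).f l) (φ.f l ∘ₗ (barAug M).f l) (fun i q h x y => by
    rw [LinearMap.comp_apply, LinearMap.comp_apply, barHom_bt]
    cases q with
    | zero =>
      obtain rfl : i = l := by simpa using h
      rw [barAug_zero, barAug_zero, (φ.isBimodMap_f i).2]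
    | succ q => rw [barAug_succ, barAug_succ, map_zero]) z

end BarRes

end DGMod

end

end SingDef

/-! ### The augmentation and the homotopy invariance of the bar resolution -/

namespace SingDef

section

variable {k : Type v} {A : Type u} [CommRing k] [Ring A] [Algebra k A]

variable (k A) in
/-- The unit of `A`, as an element of `A^{⊗ 1}`. -/
def oneT : T k A 0 := (1 : A)

lemma op_toA_oneT_smul (M : Bimod k A) (x : M) : op (toA (oneT k A)) • x = x := one_smul Aᵐᵒᵖ x

namespace DGMod

variable {n : ℤ}

section BarAug

variable (M : DGMod k A n)

/-- The map `x ⊗ y ↦ x ⊗ y ⊗ 1`. -/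
def barSnoc (l l' : ℤ) : (barRes M).X l →ₗ[k] (barRes M).X l' :=
  if hl : l + 1 = l' then
    bLift fun i q h => (bt M (show i + (q + 1 : ℕ) = l' by push_cast; omega)).compl₂ (snocOne q)
  else 0

/-- The map `x ↦ x ⊗ 1`. -/
def barUnit (l : ℤ) : M.X l →ₗ[k] (barRes M).X l :=
  (bt M (show l + (0 : ℕ) = l by simp)).flip (oneT k A)

variable {M}

lemma barSnoc_bt {l l' i : ℤ} {q : ℕ} (h : i + q = l) (h' : i + (q + 1 : ℕ) = l') (x : M.X i)
    (y : T k A q) : barSnoc M l l' (bt M h x y) = bt M h' x (snocOne q y) := by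
  rw [barSnoc, dif_pos (show l + 1 = l' by push_cast at h'; omega)]
  exact bLift_bt _ h x y

lemma barUnit_apply {l : ℤ} (h : l + (0 : ℕ) = l) (x : M.X l) :
    barUnit M l x = bt M h x (oneT k A) := rfl

lemma snocOne_zero (a : T k A 0) :
    snocOne 0 a = consT 0 (toA a) (oneT k A) := rfl

lemma snocOne_succ (m : ℕ) (a : A) (x : T k A m) :
    snocOne (m + 1) (consT m a x) = consT (m + 1) a (snocOne m x) := snoc_succ m a x 1

lemma dT_snocOne (m : ℕ) (x : T k A (m + 1)) : dT k A (m + 1) (snocOne (m + 1) x) =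
    snocOne m (dT k A m x) + (-1 : ℤ) ^ (m + 1) • x := by
  have := dT_snoc m x 1
  rwa [op_one, one_smul] at this

/-- Appending 1 commutes with all faces of β except the new last one, which returns x ⊗ y up to
sign. In bar length zero the face that multiplies into M is new as well and yields the augmentation
term. -/
lemma bb_snocOne {l l' i : ℤ} {q : ℕ} (hl : l' + 1 = l) (h : i + q = l)
    (h' : i + (q + 1 : ℕ) = l + 1) (h'' : i + q = l' + 1) (x : M.X i) (y : T k A q) :
    bb M h' x (snocOne q y) = barSnoc M l' l (bb M h'' x y) +
      barUnit M l ((barAug M).f l (bt M h x y)) - (-1 : ℤ) ^ q • bt M h x y := by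
  cases q with
  | zero =>
    obtain rfl : i = l := by simpa using h
    rw [bb_zero, map_zero, zero_add (barUnit M i _), barAug_zero, snocOne_zero, bb_succ h' h, dT_zero, pow_zero,
      one_smul, barUnit_apply h]
    congr 2
    exact mul_one (toA y)
  | succ q =>
    have h₁ : i + q = l' := by push_cast at h; omega
    rw [barAug_succ, map_zero, add_zero]
    refine consT_induction y ?_ (fun y y' hy hy' => ?_) fun a y => ?_
    · simp only [map_zero, smul_zero, sub_zero]
    · simp only [map_add, smul_add, hy, hy']
      abel
    · rw [snocOne_succ, bb_succ h' h, bb_succ h'' h₁, ← snocOne_succ, dT_snocOne, map_sub,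
        barSnoc_bt h₁ h, barSnoc_bt h₁ h, map_add, map_zsmul]
      abel

lemma negOnePow_natCast (q : ℕ) : ((q : ℤ).negOnePow : ℤ) = (-1) ^ q := by
  rw [Int.negOnePow_def, zpow_natCast, Units.val_pow_eq_pow_val, Units.val_neg, Units.val_one]

/-- The augmentation of the bar resolution is a relative quasi-isomorphism. -/
lemma isRelQuasiIso_barAug (M : DGMod k A n) : IsRelQuasiIso (barAug M) := by
  -- The contraction appends 1 on the right, which destroys right linearity, so no side is claimed.
  -- The sign in h is that of the total degree. With this choice all errors vanish, and the
  -- commutator V is the identity.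
  refine (isHtpyEquiv_of_coneGen (S := .none) (g := barUnit M)
    (h := fun i j => -((i.negOnePow : ℤ) • barSnoc M i j)) (h' := fun _ _ => 0)
    (fun _ => trivial) (fun _ _ => trivial) (fun _ _ => trivial) (fun i j hj x => ?_)
    (fun i j i' j' hj hi hj' x => ?_) (fun _ _ _ _ _ _ _ _ => ?_) (fun l y => ?_)
    (fun j l hj x => ?_)).isRelQuasiIso
  · rw [barUnit_apply (by simp), barUnit_apply (by simp),
      barRes_e_bt hj _ (show j + (0 : ℕ) = j by simp)]
    simp
  · refine bar_congr ((-((i'.negOnePow : ℤ) • barSnoc M i' j')) ∘ₗ (barRes M).e i i')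
      ((barRes M).e j j' ∘ₗ (-((i.negOnePow : ℤ) • barSnoc M i j))) (fun r q h x y => ?_) x
    simp only [LinearMap.comp_apply, LinearMap.neg_apply, LinearMap.smul_apply, map_neg, map_zsmul]
    rw [barRes_e_bt hi h (show r + n + q = i' by omega), map_zsmul,
      barSnoc_bt _ (show r + n + (q + 1 : ℕ) = j' by push_cast; omega),
      barSnoc_bt _ (show r + (q + 1 : ℕ) = j by push_cast; omega),
      barRes_e_bt hj' _ (show r + n + (q + 1 : ℕ) = j' by push_cast; omega), smul_smul, smul_smul,
      ← Units.val_mul, ← Units.val_mul, ← Int.negOnePow_add, ← Int.negOnePow_add]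
    congr 3
    rw [Int.negOnePow_eq_iff]
    exact ⟨0, by push_cast; subst hi; ring⟩
  · simp
  · have hl : l - 1 + 1 = l := by omega
    refine inl_mem_coneGen hl rfl ?_
    convert Submodule.zero_mem _
    rw [LinearMap.zero_apply, LinearMap.zero_apply, map_zero, zero_add, zero_add,
      barUnit_apply (l := l) (by simp), barAug_zero, barUnit_apply (by simp),
      barRes_d_bt hl _ (show l - 1 + (0 : ℕ) = l - 1 by simp) (by simp), bb_zero, smul_zero,
      op_toA_oneT_smul, sub_self, map_zero, zero_add (mappingCone.inr _ _ _),
      add_zero (bt M _ _ _), sub_self, map_zero]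
  · refine bar_mem _ (mappingCone.inr (barAug M) hj) (fun i q h x y => ?_) x
    have hi : j - 1 + 1 = j := by omega
    refine inr_mem_coneGen hi hj ?_
    convert Submodule.zero_mem _
    simp only [LinearMap.neg_apply, LinearMap.smul_apply, map_neg, map_zsmul, LinearMap.zero_apply]
    rw [barSnoc_bt h (show i + (q + 1 : ℕ) = l by push_cast; omega), barAug_succ, smul_zero,
      neg_zero, sub_zero, map_zero, zero_add, barRes_d_bt (i' := i - 1) hj _ (by push_cast; omega)
        (by push_cast; omega), barRes_d_bt (i' := i - 1) hi h (by omega) (by omega),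
      bb_snocOne hi h _ (show i + q = j - 1 + 1 by omega), map_add, map_zsmul,
      barSnoc_bt (show i - 1 + q = j - 1 by omega) (show i - 1 + (q + 1 : ℕ) = j by push_cast; omega),
      Int.negOnePow_sub, Int.negOnePow_one, mul_neg_one, Units.val_neg, neg_smul, neg_neg]
    -- The homotopy carries the sign of the total degree j = i + q, the differential that of i
    -- alone; their product is (-1)^q, the sign of the new last face.
    have hs : (j.negOnePow : ℤ) = (i.negOnePow : ℤ) * (-1) ^ q := by
      rw [← h, Int.negOnePow_add, Units.val_mul, negOnePow_natCast]
    have h₁ : (i.negOnePow : ℤ) * (i.negOnePow : ℤ) = 1 := by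
      rw [← Units.val_mul, Int.units_mul_self, Units.val_one]
    have h₂ : ((-1 : ℤ) ^ q) * (-1) ^ q = 1 := by rw [← mul_pow]; simp
    have h₃ : (-1 : ℤ) ^ q • barUnit M j ((barAug M).f j (bt M h x y)) =
        barUnit M j ((barAug M).f j (bt M h x y)) := by
      cases q with
      | zero => rw [pow_zero, one_smul]
      | succ q => rw [barAug_succ, map_zero, smul_zero]
    have h₄ : (j.negOnePow : ℤ) * (i.negOnePow : ℤ) = (-1) ^ q := by
      rw [hs, mul_right_comm, h₁, one_mul]
    have h₅ : (j.negOnePow : ℤ) * ((i.negOnePow : ℤ) * (-1) ^ q) = 1 := by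
      rw [← mul_assoc, h₄, h₂]
    simp only [smul_add, smul_sub, smul_smul, h₅, h₄, h₂, h₃, one_smul]
    convert map_zero (mappingCone.inr (barAug M) hj) using 2
    abel

end BarAug

/-- The bar resolution turns relative quasi-isomorphisms into homotopy equivalences that are
compatible with the right action. -/
lemma IsRelQuasiIso.isHtpyEquiv_barHom {M N : DGMod k A n} {φ : Hom M N} (H : IsRelQuasiIso φ) :
    IsHtpyEquiv .right (barHom φ) := by
  obtain ⟨g, h, h', gd, ge, he, he', H₁, H₂⟩ := H
  have E : ∀ {P Q : DGMod k A n} (u : ∀ i j, P.X i →ₗ[k] Q.X j) {c : ℤ}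
      (hu : ∀ i i' x, u i' (i' + c) (P.e i i' x) = Q.e (i + c) (i' + c) (u i (i + c) x)),
      ∀ i j i' j', i + c = j → i' + c = j' → i + n = i' → j + n = j' → ∀ x,
        u i' j' (P.e i i' x) = Q.e j j' (u i j x) := by
    rintro P Q u c hu i j i' j' rfl rfl hi hj x
    exact hu i i' x
  have Eg : ∀ i j i' j' h h', i + n = i' → j + n = j' → ∀ x,
      degZero g i' j' h' (N.e i i' x) = M.e j j' (degZero g i j h x) := by
    intro i j i' j' hij hij' hi hj x
    obtain rfl : i = j := by omega
    obtain rfl : i' = j' := by omega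
    exact ge _ _ x
  let Bg := fun l => barMap (degZero g) l l
  let Bh := barMap (c := 1) fun i j _ => h i j
  let Bh' := barMap (c := 1) fun i j _ => h' i j
  -- The data g, h, h' are applied to x in x ⊗ y, so right linearity holds automatically, but they
  -- do not commute with β since they are not right linear on M. Every error that is due to this
  -- contains β and has smaller bar length, whence the strong induction on q.
  have key : ∀ q : ℕ,
      (∀ (l i : ℤ) (h : i + q = l) x (y : T k A q),
        mappingCone.inl (barHom φ) l (bt N h x y) ∈ coneGen (barHom φ) Bg Bh Bh' l) ∧
      ∀ (l i j : ℤ) (hj : j + 1 = l) (h : i + q = j) x (y : T k A q),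
        mappingCone.inr (barHom φ) hj (bt M h x y) ∈ coneGen (barHom φ) Bg Bh Bh' l := by
    intro q
    induction q using Nat.strong_induction_on with
    | _ q ih =>
      -- Target elements of length q depend only on elements of smaller length. Source elements of
      -- length q also depend on target elements of the same length, so they come second.
      have first : ∀ (l i : ℤ) (h : i + q = l) x (y : T k A q),
          mappingCone.inl (barHom φ) l (bt N h x y) ∈ coneGen (barHom φ) Bg Bh Bh' l := by
        intro l i hi x y
        have hl : l - 1 + 1 = l := by omega
        refine inl_mem_coneGen hl rfl ?_
        rw [barMap_bt _ hi rfl (show i + 1 + q = l + 1 by omega),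
          barRes_d_bt (i' := i) rfl _ hi (by omega),
          barRes_d_bt (i' := i - 1) hl hi (by omega) (by omega), map_add, map_zsmul,
          barMap_bt _ _ (show i - 1 + 1 = i by omega) hi,
          barMap_bt _ hi (add_zero i) hi, barHom_bt, map_add, map_zsmul,
          barMap_bt _ _ (add_zero (i - 1)) (show i - 1 + q = l - 1 by omega),
          barRes_d_bt (i' := i - 1) hl hi (by omega) (by omega)]
        have e := congrArg (fun z => bt N hi z y) (H₂ i x)
        simp only [map_sub, map_add, LinearMap.sub_apply, LinearMap.add_apply] at e
        rw [sub_eq_iff_eq_add] at e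
        rw [degZero_apply, e]
        -- After the homotopy identity for x has been used, the error is a combination of β (h' x ⊗
        -- y), h' β (x ⊗ y), g β (x ⊗ y) and β (g x ⊗ y), with h' and g acting on the first factor.
        have m₁ : mappingCone.inl (barHom φ) l (bb N (show i + 1 + q = l + 1 by omega)
            (h' i (i + 1) x) y) ∈ coneGen (barHom φ) Bg Bh Bh' l :=
          bb_mem _ _ (mappingCone.inl (barHom φ) l) (fun r hr x y hrq => (ih r hrq).1 _ _ hr x y) _ _
        have m₂ : mappingCone.inl (barHom φ) l (Bh' (l - 1) l (bb N (show i + q = l - 1 + 1 by omega)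
            x y)) ∈ coneGen (barHom φ) Bg Bh Bh' l :=
          bb_mem _ _ (mappingCone.inl (barHom φ) l ∘ₗ Bh' (l - 1) l) (fun r hr x y hrq => by
            rw [LinearMap.comp_apply, barMap_bt _ hr rfl (show i + 1 + r = l by omega)]
            exact (ih r hrq).1 _ _ _ _ y) _ _
        have m₃ : mappingCone.inr (barHom φ) hl (Bg (l - 1) (bb N (show i + q = l - 1 + 1 by omega)
            x y)) ∈ coneGen (barHom φ) Bg Bh Bh' l :=
          bb_mem _ _ (mappingCone.inr (barHom φ) hl ∘ₗ Bg (l - 1)) (fun r hr x y hrq => by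
            rw [LinearMap.comp_apply, barMap_bt _ hr (add_zero i) hr]
            exact (ih r hrq).2 _ _ _ _ _ _ y) _ _
        have m₄ : mappingCone.inr (barHom φ) hl (bb M (show i + q = l - 1 + 1 by omega)
            (g i x) y) ∈ coneGen (barHom φ) Bg Bh Bh' l :=
          bb_mem _ _ (mappingCone.inr (barHom φ) hl) (fun r hr x y hrq => (ih r hrq).2 _ _ _ _ hr x y)
            _ _
        refine Submodule.add_mem _ ?_ ?_
        · convert Submodule.add_mem _ (zsmul_mem m₁ ((i + 1).negOnePow : ℤ))
            (zsmul_mem m₂ (i.negOnePow : ℤ)) using 1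
          simp only [map_add, map_sub, map_zsmul]
          abel
        · convert Submodule.sub_mem _ (zsmul_mem m₃ (i.negOnePow : ℤ))
            (zsmul_mem m₄ (i.negOnePow : ℤ)) using 1
          rw [degZero_apply, gd]
          simp only [map_add, map_sub, map_zsmul]
          abel
      refine ⟨first, fun l i j hj hi x y => ?_⟩
      have hj' : j - 1 + 1 = j := by omega
      refine inr_mem_coneGen hj' hj ?_
      rw [barHom_bt, barMap_bt _ hi rfl (show i + 1 + q = l by omega),
        barMap_bt _ hi rfl (show i + 1 + q = l by omega), barHom_bt,
        barMap_bt _ hi (add_zero i) hi, barRes_d_bt (i' := i) hj _ hi (by omega),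
        barRes_d_bt (i' := i - 1) hj' hi (by omega) (by omega), map_add, map_zsmul,
        barMap_bt _ _ (show i - 1 + 1 = i by omega) hi]
      have e := congrArg (fun z => bt M hi z y) (H₁ i x)
      simp only [map_sub, map_add, LinearMap.sub_apply, LinearMap.add_apply] at e
      rw [sub_eq_iff_eq_add] at e
      rw [degZero_apply, e]
      refine Submodule.add_mem _ ?_ ?_
      -- The entry h' φ x ⊗ y - φ h x ⊗ y still has length q, but it lies in the target summand.
      · rw [map_sub]
        exact Submodule.sub_mem _ (first _ _ _ _ _) (first _ _ _ _ _)
      have m₁ : mappingCone.inr (barHom φ) hj (bb M (show i + 1 + q = j + 1 by omega)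
          (h i (i + 1) x) y) ∈ coneGen (barHom φ) Bg Bh Bh' l :=
        bb_mem _ _ (mappingCone.inr (barHom φ) hj) (fun r hr x y hrq => (ih r hrq).2 _ _ _ _ hr x y)
          _ _
      have m₂ : mappingCone.inr (barHom φ) hj (Bh (j - 1) j (bb M (show i + q = j - 1 + 1 by omega)
          x y)) ∈ coneGen (barHom φ) Bg Bh Bh' l :=
        bb_mem _ _ (mappingCone.inr (barHom φ) hj ∘ₗ Bh (j - 1) j) (fun r hr x y hrq => by
          rw [LinearMap.comp_apply, barMap_bt _ hr rfl (show i + 1 + r = j by omega)]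
          exact (ih r hrq).2 _ _ _ _ _ _ y) _ _
      convert Submodule.add_mem _ (zsmul_mem m₁ ((i + 1).negOnePow : ℤ))
        (zsmul_mem m₂ (i.negOnePow : ℤ)) using 1
      simp only [map_add, map_sub, map_zsmul]
      abel
  refine isHtpyEquiv_of_coneGen (g := Bg) (h := Bh) (h' := Bh')
    (fun i => isRight_barMap _ _ _) (fun i j => isRight_barMap _ _ _)
    (fun i j => isRight_barMap _ _ _) (fun i j hj x => barMap_e Eg (add_zero i) (add_zero j) hj x)
    (fun i j i' j' hj hi hj' x => barMap_e (E h he) hj (by omega) hi x)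
    (fun i j i' j' hj hi hj' x => barMap_e (E h' he') hj (by omega) hi x)
    (fun l y => bar_mem _ (mappingCone.inl (barHom φ) l) (fun i q hi x y => (key q).1 l i hi x y) y)
    (fun j l hj x => bar_mem _ (mappingCone.inr (barHom φ) hj)
      (fun i q hi x y => (key q).2 l i j hj hi x y) x)

end DGMod

end

end SingDef

namespace SingDef

section

variable {k : Type v} {A : Type u} [CommRing k] [Ring A] [Algebra k A]

/-! ### Splittings of the right action -/

/-- The right action as a linear map on `M ⊗ A`. -/
def Bimod.ract (M : Bimod k A) : M ⊗[k] T k A 0 →ₗ[k] M :=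
  TensorProduct.lift (show M →ₗ[k] T k A 0 →ₗ[k] M from M.rmul.flip)

lemma Bimod.ract_tmul (M : Bimod k A) (x : M) (a : T k A 0) :
    M.ract (x ⊗ₜ a) = op (toA a) • x := TensorProduct.lift.tmul x a

/-- A right linear splitting of the right action `M ⊗ A → M`. -/
structure Bimod.Splitting (M : Bimod k A) where
  σ : M →ₗ[k] M ⊗[k] T k A 0
  σ_op_smul : ∀ (a : A) x, σ (op a • x) = rightEnd M (T k A 0) (op a) (σ x)
  ract_σ : ∀ x, M.ract (σ x) = x

lemma rTensor_rightEnd {M N : Bimod k A} (φ : M →ₗ[k] N) (a : Aᵐᵒᵖ) (w : M ⊗[k] T k A 0) :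
    LinearMap.rTensor (T k A 0) φ (rightEnd M (T k A 0) a w) =
      rightEnd N (T k A 0) a (LinearMap.rTensor (T k A 0) φ w) :=
  LinearMap.congr_fun (f := LinearMap.rTensor (T k A 0) φ ∘ₗ rightEnd M (T k A 0) a)
    (g := rightEnd N (T k A 0) a ∘ₗ LinearMap.rTensor (T k A 0) φ)
    (TensorProduct.ext' fun _ _ => rfl) w

lemma ract_rTensor {M N : Bimod k A} {φ : M →ₗ[k] N} (h : IsRight φ) (w : M ⊗[k] T k A 0) :
    N.ract (LinearMap.rTensor (T k A 0) φ w) = φ (M.ract w) :=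
  LinearMap.congr_fun (f := N.ract ∘ₗ LinearMap.rTensor (T k A 0) φ) (g := φ ∘ₗ M.ract)
    (TensorProduct.ext' fun x a => (h (toA a) x).symm) w

/-- The map `c₀ ⊗ ⋯ ⊗ c_q ↦ (c₀ ⊗ ⋯ ⊗ c_{q-1} ⊗ 1) ⊗ c_q`. -/
def sigmaT : ∀ q : ℕ, T k A q →ₗ[k] T k A q ⊗[k] T k A 0
  | 0 => TensorProduct.mk k (T k A 0) (T k A 0) (oneT k A)
  | q + 1 => liftT ((LinearMap.rTensorHom (T k A 0) ∘ₗ consT q).compl₂ (sigmaT q))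

lemma sigmaT_consT (q : ℕ) (a : A) (y : T k A q) :
    sigmaT (q + 1) (consT q a y) = LinearMap.rTensor (T k A 0) (consT q a) (sigmaT q y) :=
  liftT_consT _ a y

lemma sigmaT_op_smul : ∀ (q : ℕ) (a : A) (y : T k A q),
    sigmaT q (op a • y) = rightEnd (T k A q) (T k A 0) (op a) (sigmaT q y)
  | 0, a, y => rfl
  | q + 1, a, y => by
      refine consT_induction y ?_ (fun y y' hy hy' => ?_) fun c y => ?_
      · simp only [smul_zero, map_zero]
      · simp only [smul_add, map_add, hy, hy']
      · rw [op_smul_consT, sigmaT_consT, sigmaT_consT, sigmaT_op_smul]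
        exact LinearMap.congr_fun (f := LinearMap.rTensor (T k A 0) (consT q c) ∘ₗ
            rightEnd (T k A q) (T k A 0) (op a))
          (g := rightEnd (T k A (q + 1)) (T k A 0) (op a) ∘ₗ
            LinearMap.rTensor (T k A 0) (consT q c))
          (TensorProduct.ext' fun _ _ => rfl) (sigmaT q y)

lemma ract_sigmaT : ∀ (q : ℕ) (y : T k A q), (T k A q).ract (sigmaT q y) = y
  | 0, y => one_mul (show A from y)
  | q + 1, y => by
      refine consT_induction y ?_ (fun y y' hy hy' => ?_) fun c y => ?_
      · simp only [map_zero]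
      · simp only [map_add, hy, hy']
      · rw [sigmaT_consT]
        nth_rewrite 2 [← ract_sigmaT q y]
        exact LinearMap.congr_fun
          (f := (T k A (q + 1)).ract ∘ₗ LinearMap.rTensor (T k A 0) (consT q c))
          (g := consT q c ∘ₗ (T k A q).ract) (TensorProduct.ext' fun _ _ => rfl) (sigmaT q y)

namespace DGMod

variable {n : ℤ}

/-- A splitting of the right action that is compatible with `ε`, and that is compatible with the
differential up to terms that lower an exhaustive filtration. -/
structure FilteredSplitting (M : DGMod k A n) where
  s : ∀ i, (M.X i).Splitting
  σ_e : ∀ i j x, (s j).σ (M.e i j x) = LinearMap.rTensor (T k A 0) (M.e i j) ((s i).σ x)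
  fil : ℕ → ∀ i, Submodule k (M.X i)
  fil_zero : ∀ i, ∀ x ∈ fil 0 i, x = 0
  exhaustive : ∀ i x, ∃ r, x ∈ fil r i
  σ_d : ∀ r i j, j + 1 = i → ∀ x ∈ fil (r + 1) i,
    (s j).σ (M.d i j x) - LinearMap.rTensor (T k A 0) (M.d i j) ((s i).σ x) ∈
      Submodule.span k {w | ∃ x ∈ fil r j, ∃ a, w = x ⊗ₜ a}

section Bar

variable (M : DGMod k A n)

/-- The map `(x ⊗ a) ⊗ y ↦ x ⊗ (a ⊗ y)`. -/
def barCons {l i : ℤ} {q : ℕ} (h : i + (q + 1 : ℕ) = l) :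
    M.X i ⊗[k] T k A 0 →ₗ[k] T k A q →ₗ[k] (barRes M).X l :=
  TensorProduct.lift ((LinearMap.llcomp k (T k A q) (T k A (q + 1)) ((barRes M).X l) ∘ₗ
    bt M h).compl₂ (consT q ∘ₗ toA))

/-- The map `(x ⊗ a) ⊗ y ↦ β (x ⊗ (a ⊗ y))`. -/
def bbCons {l i : ℤ} {q : ℕ} (h : i + (q + 1 : ℕ) = l + 1) :
    M.X i ⊗[k] T k A 0 →ₗ[k] T k A q →ₗ[k] (barRes M).X l :=
  TensorProduct.lift ((LinearMap.llcomp k (T k A q) (T k A (q + 1)) ((barRes M).X l) ∘ₗ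
    bb M h).compl₂ (consT q ∘ₗ toA))

/-- The map `x ⊗ a ↦ x ⊗ a`. -/
def barTens (l : ℤ) : M.X l ⊗[k] T k A 0 →ₗ[k] (barRes M).X l :=
  TensorProduct.lift (bt M (show l + (0 : ℕ) = l by simp))

variable {M}

lemma barCons_tmul {l i : ℤ} {q : ℕ} (h : i + (q + 1 : ℕ) = l) (x : M.X i) (a : T k A 0)
    (y : T k A q) : barCons M h (x ⊗ₜ a) y = bt M h x (consT q (toA a) y) :=
  LinearMap.congr_fun (TensorProduct.lift.tmul x a) y

lemma bbCons_tmul {l i : ℤ} {q : ℕ} (h : i + (q + 1 : ℕ) = l + 1) (x : M.X i) (a : T k A 0)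
    (y : T k A q) : bbCons M h (x ⊗ₜ a) y = bb M h x (consT q (toA a) y) :=
  LinearMap.congr_fun (TensorProduct.lift.tmul x a) y

lemma barTens_tmul {l : ℤ} (h : l + (0 : ℕ) = l) (x : M.X l) (a : T k A 0) :
    barTens M l (x ⊗ₜ a) = bt M h x a :=
  TensorProduct.lift.tmul x a

/-- Linear maps on `M_i ⊗ A` that agree on pure tensors are equal. -/
lemma tmul_congr {M N Z : Type*} [AddCommGroup M] [Module k M] [AddCommGroup N] [Module k N]
    [AddCommGroup Z] [Module k Z] (F G : M ⊗[k] N →ₗ[k] Z) (H : ∀ x y, F (x ⊗ₜ y) = G (x ⊗ₜ y))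
    (w : M ⊗[k] N) : F w = G w := LinearMap.congr_fun (TensorProduct.ext' H) w

lemma e_barTens {l l' : ℤ} (hl : l + n = l') (w : M.X l ⊗[k] T k A 0) :
    (barRes M).e l l' (barTens M l w) =
      barTens M l' (LinearMap.rTensor (T k A 0) (M.e l l') w) :=
  tmul_congr ((barRes M).e l l' ∘ₗ barTens M l)
    (barTens M l' ∘ₗ LinearMap.rTensor (T k A 0) (M.e l l')) (fun x a => by
      rw [LinearMap.comp_apply, LinearMap.comp_apply, LinearMap.rTensor_tmul,
        barTens_tmul (by simp), barTens_tmul (by simp),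
        barRes_e_bt hl _ (show l' + (0 : ℕ) = l' by simp)]
      simp) w

lemma barAug_barTens {l : ℤ} (w : M.X l ⊗[k] T k A 0) :
    (barAug M).f l (barTens M l w) = (M.X l).ract w :=
  tmul_congr ((barAug M).f l ∘ₗ barTens M l) (M.X l).ract (fun x a => by
    rw [LinearMap.comp_apply, barTens_tmul (by simp), barAug_zero, Bimod.ract_tmul]) w

lemma barTens_rightEnd {l : ℤ} (a : A) (w : M.X l ⊗[k] T k A 0) :
    barTens M l (rightEnd (M.X l) (T k A 0) (op a) w) = op a • barTens M l w :=
  tmul_congr (barTens M l ∘ₗ rightEnd (M.X l) (T k A 0) (op a))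
    (Algebra.lsmul k k ((barRes M).X l) (op a) ∘ₗ barTens M l) (fun x b => by
      rw [LinearMap.comp_apply, LinearMap.comp_apply, rightEnd_tmul, Algebra.lsmul_coe,
        barTens_tmul (by simp), barTens_tmul (by simp)]
      exact (op_smul_bt _ a x b).symm) w

lemma d_barCons {l l' i i' : ℤ} {q : ℕ} (hl : l' + 1 = l) (h : i + (q + 1 : ℕ) = l)
    (h' : i' + (q + 1 : ℕ) = l') (h'' : i + (q + 1 : ℕ) = l' + 1) (w : M.X i ⊗[k] T k A 0)
    (y : T k A q) : (barRes M).d l l' (barCons M h w y) =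
      barCons M h' (LinearMap.rTensor (T k A 0) (M.d i i') w) y +
        (i.negOnePow : ℤ) • bbCons M h'' w y :=
  tmul_congr ((barRes M).d l l' ∘ₗ (barCons M h).flip y)
    ((barCons M h').flip y ∘ₗ LinearMap.rTensor (T k A 0) (M.d i i') +
      (i.negOnePow : ℤ) • (bbCons M h'').flip y) (fun x a => by
        simp only [LinearMap.comp_apply, LinearMap.add_apply, LinearMap.smul_apply,
          LinearMap.rTensor_tmul, LinearMap.flip_apply]
        rw [barCons_tmul, barCons_tmul, bbCons_tmul, barRes_d_bt hl h h' h'']) w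

lemma e_barCons {l l' i i' : ℤ} {q : ℕ} (hl : l + n = l') (h : i + (q + 1 : ℕ) = l)
    (h' : i' + (q + 1 : ℕ) = l') (w : M.X i ⊗[k] T k A 0)
    (y : T k A q) : (barRes M).e l l' (barCons M h w y) =
      ((n * (q + 1 : ℕ)).negOnePow : ℤ) •
        barCons M h' (LinearMap.rTensor (T k A 0) (M.e i i') w) y :=
  tmul_congr ((barRes M).e l l' ∘ₗ (barCons M h).flip y)
    (((n * (q + 1 : ℕ)).negOnePow : ℤ) •
      (barCons M h').flip y ∘ₗ LinearMap.rTensor (T k A 0) (M.e i i')) (fun x a => by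
        simp only [LinearMap.comp_apply, LinearMap.smul_apply,
          LinearMap.rTensor_tmul, LinearMap.flip_apply]
        rw [barCons_tmul, barCons_tmul, barRes_e_bt hl h h']) w

lemma barAug_barCons {l i : ℤ} {q : ℕ} (h : i + (q + 1 : ℕ) = l) (w : M.X i ⊗[k] T k A 0)
    (y : T k A q) : (barAug M).f l (barCons M h w y) = 0 :=
  tmul_congr ((barAug M).f l ∘ₗ (barCons M h).flip y) 0 (fun x a => by
    rw [LinearMap.comp_apply, LinearMap.flip_apply, barCons_tmul, barAug_succ,
      LinearMap.zero_apply]) w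

lemma barCons_op_smul {l i : ℤ} {q : ℕ} (h : i + (q + 1 : ℕ) = l) (w : M.X i ⊗[k] T k A 0)
    (a : A) (y : T k A q) : barCons M h w (op a • y) = op a • barCons M h w y :=
  tmul_congr ((barCons M h).flip (op a • y))
    (Algebra.lsmul k k ((barRes M).X l) (op a) ∘ₗ (barCons M h).flip y) (fun x b => by
      rw [LinearMap.comp_apply, LinearMap.flip_apply, LinearMap.flip_apply, Algebra.lsmul_coe,
        barCons_tmul, barCons_tmul, ← op_smul_consT]
      exact (op_smul_bt _ a x _).symm) w

/-- The face that multiplies into M is the action `ract`. For w = σ x it gives back x, which is how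
the splitting enters the contraction. -/
lemma bbCons_zero {l : ℤ} (h : l + (0 + 1 : ℕ) = l + 1) (h' : l + (0 : ℕ) = l)
    (w : M.X l ⊗[k] T k A 0) (y : T k A 0) :
    bbCons M h w y = bt M h' ((M.X l).ract w) y -
      barTens M l (rightEnd (M.X l) (T k A 0) (op (toA y)) w) :=
  tmul_congr ((bbCons M h).flip y) ((bt M h').flip y ∘ₗ (M.X l).ract -
    barTens M l ∘ₗ rightEnd (M.X l) (T k A 0) (op (toA y))) (fun x a => by
      rw [LinearMap.sub_apply, LinearMap.comp_apply, LinearMap.comp_apply, LinearMap.flip_apply,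
        LinearMap.flip_apply, rightEnd_tmul, bbCons_tmul, barTens_tmul h', bb_succ h h', dT_zero,
        Bimod.ract_tmul]
      rfl) w

/-- Besides the action into M there is the face that multiplies the last factor of w by a, which
right linear splittings respect, and there are the faces of the tail. -/
lemma bbCons_succ {l i : ℤ} {q : ℕ} (h : i + (q + 1 + 1 : ℕ) = l + 1) (h' : i + (q + 1 : ℕ) = l)
    (w : M.X i ⊗[k] T k A 0) (a : A) (y : T k A q) :
    bbCons M h w (consT q a y) = bt M h' ((M.X i).ract w) (consT q a y) -
      barCons M h' (rightEnd (M.X i) (T k A 0) (op a) w) y +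
      barCons M h' w (dT k A q (consT q a y)) :=
  tmul_congr ((bbCons M h).flip (consT q a y)) ((bt M h').flip (consT q a y) ∘ₗ (M.X i).ract -
    (barCons M h').flip y ∘ₗ rightEnd (M.X i) (T k A 0) (op a) +
      (barCons M h').flip (dT k A q (consT q a y))) (fun x b => by
      simp only [LinearMap.add_apply, LinearMap.sub_apply, LinearMap.comp_apply,
        LinearMap.flip_apply]
      rw [rightEnd_tmul, bbCons_tmul, barCons_tmul, barCons_tmul, bb_succ h h', dT_cons,
        Bimod.ract_tmul, map_sub, smul_consT, sub_sub_eq_add_sub, add_sub_right_comm]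
      rfl) w

end Bar

/-- The augmentation of the bar resolution of a differential graded module with a filtered splitting
is a homotopy equivalence that is compatible with the right action. -/
lemma FilteredSplitting.isHtpyEquiv_barAug {M : DGMod k A n} (S : FilteredSplitting M) :
    IsHtpyEquiv .right (barAug M) := by
  let σ := fun i => (S.s i).σ
  -- The section σ gives a map from M to the part M ⊗ A of bar length zero. In positive length the
  -- homotopy inserts a factor through σ directly after x: it is an extra degeneracy that is right
  -- linear.
  let g : ∀ l, M.X l →ₗ[k] (barRes M).X l := fun l => barTens M l ∘ₗ σ l
  let h : ∀ l l', (barRes M).X l →ₗ[k] (barRes M).X l' := fun l l' =>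
    if hl : l + 1 = l' then bLift fun i q hi => (i.negOnePow : ℤ) •
      (barCons M (show i + (q + 1 : ℕ) = l' by push_cast; omega) ∘ₗ σ i) else 0
  have h_bt : ∀ {l l' i : ℤ} {q : ℕ} (hi : i + q = l) (hi' : i + (q + 1 : ℕ) = l') x (y : T k A q),
      h l l' (bt M hi x y) = (i.negOnePow : ℤ) • barCons M hi' (σ i x) y := by
    intro l l' i q hi hi' x y
    simp only [h]
    rw [dif_pos (show l + 1 = l' by push_cast at hi'; omega)]
    exact bLift_bt _ hi x y
  have sq : ∀ i : ℤ, (i.negOnePow : ℤ) * (i.negOnePow : ℤ) = 1 := fun i => by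
    rw [← Units.val_mul, Int.units_mul_self, Units.val_one]
  -- In the direction of the bar length the contraction is exact, by ract ∘ σ = 1 and the right
  -- linearity of σ. The only error of h comes from σ not commuting with the differential of M.
  have key : ∀ {l i j : ℤ} {q : ℕ} (hj : j + 1 = l) (hi : i + q = l) (hi' : i + q = j + 1)
      (hi'' : i + (q + 1 : ℕ) = l + 1) x (y : T k A q),
      bbCons M hi'' (σ i x) y + (i.negOnePow : ℤ) • h j l (bb M hi' x y) +
        g l ((barAug M).f l (bt M hi x y)) = bt M hi x y := by
    intro l i j q hj hi hi' hi'' x y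
    cases q with
    | zero =>
      obtain rfl : i = l := by simpa using hi
      rw [bb_zero, map_zero, smul_zero, bbCons_zero hi'' hi, barAug_zero]
      simp only [g, LinearMap.comp_apply, σ]
      rw [(S.s i).σ_op_smul, (S.s i).ract_σ]
      exact (add_right_comm _ (0 : (barRes M).X i) _).trans (by
        rw [add_zero (_ + _ : (barRes M).X i), sub_add_cancel])
    | succ q =>
      have hq : i + q = j := by push_cast at hi; omega
      rw [barAug_succ, map_zero, add_zero]
      refine consT_induction y ?_ (fun y y' hy hy' => ?_) fun a y => ?_
      · simp only [map_zero, smul_zero, add_zero]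
      · simp only [map_add, smul_add]
        rw [← hy, ← hy']
        abel
      · rw [bb_succ hi' hq, map_sub, h_bt hq hi, h_bt hq hi, bbCons_succ hi'' hi, smul_sub,
          smul_smul, smul_smul, sq, one_smul, one_smul]
        simp only [σ]
        rw [(S.s i).σ_op_smul, (S.s i).ract_σ]
        abel
  -- The induction is on the filtration step of x, and the bar length is arbitrary. For x in step r
  -- + 1 the error is built from σ d x - (d ⊗ 1) σ x, which lies in the span of step r tensored with
  -- A.
  have inr_mem : ∀ r {l i j : ℤ} {q : ℕ} (hj : j + 1 = l) (hi : i + q = j), ∀ x ∈ S.fil r i,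
      ∀ y : T k A q, mappingCone.inr (barAug M) hj (bt M hi x y) ∈
        coneGen (barAug M) g h (fun _ _ => 0) l := by
    intro r
    induction r with
    | zero =>
      intro l i j q hj hi x hx y
      rw [S.fil_zero i x hx, map_zero, LinearMap.zero_apply, map_zero]
      exact Submodule.zero_mem _
    | succ r ih =>
      intro l i j q hj hi x hx y
      have hj' : j - 1 + 1 = j := by omega
      have hi₁ : i + (q + 1 : ℕ) = j + 1 := by push_cast; omega
      refine inr_mem_coneGen hj' hj ?_
      rw [h_bt hi (show i + (q + 1 : ℕ) = l by push_cast; omega), map_zsmul, barAug_barCons,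
        smul_zero, LinearMap.zero_apply, sub_zero, map_zero, zero_add, map_zsmul,
        d_barCons hj _ (show i - 1 + (q + 1 : ℕ) = j by push_cast; omega) hi₁,
        barRes_d_bt hj' hi (show i - 1 + q = j - 1 by omega) (by omega), map_add, map_zsmul,
        h_bt _ (show i - 1 + (q + 1 : ℕ) = j by push_cast; omega), smul_add, smul_smul, sq, one_smul,
        Int.negOnePow_sub, Int.negOnePow_one, mul_neg_one, Units.val_neg, neg_smul]
      have e := key hj' hi (by omega) hi₁ x y
      have m : ∀ w ∈ Submodule.span k {w | ∃ x ∈ S.fil r (i - 1), ∃ a : T k A 0, w = x ⊗ₜ[k] a},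
          mappingCone.inr (barAug M) hj (barCons M
            (show i - 1 + (q + 1 : ℕ) = j by push_cast; omega) w y) ∈
              coneGen (barAug M) g h (fun _ _ => 0) l := by
        intro w hw
        suffices hle : Submodule.span k
            {w | ∃ x ∈ S.fil r (i - 1), ∃ a : T k A 0, w = x ⊗ₜ[k] a} ≤
            (coneGen (barAug M) g h (fun _ _ => 0) l).comap (mappingCone.inr (barAug M) hj ∘ₗ
              (barCons M (show i - 1 + (q + 1 : ℕ) = j by push_cast; omega)).flip y) from hle hw
        refine Submodule.span_le.2 ?_
        rintro _ ⟨x', hx', a, rfl⟩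
        rw [SetLike.mem_coe, Submodule.mem_comap, LinearMap.comp_apply, LinearMap.flip_apply,
          barCons_tmul]
        exact ih _ _ _ hx' _
      convert zsmul_mem (m _ (S.σ_d r i (i - 1) (by omega) x hx)) (-(i.negOnePow : ℤ)) using 1
      nth_rewrite 2 [← e]
      simp only [map_add, map_sub, map_zsmul, map_neg, LinearMap.sub_apply, neg_smul, smul_sub]
      abel
  have inr_all : ∀ {j l : ℤ} (hj : j + 1 = l) z, mappingCone.inr (barAug M) hj z ∈
        coneGen (barAug M) g h (fun _ _ => 0) l := fun hj z =>
    bar_mem _ (mappingCone.inr (barAug M) hj) (fun i q hi x y => by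
      obtain ⟨r, hr⟩ := S.exhaustive i x
      exact inr_mem r hj hi x hr y) z
  refine isHtpyEquiv_of_coneGen (g := g) (h := h) (h' := fun _ _ => 0) (fun l => ?_)
    (fun l l' => ?_) (fun _ _ => Side.lin_zero _) (fun i j hj x => ?_)
    (fun i j i' j' hj hi hj' z => ?_) (fun _ _ _ _ _ _ _ _ => ?_) (fun l y => ?_)
    (fun j l hj z => inr_all hj z)
  · intro a x
    simp only [g, LinearMap.comp_apply, σ]
    rw [(S.s l).σ_op_smul, barTens_rightEnd]
  · by_cases hl : l + 1 = l'
    · refine isRight_of_bt fun i q hi a x y => ?_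
      have hi' : i + (q + 1 : ℕ) = l' := by push_cast; omega
      rw [h_bt hi hi', h_bt hi hi', barCons_op_smul, smul_comm]
    · simp only [h, dif_neg hl]
      exact Side.lin_zero _
  · simp only [g, LinearMap.comp_apply, σ]
    rw [S.σ_e, e_barTens hj]
  · refine bar_congr (h i' j' ∘ₗ (barRes M).e i i') ((barRes M).e j j' ∘ₗ h i j)
      (fun r q hr x y => ?_) z
    have h₁ : r + n + (q + 1 : ℕ) = j' := by push_cast; omega
    rw [LinearMap.comp_apply, LinearMap.comp_apply, barRes_e_bt hi hr (show r + n + q = i' by omega),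
      map_zsmul, h_bt _ h₁, h_bt hr (show r + (q + 1 : ℕ) = j by push_cast; omega), map_zsmul,
      e_barCons hj' _ h₁, smul_smul, smul_smul]
    simp only [σ]
    rw [S.σ_e, ← Units.val_mul, ← Units.val_mul, ← Int.negOnePow_add, ← Int.negOnePow_add]
    congr 2
    rw [Int.negOnePow_eq_iff]
    exact ⟨0, by push_cast; ring⟩
  · simp
  · have hl : l - 1 + 1 = l := by omega
    refine inl_mem_coneGen hl rfl ?_
    simp only [g, LinearMap.comp_apply, LinearMap.zero_apply, map_zero, zero_add]
    rw [barAug_barTens]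
    simp only [σ]
    rw [(S.s l).ract_σ, sub_self, map_zero, zero_add]
    -- As ract ∘ σ = 1, the target entry of the error is zero, and g d y - d g y lies in the source
    -- summand, where everything is already known.
    exact inr_all hl _

end DGMod

end

end SingDef

/-! ### Filtered splittings of bar resolutions and of cones -/

namespace SingDef

section

variable {k : Type v} {A : Type u} [CommRing k] [Ring A] [Algebra k A]

namespace DGMod

variable {n : ℤ}

section BarSplitting

variable (M : DGMod k A n)

/-- The map `x ⊗ y ↦ x ⊗ σ y`. -/
def barSigma (l : ℤ) : (barRes M).X l →ₗ[k] (barRes M).X l ⊗[k] T k A 0 :=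
  bLift fun _ q h => (LinearMap.rTensorHom (T k A 0) ∘ₗ bt M h).compl₂ (sigmaT q)

variable {M} in
lemma barSigma_bt {l i : ℤ} {q : ℕ} (h : i + q = l) (x : M.X i) (y : T k A q) :
    barSigma M l (bt M h x y) = LinearMap.rTensor (T k A 0) (bt M h x) (sigmaT q y) :=
  bLift_bt _ h x y

/-- The splitting of the right action on the bar resolution. -/
def barSplitting (l : ℤ) : ((barRes M).X l).Splitting where
  σ := barSigma M l
  σ_op_smul a z := bar_congr (barSigma M l ∘ₗ Algebra.lsmul k k ((barRes M).X l) (op a))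
    (rightEnd ((barRes M).X l) (T k A 0) (op a) ∘ₗ barSigma M l) (fun i q h x y => by
      rw [LinearMap.comp_apply, LinearMap.comp_apply, barSigma_bt, Algebra.lsmul_coe]
      refine (congrArg _ (op_smul_bt h a x y)).trans ?_
      rw [barSigma_bt, sigmaT_op_smul]
      exact tmul_congr (LinearMap.rTensor (T k A 0) (bt M h x) ∘ₗ
        rightEnd (T k A q) (T k A 0) (op a)) (rightEnd ((barRes M).X l) (T k A 0) (op a) ∘ₗ
        LinearMap.rTensor (T k A 0) (bt M h x)) (fun _ _ => rfl) _) z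
  ract_σ z := bar_congr (((barRes M).X l).ract ∘ₗ barSigma M l) LinearMap.id
    (fun i q h x y => by
      rw [LinearMap.comp_apply, barSigma_bt, ract_rTensor, ract_sigmaT, LinearMap.id_apply]
      exact fun a y => (op_smul_bt h a x y).symm) z

/-- The filtration of the bar resolution by the rank. -/
def barFil (r : ℕ) (l : ℤ) : Submodule k ((barRes M).X l) :=
  Submodule.span k {z | ∃ (i : ℤ) (q : ℕ) (h : i + q = l) (x : M.X i) (y : T k A q), q < r ∧
    z = bt M h x y}

variable {M}

lemma bt_mem_barFil {r : ℕ} {l i : ℤ} {q : ℕ} (hq : q < r) (h : i + q = l) (x : M.X i)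
    (y : T k A q) : bt M h x y ∈ barFil M r l :=
  Submodule.subset_span ⟨i, q, h, x, y, hq, rfl⟩

lemma rTensor_mem_span {E F : Bimod k A} (S : Submodule k F) (φ : E →ₗ[k] F) (h : ∀ x, φ x ∈ S)
    (w : E ⊗[k] T k A 0) : LinearMap.rTensor (T k A 0) φ w ∈
      Submodule.span k {w | ∃ x ∈ S, ∃ a, w = x ⊗ₜ a} := by
  induction w with
  | zero => rw [map_zero]; exact Submodule.zero_mem _
  | add x y hx hy => rw [map_add]; exact Submodule.add_mem _ hx hy
  | tmul x a => exact Submodule.subset_span ⟨_, h x, a, rfl⟩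

variable (M) in
/-- The filtered splitting of the bar resolution. -/
def barFilteredSplitting : FilteredSplitting (barRes M) where
  s := barSplitting M
  σ_e l l' z := by
    by_cases hl : l + n = l'
    · refine bar_congr (barSigma M l' ∘ₗ (barRes M).e l l')
        (LinearMap.rTensor (T k A 0) ((barRes M).e l l') ∘ₗ barSigma M l) (fun i q h x y => ?_) z
      rw [LinearMap.comp_apply, LinearMap.comp_apply, barSigma_bt,
        barRes_e_bt hl h (show i + n + q = l' by omega), map_zsmul, barSigma_bt]
      refine tmul_congr (((n * q).negOnePow : ℤ) • LinearMap.rTensor (T k A 0)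
        (bt M (show i + n + q = l' by omega) (M.e i (i + n) x)))
        (LinearMap.rTensor (T k A 0) ((barRes M).e l l') ∘ₗ
          LinearMap.rTensor (T k A 0) (bt M h x)) (fun y a => ?_) _
      rw [LinearMap.smul_apply, LinearMap.comp_apply, LinearMap.rTensor_tmul,
        LinearMap.rTensor_tmul, LinearMap.rTensor_tmul,
        barRes_e_bt hl h (show i + n + q = l' by omega), TensorProduct.smul_tmul']
    · rw [(barRes M).e_shape _ _ hl, LinearMap.zero_apply, map_zero, LinearMap.rTensor_zero,
        LinearMap.zero_apply]
  fil := barFil M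
  fil_zero l z hz := by
    have : barFil M 0 l = ⊥ := by
      rw [barFil, Submodule.span_eq_bot]
      rintro _ ⟨i, q, h, x, y, hq, -⟩
      exact absurd hq q.not_lt_zero
    rwa [this, Submodule.mem_bot] at hz
  exhaustive l z := by
    have hz := bar_mem (⨆ r, barFil M r l) LinearMap.id (fun i q h x y =>
      Submodule.mem_iSup_of_mem (q + 1) (bt_mem_barFil q.lt_succ_self h x y)) z
    refine (Submodule.mem_iSup_of_directed _ (Monotone.directed_le fun r r' hr => ?_)).1 hz
    refine Submodule.span_mono ?_
    rintro _ ⟨i, q, h, x, y, hq, rfl⟩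
    exact ⟨i, q, h, x, y, hq.trans_le hr, rfl⟩
  -- The splitting acts on the last factor of y and so commutes with the differential of M. The
  -- discrepancy consists of terms with β, which lowers the bar length.
  σ_d r l l' hl z hz := by
    suffices hle : barFil M (r + 1) l ≤ (Submodule.span k {w | ∃ x ∈ barFil M r l', ∃ a : T k A 0,
        w = x ⊗ₜ[k] a}).comap (barSigma M l' ∘ₗ (barRes M).d l l' -
          LinearMap.rTensor (T k A 0) ((barRes M).d l l') ∘ₗ barSigma M l) from hle hz
    refine Submodule.span_le.2 ?_
    rintro _ ⟨i, q, h, x, y, hq, rfl⟩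
    have h₁ : i + q = l' + 1 := by omega
    rw [SetLike.mem_coe, Submodule.mem_comap, LinearMap.sub_apply, LinearMap.comp_apply,
      LinearMap.comp_apply, barRes_d_bt hl h (show i - 1 + q = l' by omega) h₁, map_add, map_zsmul,
      barSigma_bt, barSigma_bt]
    have e : LinearMap.rTensor (T k A 0) ((barRes M).d l l')
        (LinearMap.rTensor (T k A 0) (bt M h x) (sigmaT q y)) =
        LinearMap.rTensor (T k A 0) (bt M (show i - 1 + q = l' by omega) (M.d i (i - 1) x))
          (sigmaT q y) +
        (i.negOnePow : ℤ) • LinearMap.rTensor (T k A 0) (bb M h₁ x) (sigmaT q y) := by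
      refine tmul_congr (LinearMap.rTensor (T k A 0) ((barRes M).d l l') ∘ₗ
        LinearMap.rTensor (T k A 0) (bt M h x))
        (LinearMap.rTensor (T k A 0) (bt M (show i - 1 + q = l' by omega) (M.d i (i - 1) x)) +
          (i.negOnePow : ℤ) • LinearMap.rTensor (T k A 0) (bb M h₁ x)) (fun y a => ?_) _
      rw [LinearMap.add_apply, LinearMap.smul_apply, LinearMap.comp_apply, LinearMap.rTensor_tmul,
        LinearMap.rTensor_tmul, LinearMap.rTensor_tmul, LinearMap.rTensor_tmul,
        barRes_d_bt hl h (show i - 1 + q = l' by omega) h₁, TensorProduct.add_tmul,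
        TensorProduct.smul_tmul']
    rw [e, add_sub_add_left_eq_sub, ← smul_sub]
    refine zsmul_mem (Submodule.sub_mem _ ?_ ?_) _
    · refine bb_mem h₁ _ (barSigma M l') (fun s hs x y hsq => ?_) x y
      rw [barSigma_bt]
      exact rTensor_mem_span _ _ (fun y => bt_mem_barFil (by omega) hs x y) _
    · exact rTensor_mem_span _ _ (fun y => bb_mem h₁ _ LinearMap.id
        (fun s hs x y hsq => bt_mem_barFil (by omega) hs x y) x y) _

lemma mem_span_top {E : Bimod k A} (w : E ⊗[k] T k A 0) :
    w ∈ Submodule.span k {w | ∃ x ∈ (⊤ : Submodule k E), ∃ a : T k A 0, w = x ⊗ₜ a} := by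
  induction w with
  | zero => exact Submodule.zero_mem _
  | add x y hx hy => exact Submodule.add_mem _ hx hy
  | tmul x a => exact Submodule.subset_span ⟨x, trivial, a, rfl⟩

end BarSplitting

end DGMod

/-! ### Splittings of the bar complex -/

namespace Bimod

/-- The splitting of `A^{⊗ (q+1)}`. -/
def splittingT (q : ℕ) : (T k A q).Splitting where
  σ := sigmaT q
  σ_op_smul := sigmaT_op_smul q
  ract_σ := ract_sigmaT q

variable {ι : Type} [Subsingleton ι]

/-- A splitting of a product with at most one factor. -/
noncomputable def Splitting.pi {P : ι → Bimod k A} (s : ∀ i, (P i).Splitting) :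
    (Bimod.pi P).Splitting where
  σ := piDesc fun i => LinearMap.rTensor (T k A 0) (single P i) ∘ₗ (s i).σ
  σ_op_smul a x := by
    by_cases hι : Nonempty ι
    · obtain ⟨i⟩ := hι
      rw [piDesc_apply _ i, piDesc_apply _ i, (isBimodMap_proj i).2, LinearMap.comp_apply,
        LinearMap.comp_apply, (s i).σ_op_smul, rTensor_rightEnd]
    · have := not_nonempty_iff.1 hι
      rw [pi_eq_zero x, smul_zero, map_zero, map_zero]
  ract_σ x := by
    by_cases hι : Nonempty ι
    · obtain ⟨i⟩ := hι
      rw [piDesc_apply _ i, LinearMap.comp_apply, ract_rTensor (isBimodMap_single i).2,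
        (s i).ract_σ, single_proj]
    · have := not_nonempty_iff.1 hι
      exact (pi_eq_zero _).trans (pi_eq_zero x).symm

lemma Splitting.pi_σ {P : ι → Bimod k A} (s : ∀ i, (P i).Splitting) (i : ι) (x : Bimod.pi P) :
    (Splitting.pi s).σ x = LinearMap.rTensor (T k A 0) (single P i) ((s i).σ (proj P i x)) :=
  piDesc_apply _ i x

lemma piMap_single {κ : Type} [Subsingleton κ] {P : ι → Bimod k A} {Q : κ → Bimod k A} (f : κ → ι)
    (φ : ∀ b, P (f b) →ₗ[k] Q b) (b : κ) (x : P (f b)) :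
    piMap f φ (single P (f b) x) = single Q b (φ b x) :=
  pi_ext fun c => by
    obtain rfl := Subsingleton.elim b c
    rw [proj_piMap, proj_single, proj_single]

/-- Applied with identity components, this shows that ε on a cone, which merely identifies
Bar_{p+s}(A) with Bar_s(Ω^p(A)), respects the splitting. -/
lemma Splitting.pi_σ_piMap {κ : Type} [Subsingleton κ] {P : ι → Bimod k A} {Q : κ → Bimod k A}
    (s : ∀ i, (P i).Splitting) (t : ∀ i, (Q i).Splitting) (f : κ → ι)
    (φ : ∀ b, P (f b) →ₗ[k] Q b)
    (h : ∀ b x, (t b).σ (φ b x) = LinearMap.rTensor (T k A 0) (φ b) ((s (f b)).σ x))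
    (x : Bimod.pi P) : (Splitting.pi t).σ (piMap f φ x) =
      LinearMap.rTensor (T k A 0) (piMap f φ) ((Splitting.pi s).σ x) := by
  by_cases hκ : Nonempty κ
  · obtain ⟨b⟩ := hκ
    rw [pi_σ t b, pi_σ s (f b), proj_piMap, h, ← LinearMap.rTensor_comp_apply,
      ← LinearMap.rTensor_comp_apply]
    congr 2
    exact LinearMap.ext fun x => (piMap_single f φ b x).symm
  · have := not_nonempty_iff.1 hκ
    have h₀ : piMap f φ = 0 := LinearMap.ext fun x => pi_eq_zero _
    rw [h₀, LinearMap.rTensor_zero, LinearMap.zero_apply, LinearMap.zero_apply, map_zero]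

/-- A splitting of a direct sum. -/
def Splitting.prod {M N : Bimod k A} (s : M.Splitting) (t : N.Splitting) :
    (M.prod N).Splitting where
  σ := LinearMap.rTensor (T k A 0) (inl M N) ∘ₗ s.σ ∘ₗ fst M N +
    LinearMap.rTensor (T k A 0) (inr M N) ∘ₗ t.σ ∘ₗ snd M N
  σ_op_smul a x := by
    simp only [LinearMap.add_apply, LinearMap.comp_apply]
    rw [isBimodMap_fst.2, isBimodMap_snd.2, s.σ_op_smul, t.σ_op_smul, rTensor_rightEnd,
      rTensor_rightEnd, map_add]
  ract_σ x := by
    simp only [LinearMap.add_apply, LinearMap.comp_apply, map_add]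
    rw [ract_rTensor isBimodMap_inl.2, ract_rTensor isBimodMap_inr.2, s.ract_σ, t.ract_σ]
    exact prod_ext (add_zero _) (zero_add _)

lemma Splitting.prod_σ_inr {M N : Bimod k A} (s : M.Splitting) (t : N.Splitting) (y : N) :
    (s.prod t).σ (inr M N y) = LinearMap.rTensor (T k A 0) (inr M N) (t.σ y) := by
  simp only [prod, LinearMap.add_apply, LinearMap.comp_apply, fst_inr, snd_inr, map_zero, zero_add]

lemma Splitting.rTensor_prod_σ {M N : Bimod k A} {Z : Bimod k A} (s : M.Splitting)
    (t : N.Splitting) (φ : M →ₗ[k] Z) (x : M.prod N) :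
    LinearMap.rTensor (T k A 0) (φ ∘ₗ fst M N) ((s.prod t).σ x) =
      LinearMap.rTensor (T k A 0) φ (s.σ (fst M N x)) := by
  have h₁ : (φ ∘ₗ fst M N) ∘ₗ inl M N = φ := rfl
  have h₂ : (φ ∘ₗ fst M N) ∘ₗ inr M N = 0 := LinearMap.ext fun x => map_zero φ
  simp only [prod, LinearMap.add_apply, LinearMap.comp_apply, map_add]
  rw [← LinearMap.rTensor_comp_apply, h₁, ← LinearMap.rTensor_comp_apply, h₂, LinearMap.rTensor_zero, LinearMap.zero_apply, add_zero]

end Bimod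

instance (i : ℤ) : Subsingleton {r : ℕ // (r : ℤ) = i} :=
  ⟨fun a b => Subtype.ext (by have := a.2; have := b.2; omega)⟩

instance (c i : ℤ) : Subsingleton {s : ℕ // (s : ℤ) + c = i} :=
  ⟨fun a b => Subtype.ext (by have := a.2; have := b.2; omega)⟩

section Cone

variable {m p : ℕ}

/-- The filtered splitting of the cone of a lift of a cocycle. -/
noncomputable def coneFilteredSplitting (θ : ∀ s, T k A (m + s + 1) →ₗ[k] T k A (p + s + 1))
    (hθ : ∀ s, IsBimodMap (θ s))
    (h : ∀ s, θ s ∘ₗ dT k A (m + s + 1) = -(dT k A (p + s + 1) ∘ₗ θ (s + 1))) :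
    DGMod.FilteredSplitting (cone θ hθ h) where
  s i := Bimod.Splitting.prod (M := barX k A i) (N := barOmX k A p (m - 1) i)
    (Bimod.Splitting.pi fun _ => Bimod.splittingT _) (Bimod.Splitting.pi fun _ => Bimod.splittingT _)
  σ_e i j x := by
    by_cases hj : i + ((m : ℤ) - p - 1) = j
    · let ρ : barX k A i →ₗ[k] barOmX k A p (m - 1) j :=
        piMap (fun s : {s : ℕ // (s : ℤ) + (m - 1) = j} =>
          (⟨p + s.1, by have := s.2; push_cast; omega⟩ : {r : ℕ // (r : ℤ) = i}))
          (fun _ => LinearMap.id)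
      have he : (cone θ hθ h).e i j = Bimod.inr (barX k A j) (barOmX k A p (m - 1) j) ∘ₗ ρ ∘ₗ
          Bimod.fst (barX k A i) (barOmX k A p (m - 1) i) := by
        refine (dif_pos hj).trans (LinearMap.ext fun x => Prod.ext rfl ?_)
        exact add_zero _
      rw [he]
      have key := Bimod.Splitting.pi_σ_piMap
        (fun r : {r : ℕ // (r : ℤ) = i} => Bimod.splittingT (k := k) (A := A) (r.1 + 1))
        (fun s : {s : ℕ // (s : ℤ) + (m - 1) = j} => Bimod.splittingT (p + s.1 + 1))
        (fun s => (⟨p + s.1, by have := s.2; push_cast; omega⟩ : {r : ℕ // (r : ℤ) = i}))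
        (fun _ => LinearMap.id) (fun b y => by
          rw [LinearMap.rTensor_id]
          rfl) (Bimod.fst (barX k A i) (barOmX k A p (m - 1) i) x)
      refine (Bimod.Splitting.prod_σ_inr _ _ _).trans ((congrArg _ key).trans ?_)
      refine (LinearMap.rTensor_comp_apply _ _ _ _).symm.trans ?_
      exact (Bimod.Splitting.rTensor_prod_σ _ _ (Bimod.inr (barX k A j) _ ∘ₗ ρ) x).symm
    · rw [(cone θ hθ h).e_shape _ _ hj, LinearMap.zero_apply, map_zero, LinearMap.rTensor_zero,
        LinearMap.zero_apply]
  -- This is the filtration by degree. The cone is zero in degrees below -1: the bar complex starts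
  -- in degree 0 and the second summand in degree m - 1, which is -1 for m = 0. As d lowers the
  -- degree, no compatibility of σ with θ is needed.
  fil r i := if i < r - 1 then ⊤ else ⊥
  fil_zero i x hx := by
    split_ifs at hx with hi
    · refine Bimod.prod_ext (Bimod.pi_ext fun r => ?_) (Bimod.pi_ext fun s => ?_)
      · have := r.2
        push_cast at hi
        omega
      · have := s.2
        push_cast at hi
        omega
    · exact hx
  exhaustive i x := ⟨(i + 2).toNat, by
    rw [if_pos (by omega)]
    trivial⟩
  σ_d r i j hj x hx := by
    split_ifs at hx with hi
    · rw [if_pos (by push_cast at hi; omega)]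
      exact DGMod.mem_span_top _
    · rw [(Submodule.mem_bot k).1 hx]
      simp only [map_zero, sub_zero]
      exact Submodule.zero_mem _

end Cone

end

end SingDef

namespace SingDef

/-! ### Left derived functors from functorial resolutions -/

section Derived

open CategoryTheory

section Resolution

universe v₁ u₁ v₂ u₂

variable {C : Type u₁} [Category.{v₁} C] {H : Type u₂} [Category.{v₂} H] {W : MorphismProperty C}
  {F : C ⥤ H} {B : C ⥤ C} (q : B ⟶ 𝟭 C) (hB : W.IsInvertedBy (B ⋙ F))

/-- The left derived functor of `F` obtained from a functorial resolution `B ⟶ 𝟭`. -/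
noncomputable def resolvedFunctor : W.Localization ⥤ H := Localization.lift (B ⋙ F) hB W.Q

/-- The left derived functor restricts to `B ⋙ F`. -/
noncomputable def resolvedFac : W.Q ⋙ resolvedFunctor hB ≅ B ⋙ F :=
  Localization.fac (B ⋙ F) hB W.Q

/-- The natural transformation from the left derived functor to `F`. -/
noncomputable def resolvedCounit : W.Q ⋙ resolvedFunctor hB ⟶ F :=
  (resolvedFac hB).hom ≫
    { app := fun M => F.map (q.app M)
      naturality := fun M N φ => by
        have e := congrArg F.map (q.naturality φ)
        simpa only [Functor.comp_map, Functor.id_map, Functor.map_comp] using e }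

lemma resolvedCounit_app (M : C) : (resolvedCounit q hB).app M =
    (resolvedFac hB).hom.app M ≫ F.map (q.app M) := rfl

lemma isIso_resolvedCounit_app {M : C} (h : IsIso (F.map (q.app M))) :
    IsIso ((resolvedCounit q hB).app M) := by
  rw [resolvedCounit_app]
  exact IsIso.comp_isIso

variable {q}

/-- A natural transformation to `F` factors through the left derived functor. -/
noncomputable def resolvedLift (hq : ∀ M, W (q.app M)) (G : W.Localization ⥤ H)
    (β : W.Q ⋙ G ⟶ F) : W.Q ⋙ G ⟶ W.Q ⋙ resolvedFunctor hB :=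
  have (M : C) : IsIso (W.Q.map (q.app M)) := Localization.inverts W.Q W _ (hq M)
  { app M := inv (G.map (W.Q.map (q.app M))) ≫ β.app (B.obj M) ≫ (resolvedFac hB).inv.app M
    naturality M N φ := by
      have e₁ := (resolvedFac hB).inv.naturality φ
      have e₂ := β.naturality (B.map φ)
      have e₃ := congrArg (fun ψ => G.map (W.Q.map ψ)) (q.naturality φ)
      simp only [Functor.comp_map, Functor.id_map, Functor.map_comp] at e₁ e₂ e₃
      rw [Functor.comp_map, Functor.comp_map, Category.assoc, Category.assoc, ← e₁,
        ← reassoc_of% e₂, IsIso.eq_inv_comp, ← reassoc_of% e₃, IsIso.hom_inv_id_assoc] }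

lemma resolvedLift_app (hq : ∀ M, W (q.app M)) (G : W.Localization ⥤ H) (β : W.Q ⋙ G ⟶ F) (M : C) :
    G.map (W.Q.map (q.app M)) ≫ (resolvedLift hB hq G β).app M =
      β.app (B.obj M) ≫ (resolvedFac hB).inv.app M := by
  have : IsIso (W.Q.map (q.app M)) := Localization.inverts W.Q W _ (hq M)
  exact IsIso.hom_inv_id_assoc (G.map (W.Q.map (q.app M))) _

lemma resolvedLift_liftNatTrans (hq : ∀ M, W (q.app M)) (G : W.Localization ⥤ H)
    (β : W.Q ⋙ G ⟶ F) (M : C) :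
    (Localization.liftNatTrans W.Q W (W.Q ⋙ G) (W.Q ⋙ resolvedFunctor hB) G
      (resolvedFunctor hB) (resolvedLift hB hq G β)).app (W.Q.obj M) =
    (resolvedLift hB hq G β).app M := by
  rw [Localization.liftNatTrans_app]
  exact (Category.id_comp _).trans (Category.comp_id _)

/-- After composition with the isomorphism G (Q q_M), where q_M : B M → M is the resolution, the
claim becomes the naturality of β at q_M. -/
lemma resolvedLift_fac (hq : ∀ M, W (q.app M)) (G : W.Localization ⥤ H) (β : W.Q ⋙ G ⟶ F) :
    resolvedLift hB hq G β ≫ resolvedCounit q hB = β := by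
  ext M
  have : IsIso (W.Q.map (q.app M)) := Localization.inverts W.Q W _ (hq M)
  rw [← cancel_epi (G.map (W.Q.map (q.app M))), NatTrans.comp_app,
    reassoc_of% resolvedLift_app hB hq G β M, resolvedCounit_app, Iso.inv_hom_id_app_assoc]
  exact (β.naturality (q.app M)).symm

/-- A transformation out of Q ⋙ G is determined by its values at the objects B M, since Q inverts
the maps B M → M. At B M the counit is invertible because F inverts the resolution of B M, so the
counit can be cancelled. -/
lemma resolvedLift_unique (hq : ∀ M, W (q.app M)) (hF : ∀ M, IsIso (F.map (q.app (B.obj M))))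
    (G : W.Localization ⥤ H) {γ δ : W.Q ⋙ G ⟶ W.Q ⋙ resolvedFunctor hB}
    (h : γ ≫ resolvedCounit q hB = δ ≫ resolvedCounit q hB) : γ = δ := by
  ext M
  have : IsIso (W.Q.map (q.app M)) := Localization.inverts W.Q W _ (hq M)
  have hM := hF M
  have : IsIso ((resolvedCounit q hB).app (B.obj M)) := isIso_resolvedCounit_app q hB hM
  have e : γ.app (B.obj M) = δ.app (B.obj M) := by
    rw [← cancel_mono ((resolvedCounit q hB).app (B.obj M)), ← NatTrans.comp_app,
      ← NatTrans.comp_app, h]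
  rw [← cancel_epi (G.map (W.Q.map (q.app M)))]
  exact (γ.naturality (q.app M)).trans
    ((congrArg (· ≫ _) e).trans (δ.naturality (q.app M)).symm)

/-- A functorial resolution by objects that are acyclic for `F` gives a left derived functor. -/
lemma isLeftDerivedFunctor_resolvedCounit (hq : ∀ M, W (q.app M))
    (hF : ∀ M, IsIso (F.map (q.app (B.obj M)))) :
    (resolvedFunctor hB).IsLeftDerivedFunctor (resolvedCounit q hB) W where
  -- A left derived functor is a right Kan extension along Q, that is a terminal object among the
  -- functors G on the localization with a transformation Q ⋙ G ⟶ F. Existence of the morphism is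
  -- `resolvedLift`, carried over to the localization, and uniqueness is `resolvedLift_unique`.
  isRightKanExtension := ⟨⟨Limits.IsTerminal.ofUniqueHom
    (fun X => CostructuredArrow.homMk
      (Localization.liftNatTrans W.Q W (W.Q ⋙ X.left) (W.Q ⋙ resolvedFunctor hB) X.left
        (resolvedFunctor hB) (resolvedLift hB hq X.left X.hom)) (by
      refine Eq.trans ?_ (resolvedLift_fac hB hq X.left X.hom)
      exact congrArg (· ≫ resolvedCounit q hB) (NatTrans.ext (funext fun M =>
        resolvedLift_liftNatTrans hB hq X.left X.hom M))))
    (fun X γ => by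
      refine CostructuredArrow.hom_ext _ _ (Localization.natTrans_ext W.Q W fun M => ?_)
      have e : Functor.whiskerLeft W.Q γ.left = resolvedLift hB hq X.left X.hom :=
        resolvedLift_unique hB hq hF X.left
          ((CostructuredArrow.w γ).trans (resolvedLift_fac hB hq X.left X.hom).symm)
      exact (NatTrans.congr_app e M).trans
        (resolvedLift_liftNatTrans hB hq X.left X.hom M).symm)⟩⟩

/-- The counit of the total left derived functor is invertible at `F`-acyclic objects. -/
lemma exists_hasLeftDerivedFunctor_isIso (hB : W.IsInvertedBy (B ⋙ F)) (hq : ∀ M, W (q.app M))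
    (hF : ∀ M, IsIso (F.map (q.app (B.obj M)))) {M : C} (hM : IsIso (F.map (q.app M))) :
    ∃ _ : F.HasLeftDerivedFunctor W, IsIso ((F.totalLeftDerivedCounit W.Q W).app M) := by
  have := isLeftDerivedFunctor_resolvedCounit hB hq hF
  have h : F.HasLeftDerivedFunctor W := Functor.HasLeftDerivedFunctor.mk' _ (resolvedCounit q hB)
  refine ⟨h, ?_⟩
  -- Two left derived functors are isomorphic compatibly with their counits, so invertibility at M
  -- passes from the functor built from resolutions to the chosen total left derived functor.
  let e := Functor.leftDerivedUnique (resolvedFunctor hB) (F.totalLeftDerived W.Q W)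
    (F.totalLeftDerivedCounit W.Q W) (resolvedCounit q hB) W
  have he : e.hom.app (W.Q.obj M) ≫ (resolvedCounit q hB).app M =
      (F.totalLeftDerivedCounit W.Q W).app M := by
    simp [e]
  have := isIso_resolvedCounit_app q hB hM
  rw [← he]
  exact IsIso.comp_isIso

end Resolution

variable {k : Type v} {A : Type u} [CommRing k] [Ring A] [Algebra k A]

namespace DGMod

variable {n : ℤ}

/-- The bar resolution as a functor. -/
def barFunctor (k : Type v) (A : Type u) [CommRing k] [Ring A] [Algebra k A] (n : ℤ) :
    DGMod k A n ⥤ DGMod k A n where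
  obj M := barRes M
  map φ := barHom φ
  map_id M := Hom.ext (funext fun l => LinearMap.ext fun z =>
    bar_congr ((barHom (𝟙 M)).f l) LinearMap.id (fun _ _ h x y => barHom_bt _ h x y) z)
  map_comp φ ψ := Hom.ext (funext fun l => LinearMap.ext fun z =>
    bar_congr ((barHom (φ ≫ ψ)).f l) ((barHom ψ).f l ∘ₗ (barHom φ).f l) (fun _ _ h x y =>
      (barHom_bt _ h x y).trans ((barHom_bt ψ h _ y).symm.trans
        (congrArg ((barHom ψ).f l) (barHom_bt φ h x y).symm))) z)

/-- The augmentation of the bar resolution. -/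
def barFunctorAug (k : Type v) (A : Type u) [CommRing k] [Ring A] [Algebra k A] (n : ℤ) :
    barFunctor k A n ⟶ 𝟭 (DGMod k A n) where
  app M := barAug M
  naturality M N φ := Hom.ext (funext fun l => LinearMap.ext fun z => by
    exact (barAug_naturality φ l z))

/-- A homotopy equivalence linear over `A` on the right is inverted by the tensor product. -/
lemma isIso_tensorRightQ_map {M M' : DGMod k A n} (N : DGMod k A n) {φ : M ⟶ M'}
    (h : IsHtpyEquiv .right φ) : IsIso ((tensorRightQ N).map φ) :=
  Localization.inverts (relQuasiIso k A n).Q (relQuasiIso k A n) _ (h.tensHom N)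

/-- The bar resolution provides enough acyclic objects for every N. A filtered splitting makes the
augmentation a right linear homotopy equivalence, which tensoring with N preserves; the bar
resolutions themselves have such splittings, and M has one by assumption. -/
lemma exists_derived_tensor (M N : DGMod k A n) (S : FilteredSplitting M) :
    ∃ _ : (tensorRightQ N).HasLeftDerivedFunctor (relQuasiIso k A n),
      IsIso (((tensorRightQ N).totalLeftDerivedCounit (relQuasiIso k A n).Q
        (relQuasiIso k A n)).app M) :=
  exists_hasLeftDerivedFunctor_isIso (F := tensorRightQ N) (q := barFunctorAug k A n)
    (fun _ _ φ h => isIso_tensorRightQ_map N (φ := barHom φ) h.isHtpyEquiv_barHom)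
    (fun M => isRelQuasiIso_barAug M)
    (fun M => isIso_tensorRightQ_map N (barFilteredSplitting M).isHtpyEquiv_barAug)
    (isIso_tensorRightQ_map N S.isHtpyEquiv_barAug)

end DGMod

end Derived

end SingDef

namespace SingDef

section

variable {k : Type v} {A : Type u} [CommRing k] [Ring A] [Algebra k A]

/-! ### Twisted direct sums -/

variable (k A) in
/-- The data that define a twisted direct sum. -/
structure TwistData (n : ℤ) where
  B : ℤ → Bimod k A
  E : ℤ → Bimod k A
  dB : ∀ i j, j + 1 = i → (B i →ₗ[k] B j)
  dE : ∀ i j, j + 1 = i → (E i →ₗ[k] E j)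
  t : ∀ i j, j + 1 = i → (B i →ₗ[k] E j)
  ρ : ∀ i j, i + n = j → (B i →ₗ[k] E j)
  hdB : ∀ i j h, IsBimodMap (dB i j h)
  hdE : ∀ i j h, IsBimodMap (dE i j h)
  ht : ∀ i j h, IsBimodMap (t i j h)
  hρ : ∀ i j h, IsBimodMap (ρ i j h)
  dB_dB : ∀ i j l h h' x, dB j l h' (dB i j h x) = 0
  dE_dE : ∀ i j l h h' x, dE j l h' (dE i j h x) = 0
  t_dB : ∀ i j l h h' x, t j l h' (dB i j h x) + dE j l h' (t i j h x) = 0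
  dE_ρ : ∀ i j i' j' h h' h₁ h₂ x, dE i' j' h' (ρ i i' h₁ x) = ρ j j' h₂ (dB i j h x)

namespace TwistData

variable {n : ℤ}

/-- The twisted direct sum. -/
def mod (D : TwistData k A n) : DGMod k A n :=
  DGMod.twisted n D.B D.E D.dB D.dE D.t D.ρ D.hdB D.hdE D.ht D.hρ D.dB_dB D.dE_dE D.t_dB D.dE_ρ

variable (D D' : TwistData k A n)

/-- The first component. -/
def fst (i : ℤ) : D.mod.X i →ₗ[k] D.B i := Bimod.fst _ _

/-- The second component. -/
def snd (i : ℤ) : D.mod.X i →ₗ[k] D.E i := Bimod.snd _ _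

/-- The inclusion of the first summand. -/
def inl (i : ℤ) : D.B i →ₗ[k] D.mod.X i := Bimod.inl _ _

/-- The inclusion of the second summand. -/
def inr (i : ℤ) : D.E i →ₗ[k] D.mod.X i := Bimod.inr _ _

@[simp] lemma fst_inl (i : ℤ) (x : D.B i) : D.fst i (D.inl i x) = x := rfl

@[simp] lemma snd_inl (i : ℤ) (x : D.B i) : D.snd i (D.inl i x) = 0 := rfl

@[simp] lemma fst_inr (i : ℤ) (x : D.E i) : D.fst i (D.inr i x) = 0 := rfl

@[simp] lemma snd_inr (i : ℤ) (x : D.E i) : D.snd i (D.inr i x) = x := rfl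

lemma isBimodMap_fst (i : ℤ) : IsBimodMap (D.fst i) := Bimod.isBimodMap_fst

lemma isBimodMap_snd (i : ℤ) : IsBimodMap (D.snd i) := Bimod.isBimodMap_snd

lemma isBimodMap_inl (i : ℤ) : IsBimodMap (D.inl i) := Bimod.isBimodMap_inl

lemma isBimodMap_inr (i : ℤ) : IsBimodMap (D.inr i) := Bimod.isBimodMap_inr

lemma ext {i : ℤ} {x y : D.mod.X i} (h₁ : D.fst i x = D.fst i y) (h₂ : D.snd i x = D.snd i y) :
    x = y := Bimod.prod_ext h₁ h₂

lemma eq_add (i : ℤ) (x : D.mod.X i) : x = D.inl i (D.fst i x) + D.inr i (D.snd i x) :=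
  D.ext (by rw [map_add, fst_inl, fst_inr, add_zero]) (by rw [map_add, snd_inl, snd_inr, zero_add])

lemma fst_d {i j : ℤ} (h : j + 1 = i) (x : D.mod.X i) :
    D.fst j (D.mod.d i j x) = D.dB i j h (D.fst i x) := by
  have e : D.mod.d i j = prodMap (D.dB i j h) (D.t i j h) (D.dE i j h) := dif_pos h
  rw [e]
  rfl

lemma snd_d {i j : ℤ} (h : j + 1 = i) (x : D.mod.X i) :
    D.snd j (D.mod.d i j x) = D.t i j h (D.fst i x) + D.dE i j h (D.snd i x) := by
  have e : D.mod.d i j = prodMap (D.dB i j h) (D.t i j h) (D.dE i j h) := dif_pos h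
  rw [e]
  rfl

lemma fst_e (i j : ℤ) (x : D.mod.X i) : D.fst j (D.mod.e i j x) = 0 := by
  by_cases h : i + n = j
  · have e : D.mod.e i j = prodMap 0 (D.ρ i j h) 0 := dif_pos h
    rw [e]
    rfl
  · rw [D.mod.e_shape _ _ h, LinearMap.zero_apply, map_zero]

lemma snd_e {i j : ℤ} (h : i + n = j) (x : D.mod.X i) :
    D.snd j (D.mod.e i j x) = D.ρ i j h (D.fst i x) := by
  have e : D.mod.e i j = prodMap 0 (D.ρ i j h) 0 := dif_pos h
  rw [e]
  exact add_zero _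

lemma d_inl {i j : ℤ} (h : j + 1 = i) (x : D.B i) :
    D.mod.d i j (D.inl i x) = D.inl j (D.dB i j h x) + D.inr j (D.t i j h x) :=
  D.ext (by rw [D.fst_d h, map_add, fst_inl, fst_inl, fst_inr, add_zero])
    (by rw [D.snd_d h, map_add, fst_inl, snd_inl, snd_inl, snd_inr, map_zero, add_zero, zero_add])

lemma d_inr {i j : ℤ} (h : j + 1 = i) (y : D.E i) :
    D.mod.d i j (D.inr i y) = D.inr j (D.dE i j h y) :=
  D.ext (by rw [D.fst_d h, fst_inr, fst_inr, map_zero])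
    (by rw [D.snd_d h, fst_inr, snd_inr, snd_inr, map_zero, zero_add])

lemma e_inl {i j : ℤ} (h : i + n = j) (x : D.B i) :
    D.mod.e i j (D.inl i x) = D.inr j (D.ρ i j h x) :=
  D.ext (by rw [D.fst_e, fst_inr]) (by rw [D.snd_e h, fst_inl, snd_inr])

lemma e_inr (i j : ℤ) (y : D.E i) : D.mod.e i j (D.inr i y) = 0 := by
  by_cases h : i + n = j
  · exact D.ext (by rw [D.fst_e, map_zero]) (by rw [D.snd_e h, fst_inr, map_zero, map_zero])
  · rw [D.mod.e_shape _ _ h, LinearMap.zero_apply]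

variable {D D'}

/-- The block diagonal map with the given blocks. -/
def diag {i j : ℤ} (α : D.B i →ₗ[k] D'.B j) (γ : D.E i →ₗ[k] D'.E j) :
    D.mod.X i →ₗ[k] D'.mod.X j := D'.inl j ∘ₗ α ∘ₗ D.fst i + D'.inr j ∘ₗ γ ∘ₗ D.snd i

@[simp] lemma diag_inl {i j : ℤ} (α : D.B i →ₗ[k] D'.B j) (γ : D.E i →ₗ[k] D'.E j) (x : D.B i) :
    diag α γ (D.inl i x) = D'.inl j (α x) := by simp [diag]

@[simp] lemma diag_inr {i j : ℤ} (α : D.B i →ₗ[k] D'.B j) (γ : D.E i →ₗ[k] D'.E j) (x : D.E i) :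
    diag α γ (D.inr i x) = D'.inr j (γ x) := by simp [diag]

lemma lin_diag {S : Side} {i j : ℤ} {α : D.B i →ₗ[k] D'.B j} {γ : D.E i →ₗ[k] D'.E j}
    (hα : S.Lin α) (hγ : S.Lin γ) : S.Lin (diag α γ) :=
  ((S.lin_of_isBimodMap (D'.isBimodMap_inl j)).comp
    (hα.comp (S.lin_of_isBimodMap (D.isBimodMap_fst i)))).add
  ((S.lin_of_isBimodMap (D'.isBimodMap_inr j)).comp
    (hγ.comp (S.lin_of_isBimodMap (D.isBimodMap_snd i))))

lemma isBimodMap_diag {i j : ℤ} {α : D.B i →ₗ[k] D'.B j} {γ : D.E i →ₗ[k] D'.E j}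
    (hα : IsBimodMap α) (hγ : IsBimodMap γ) : IsBimodMap (diag α γ) :=
  ⟨lin_diag (S := .left) hα.1 hγ.1, lin_diag (S := .right) hα.2 hγ.2⟩

section Map

variable (α : ∀ i, D.B i →ₗ[k] D'.B i) (γ : ∀ i, D.E i →ₗ[k] D'.E i)
  (hα : ∀ i, IsBimodMap (α i)) (hγ : ∀ i, IsBimodMap (γ i))
  (α_d : ∀ i j h x, α j (D.dB i j h x) = D'.dB i j h (α i x))
  (γ_d : ∀ i j h y, γ j (D.dE i j h y) = D'.dE i j h (γ i y))
  (γ_t : ∀ i j h x, γ j (D.t i j h x) = D'.t i j h (α i x))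
  (γ_ρ : ∀ i j h x, γ j (D.ρ i j h x) = D'.ρ i j h (α i x))

/-- A block diagonal morphism of twisted direct sums. -/
def map : DGMod.Hom D.mod D'.mod where
  f i := diag (α i) (γ i)
  isBimodMap_f i := isBimodMap_diag (hα i) (hγ i)
  comm_d i j z := by
    by_cases h : j + 1 = i
    · rw [D.eq_add i z]
      simp only [map_add]
      rw [diag_inl, diag_inr, D.d_inl h, D.d_inr h, D'.d_inl h, D'.d_inr h, map_add, diag_inl,
        diag_inr, diag_inr, α_d, γ_d, γ_t]
    · rw [D.mod.d_shape _ _ h, D'.mod.d_shape _ _ h, LinearMap.zero_apply, LinearMap.zero_apply,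
        map_zero]
  comm_e i j z := by
    by_cases h : i + n = j
    · rw [D.eq_add i z]
      simp only [map_add]
      rw [diag_inl, diag_inr, D.e_inl h, D.e_inr, D'.e_inl h, D'.e_inr, map_zero, diag_inr, γ_ρ]
    · rw [D.mod.e_shape _ _ h, D'.mod.e_shape _ _ h, LinearMap.zero_apply, LinearMap.zero_apply,
        map_zero]

lemma map_inl (i : ℤ) (x : D.B i) :
    (map α γ hα hγ α_d γ_d γ_t γ_ρ).f i (D.inl i x) = D'.inl i (α i x) := diag_inl _ _ _

lemma map_inr (i : ℤ) (x : D.E i) :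
    (map α γ hα hγ α_d γ_d γ_t γ_ρ).f i (D.inr i x) = D'.inr i (γ i x) := diag_inr _ _ _

/-- A block diagonal morphism is a homotopy equivalence if its blocks have homotopy inverses that
are compatible with the action of `ε`. -/
lemma isHtpyEquiv_map {S : Side} (aB : ∀ i, D'.B i →ₗ[k] D.B i) (aE : ∀ i, D'.E i →ₗ[k] D.E i)
    (hB : ∀ i j, D.B i →ₗ[k] D.B j) (hE : ∀ i j, D.E i →ₗ[k] D.E j)
    (hB' : ∀ i j, D'.B i →ₗ[k] D'.B j) (hE' : ∀ i j, D'.E i →ₗ[k] D'.E j)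
    (laB : ∀ i, S.Lin (aB i)) (laE : ∀ i, S.Lin (aE i))
    (lhB : ∀ i j, S.Lin (hB i j)) (lhE : ∀ i j, S.Lin (hE i j))
    (lhB' : ∀ i j, S.Lin (hB' i j)) (lhE' : ∀ i j, S.Lin (hE' i j))
    (aB_d : ∀ i j h x, aB j (D'.dB i j h x) = D.dB i j h (aB i x))
    (aE_d : ∀ i j h x, aE j (D'.dE i j h x) = D.dE i j h (aE i x))
    (aE_ρ : ∀ i j h x, aE j (D'.ρ i j h x) = D.ρ i j h (aB i x))
    (hE_ρ : ∀ i j i' j' (_ : i + 1 = j) h h' x, hE i' j' (D.ρ i i' h x) = D.ρ j j' h' (hB i j x))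
    (hE'_ρ : ∀ i j i' j' (_ : i + 1 = j) h h' x,
      hE' i' j' (D'.ρ i i' h x) = D'.ρ j j' h' (hB' i j x))
    (hBα : ∀ i j x, hB' i j (α i x) = α j (hB i j x))
    (eB : ∀ i j l h h' x, aB i (α i x) + D.dB j i h (hB i j x) + hB l i (D.dB i l h' x) = x)
    (eE : ∀ i j l h h' x, aE i (γ i x) + D.dE j i h (hE i j x) + hE l i (D.dE i l h' x) = x)
    (eB' : ∀ i j l h h' x, D'.dB j i h (hB' i j x) + hB' l i (D'.dB i l h' x) + α i (aB i x) = x)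
    (eE' : ∀ i j l h h' x, D'.dE j i h (hE' i j x) + hE' l i (D'.dE i l h' x) + γ i (aE i x) = x) :
    DGMod.IsHtpyEquiv S (map α γ hα hγ α_d γ_d γ_t γ_ρ) := by
  -- The block diagonal inverse and homotopies take no account of the twisting maps, so V - 1 has
  -- only entries that lead from a summand B to a summand E, together with h' φ - φ h on the source.
  -- It is nilpotent along the order E', E, B', B, where primes denote the target.
  set φ := map α γ hα hγ α_d γ_d γ_t γ_ρ with hφ
  let g : ∀ i, D'.mod.X i →ₗ[k] D.mod.X i := fun i => diag (aB i) (aE i)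
  let h : ∀ i j, D.mod.X i →ₗ[k] D.mod.X j := fun i j => diag (hB i j) (hE i j)
  let h' : ∀ i j, D'.mod.X i →ₗ[k] D'.mod.X j := fun i j => diag (hB' i j) (hE' i j)
  have g_inl : ∀ i x, g i (D'.inl i x) = D.inl i (aB i x) := fun i x => diag_inl _ _ _
  have g_inr : ∀ i x, g i (D'.inr i x) = D.inr i (aE i x) := fun i x => diag_inr _ _ _
  have h_inl : ∀ i j x, h i j (D.inl i x) = D.inl j (hB i j x) := fun i j x => diag_inl _ _ _
  have h_inr : ∀ i j x, h i j (D.inr i x) = D.inr j (hE i j x) := fun i j x => diag_inr _ _ _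
  have h'_inl : ∀ i j x, h' i j (D'.inl i x) = D'.inl j (hB' i j x) := fun i j x => diag_inl _ _ _
  have h'_inr : ∀ i j x, h' i j (D'.inr i x) = D'.inr j (hE' i j x) := fun i j x => diag_inr _ _ _
  have φ_inl : ∀ i x, φ.f i (D.inl i x) = D'.inl i (α i x) := fun i x => diag_inl _ _ _
  have φ_inr : ∀ i x, φ.f i (D.inr i x) = D'.inr i (γ i x) := fun i x => diag_inr _ _ _
  -- On E' there is no error: the homotopy identity `eE'` and the chain map property of the inverse
  -- on E' are exact.
  have lr : ∀ l y, DGMod.mappingCone.inl φ l (D'.inr l y) ∈ DGMod.coneGen φ g h h' l :=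
    fun l y => by
      have hj : l - 1 + 1 = l := by omega
      refine DGMod.inl_mem_coneGen (l' := l + 1) hj rfl ?_
      rw [g_inr, h'_inr, D'.d_inr rfl, D'.d_inr hj, h'_inr, g_inr, φ_inr, D.d_inr hj, aE_d,
        sub_self, map_zero, add_zero, ← map_add, ← map_add, ← map_sub, eE', sub_self, map_zero,
        map_zero]
      exact Submodule.zero_mem _
  -- On E the only error is h' φ - φ h, which lands in E'.
  have rr : ∀ j l (hj : j + 1 = l) y,
      DGMod.mappingCone.inr φ hj (D.inr j y) ∈ DGMod.coneGen φ g h h' l := fun j l hj y => by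
    have hi : j - 1 + 1 = j := by omega
    refine DGMod.inr_mem_coneGen hi hj ?_
    rw [φ_inr, h'_inr, h_inr, φ_inr, g_inr, D.d_inr hj, D.d_inr hi, h_inr, ← map_add, ← map_add,
      ← map_sub (D.inr j), eE, sub_self, map_zero, map_zero, add_zero, ← map_sub]
    exact lr _ _
  refine DGMod.isHtpyEquiv_of_coneGen (g := g) (h := h) (h' := h')
    (fun i => lin_diag (laB i) (laE i)) (fun i j => lin_diag (lhB i j) (lhE i j))
    (fun i j => lin_diag (lhB' i j) (lhE' i j)) (fun i j hj x => ?_)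
    (fun i j i' j' hj hi hj' x => ?_) (fun i j i' j' hj hi hj' x => ?_)
    (fun l y => ?_) fun j l hj x => ?_
  · rw [D'.eq_add i x]
    simp only [map_add]
    rw [D'.e_inl hj, D'.e_inr, g_inl, g_inr, g_inr, D.e_inl hj, D.e_inr, map_zero, aE_ρ]
  · rw [D.eq_add i x]
    simp only [map_add]
    rw [D.e_inl hi, D.e_inr, h_inl, h_inr, h_inr, D.e_inl hj', D.e_inr, map_zero, hE_ρ i j i' j' hj]
  · rw [D'.eq_add i x]
    simp only [map_add]
    rw [D'.e_inl hi, D'.e_inr, h'_inl, h'_inr, h'_inr, D'.e_inl hj', D'.e_inr, map_zero,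
      hE'_ρ i j i' j' hj]
  · have hj : l - 1 + 1 = l := by omega
    rw [D'.eq_add l y, map_add]
    refine Submodule.add_mem _ (DGMod.inl_mem_coneGen (l' := l + 1) hj rfl ?_) (lr _ _)
    generalize D'.fst l y = y
    rw [g_inl, h'_inl, D'.d_inl rfl, D'.d_inl hj, map_add, map_add, h'_inl, h'_inr, g_inl, g_inr,
      φ_inl, D.d_inl hj, aB_d]
    -- The identity `eB'` removes all entries in B'; what is left are the two twisting terms, in E'.
    have e₁ : ∀ a b c d e f : D'.mod.X l, a + c + e = f → a + b + (c + d) + e - f = b + d := by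
      rintro a b c d e _ rfl
      abel
    have e₂ : ∀ a b c : D.mod.X (l - 1), a + b - (a + c) = b - c := fun a b c => by abel
    have key := congrArg (D'.inl l) (eB' l (l + 1) (l - 1) rfl hj y)
    simp only [map_add (D'.inl l)] at key
    rw [e₁ _ _ _ _ _ _ key, e₂]
    simp only [← map_add, ← map_sub]
    exact Submodule.add_mem _ (lr _ _) (rr _ _ _ _)
  · have hi : j - 1 + 1 = j := by omega
    rw [D.eq_add j x, map_add]
    refine Submodule.add_mem _ (DGMod.inr_mem_coneGen hi hj ?_) (rr _ _ _ _)
    generalize D.fst j x = x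
    rw [φ_inl, h'_inl, h_inl, φ_inl, g_inl, D.d_inl hj, D.d_inl hi, map_add, h_inl, h_inr]
    have e₁ : ∀ a b c d e f : D.mod.X j, a + b + d = f → a + (b + c) + (d + e) - f = c + e := by
      rintro a b c d e _ rfl
      abel
    have key := congrArg (D.inl j) (eB j l (j - 1) hj hi x)
    simp only [map_add (D.inl j)] at key
    rw [e₁ _ _ _ _ _ _ key]
    -- The homotopies on the first summands commute with α, so there is no entry in B'; only
    -- twisting terms in E remain.
    rw [hBα, sub_self, map_zero, zero_add, ← map_add]
    exact rr _ _ _ _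

end Map

end TwistData

end

end SingDef

namespace SingDef

section

variable {k : Type v} {A : Type u} [CommRing k] [Ring A] [Algebra k A]

/-! ### Elements of the bar complex -/

namespace Bimod

variable {ι : Type} [Subsingleton ι] {P : ι → Bimod k A} {Z : Type*} [AddCommGroup Z] [Module k Z]

lemma pi_congr (φ ψ : Bimod.pi P →ₗ[k] Z) (h : ∀ i x, φ (single P i x) = ψ (single P i x))
    (x : Bimod.pi P) : φ x = ψ x := by
  by_cases hι : Nonempty ι
  · obtain ⟨i⟩ := hι
    rw [← single_proj i x, h]
  · have := not_nonempty_iff.1 hι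
    rw [pi_eq_zero x, map_zero, map_zero]

lemma lin_piDesc {S : Side} {Q : Bimod k A} {φ : ∀ i, P i →ₗ[k] Q} (h : ∀ i, S.Lin (φ i)) :
    S.Lin (piDesc φ) := by
  by_cases hι : Nonempty ι
  · obtain ⟨i⟩ := hι
    have e : piDesc φ = φ i ∘ₗ proj P i := LinearMap.ext fun x => piDesc_apply φ i x
    rw [e]
    exact (h i).comp (S.lin_of_isBimodMap (isBimodMap_proj i))
  · rw [piDesc, dif_neg hι]
    exact S.lin_zero

lemma piDesc_single (φ : ∀ i, P i →ₗ[k] Z) (i : ι) (x : P i) :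
    piDesc φ (single P i x) = φ i x := by rw [piDesc_apply φ i, proj_single]

end Bimod

/-- The inclusion of `A^{⊗ (r+2)}` into the degree `i = r` part of `Bar_*(A)`. -/
def barT {r : ℕ} {i : ℤ} (h : (r : ℤ) = i) : T k A (r + 1) →ₗ[k] barX k A i :=
  Bimod.single (fun r : {r : ℕ // (r : ℤ) = i} => T k A (r.1 + 1)) ⟨r, h⟩

lemma isBimodMap_barT {r : ℕ} {i : ℤ} (h : (r : ℤ) = i) :
    IsBimodMap (barT h : T k A (r + 1) →ₗ[k] _) :=
  Bimod.isBimodMap_single (P := fun r : {r : ℕ // (r : ℤ) = i} => T k A (r.1 + 1)) _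

lemma barX_congr {Z : Type*} [AddCommGroup Z] [Module k Z] {i : ℤ} (φ ψ : barX k A i →ₗ[k] Z)
    (H : ∀ (r : ℕ) (h : (r : ℤ) = i) x, φ (barT h x) = ψ (barT h x)) (x : barX k A i) :
    φ x = ψ x := Bimod.pi_congr φ ψ (fun r x => H r.1 r.2 x) x

lemma barD_barT_succ {r : ℕ} {i j : ℤ} (hij : j + 1 = i) (h : ((r + 1 : ℕ) : ℤ) = i)
    (h' : (r : ℤ) = j) (x : T k A (r + 1 + 1)) :
    barD k A i j hij (barT h x) = barT h' (dT k A (r + 1) x) :=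
  Bimod.piMap_single (P := fun r : {r : ℕ // (r : ℤ) = i} => T k A (r.1 + 1))
    (Q := fun r : {r : ℕ // (r : ℤ) = j} => T k A (r.1 + 1))
    (fun r => ⟨r.1 + 1, by have := r.2; push_cast; omega⟩) (fun r => dT k A (r.1 + 1)) ⟨r, h'⟩ x

lemma barX_eq_zero {i : ℤ} (h : i < 0) (x : barX k A i) : x = 0 :=
  Bimod.pi_ext fun r => by
    have := r.2
    omega

/-- The map out of the degree `i` part of `Bar_*(A)` with given components. -/
noncomputable def barDesc {Z : Type*} [AddCommGroup Z] [Module k Z] {i : ℤ}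
    (φ : ∀ r : ℕ, (r : ℤ) = i → (T k A (r + 1) →ₗ[k] Z)) : barX k A i →ₗ[k] Z :=
  Bimod.piDesc fun r => φ r.1 r.2

lemma barDesc_barT {Z : Type*} [AddCommGroup Z] [Module k Z] {i : ℤ}
    (φ : ∀ r : ℕ, (r : ℤ) = i → (T k A (r + 1) →ₗ[k] Z)) {r : ℕ} (h : (r : ℤ) = i)
    (x : T k A (r + 1)) : barDesc φ (barT h x) = φ r h x :=
  Bimod.piDesc_single (P := fun r : {r : ℕ // (r : ℤ) = i} => T k A (r.1 + 1))
    (fun r => φ r.1 r.2) ⟨r, h⟩ x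

section BarOm

variable {p : ℕ} {c : ℤ}

/-- The inclusion of `A^{⊗ (p+s+2)}` into the degree `i = s + c` part of `Bar_*(Ω^p(A))`. -/
def barOmT {s : ℕ} {i : ℤ} (h : (s : ℤ) + c = i) : T k A (p + s + 1) →ₗ[k] barOmX k A p c i :=
  Bimod.single (fun s : {s : ℕ // (s : ℤ) + c = i} => T k A (p + s.1 + 1)) ⟨s, h⟩

lemma isBimodMap_barOmT {s : ℕ} {i : ℤ} (h : (s : ℤ) + c = i) :
    IsBimodMap (barOmT h : T k A (p + s + 1) →ₗ[k] _) :=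
  Bimod.isBimodMap_single (P := fun s : {s : ℕ // (s : ℤ) + c = i} => T k A (p + s.1 + 1)) _

lemma barOmX_congr {Z : Type*} [AddCommGroup Z] [Module k Z] {i : ℤ}
    (φ ψ : barOmX k A p c i →ₗ[k] Z)
    (H : ∀ (s : ℕ) (h : (s : ℤ) + c = i) x, φ (barOmT h x) = ψ (barOmT h x))
    (x : barOmX k A p c i) : φ x = ψ x := Bimod.pi_congr φ ψ (fun s x => H s.1 s.2 x) x

lemma barOmD_barOmT_succ {s : ℕ} {i j : ℤ} (hij : j + 1 = i) (h : ((s + 1 : ℕ) : ℤ) + c = i)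
    (h' : (s : ℤ) + c = j) (x : T k A (p + s + 1 + 1)) :
    barOmD k A p c i j hij (barOmT (s := s + 1) h x) = barOmT h' (dT k A (p + s + 1) x) :=
  Bimod.piMap_single (P := fun s : {s : ℕ // (s : ℤ) + c = i} => T k A (p + s.1 + 1))
    (Q := fun s : {s : ℕ // (s : ℤ) + c = j} => T k A (p + s.1 + 1))
    (fun s => ⟨s.1 + 1, by have := s.2; push_cast; omega⟩) (fun s => dT k A (p + s.1 + 1)) ⟨s, h'⟩ x

lemma barOmX_eq_zero {i : ℤ} (h : i < c) (x : barOmX k A p c i) : x = 0 :=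
  Bimod.pi_ext fun s => by
    have := s.2
    omega

/-- The map out of the degree `i` part of `Bar_*(Ω^p(A))` with given components. -/
noncomputable def barOmDesc {Z : Type*} [AddCommGroup Z] [Module k Z] {i : ℤ}
    (φ : ∀ s : ℕ, (s : ℤ) + c = i → (T k A (p + s + 1) →ₗ[k] Z)) : barOmX k A p c i →ₗ[k] Z :=
  Bimod.piDesc fun s => φ s.1 s.2

lemma barOmDesc_barOmT {Z : Type*} [AddCommGroup Z] [Module k Z] {i : ℤ}
    (φ : ∀ s : ℕ, (s : ℤ) + c = i → (T k A (p + s + 1) →ₗ[k] Z)) {s : ℕ} (h : (s : ℤ) + c = i)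
    (x : T k A (p + s + 1)) : barOmDesc φ (barOmT h x) = φ s h x :=
  Bimod.piDesc_single (P := fun s : {s : ℕ // (s : ℤ) + c = i} => T k A (p + s.1 + 1))
    (fun s => φ s.1 s.2) ⟨s, h⟩ x

end BarOm

/-- The bimodule `M`, placed in degree `c`. -/
def ptX (M : Bimod k A) (c i : ℤ) : Bimod k A := Bimod.pi fun _ : {_u : Unit // c = i} => M

/-- The inclusion of `M` into the degree `c` part. -/
def ptT (M : Bimod k A) {c i : ℤ} (h : c = i) : M →ₗ[k] ptX M c i :=
  Bimod.single (fun _ : {_u : Unit // c = i} => M) ⟨(), h⟩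

lemma isBimodMap_ptT (M : Bimod k A) {c i : ℤ} (h : c = i) : IsBimodMap (ptT M h) :=
  Bimod.isBimodMap_single (P := fun _ : {_u : Unit // c = i} => M) _

lemma ptX_congr {M : Bimod k A} {c i : ℤ} {Z : Type*} [AddCommGroup Z] [Module k Z]
    (φ ψ : ptX M c i →ₗ[k] Z) (H : ∀ h x, φ (ptT M h x) = ψ (ptT M h x)) (x : ptX M c i) :
    φ x = ψ x :=
  Bimod.pi_congr (P := fun _ : {_u : Unit // c = i} => M) φ ψ (fun ⟨⟨⟩, h⟩ x => H h x) x

lemma ptX_eq_zero {M : Bimod k A} {c i : ℤ} (h : c ≠ i) (x : ptX M c i) : x = 0 :=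
  Bimod.pi_ext fun u => (h u.2).elim

/-- The map out of `M` placed in one degree. -/
noncomputable def ptDesc {M : Bimod k A} {c i : ℤ} {Z : Type*} [AddCommGroup Z] [Module k Z]
    (φ : c = i → (M →ₗ[k] Z)) : ptX M c i →ₗ[k] Z := Bimod.piDesc fun u => φ u.2

lemma ptDesc_ptT {M : Bimod k A} {c i : ℤ} {Z : Type*} [AddCommGroup Z] [Module k Z]
    (φ : c = i → (M →ₗ[k] Z)) (h : c = i) (x : M) : ptDesc φ (ptT M h x) = φ h x :=
  Bimod.piDesc_single (P := fun _ : {_u : Unit // c = i} => M) (fun u => φ u.2) ⟨(), h⟩ x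

/-- The map from `Bar_*(A)` to `M` placed in degree `c` that is given by `φ` on `Bar_r(A)`. -/
def barToPt {M : Bimod k A} {c i j : ℤ} {r : ℕ} (hr : c = j → (r : ℤ) = i)
    (φ : T k A (r + 1) →ₗ[k] M) : barX k A i →ₗ[k] ptX M c j :=
  piMap (fun u : {_u : Unit // c = j} => (⟨r, hr u.2⟩ : {r : ℕ // (r : ℤ) = i})) (fun _ => φ)

lemma isBimodMap_barToPt {M : Bimod k A} {c i j : ℤ} {r : ℕ} {hr : c = j → (r : ℤ) = i}
    {φ : T k A (r + 1) →ₗ[k] M} (h : IsBimodMap φ) : IsBimodMap (barToPt hr φ) :=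
  isBimodMap_piMap (P := fun r : {r : ℕ // (r : ℤ) = i} => T k A (r.1 + 1))
    (σ := fun u : {_u : Unit // c = j} => (⟨r, hr u.2⟩ : {r : ℕ // (r : ℤ) = i})) fun _ => h

lemma barToPt_barD {M : Bimod k A} {c i j l : ℤ} {r : ℕ} {hr : c = l → (r : ℤ) = j}
    {φ : T k A (r + 1) →ₗ[k] M} (h : φ ∘ₗ dT k A (r + 1) = 0) (hj : j + 1 = i) (x : barX k A i) :
    barToPt hr φ (barD k A i j hj x) = 0 :=
  funext fun u : {_u : Unit // c = l} => LinearMap.congr_fun h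
    (x ⟨r + 1, by have := hr u.2; push_cast; omega⟩)

lemma barToPt_barT {M : Bimod k A} {c i j : ℤ} {r : ℕ} (hr : c = j → (r : ℤ) = i)
    (φ : T k A (r + 1) →ₗ[k] M) (h : (r : ℤ) = i) (hc : c = j) (x : T k A (r + 1)) :
    barToPt hr φ (barT h x) = ptT M hc (φ x) :=
  Bimod.piMap_single (P := fun r : {r : ℕ // (r : ℤ) = i} => T k A (r.1 + 1))
    (Q := fun _ : {_u : Unit // c = j} => M) (fun u => ⟨r, hr u.2⟩) (fun _ => φ) ⟨(), hc⟩ x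

lemma barToPt_of_ne {M : Bimod k A} {c i j : ℤ} {r : ℕ} (hr : c = j → (r : ℤ) = i)
    (φ : T k A (r + 1) →ₗ[k] M) (hi : (r : ℤ) ≠ i) (x : barX k A i) : barToPt hr φ x = 0 :=
  ptX_eq_zero (fun h => hi (hr h)) _

/-! ### Replacing the resolution of `Ω^p(A)` by `Ω^p(A)` -/

section Cone

variable {m p : ℕ}

variable (k A) in
/-- The identification of `Bar_{p+s}(A)` with `Bar_s(Ω^p(A))`. -/
def truncOm (p : ℕ) (c : ℤ) {i j : ℤ} (h : i + c = j + p) : barX k A i →ₗ[k] barOmX k A p c j :=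
  piMap (fun s : {s : ℕ // (s : ℤ) + c = j} =>
    (⟨p + s.1, by have := s.2; push_cast; omega⟩ : {r : ℕ // (r : ℤ) = i})) (fun _ => LinearMap.id)

lemma truncOm_barT {c i j : ℤ} (h : i + c = j + p) {s : ℕ} (h₁ : ((p + s : ℕ) : ℤ) = i)
    (h₂ : (s : ℤ) + c = j) (x : T k A (p + s + 1)) :
    truncOm k A p c h (barT h₁ x) = barOmT h₂ x :=
  Bimod.piMap_single (P := fun r : {r : ℕ // (r : ℤ) = i} => T k A (r.1 + 1))
    (Q := fun s : {s : ℕ // (s : ℤ) + c = j} => T k A (p + s.1 + 1))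
    (fun s => ⟨p + s.1, by have := s.2; push_cast; omega⟩) (fun _ => LinearMap.id) ⟨s, h₂⟩ x

lemma barOmD_truncOm {c i j i' j' : ℤ} (hi : i + c = j + p) (hj : i' + c = j' + p)
    (h : i' + 1 = i) (h' : j' + 1 = j) (x : barX k A i) :
    barOmD k A p c j j' h' (truncOm k A p c hi x) = truncOm k A p c hj (barD k A i i' h x) := rfl

/-- The data that define `cone`. -/
def coneData (θ : ∀ s, T k A (m + s + 1) →ₗ[k] T k A (p + s + 1)) (hθ : ∀ s, IsBimodMap (θ s))
    (h : ∀ s, θ s ∘ₗ dT k A (m + s + 1) = -(dT k A (p + s + 1) ∘ₗ θ (s + 1))) :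
    TwistData k A ((m : ℤ) - p - 1) where
  B := barX k A
  E := barOmX k A p (m - 1)
  dB := barD k A
  dE := barOmD k A p (m - 1)
  t i j h := piMap (fun s : {s : ℕ // (s : ℤ) + (m - 1) = j} =>
        (⟨m + s.1, by have := s.2; push_cast; omega⟩ : {r : ℕ // (r : ℤ) = i}))
      (fun s => θ s.1)
  ρ i j h := truncOm k A p (m - 1) (by omega)
  hdB _ _ _ := isBimodMap_piMap fun _ => isBimodMap_dT _
  hdE _ _ _ := isBimodMap_piMap fun _ => isBimodMap_dT _
  ht _ _ _ := isBimodMap_piMap fun s => hθ s.1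
  hρ _ _ _ := isBimodMap_piMap fun _ => ⟨fun _ _ => rfl, fun _ _ => rfl⟩
  dB_dB := barD_barD k A
  dE_dE := barOmD_barOmD k A p (m - 1)
  t_dB _ _ _ _ _ x := funext fun s =>
    (congrArg (· + _) (LinearMap.congr_fun (h s.1) (x ⟨m + s.1 + 1, _⟩))).trans
      (neg_add_cancel _)
  dE_ρ _ _ _ _ _ _ _ _ _ := rfl

/-- The data that define the twisted direct sum of `Bar_*(A)` and `Ω^p(A) ⊗ ε_{m-1}` given by a
cocycle. -/
def cocycleData (f : Cochain m (Om k A p)) (hf : IsCocycle f) :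
    TwistData k A ((m : ℤ) - p - 1) where
  B := barX k A
  E := ptX (Om k A p) (m - 1)
  dB := barD k A
  dE _ _ _ := 0
  -- The sign is dictated by the lifts: in the lowest degree d_p θ_i(f) = -f holds for both of them.
  t i j h := barToPt (r := m) (by omega) (-biext f)
  ρ i j h := barToPt (r := p) (by omega) (dOm k A p)
  hdB _ _ _ := isBimodMap_piMap fun _ => isBimodMap_dT _
  hdE _ _ _ := IsBimodMap.zero
  ht _ _ _ := isBimodMap_barToPt (isBimodMap_biext f).neg
  hρ _ _ _ := isBimodMap_barToPt (isBimodMap_dOm p)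
  dB_dB := barD_barD k A
  dE_dE _ _ _ _ _ _ := rfl
  t_dB _ _ _ _ _ x := by
    rw [barToPt_barD (by rw [LinearMap.neg_comp, biext_dT hf, neg_zero]), LinearMap.zero_apply,
      add_zero]
  dE_ρ _ _ _ _ _ _ _ _ x := by rw [barToPt_barD (dOm_dT p), LinearMap.zero_apply]

variable (θ : ∀ s, T k A (m + s + 1) →ₗ[k] T k A (p + s + 1)) (hθ : ∀ s, IsBimodMap (θ s))
  (h : ∀ s, θ s ∘ₗ dT k A (m + s + 1) = -(dT k A (p + s + 1) ∘ₗ θ (s + 1)))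
  (f : Cochain m (Om k A p)) (hf : IsCocycle f)
  (h₀ : ∀ x, dOm k A p (θ 0 x) = -biext f x)

variable (k A p) in
/-- The augmentation `Bar_*(Ω^p(A)) → Ω^p(A)`. -/
def augOm (c i : ℤ) : barOmX k A p c i →ₗ[k] ptX (Om k A p) c i :=
  piMap (fun u : {_u : Unit // c = i} => (⟨0, by have := u.2; push_cast; omega⟩ : {s : ℕ // (s : ℤ) + c = i}))
    (fun _ => (dOm k A p : T k A (p + 0 + 1) →ₗ[k] _))

lemma augOm_zero {c i : ℤ} (hc : c = i) (hs : ((0 : ℕ) : ℤ) + c = i) (x : T k A (p + 0 + 1)) :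
    augOm k A p c i (barOmT hs x) = ptT (Om k A p) hc (dOm k A p x) :=
  Bimod.piMap_single (P := fun s : {s : ℕ // (s : ℤ) + c = i} => T k A (p + s.1 + 1))
    (Q := fun _ : {_u : Unit // c = i} => Om k A p)
    (fun u => ⟨0, by have := u.2; push_cast; omega⟩) (fun _ => dOm k A p) ⟨(), hc⟩ x

/-- The morphism from the cone of a lift of a cocycle to the twisted direct sum. -/
def coneAug : DGMod.Hom (coneData θ hθ h).mod (cocycleData f hf).mod :=
  TwistData.map (D := coneData θ hθ h) (D' := cocycleData f hf) (fun _ => LinearMap.id)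
    (augOm k A p (m - 1)) (fun _ => ⟨fun _ _ => rfl, fun _ _ => rfl⟩)
    (fun _ => isBimodMap_piMap fun _ => isBimodMap_dOm p) (fun _ _ _ _ => rfl)
    (fun _ j _ x => funext fun u : {_u : Unit // (m : ℤ) - 1 = j} =>
      LinearMap.congr_fun (dOm_dT p) (x ⟨1, by have := u.2; push_cast; omega⟩))
    (fun i j _ x => funext fun u : {_u : Unit // (m : ℤ) - 1 = j} =>
      h₀ (x ⟨m + 0, by have := u.2; push_cast; omega⟩))
    (fun _ _ _ _ => rfl)

section Homotopy

variable (p) (ins : ∀ N, T k A N →ₗ[k] T k A (N + 1))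

open Classical in
/-- The homotopy on the part of `Bar_*(A)` in degrees at least `p` that is given by insertions. -/
noncomputable def barIns (i j : ℤ) : barX k A i →ₗ[k] barX k A j :=
  if hj : i + 1 = j then
    barDesc fun r h => if p ≤ r then barT (r := r + 1) (by push_cast; omega) ∘ₗ ins (r + 1) else 0
  else 0

variable {p} in
lemma barIns_of_le {r : ℕ} {i j : ℤ} (h : (r : ℤ) = i) (hj : i + 1 = j) (hr : p ≤ r)
    (x : T k A (r + 1)) : barIns p ins i j (barT h x) =
      barT (r := r + 1) (by push_cast; omega) (ins (r + 1) x) := by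
  rw [barIns, dif_pos hj, barDesc_barT, if_pos hr]
  rfl

variable {p} in
lemma barIns_of_lt {r : ℕ} {i j : ℤ} (h : (r : ℤ) = i) (hr : r < p)
    (x : T k A (r + 1)) : barIns p ins i j (barT h x) = 0 := by
  rw [barIns]
  split_ifs with hj
  · rw [barDesc_barT, if_neg (by omega), LinearMap.zero_apply]
  · rfl

variable {ins} in
lemma lin_barIns {S : Side} (hS : ∀ N, S.Lin (ins N)) (i j : ℤ) : S.Lin (barIns p ins i j) := by
  rw [barIns]
  split_ifs with hj
  · refine Bimod.lin_piDesc fun r => ?_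
    dsimp only
    split_ifs
    · exact (S.lin_of_isBimodMap (isBimodMap_barT _)).comp (hS _)
    · exact S.lin_zero
  · exact S.lin_zero

/-- The endomorphism of `Bar_*(A)` that is homotopic to the identity through insertions. -/
noncomputable def barTrunc (i : ℤ) : barX k A i →ₗ[k] barX k A i :=
  LinearMap.id - barD k A (i + 1) i rfl ∘ₗ barIns p ins i (i + 1) -
    barIns p ins (i - 1) i ∘ₗ barD k A i (i - 1) (by omega)

lemma barTrunc_apply {i j l : ℤ} (hj : i + 1 = j) (hl : l + 1 = i) (x : barX k A i) :
    barTrunc p ins i x = x - barD k A j i hj (barIns p ins i j x) -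
      barIns p ins l i (barD k A i l hl x) := by
  subst hj
  obtain rfl : l = i - 1 := by omega
  rfl

/-- The homotopy on `Bar_*(Ω^p(A))` that is given by insertions. -/
noncomputable def barOmIns (c i j : ℤ) : barOmX k A p c i →ₗ[k] barOmX k A p c j :=
  if hj : i + 1 = j then
    barOmDesc fun s h => barOmT (s := s + 1) (by push_cast; omega) ∘ₗ ins (p + s + 1)
  else 0

variable {p} in
lemma barOmIns_barOmT {s : ℕ} {c i j : ℤ} (h : (s : ℤ) + c = i) (hj : i + 1 = j)
    (x : T k A (p + s + 1)) : barOmIns p ins c i j (barOmT h x) =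
      barOmT (s := s + 1) (by push_cast; omega) (ins (p + s + 1) x) := by
  rw [barOmIns, dif_pos hj, barOmDesc_barOmT]
  rfl

variable {ins} in
lemma lin_barOmIns {S : Side} (hS : ∀ N, S.Lin (ins N)) (c i j : ℤ) :
    S.Lin (barOmIns p ins c i j) := by
  rw [barOmIns]
  split_ifs with hj
  · exact Bimod.lin_piDesc fun s => (S.lin_of_isBimodMap (isBimodMap_barOmT _)).comp (hS _)
  · exact S.lin_zero

/-- The section of the augmentation `Bar_*(Ω^p(A)) → Ω^p(A)` that is given by an insertion. -/
noncomputable def omIns (c i : ℤ) : ptX (Om k A p) c i →ₗ[k] barOmX k A p c i :=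
  ptDesc fun h => barOmT (s := 0) (by push_cast; omega) ∘ₗ
    (ins p ∘ₗ omIncl k A p : Om k A p →ₗ[k] T k A (p + 0 + 1))

variable {ins} in
lemma lin_omIns {S : Side} (hS : ∀ N, S.Lin (ins N)) (c i : ℤ) : S.Lin (omIns p ins c i) := by
  have h : S.Lin (ins p ∘ₗ omIncl k A p) :=
    (hS p).comp (S.lin_of_isBimodMap (isBimodMap_omIncl p))
  exact Bimod.lin_piDesc (P := fun _ : {_u : Unit // c = i} => Om k A p) fun u =>
    Side.Lin.comp (N := T k A (p + 0 + 1)) (S.lin_of_isBimodMap (isBimodMap_barOmT (s := 0)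
      (by have := u.2; push_cast; omega))) h

variable {p} in
lemma omIns_ptT {c i : ℤ} (h : c = i) (hs : ((0 : ℕ) : ℤ) + c = i) (x : Om k A p) :
    omIns p ins c i (ptT _ h x) = barOmT (s := 0) hs (ins p (omIncl k A p x)) :=
  ptDesc_ptT _ h x

variable {p ins}

lemma barTrunc_barD {i j : ℤ} (hij : j + 1 = i) (x : barX k A i) :
    barTrunc p ins j (barD k A i j hij x) = barD k A i j hij (barTrunc p ins i x) := by
  rw [barTrunc_apply p ins (show i + 1 = i + 1 from rfl) hij,
    barTrunc_apply p ins hij (show j - 1 + 1 = j by omega), barD_barD, map_zero, map_sub, map_sub,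
    barD_barD, sub_zero, sub_zero]

/-- The insertions on Bar_*(A) are switched off in degrees below p exactly so that ε, which
identifies the part of degree at least p with Bar_*(Ω^p(A)), intertwines the two homotopies. -/
lemma barOmIns_truncOm {c i j i' j' : ℤ} (hij : i + 1 = j) (hi : i + c = i' + p)
    (hj : j + c = j' + p) (x : barX k A i) : barOmIns p ins c i' j' (truncOm k A p c hi x) =
      truncOm k A p c hj (barIns p ins i j x) :=
  barX_congr (barOmIns p ins c i' j' ∘ₗ truncOm k A p c hi)
    (truncOm k A p c hj ∘ₗ barIns p ins i j) (fun r hr x => by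
      rw [LinearMap.comp_apply, LinearMap.comp_apply]
      by_cases hp : p ≤ r
      · obtain ⟨s, rfl⟩ := Nat.exists_eq_add_of_le hp
        have h₂ : (s : ℤ) + c = i' := by push_cast at hr; omega
        rw [truncOm_barT hi hr h₂, barIns_of_le ins hr hij hp,
          barOmIns_barOmT ins h₂ (show i' + 1 = j' by omega)]
        exact (truncOm_barT hj (s := s + 1) _ _ _).symm
      · rw [barIns_of_lt ins hr (by omega), map_zero,
          barOmX_eq_zero (show i' < c by omega) (truncOm k A p c hi _), map_zero]) x

/-- This is the contraction identity of the insertions, degree by degree. The term ins ∘ d is the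
homotopy after the differential in positive degrees, and the section after the augmentation in the
lowest degree. -/
lemma omIns_augOm (hins : ∀ N x, dT k A (N + 1) (ins (N + 1) x) = x - ins N (dT k A N x))
    {c i j l : ℤ} (hj : i + 1 = j) (hl : l + 1 = i) (x : barOmX k A p c i) :
    omIns p ins c i (augOm k A p c i x) + barOmD k A p c j i hj (barOmIns p ins c i j x) +
      barOmIns p ins c l i (barOmD k A p c i l hl x) = x :=
  barOmX_congr (omIns p ins c i ∘ₗ augOm k A p c i + barOmD k A p c j i hj ∘ₗ barOmIns p ins c i j +
    barOmIns p ins c l i ∘ₗ barOmD k A p c i l hl) LinearMap.id (fun s hs x => by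
      simp only [LinearMap.add_apply, LinearMap.comp_apply, LinearMap.id_apply]
      rw [barOmIns_barOmT ins hs hj, barOmD_barOmT_succ hj _ hs]
      cases s with
      | zero =>
        have hi : c = i := by simpa using hs
        rw [augOm_zero hi, omIns_ptT ins hi hs, barOmX_eq_zero (show l < c by omega)
          (barOmD k A p c i l hl (barOmT hs x)), map_zero, add_zero, ← map_add]
        refine congrArg _ ?_
        exact (congrArg (_ + ·) (hins p x)).trans (add_sub_cancel _ _)
      | succ s =>
        have hs' : (s : ℤ) + c = l := by push_cast at hs; omega
        rw [ptX_eq_zero (by push_cast at hs; omega) (augOm k A p c i (barOmT hs x)),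
          map_zero, zero_add, barOmD_barOmT_succ hl hs hs', barOmIns_barOmT ins hs' hl,
          ← map_add]
        refine congrArg _ ?_
        exact (congrArg (· + _) (hins (p + s + 1) x)).trans (sub_add_cancel _ _)) x

/-- An inverse of the augmentation that is compatible with ε cannot be the identity on Bar_*(A). The
section after d_p is ins ∘ d_p on Bar_p(A), and this is what 1 - dh - hd gives there when h consists
of insertions in degrees at least p; in higher degrees 1 - dh - hd vanishes. -/
lemma omIns_barToPt_dOm (hins : ∀ N x, dT k A (N + 1) (ins (N + 1) x) = x - ins N (dT k A N x))
    {c i j : ℤ} (hij : i + c = j + p) (hr : c = j → (p : ℤ) = i)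
    (x : barX k A i) : omIns p ins c j (barToPt hr (dOm k A p) x) =
      truncOm k A p c hij (barTrunc p ins i x) := by
  have hl : i - 1 + 1 = i := by omega
  have hl' : j - 1 + 1 = j := by omega
  have hi' : i - 1 + c = j - 1 + p := by omega
  have hj' : i + 1 + c = j + 1 + p := by omega
  have e := omIns_augOm hins (show j + 1 = j + 1 from rfl) hl' (truncOm k A p c hij x)
  rw [barOmD_truncOm hij hi' hl hl', barOmIns_truncOm hl hi' hij,
    barOmIns_truncOm rfl hij hj', barOmD_truncOm hj' hij rfl rfl] at e
  rw [barTrunc_apply p ins rfl hl, map_sub, map_sub]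
  rw [sub_sub, eq_sub_iff_add_eq, ← add_assoc]
  exact e

/-- Applying d to the contraction identity for y shows that d ins d y = d y, and the elements of
Ω^p(A) are exactly those of the form d y. -/
lemma augOm_omIns (hins : ∀ N x, dT k A (N + 1) (ins (N + 1) x) = x - ins N (dT k A N x))
    {c i : ℤ} (x : ptX (Om k A p) c i) :
    augOm k A p c i (omIns p ins c i x) = x :=
  ptX_congr (augOm k A p c i ∘ₗ omIns p ins c i) LinearMap.id (fun hc x => by
    rw [LinearMap.comp_apply, omIns_ptT ins hc (by push_cast; omega), augOm_zero hc,
      LinearMap.id_apply]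
    refine congrArg _ (Subtype.ext ?_)
    obtain ⟨_, y, rfl⟩ := x
    change dT k A p (ins p (dT k A p y)) = dT k A p y
    have e := congrArg (dT k A p) (hins p y)
    rw [map_sub, dT_dT_apply] at e
    exact (sub_eq_zero.1 e.symm).symm) x

end Homotopy

/-- If insertions contract the bar complex, the cone of a lift of a cocycle is homotopy equivalent
to the twisted direct sum. -/
lemma isHtpyEquiv_coneAug {S : Side} (ins : ∀ N, T k A N →ₗ[k] T k A (N + 1))
    (hS : ∀ N, S.Lin (ins N))
    (hins : ∀ N x, dT k A (N + 1) (ins (N + 1) x) = x - ins N (dT k A N x)) :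
    DGMod.IsHtpyEquiv S (coneAug θ hθ h f hf h₀) := by
  -- On Bar_*(A) the inverse is `barTrunc`, with the same insertions as homotopy on both sides. On
  -- the second summands the inverse is the section of the augmentation, and the composite on Ω^p(A)
  -- is the identity, so its homotopy is zero.
  refine TwistData.isHtpyEquiv_map (D := coneData θ hθ h) (D' := cocycleData f hf) _ _ _ _ _ _ _ _
    (barTrunc p ins) (omIns p ins (m - 1))
    (barIns p ins) (barOmIns p ins (m - 1)) (barIns p ins) (fun _ _ => 0)
    (fun i => ?_) (lin_omIns p hS _) (lin_barIns p hS) (lin_barOmIns p hS _) (lin_barIns p hS)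
    (fun _ _ => S.lin_zero) (fun i j hij x => barTrunc_barD hij x) (fun i j hij x => ?_)
    (fun i j hij x => omIns_barToPt_dOm hins (by omega) (by omega) x)
    (fun i j i' j' hij hi hj x => barOmIns_truncOm hij (by omega) (by omega) x)
    (fun i j i' j' hij hi hj x => (Eq.symm ?_)) (fun _ _ _ => rfl)
    (fun i j l hj hl (x : barX k A i) => ?_)
    (fun i j l hj hl x => omIns_augOm hins hj hl x) (fun i j l hj hl (x : barX k A i) => ?_)
    (fun i j l hj hl (x : ptX (Om k A p) (m - 1) i) => ?_)
  · have hd : ∀ i j hij, S.Lin (barD k A i j hij) := fun i j hij =>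
      S.lin_of_isBimodMap ((coneData θ hθ h).hdB i j hij)
    exact ((S.lin_id).sub ((hd _ _ _).comp (lin_barIns p hS _ _))).sub
      ((lin_barIns p hS _ _).comp (hd _ _ _))
  -- The section takes values in the lowest degree of Bar_*(Ω^p(A)), where the differential
  -- vanishes.
  · refine (map_zero _).trans (Eq.symm ?_)
    refine ptX_congr (barOmD k A p (m - 1) i j hij ∘ₗ omIns p ins (m - 1) i) 0 (fun hc x => ?_) x
    exact barOmX_eq_zero (by omega) _
  -- The insertions produce only elements of degree greater than p, while ε on the small module is
  -- nonzero only on Bar_p(A).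
  · revert x
    refine barX_congr (barToPt (r := p) (by omega) (dOm k A p) ∘ₗ barIns p ins i j) 0
      fun r hr x => ?_
    rw [LinearMap.comp_apply]
    by_cases hp : p ≤ r
    · rw [barToPt_of_ne _ _ (by omega), LinearMap.zero_apply]
    · rw [barIns_of_lt ins hr (by omega), map_zero, LinearMap.zero_apply]
  · change barTrunc p ins i x + barD k A j i hj (barIns p ins i j x) +
      barIns p ins l i (barD k A i l hl x) = x
    rw [barTrunc_apply p ins hj hl]
    abel
  · change barD k A j i hj (barIns p ins i j x) + barIns p ins l i (barD k A i l hl x) +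
      barTrunc p ins i x = x
    rw [barTrunc_apply p ins hj hl]
    abel
  · change 0 + 0 + augOm k A p (m - 1) i (omIns p ins (m - 1) i x) = x
    rw [augOm_omIns hins, add_zero, zero_add]

end Cone

end

end SingDef

/-! ### The two lifts of a cocycle and their one-sided contractions -/

namespace SingDef

section

variable {k : Type v} {A : Type u} [CommRing k] [Ring A] [Algebra k A]

/-- The map θ₁ is described by splitting off factors at the right end, whereas tensor powers are
built from the left; the induction reconciles the two. -/
lemma T_ext_snoc {Z : Type*} [AddCommGroup Z] [Module k Z] : ∀ {n : ℕ}
    {φ ψ : T k A (n + 1) →ₗ[k] Z}, (∀ x b, φ (snoc n x b) = ψ (snoc n x b)) → φ = ψ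
  | 0, _, _, h => T_hom_ext fun a x => h (show T k A 0 from a) (toA x)
  | n + 1, φ, ψ, h => T_hom_ext fun a x => by
      have := T_ext_snoc (φ := φ ∘ₗ consT (n + 1) a) (ψ := ψ ∘ₗ consT (n + 1) a) fun x b => by
        have := h (consT n a x) b
        rwa [snoc_succ] at this
      exact LinearMap.congr_fun this x

lemma splitT_snoc : ∀ (n : ℕ) (x : T k A n) (b : T k A 0),
    splitT n 0 (castT (by omega) (snoc n x (toA b))) = x ⊗ₜ b
  | 0, x, b => splitT_zero 0 (toA x) _
  | n + 1, x, b => by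
      refine consT_induction x ?_ (fun x y hx hy => ?_) fun a x => ?_
      · simp only [map_zero, LinearMap.zero_apply, TensorProduct.zero_tmul]
      · simp only [map_add, LinearMap.add_apply, TensorProduct.add_tmul, hx, hy]
      · have e : castT (by omega : n + 1 + 1 = 0 + (n + 1) + 1) (consT (n + 1) a (snoc n x (toA b))) =
            consT (0 + n + 1) a (castT (by omega) (snoc n x (toA b))) := castT_consT _ _ _ _
        rw [snoc_succ]
        refine (congrArg _ e).trans ((splitT_succ n 0 a _).trans ?_)
        rw [splitT_snoc n x b, LinearMap.rTensor_tmul]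

lemma concatT_eq_snoc : ∀ (n : ℕ) (x : T k A n) (b : T k A 0),
    castT (by omega) (concatT n 0 x b) = snoc n x (toA b)
  | 0, x, b => rfl
  | n + 1, x, b => by
      refine consT_induction x ?_ (fun x y hx hy => ?_) fun a x => ?_
      · simp only [map_zero, LinearMap.zero_apply]
      · simp only [map_add, LinearMap.add_apply, hx, hy]
      · have e : castT (by omega : 0 + (n + 1) + 1 = n + 1 + 1)
            (consT (0 + n + 1) a (concatT n 0 x b)) =
            consT (n + 1) a (castT (by omega) (concatT n 0 x b)) :=
          castT_consT _ _ _ _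
        rw [concatT_succ, snoc_succ]
        exact e.trans (congrArg _ (concatT_eq_snoc n x b))

/-- For p > 0 an element y of Ω^p(A) is a cycle, so only the last face of y ⊗ b contributes. For p =
0 the only face is the multiplication. -/
lemma dT_snoc_omIncl (p : ℕ) (y : Om k A p) (b : A) :
    dT k A p (snoc p (omIncl k A p y) b) = (-1 : ℤ) ^ p • op b • omIncl k A p y := by
  cases p with
  | zero =>
    rw [pow_zero, one_smul, snoc_zero, dT_zero]
    rfl
  | succ q => rw [dT_snoc, dT_omIncl, map_zero, LinearMap.zero_apply, zero_add]

section Lifts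

variable {m p : ℕ} (f : Cochain m (Om k A p))

/-- In the lowest degree the sign (-1)^(p+1) of θ₁ meets the sign (-1)^p of the last face of f(…) ⊗
b, and the product is -1. -/
lemma dOm_theta1 (x : T k A (m + 1)) : dOm k A p (theta1 f 0 x) = -biext f x := by
  refine LinearMap.congr_fun (f := dOm k A p ∘ₗ (theta1 f 0 : T k A (m + 1) →ₗ[k] T k A (p + 1)))
    (g := -biext f) (T_ext_snoc fun x b => Subtype.ext ?_) x
  obtain ⟨b, rfl⟩ : ∃ c : T k A 0, toA c = b := ⟨(show T k A 0 from b), rfl⟩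
  change dT k A p (theta1 f 0 (snoc m x (toA b))) = -omIncl k A p (biext f (snoc m x (toA b)))
  have e₁ : theta1 f 0 (snoc m x (toA b)) = ((p : ℤ) + 1).negOnePow • snoc p
      (omIncl k A p (biext f (snocOne m x))) (toA b) := by
    rw [← concatT_eq_snoc p]
    simp only [theta1, LinearMap.smul_apply, LinearMap.comp_apply, leftLift]
    rw [splitT_snoc, Nat.cast_zero, mul_zero, add_zero ((p : ℤ) + 1)]
    rfl
  rw [e₁, apply_snoc (isBimodMap_biext f).2, (isBimodMap_omIncl p).2]
  refine (map_zsmul (dT k A p) _ _).trans ?_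
  rw [dT_snoc_omIncl, smul_smul, Int.negOnePow_succ, Units.val_neg, neg_mul, neg_smul,
    DGMod.negOnePow_natCast, ← pow_add, Even.neg_one_pow ⟨p, rfl⟩, one_smul]

/-- Here f(…) lies to the right of a, so the surviving face is the first one, without sign, and the
-1 is the sign of θ₂ at s = 0. -/
lemma dOm_theta2 (x : T k A (m + 1)) : dOm k A p (theta2 f 0 x) = -biext f x := by
  refine LinearMap.congr_fun (f := dOm k A p ∘ₗ (theta2 f 0 : T k A (m + 1) →ₗ[k] T k A (p + 1)))
    (g := -biext f) (T_hom_ext fun a x => Subtype.ext ?_) x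
  change dT k A p (theta2 f 0 (consT m a x)) = -omIncl k A p (biext f (consT m a x))
  have e₁ : theta2 f 0 (consT m a x) = -consT p a (omIncl k A p (evalR m f x)) := by
    rw [theta2, LinearMap.smul_apply]
    refine (congrArg _ (whiskT_cons (omIncl k A p ∘ₗ evalR m f) 0 a x)).trans ?_
    rw [Nat.cast_zero, zero_add, Int.negOnePow_one]
    exact neg_one_smul ℤ _
  rw [e₁, map_neg, dT_consT_omIncl, biext_cons, (isBimodMap_omIncl p).1]

variable (hf : IsCocycle f)

/-- The morphism from `C(θ₁(f))` to the twisted direct sum given by `f`. -/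
def theta1Aug : DGMod.Hom (Ctheta1 f hf) (cocycleData f hf).mod :=
  coneAug (theta1 f) (isBimodMap_theta1 f) (theta1_anticomm hf) f hf (dOm_theta1 f)

/-- The morphism from `C(θ₂(f))` to the twisted direct sum given by `f`. -/
def theta2Aug : DGMod.Hom (Ctheta2 f hf) (cocycleData f hf).mod :=
  coneAug (theta2 f) (isBimodMap_theta2 f) (theta2_anticomm hf) f hf (dOm_theta2 f)

/-- Inserting 1 on the left is right linear. This is the side needed for the first factor of the
tensor product. -/
lemma isHtpyEquiv_theta1Aug : DGMod.IsHtpyEquiv .right (theta1Aug f hf) :=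
  isHtpyEquiv_coneAug _ _ _ f hf _ (fun N => consT N 1) (fun _ _ _ => rfl) fun N x => by
    rw [dT_cons, one_smul]

/-- Inserting 1 on the right is left linear, as the second factor requires. The sign (-1)^N
compensates the sign of the last face of the bar differential. -/
lemma isHtpyEquiv_theta2Aug : DGMod.IsHtpyEquiv .left (theta2Aug f hf) :=
  isHtpyEquiv_coneAug _ _ _ f hf _ (fun N => (-1 : ℤ) ^ N • snocOne N)
    (fun N => Side.Lin.zsmul (S := .left) _ fun a x => snoc_smul N a 1 x) fun N x => by
      have e := dT_snoc N x 1
      change dT k A (N + 1) (snocOne (N + 1) x) = snocOne N (dT k A N x) + _ at e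
      rw [LinearMap.smul_apply, LinearMap.smul_apply, map_zsmul, e, op_one, one_smul, smul_add,
        smul_smul, ← pow_add, Even.neg_one_pow ⟨N + 1, rfl⟩, one_smul, pow_succ, mul_neg_one,
        neg_smul]
      abel

end Lifts

end

end SingDef

namespace SingDef

section

variable {k : Type v} {A : Type u} [CommRing k] [Ring A] [Algebra k A]

/-! ### Components of elements -/

/-- The linear map out of `M ⊗_A N` given by a balanced bilinear map. -/
def balLift {M N : Bimod k A} {Z : Type*} [AddCommGroup Z] [Module k Z]
    (φ : M →ₗ[k] N →ₗ[k] Z) (h : ∀ (a : A) x y, φ (op a • x) y = φ x (a • y)) : M.bal N →ₗ[k] Z :=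
  (balRel M N).liftQ (TensorProduct.lift φ) (Submodule.span_le.2 (by
    rintro _ ⟨a, x, y, rfl⟩
    refine LinearMap.mem_ker.2 ?_
    rw [map_sub, TensorProduct.lift.tmul, TensorProduct.lift.tmul, h, sub_self]))

lemma balLift_balMk {M N : Bimod k A} {Z : Type*} [AddCommGroup Z] [Module k Z]
    (φ : M →ₗ[k] N →ₗ[k] Z) (h : ∀ (a : A) x y, φ (op a • x) y = φ x (a • y)) (x : M) (y : N) :
    balLift φ h (balMk M N x y) = φ x y := TensorProduct.lift.tmul x y

lemma bal_congr {M N : Bimod k A} {Z : Type*} [AddCommGroup Z] [Module k Z]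
    (φ ψ : M.bal N →ₗ[k] Z) (H : ∀ x y, φ (balMk M N x y) = ψ (balMk M N x y)) (z : M.bal N) :
    φ z = ψ z :=
  LinearMap.congr_fun (Submodule.linearMap_qext (balRel M N) (TensorProduct.ext' H) :
    (φ : ((M ⊗[k] N) ⧸ balRel M N) →ₗ[k] Z) = ψ) z

section Eval

variable {M : Bimod k A} {r : ℕ} (φ : T k A (r + 1) →ₗ[k] M)

/-- The map on the degree `i` part of `Bar_*(A)` that is `φ` if `i = r` and zero otherwise. -/
def barEval (i : ℤ) : barX k A i →ₗ[k] M :=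
  if h : (r : ℤ) = i then
    φ ∘ₗ Bimod.proj (fun r : {r : ℕ // (r : ℤ) = i} => T k A (r.1 + 1)) ⟨r, h⟩ else 0

lemma barEval_barT {i : ℤ} (h : (r : ℤ) = i) (x : T k A (r + 1)) :
    barEval φ i (barT h x) = φ x := by
  rw [barEval, dif_pos h]
  rfl

lemma barEval_of_ne {i : ℤ} (h : (r : ℤ) ≠ i) (x : barX k A i) : barEval φ i x = 0 := by
  rw [barEval, dif_neg h, LinearMap.zero_apply]

variable {φ} in
lemma isBimodMap_barEval (hφ : IsBimodMap φ) (i : ℤ) : IsBimodMap (barEval φ i) := by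
  rw [barEval]
  split_ifs with h
  · exact hφ.comp (Bimod.isBimodMap_proj _)
  · exact IsBimodMap.zero

variable {φ} in
lemma barEval_barD (hφ : φ ∘ₗ dT k A (r + 1) = 0) {i j : ℤ} (hij : j + 1 = i) (x : barX k A i) :
    barEval φ j (barD k A i j hij x) = 0 := by
  by_cases h : (r : ℤ) = j
  · have e : barEval φ j = φ ∘ₗ Bimod.proj (fun r : {r : ℕ // (r : ℤ) = j} => T k A (r.1 + 1))
      ⟨r, h⟩ := dif_pos h
    rw [e]
    exact LinearMap.congr_fun hφ (x ⟨r + 1, by push_cast; omega⟩)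
  · exact barEval_of_ne φ h _

variable (M) in
/-- The underlying element of `M` of an element in degree `c`. -/
def ptProj {c i : ℤ} (h : c = i) : ptX M c i →ₗ[k] M :=
  Bimod.proj (fun _ : {_u : Unit // c = i} => M) ⟨(), h⟩

variable (M) in
/-- The underlying element of `M` of an element of `M` placed in degree `c`. -/
def ptEval (c i : ℤ) : ptX M c i →ₗ[k] M := if h : c = i then ptProj M h else 0

lemma ptEval_ptT {c i : ℤ} (h : c = i) (x : M) : ptEval M c i (ptT M h x) = x := by
  rw [ptEval, dif_pos h]
  rfl

lemma ptEval_of_ne {c i : ℤ} (h : c ≠ i) (x : ptX M c i) : ptEval M c i x = 0 := by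
  rw [ptEval, dif_neg h, LinearMap.zero_apply]

lemma isBimodMap_ptEval (c i : ℤ) : IsBimodMap (ptEval M c i) := by
  rw [ptEval]
  split_ifs with h
  · exact ⟨fun _ _ => rfl, fun _ _ => rfl⟩
  · exact IsBimodMap.zero

variable (M) in
/-- The inclusion of `M` into the degree `c` part, and zero in other degrees. -/
def ptIn (c i : ℤ) : M →ₗ[k] ptX M c i := if h : c = i then ptT M h else 0

lemma ptIn_of_eq {c i : ℤ} (h : c = i) (x : M) : ptIn M c i x = ptT M h x := by
  rw [ptIn, dif_pos h]

lemma isBimodMap_ptIn (c i : ℤ) : IsBimodMap (ptIn M c i) := by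
  rw [ptIn]
  split_ifs with h
  · exact isBimodMap_ptT M h
  · exact IsBimodMap.zero

lemma barToPt_eq {c i j : ℤ} (hr : c = j → (r : ℤ) = i) (x : barX k A i) :
    barToPt hr φ x = ptIn M c j (barEval φ i x) := by
  by_cases hc : c = j
  · refine barX_congr (barToPt hr φ) (ptIn M c j ∘ₗ barEval φ i) (fun s hs x => ?_) x
    obtain rfl : s = r := by have := hr hc; omega
    rw [LinearMap.comp_apply, barToPt_barT hr φ hs hc, barEval_barT, ptIn_of_eq hc]
  · rw [ptX_eq_zero hc (barToPt hr φ x), ptX_eq_zero hc (ptIn M c j _)]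

lemma ptEval_barToPt {c i j : ℤ} (hr : c = j → (r : ℤ) = i) (hj : (r : ℤ) = i → c = j)
    (x : barX k A i) : ptEval M c j (barToPt hr φ x) = barEval φ i x := by
  rw [barToPt_eq]
  by_cases hc : c = j
  · rw [ptIn_of_eq hc, ptEval_ptT]
  · rw [ptEval_of_ne hc, barEval_of_ne φ fun h => hc (hj h)]

end Eval

/-! ### The tensor square of the bar complex -/

variable (k A) in
/-- The bar complex, with the zero action of `ε`. -/
def barMod (n : ℤ) : DGMod k A n where
  X := barX k A
  d i j := if h : j + 1 = i then barD k A i j h else 0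
  isBimodMap_d i j := by
    split_ifs with h
    · exact isBimodMap_piMap fun _ => isBimodMap_dT _
    · exact IsBimodMap.zero
  d_shape i j h := dif_neg h
  d_d i j l x := by
    by_cases h : j + 1 = i
    · by_cases h' : l + 1 = j
      · rw [dif_pos h, dif_pos h', barD_barD]
      · rw [dif_neg h', LinearMap.zero_apply]
    · rw [dif_neg h, LinearMap.zero_apply, map_zero]
  e _ _ := 0
  isBimodMap_e _ _ := IsBimodMap.zero
  e_shape _ _ _ := rfl
  e_e _ _ _ _ := rfl
  d_e _ _ _ _ _ _ _ := map_zero _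

lemma barMod_d {n i j : ℤ} (h : j + 1 = i) : (barMod k A n).d i j = barD k A i j h := dif_pos h

variable (k A) in
/-- The complex `Bar_*(A) ⊗_A Bar_*(A)`. -/
abbrev barSq (n : ℤ) : DGMod k A n := DGMod.tens (barMod k A n) (barMod k A n)

section SquareElements

variable {n : ℤ}

/-- The tensor `x ⊗ y` in `Bar_*(A) ⊗_A Bar_*(A)`. -/
def barSqT {l i j : ℤ} (h : i + j = l) : barX k A i →ₗ[k] barX k A j →ₗ[k] (barSq k A n).X l :=
  DGMod.tmul (barMod k A n) (barMod k A n) h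

lemma barSqT_op_smul {l i j : ℤ} (h : i + j = l) (a : A) (x : barX k A i) (y : barX k A j) :
    barSqT (n := n) h (op a • x) y = barSqT h x (a • y) :=
  DGMod.tmul_op_smul (M := barMod k A n) (N := barMod k A n) h a x y

lemma smul_barSqT {l i j : ℤ} (h : i + j = l) (a : A) (x : barX k A i) (y : barX k A j) :
    a • barSqT (n := n) h x y = barSqT h (a • x) y :=
  DGMod.smul_tmul (M := barMod k A n) (N := barMod k A n) h a x y

lemma op_smul_barSqT {l i j : ℤ} (h : i + j = l) (a : A) (x : barX k A i) (y : barX k A j) :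
    op a • barSqT (n := n) h x y = barSqT h x (op a • y) :=
  DGMod.op_smul_tmul (M := barMod k A n) (N := barMod k A n) h a x y

lemma barSq_d_barSqT {l l' i j i' j' : ℤ} (hl : l' + 1 = l) (h : i + j = l) (hi : i' + 1 = i)
    (hj : j' + 1 = j) (h₁ : i' + j = l') (h₂ : i + j' = l') (x : barX k A i) (y : barX k A j) :
    (barSq k A n).d l l' (barSqT h x y) =
      barSqT h₁ (barD k A i i' hi x) y +
        (i.negOnePow : ℤ) • barSqT h₂ x (barD k A j j' hj y) := by
  have e := DGMod.tens_d_tmul (barMod k A n) (barMod k A n) hl h h₁ h₂ x y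
  rw [barMod_d hi, barMod_d hj] at e
  exact e

lemma barSq_congr {Z : Type*} [AddCommGroup Z] [Module k Z] {l : ℤ}
    (φ ψ : (barSq k A n).X l →ₗ[k] Z)
    (H : ∀ (i j : ℤ) (h : i + j = l) x y, φ (barSqT h x y) = ψ (barSqT h x y))
    (z : (barSq k A n).X l) : φ z = ψ z :=
  DGMod.tens_congr (M := barMod k A n) (N := barMod k A n) φ ψ H z

/-- The linear map out of `Bar_*(A) ⊗_A Bar_*(A)` given by balanced bilinear maps. -/
def barSqLift {Z : Type*} [AddCommGroup Z] [Module k Z] {l : ℤ}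
    (Φ : ∀ i j : ℤ, i + j = l → barX k A i →ₗ[k] barX k A j →ₗ[k] Z)
    (hA : ∀ (i j : ℤ) (h : i + j = l) (a : A) x y, Φ i j h (op a • x) y = Φ i j h x (a • y)) :
    (barSq k A n).X l →ₗ[k] Z :=
  DGMod.tensLift (M := barMod k A n) (N := barMod k A n) Φ hA
    -- Since ε acts by zero on the bar complex, its relation holds trivially, and the tensor product
    -- over A ⊗ R is the one over A.
    (fun i j i' j' h h' _ _ _ =>
      (LinearMap.congr_fun (map_zero (Φ i' j h)) _).trans
        ((congrArg _ (map_zero (Φ i j' h' _))).trans (smul_zero _)).symm)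

lemma barSqLift_barSqT {Z : Type*} [AddCommGroup Z] [Module k Z] {l : ℤ}
    (Φ : ∀ i j : ℤ, i + j = l → barX k A i →ₗ[k] barX k A j →ₗ[k] Z) (hA) {i j : ℤ}
    (h : i + j = l) (x : barX k A i) (y : barX k A j) :
    barSqLift (n := n) Φ hA (barSqT h x y) = Φ i j h x y :=
  DGMod.tensLift_tmul (M := barMod k A n) (N := barMod k A n) Φ _ _ h x y

lemma isBimodMap_of_barSqT {l : ℤ} {Z : Bimod k A} {φ : (barSq k A n).X l →ₗ[k] Z}
    (hl : ∀ (i j : ℤ) (h : i + j = l) (a : A) x y,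
      φ (barSqT h (a • x) y) = a • φ (barSqT h x y))
    (hr : ∀ (i j : ℤ) (h : i + j = l) (a : A) x y,
      φ (barSqT h x (op a • y)) = op a • φ (barSqT h x y)) : IsBimodMap φ :=
  DGMod.isBimodMap_of_tmul (M := barMod k A n) (N := barMod k A n) hl hr

end SquareElements

section Cross

variable {n : ℤ} {M N : Bimod k A} {r s : ℕ} (φ : T k A (r + 1) →ₗ[k] M)
  (ψ : T k A (s + 1) →ₗ[k] N) (hφ : IsBimodMap φ) (hψ : IsBimodMap ψ)

variable (n) in
/-- The map `φ ⊗_A ψ` on `Bar_*(A) ⊗_A Bar_*(A)`. -/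
def cross (c l l' : ℤ) : (barSq k A n).X l →ₗ[k] ptX (M.bal N) c l' :=
  barSqLift (fun i j _ => ((balMk M N).compl₁₂ (barEval φ i) (barEval ψ j)).compr₂
      (ptIn (M.bal N) c l'))
    (fun i j _ a x y => by
      simp only [LinearMap.compr₂_apply, LinearMap.compl₁₂_apply]
      rw [(isBimodMap_barEval hφ i).2, (isBimodMap_barEval hψ j).1, balMk_balanced])

lemma cross_barSqT {c l l' i j : ℤ} (h : i + j = l) (x : barX k A i) (y : barX k A j) :
    cross n φ ψ hφ hψ c l l' (barSqT h x y) =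
      ptIn (M.bal N) c l' (balMk M N (barEval φ i x) (barEval ψ j y)) :=
  barSqLift_barSqT _ _ h x y

lemma isBimodMap_cross (c l l' : ℤ) : IsBimodMap (cross n φ ψ hφ hψ c l l') :=
  isBimodMap_of_barSqT
    (fun i j h a x y => by
      rw [cross_barSqT, cross_barSqT, (isBimodMap_barEval hφ i).1, smul_balMk,
        (isBimodMap_ptIn c l').1])
    (fun i j h a x y => by
      rw [cross_barSqT, cross_barSqT, (isBimodMap_barEval hψ j).2, op_smul_balMk,
        (isBimodMap_ptIn c l').2])

/-- Both terms of the tensor differential vanish, because φ and ψ each kill boundaries; no sign has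
to be compared. This makes both the twisting map and the action of ε on the product well defined. -/
lemma cross_d (hφ₀ : φ ∘ₗ dT k A (r + 1) = 0) (hψ₀ : ψ ∘ₗ dT k A (s + 1) = 0) {c l l' l'' : ℤ}
    (hl : l' + 1 = l) (z : (barSq k A n).X l) :
    cross n φ ψ hφ hψ c l' l'' ((barSq k A n).d l l' z) = 0 :=
  barSq_congr (cross n φ ψ hφ hψ c l' l'' ∘ₗ (barSq k A n).d l l') 0 (fun i j h x y => by
      rw [LinearMap.comp_apply, barSq_d_barSqT (i' := i - 1) (j' := j - 1) hl h (by omega)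
        (by omega) (by omega) (by omega), map_add, map_zsmul, cross_barSqT, cross_barSqT,
        barEval_barD hφ₀, barEval_barD hψ₀]
      simp) z

end Cross

section Product

variable {m p : ℕ} (f g : Cochain m (Om k A p)) (hf : IsCocycle f) (hg : IsCocycle g)

/-- The data that define the twisted direct sum of `Bar_*(A) ⊗_A Bar_*(A)` and
`(Ω^p(A) ⊗_A Ω^p(A)) ⊗ ε_{m+p-1}`. -/
def productData : TwistData k A ((m : ℤ) - p - 1) where
  B := (barSq k A (m - p - 1)).X
  E := ptX ((Om k A p).bal (Om k A p)) (m + p - 1)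
  dB i j _ := (barSq k A (m - p - 1)).d i j
  dE _ _ _ := 0
  t i j _ := -(((m * p : ℤ).negOnePow : ℤ) •
      cross _ (biext f) (dOm k A p) (isBimodMap_biext f) (isBimodMap_dOm p) (m + p - 1) i j +
    ((p : ℤ).negOnePow : ℤ) •
      cross _ (dOm k A p) (biext g) (isBimodMap_dOm p) (isBimodMap_biext g) (m + p - 1) i j)
  ρ i j _ := cross _ (dOm k A p) (dOm k A p) (isBimodMap_dOm p) (isBimodMap_dOm p) (m + p - 1) i j
  hdB _ _ _ := DGMod.isBimodMap_d _ _ _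
  hdE _ _ _ := IsBimodMap.zero
  ht _ _ _ := (((isBimodMap_cross _ _ _ _ _ _ _).zsmul _).add
    ((isBimodMap_cross _ _ _ _ _ _ _).zsmul _)).neg
  hρ _ _ _ := isBimodMap_cross _ _ _ _ _ _ _
  dB_dB _ _ _ _ _ _ := DGMod.d_d _ _ _ _ _
  dE_dE _ _ _ _ _ _ := rfl
  t_dB _ _ _ h _ x := by
    rw [LinearMap.zero_apply, add_zero, LinearMap.neg_apply, LinearMap.add_apply,
      LinearMap.smul_apply, LinearMap.smul_apply, cross_d _ _ _ _ (biext_dT hf) (dOm_dT p) h,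
      cross_d _ _ _ _ (dOm_dT p) (biext_dT hg) h, smul_zero, smul_zero, add_zero, neg_zero]
  dE_ρ _ _ _ _ h _ _ _ x := by
    rw [cross_d _ _ _ _ (dOm_dT p) (dOm_dT p) h, LinearMap.zero_apply]

end Product

end

end SingDef

namespace SingDef

section

variable {k : Type v} {A : Type u} [CommRing k] [Ring A] [Algebra k A] {m p : ℕ}

/-! ### Components of the twisted direct sum given by a cocycle -/

section Cocycle

variable (f : Cochain m (Om k A p)) (hf : IsCocycle f)

/-- The component in the bar complex. -/
def cocBar (i : ℤ) : (cocycleData f hf).mod.X i →ₗ[k] barX k A i := (cocycleData f hf).fst i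

/-- The image in `Ω^p(A)` of the component in the bar complex. -/
def cocAug (i : ℤ) : (cocycleData f hf).mod.X i →ₗ[k] Om k A p :=
  barEval (dOm k A p) i ∘ₗ cocBar f hf i

/-- The second component. -/
def cocSnd (i : ℤ) : (cocycleData f hf).mod.X i →ₗ[k] ptX (Om k A p) (m - 1) i :=
  (cocycleData f hf).snd i

/-- The component in `Ω^p(A)`. -/
def cocOm (i : ℤ) : (cocycleData f hf).mod.X i →ₗ[k] Om k A p :=
  ptEval (Om k A p) (m - 1) i ∘ₗ cocSnd f hf i

/-- The inclusion of the bar complex. -/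
def cocInl (i : ℤ) : barX k A i →ₗ[k] (cocycleData f hf).mod.X i := (cocycleData f hf).inl i

/-- The inclusion of the second summand. -/
def cocPt (i : ℤ) : ptX (Om k A p) (m - 1) i →ₗ[k] (cocycleData f hf).mod.X i :=
  (cocycleData f hf).inr i

/-- The inclusion of `Ω^p(A)`, which is zero except in one degree. -/
def cocInr (i : ℤ) : Om k A p →ₗ[k] (cocycleData f hf).mod.X i :=
  cocPt f hf i ∘ₗ ptIn (Om k A p) (m - 1) i

lemma isBimodMap_cocBar (i : ℤ) : IsBimodMap (cocBar f hf i) := (cocycleData f hf).isBimodMap_fst i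

lemma isBimodMap_cocAug (i : ℤ) : IsBimodMap (cocAug f hf i) :=
  (isBimodMap_barEval (isBimodMap_dOm p) i).comp (isBimodMap_cocBar f hf i)

lemma isBimodMap_cocOm (i : ℤ) : IsBimodMap (cocOm f hf i) :=
  (isBimodMap_ptEval _ i).comp ((cocycleData f hf).isBimodMap_snd i)

lemma isBimodMap_cocInl (i : ℤ) : IsBimodMap (cocInl f hf i) :=
  (cocycleData f hf).isBimodMap_inl i

lemma isBimodMap_cocInr (i : ℤ) : IsBimodMap (cocInr f hf i) :=
  ((cocycleData f hf).isBimodMap_inr i).comp (isBimodMap_ptIn _ i)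

lemma cocBar_inl (i : ℤ) (x : barX k A i) : cocBar f hf i (cocInl f hf i x) = x := rfl

lemma cocBar_inr (i : ℤ) (x : Om k A p) : cocBar f hf i (cocInr f hf i x) = 0 := rfl

lemma cocAug_inl (i : ℤ) (x : barX k A i) :
    cocAug f hf i (cocInl f hf i x) = barEval (dOm k A p) i x := rfl

lemma cocAug_inr (i : ℤ) (x : Om k A p) : cocAug f hf i (cocInr f hf i x) = 0 :=
  map_zero (barEval (dOm k A p) i)

lemma cocOm_inl (i : ℤ) (x : barX k A i) : cocOm f hf i (cocInl f hf i x) = 0 :=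
  map_zero (ptEval (Om k A p) (m - 1) i)

lemma cocOm_inr {i : ℤ} (h : (m : ℤ) - 1 = i) (x : Om k A p) :
    cocOm f hf i (cocInr f hf i x) = x := by
  change ptEval (Om k A p) (m - 1) i (ptIn (Om k A p) (m - 1) i x) = x
  rw [ptIn_of_eq h, ptEval_ptT]

lemma cocInr_of_ne {i : ℤ} (h : (m : ℤ) - 1 ≠ i) (x : Om k A p) : cocInr f hf i x = 0 := by
  rw [cocInr, LinearMap.comp_apply, ptX_eq_zero h (ptIn (Om k A p) (m - 1) i x), map_zero]

lemma cocAug_of_ne {i : ℤ} (h : (p : ℤ) ≠ i) (x : (cocycleData f hf).mod.X i) :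
    cocAug f hf i x = 0 := barEval_of_ne _ h _

lemma coc_eq_add (i : ℤ) (x : (cocycleData f hf).mod.X i) :
    x = cocInl f hf i (cocBar f hf i x) + cocInr f hf i (cocOm f hf i x) := by
  refine ((cocycleData f hf).eq_add i x).trans (congrArg (cocInl f hf i (cocBar f hf i x) + ·)
    (congrArg (cocPt f hf i) ?_))
  change cocSnd f hf i x = ptIn _ _ _ (ptEval _ _ _ (cocSnd f hf i x))
  generalize cocSnd f hf i x = y
  refine (ptX_congr (ptIn (Om k A p) (m - 1) i ∘ₗ ptEval (Om k A p) (m - 1) i) LinearMap.id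
    (fun h x => ?_) y).symm
  rw [LinearMap.comp_apply, ptEval_ptT, ptIn_of_eq h, LinearMap.id_apply]

lemma cocBar_d {i j : ℤ} (h : j + 1 = i) (x : (cocycleData f hf).mod.X i) :
    cocBar f hf j ((cocycleData f hf).mod.d i j x) = barD k A i j h (cocBar f hf i x) :=
  (cocycleData f hf).fst_d h x

lemma cocAug_d {i j : ℤ} (h : j + 1 = i) (x : (cocycleData f hf).mod.X i) :
    cocAug f hf j ((cocycleData f hf).mod.d i j x) = 0 := by
  rw [cocAug, LinearMap.comp_apply, cocBar_d f hf h, barEval_barD (dOm_dT p)]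

lemma barEval_neg {M : Bimod k A} {r : ℕ} (φ : T k A (r + 1) →ₗ[k] M) (i : ℤ) (x : barX k A i) :
    barEval (-φ) i x = -barEval φ i x := by
  by_cases h : (r : ℤ) = i
  · rw [barEval, barEval, dif_pos h, dif_pos h]
    rfl
  · rw [barEval_of_ne _ h, barEval_of_ne _ h, neg_zero]

lemma cocOm_d {i j : ℤ} (h : j + 1 = i) (x : (cocycleData f hf).mod.X i) :
    cocOm f hf j ((cocycleData f hf).mod.d i j x) = -barEval (biext f) i (cocBar f hf i x) := by
  refine (congrArg (ptEval (Om k A p) (m - 1) j)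
    (((cocycleData f hf).snd_d h x).trans (add_zero _))).trans ?_
  exact (ptEval_barToPt (-biext f) (by omega) (by omega) _).trans (barEval_neg _ _ _)

lemma cocBar_e (i j : ℤ) (x : (cocycleData f hf).mod.X i) :
    cocBar f hf j ((cocycleData f hf).mod.e i j x) = 0 := (cocycleData f hf).fst_e i j x

lemma cocAug_e (i j : ℤ) (x : (cocycleData f hf).mod.X i) :
    cocAug f hf j ((cocycleData f hf).mod.e i j x) = 0 := by
  rw [cocAug, LinearMap.comp_apply, cocBar_e, map_zero]

lemma cocOm_e {i j : ℤ} (h : i + ((m : ℤ) - p - 1) = j) (x : (cocycleData f hf).mod.X i) :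
    cocOm f hf j ((cocycleData f hf).mod.e i j x) = cocAug f hf i x := by
  refine (congrArg (ptEval (Om k A p) (m - 1) j) ((cocycleData f hf).snd_e h x)).trans ?_
  exact ptEval_barToPt (dOm k A p) (by omega) (by omega) _

lemma coc_e {i j : ℤ} (h : i + ((m : ℤ) - p - 1) = j) (x : (cocycleData f hf).mod.X i) :
    (cocycleData f hf).mod.e i j x = cocInr f hf j (cocAug f hf i x) := by
  rw [coc_eq_add f hf j ((cocycleData f hf).mod.e i j x), cocBar_e, cocOm_e f hf h, map_zero,
    zero_add]

end Cocycle

/-! ### The tensor product of the twisted direct sums given by two cocycles -/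

section Product

variable (f g : Cochain m (Om k A p)) (hf : IsCocycle f) (hg : IsCocycle g)

/-- The component in the bar complexes. -/
def prodInl (l : ℤ) : (barSq k A ((m : ℤ) - p - 1)).X l →ₗ[k] (productData f g hf hg).mod.X l :=
  (productData f g hf hg).inl l

/-- The inclusion of the second summand. -/
def prodPt (l : ℤ) : ptX ((Om k A p).bal (Om k A p)) (m + p - 1) l →ₗ[k]
    (productData f g hf hg).mod.X l := (productData f g hf hg).inr l

/-- The inclusion of `Ω^p(A) ⊗_A Ω^p(A)`, which is zero except in one degree. -/
def prodInr (l : ℤ) : (Om k A p).bal (Om k A p) →ₗ[k] (productData f g hf hg).mod.X l :=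
  prodPt f g hf hg l ∘ₗ ptIn ((Om k A p).bal (Om k A p)) (m + p - 1) l

lemma isBimodMap_prodInl (l : ℤ) : IsBimodMap (prodInl f g hf hg l) :=
  (productData f g hf hg).isBimodMap_inl l

lemma isBimodMap_prodInr (l : ℤ) : IsBimodMap (prodInr f g hf hg l) :=
  ((productData f g hf hg).isBimodMap_inr l).comp (isBimodMap_ptIn _ l)

lemma prod_d_inl {l l' i j i' j' : ℤ} (hl : l' + 1 = l) (h : i + j = l) (hi : i' + 1 = i)
    (hj : j' + 1 = j) (h₁ : i' + j = l') (h₂ : i + j' = l') (x : barX k A i) (y : barX k A j) :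
    (productData f g hf hg).mod.d l l' (prodInl f g hf hg l (barSqT h x y)) =
      prodInl f g hf hg l' (barSqT h₁ (barD k A i i' hi x) y +
        (i.negOnePow : ℤ) • barSqT h₂ x (barD k A j j' hj y)) -
      prodInr f g hf hg l' (((m * p : ℤ).negOnePow : ℤ) •
          balMk _ _ (barEval (biext f) i x) (barEval (dOm k A p) j y) +
        ((p : ℤ).negOnePow : ℤ) •
          balMk _ _ (barEval (dOm k A p) i x) (barEval (biext g) j y)) := by
  refine ((productData f g hf hg).d_inl hl _).trans ((congrArg₂ (· + ·)
    (congrArg (prodInl f g hf hg l') (barSq_d_barSqT hl h hi hj h₁ h₂ x y))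
    ((congrArg (prodPt f g hf hg l') ?_).trans (map_neg (prodInr f g hf hg l') _))).trans
      (sub_eq_add_neg _ _).symm)
  rw [map_neg, map_add, map_zsmul, map_zsmul, ← cross_barSqT (n := (m : ℤ) - p - 1) _ _
    (isBimodMap_biext f) (isBimodMap_dOm p) h, ← cross_barSqT (n := (m : ℤ) - p - 1) _ _
    (isBimodMap_dOm p) (isBimodMap_biext g) h]
  rfl

lemma prod_d_inr {l l' : ℤ} (hl : l' + 1 = l) (w : (Om k A p).bal (Om k A p)) :
    (productData f g hf hg).mod.d l l' (prodInr f g hf hg l w) = 0 :=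
  ((productData f g hf hg).d_inr hl _).trans (map_zero _)

lemma prod_e_inl {l l' i j : ℤ} (hl : l + ((m : ℤ) - p - 1) = l') (h : i + j = l)
    (x : barX k A i) (y : barX k A j) :
    (productData f g hf hg).mod.e l l' (prodInl f g hf hg l (barSqT h x y)) =
      prodInr f g hf hg l'
        (balMk _ _ (barEval (dOm k A p) i x) (barEval (dOm k A p) j y)) :=
  ((productData f g hf hg).e_inl hl _).trans (congrArg (prodPt f g hf hg l')
    (cross_barSqT _ _ (isBimodMap_dOm p) (isBimodMap_dOm p) h x y))

lemma prod_e_inr (l l' : ℤ) (w : (Om k A p).bal (Om k A p)) :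
    (productData f g hf hg).mod.e l l' (prodInr f g hf hg l w) = 0 :=
  (productData f g hf hg).e_inr l l' _

lemma prodInr_of_ne {l : ℤ} (h : (m : ℤ) + p - 1 ≠ l) (w : (Om k A p).bal (Om k A p)) :
    prodInr f g hf hg l w = 0 := by
  rw [prodInr, LinearMap.comp_apply,
    ptX_eq_zero h (ptIn ((Om k A p).bal (Om k A p)) (m + p - 1) l w), map_zero]

lemma product_congr {Z : Type*} [AddCommGroup Z] [Module k Z] {l : ℤ}
    (φ ψ : (productData f g hf hg).mod.X l →ₗ[k] Z)
    (H₁ : ∀ (i j : ℤ) (h : i + j = l) x y,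
      φ (prodInl f g hf hg l (barSqT h x y)) = ψ (prodInl f g hf hg l (barSqT h x y)))
    (H₂ : (m : ℤ) + p - 1 = l → ∀ x y,
      φ (prodInr f g hf hg l (balMk _ _ x y)) = ψ (prodInr f g hf hg l (balMk _ _ x y)))
    (z : (productData f g hf hg).mod.X l) : φ z = ψ z := by
  rw [(productData f g hf hg).eq_add l z, map_add, map_add]
  refine congrArg₂ (· + ·) (barSq_congr (φ ∘ₗ prodInl f g hf hg l) (ψ ∘ₗ prodInl f g hf hg l) H₁ _)
    (ptX_congr (φ ∘ₗ prodPt f g hf hg l) (ψ ∘ₗ prodPt f g hf hg l)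
      (fun h w => ?_) ((productData f g hf hg).snd l z))
  have e := bal_congr (φ ∘ₗ prodInr f g hf hg l) (ψ ∘ₗ prodInr f g hf hg l) (H₂ h) w
  rw [LinearMap.comp_apply, LinearMap.comp_apply, prodInr, LinearMap.comp_apply,
    ptIn_of_eq h] at e
  exact e

/-- The number p (p + 1) is even. The sign on the left arises when ε is moved past an element of
degree p, and the one on the right is the Koszul sign in the twisting map of C₆. -/
lemma negOnePow_twist (m p : ℕ) :
    (((m : ℤ) - p - 1) * p).negOnePow = ((m : ℤ) * p).negOnePow := by
  rw [Int.negOnePow_eq_iff]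
  have h : Even ((p : ℤ) * (p + 1)) := Int.even_mul_succ_self _
  have e : ((m : ℤ) - p - 1) * p - m * p = -(p * (p + 1)) := by ring
  rw [e]
  exact h.neg

/-- The components of the comparison morphism. -/
def prodBil {l i j : ℤ} (h : i + j = l) : (cocycleData f hf).mod.X i →ₗ[k]
    (cocycleData g hg).mod.X j →ₗ[k] (productData f g hf hg).mod.X l :=
  ((barSqT h).compl₁₂ (cocBar f hf i) (cocBar g hg j)).compr₂ (prodInl f g hf hg l) +
  (((m * p : ℤ).negOnePow : ℤ) •
      (balMk (Om k A p) (Om k A p)).compl₁₂ (cocOm f hf i) (cocAug g hg j) +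
    (balMk (Om k A p) (Om k A p)).compl₁₂ (cocAug f hf i) (cocOm g hg j)).compr₂
      (prodInr f g hf hg l)

lemma prodBil_apply {l i j : ℤ} (h : i + j = l) (z : (cocycleData f hf).mod.X i)
    (w : (cocycleData g hg).mod.X j) : prodBil f g hf hg h z w =
      prodInl f g hf hg l (barSqT h (cocBar f hf i z) (cocBar g hg j w)) +
      prodInr f g hf hg l (((m * p : ℤ).negOnePow : ℤ) •
          balMk _ _ (cocOm f hf i z) (cocAug g hg j w) +
        balMk _ _ (cocAug f hf i z) (cocOm g hg j w)) := rfl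

/-- The comparison map in one degree. -/
def prodMapX (l : ℤ) : (DGMod.tens (cocycleData f hf).mod (cocycleData g hg).mod).X l →ₗ[k]
    (productData f g hf hg).mod.X l :=
  DGMod.tensLift (fun _ _ h => prodBil f g hf hg h)
    (fun i j h a x y => by
      rw [prodBil_apply, prodBil_apply, (isBimodMap_cocBar f hf i).2, (isBimodMap_cocOm f hf i).2,
        (isBimodMap_cocAug f hf i).2, (isBimodMap_cocBar g hg j).1, (isBimodMap_cocOm g hg j).1,
        (isBimodMap_cocAug g hg j).1, barSqT_op_smul, balMk_balanced, balMk_balanced])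
    (fun i j i' j' h h' hi x y => by
      rw [prodBil_apply, prodBil_apply, cocBar_e, cocBar_e, cocOm_e f hf hi,
        cocOm_e g hg (show j + ((m : ℤ) - p - 1) = j' by omega), cocAug_e, cocAug_e]
      simp only [map_zero, LinearMap.zero_apply, zero_add, add_zero, smul_zero]
      -- Both sides are multiples of d_p x ⊗ d_p y, which vanishes unless y has degree p. In that
      -- degree the sign of the relation for ε is (-1)^(mp).
      by_cases hj : (p : ℤ) = j
      · subst hj
        rw [negOnePow_twist, map_zsmul]
      · rw [cocAug_of_ne g hg hj]
        simp only [map_zero, smul_zero])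

lemma prodMapX_tmul {l i j : ℤ} (h : i + j = l) (z : (cocycleData f hf).mod.X i)
    (w : (cocycleData g hg).mod.X j) :
    prodMapX f g hf hg l (DGMod.tmul _ _ h z w) = prodBil f g hf hg h z w :=
  DGMod.tensLift_tmul _ _ _ h z w

/-- The morphism from the tensor product of the twisted direct sums given by two cocycles. -/
def prodComparison : DGMod.Hom (DGMod.tens (cocycleData f hf).mod (cocycleData g hg).mod)
    (productData f g hf hg).mod where
  f := prodMapX f g hf hg
  isBimodMap_f l := DGMod.isBimodMap_of_tmul
    (fun i j h a x y => by
      rw [prodMapX_tmul, prodMapX_tmul, prodBil_apply, prodBil_apply, (isBimodMap_cocBar f hf i).1,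
        (isBimodMap_cocOm f hf i).1, (isBimodMap_cocAug f hf i).1, ← smul_barSqT, smul_balMk,
        smul_balMk, (isBimodMap_prodInl f g hf hg l).1, smul_add, ← (isBimodMap_prodInr f g hf hg l).1,
        smul_add, smul_comm a])
    (fun i j h a x y => by
      rw [prodMapX_tmul, prodMapX_tmul, prodBil_apply, prodBil_apply, (isBimodMap_cocBar g hg j).2,
        (isBimodMap_cocOm g hg j).2, (isBimodMap_cocAug g hg j).2, ← op_smul_barSqT, op_smul_balMk,
        op_smul_balMk, (isBimodMap_prodInl f g hf hg l).2, smul_add,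
        ← (isBimodMap_prodInr f g hf hg l).2, smul_add, smul_comm (op a)])
  comm_d l l' z := by
    by_cases hl : l' + 1 = l
    · refine DGMod.tens_congr (prodMapX f g hf hg l' ∘ₗ DGMod.d _ l l')
        (DGMod.d _ l l' ∘ₗ prodMapX f g hf hg l) (fun i j h x y => ?_) z
      have hi : i - 1 + 1 = i := by omega
      have hj : j - 1 + 1 = j := by omega
      have h₁ : i - 1 + j = l' := by omega
      have h₂ : i + (j - 1) = l' := by omega
      rw [LinearMap.comp_apply, LinearMap.comp_apply, DGMod.tens_d_tmul _ _ hl h h₁ h₂, map_add,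
        map_zsmul, prodMapX_tmul, prodMapX_tmul, prodMapX_tmul, prodBil_apply, prodBil_apply,
        prodBil_apply, map_add (DGMod.d (productData f g hf hg).mod l l'), prod_d_inr f g hf hg hl, add_zero,
        prod_d_inl f g hf hg hl h hi hj h₁ h₂, cocBar_d f hf hi, cocBar_d g hg hj,
        cocAug_d f hf hi, cocAug_d g hg hj, cocOm_d f hf hi, cocOm_d g hg hj]
      simp only [map_zero, LinearMap.zero_apply, zero_add, add_zero, smul_zero, map_neg,
        LinearMap.neg_apply, map_add, map_zsmul, smul_add, smul_neg]
      -- The first entry d_p x vanishes unless x has degree p. So the sign (-1)^i of the tensor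
      -- differential may be replaced by the constant sign (-1)^p of the twisting map.
      have e : (i.negOnePow : ℤ) • prodInr f g hf hg l' (balMk _ _ (cocAug f hf i x)
          (barEval (biext g) j (cocBar g hg j y))) =
          ((p : ℤ).negOnePow : ℤ) • prodInr f g hf hg l' (balMk _ _ (cocAug f hf i x)
          (barEval (biext g) j (cocBar g hg j y))) := by
        by_cases hp : (p : ℤ) = i
        · exact congrArg (fun q : ℤ => (q.negOnePow : ℤ) • prodInr f g hf hg l' _) hp.symm
        · rw [cocAug_of_ne f hf hp]
          simp only [map_zero, LinearMap.zero_apply, smul_zero]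
      rw [e]
      change _ = _ + _ - (_ + ((p : ℤ).negOnePow : ℤ) • prodInr f g hf hg l'
        (balMk _ _ (cocAug f hf i x) (barEval (biext g) j (cocBar g hg j y))))
      change _ + -(_ • prodInr f g hf hg l' (balMk _ _ (barEval (biext f) i (cocBar f hf i x))
        (barEval (dOm k A p) j (cocBar g hg j y)))) + _ = _
      abel
    · rw [DGMod.d_shape _ _ _ hl, DGMod.d_shape _ _ _ hl, LinearMap.zero_apply,
        LinearMap.zero_apply, map_zero]
  comm_e l l' z := by
    by_cases hl : l + ((m : ℤ) - p - 1) = l'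
    · refine DGMod.tens_congr (prodMapX f g hf hg l' ∘ₗ DGMod.e _ l l')
        (DGMod.e _ l l' ∘ₗ prodMapX f g hf hg l) (fun i j h x y => ?_) z
      have hj : j + ((m : ℤ) - p - 1) = j + ((m : ℤ) - p - 1) := rfl
      rw [LinearMap.comp_apply, LinearMap.comp_apply,
        DGMod.tens_e_tmul (j' := j + ((m : ℤ) - p - 1)) _ _ hl h (by omega), prodMapX_tmul,
        prodMapX_tmul, prodBil_apply, prodBil_apply, map_add (DGMod.e (productData f g hf hg).mod l l'), prod_e_inr, add_zero,
        prod_e_inl f g hf hg hl h, cocBar_e, cocAug_e, cocOm_e g hg hj]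
      simp only [map_zero, LinearMap.zero_apply, zero_add, add_zero, smul_zero]
      rfl
    · rw [DGMod.e_shape _ _ _ hl, DGMod.e_shape _ _ _ hl, LinearMap.zero_apply,
        LinearMap.zero_apply, map_zero]

/-! The inverse of the comparison map. -/

lemma exists_dOm_eq (w : Om k A p) : ∃ y, dOm k A p y = w := by
  obtain ⟨_, y, rfl⟩ := w
  exact ⟨y, rfl⟩

lemma dOm_consT_omIncl (w : Om k A p) : dOm k A p (consT p 1 (omIncl k A p w)) = w :=
  Subtype.ext ((dT_consT_omIncl 1 w).trans (one_smul A _))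

/-- Every element of `Ω^p(A)` is in the image of `ε`. -/
lemma cocInr_eq_e {i j : ℤ} (hi : (p : ℤ) = i) (h : i + ((m : ℤ) - p - 1) = j)
    (y : T k A (p + 1)) : cocInr f hf j (dOm k A p y) =
      (cocycleData f hf).mod.e i j (cocInl f hf i (barT hi y)) := by
  rw [coc_e f hf h, cocAug_inl, barEval_barT]

/-- Write w = d_p y, so that w in the second summand is y ε. Then w ⊗ z = ± y ⊗ z ε, and z ε depends
only on the image of the bar component of z under d_p. This is what collapses the mixed summands of
the tensor product to Ω^p(A) ⊗_A Ω^p(A). -/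
lemma tmul_inr {l i j : ℤ} (h : i + j = l) (w : Om k A p) {z z' : (cocycleData g hg).mod.X j}
    (hz : cocAug g hg j z = cocAug g hg j z') :
    DGMod.tmul (cocycleData f hf).mod _ h (cocInr f hf i w) z =
      DGMod.tmul _ _ h (cocInr f hf i w) z' := by
  by_cases hi : (m : ℤ) - 1 = i
  · obtain ⟨y, rfl⟩ := exists_dOm_eq w
    rw [cocInr_eq_e f hf rfl (by omega), DGMod.tmul_e (j' := j + ((m : ℤ) - p - 1)) h
      (by omega) (by omega), DGMod.tmul_e (j' := j + ((m : ℤ) - p - 1)) h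
      (by omega) (by omega), coc_e g hg rfl, coc_e g hg rfl, hz]
  · rw [cocInr_of_ne f hf hi, map_zero, LinearMap.zero_apply, LinearMap.zero_apply]

/-- The inverse of the comparison map on `Ω^p(A) ⊗_A Ω^p(A)`. -/
def prodInvBil {l : ℤ} (h : (m : ℤ) - 1 + p = l) : Om k A p →ₗ[k] Om k A p →ₗ[k]
    (DGMod.tens (cocycleData f hf).mod (cocycleData g hg).mod).X l :=
  ((m * p : ℤ).negOnePow : ℤ) • (DGMod.tmul (cocycleData f hf).mod (cocycleData g hg).mod h).compl₁₂
    (cocInr f hf (m - 1)) (cocInl g hg p ∘ₗ barT rfl ∘ₗ consT p 1 ∘ₗ omIncl k A p)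

lemma prodInvBil_apply {l : ℤ} (h : (m : ℤ) - 1 + p = l) (w w' : Om k A p) :
    prodInvBil f g hf hg h w w' = ((m * p : ℤ).negOnePow : ℤ) •
      DGMod.tmul (cocycleData f hf).mod (cocycleData g hg).mod h (cocInr f hf (m - 1) w)
        (cocInl g hg p (barT rfl (consT p 1 (omIncl k A p w')))) := rfl

/-- The representatives 1 ⊗ a w' and a (1 ⊗ w') = a ⊗ w' of a w' differ in Bar_p(A), but d_p takes
the same value a w' on them, so `tmul_inr` applies. -/
lemma prodInvBil_balanced {l : ℤ} (h : (m : ℤ) - 1 + p = l) (a : A) (w w' : Om k A p) :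
    prodInvBil f g hf hg h (op a • w) w' = prodInvBil f g hf hg h w (a • w') := by
  rw [prodInvBil_apply, prodInvBil_apply, (isBimodMap_cocInr f hf _).2, DGMod.tmul_op_smul]
  refine congrArg _ (tmul_inr f g hf hg h w ?_)
  rw [(isBimodMap_cocAug g hg _).1, cocAug_inl, cocAug_inl, barEval_barT, barEval_barT,
    dOm_consT_omIncl, dOm_consT_omIncl]

/-- The component in the bar complexes. -/
def prodFst (l : ℤ) : (productData f g hf hg).mod.X l →ₗ[k] (barSq k A ((m : ℤ) - p - 1)).X l :=
  (productData f g hf hg).fst l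

/-- The second component. -/
def prodSnd (l : ℤ) : (productData f g hf hg).mod.X l →ₗ[k]
    ptX ((Om k A p).bal (Om k A p)) (m + p - 1) l := (productData f g hf hg).snd l

/-- The inverse of the comparison map on the bar complexes. -/
def prodInvBar (l : ℤ) : (barSq k A ((m : ℤ) - p - 1)).X l →ₗ[k]
    (DGMod.tens (cocycleData f hf).mod (cocycleData g hg).mod).X l :=
  barSqLift (fun i j h => (DGMod.tmul (cocycleData f hf).mod (cocycleData g hg).mod h).compl₁₂
    (cocInl f hf i) (cocInl g hg j)) (fun i j h a x y => by
      simp only [LinearMap.compl₁₂_apply]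
      rw [(isBimodMap_cocInl f hf i).2, (isBimodMap_cocInl g hg j).1, DGMod.tmul_op_smul])

/-- The inverse of the comparison map on the second summand. -/
noncomputable def prodInvOm (l : ℤ) : ptX ((Om k A p).bal (Om k A p)) (m + p - 1) l →ₗ[k]
    (DGMod.tens (cocycleData f hf).mod (cocycleData g hg).mod).X l :=
  ptDesc (fun h : (m : ℤ) + p - 1 = l => balLift
    (prodInvBil f g hf hg (show (m : ℤ) - 1 + p = l by omega)) (prodInvBil_balanced f g hf hg _))

/-- The inverse of the comparison map. -/
noncomputable def prodInv (l : ℤ) : (productData f g hf hg).mod.X l →ₗ[k]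
    (DGMod.tens (cocycleData f hf).mod (cocycleData g hg).mod).X l :=
  prodInvBar f g hf hg l ∘ₗ prodFst f g hf hg l + prodInvOm f g hf hg l ∘ₗ prodSnd f g hf hg l

lemma prodInv_inl {l i j : ℤ} (h : i + j = l) (x : barX k A i) (y : barX k A j) :
    prodInv f g hf hg l (prodInl f g hf hg l (barSqT h x y)) =
      DGMod.tmul _ _ h (cocInl f hf i x) (cocInl g hg j y) := by
  have e₁ : ∀ z, prodFst f g hf hg l (prodInl f g hf hg l z) = z := fun _ => rfl
  have e₂ : ∀ z, prodSnd f g hf hg l (prodInl f g hf hg l z) = 0 := fun _ => rfl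
  rw [prodInv, LinearMap.add_apply, LinearMap.comp_apply, LinearMap.comp_apply, e₁, e₂, map_zero,
    add_zero, prodInvBar, barSqLift_barSqT]
  rfl

lemma prodInv_inr {l : ℤ} (h : (m : ℤ) - 1 + p = l) (w w' : Om k A p) :
    prodInv f g hf hg l (prodInr f g hf hg l (balMk _ _ w w')) = prodInvBil f g hf hg h w w' := by
  have e₁ : ∀ z, prodFst f g hf hg l (prodPt f g hf hg l z) = 0 := fun _ => rfl
  have e₂ : ∀ z, prodSnd f g hf hg l (prodPt f g hf hg l z) = z := fun _ => rfl
  rw [prodInv, LinearMap.add_apply, LinearMap.comp_apply, LinearMap.comp_apply, prodInr,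
    LinearMap.comp_apply, e₁, e₂, map_zero, zero_add, prodInvOm,
    ptIn_of_eq (show (m : ℤ) + p - 1 = l by omega), ptDesc_ptT, balLift_balMk]

lemma prodMapX_prodInv (l : ℤ) (z : (productData f g hf hg).mod.X l) :
    prodMapX f g hf hg l (prodInv f g hf hg l z) = z :=
  product_congr f g hf hg (prodMapX f g hf hg l ∘ₗ prodInv f g hf hg l) LinearMap.id
    (fun i j h x y => by
      rw [LinearMap.comp_apply, prodInv_inl, prodMapX_tmul, prodBil_apply, cocBar_inl, cocBar_inl,
        cocOm_inl, cocOm_inl]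
      simp only [map_zero, LinearMap.zero_apply, add_zero, smul_zero, LinearMap.id_apply])
    (fun h x y => by
      rw [LinearMap.comp_apply, prodInv_inr f g hf hg (by omega), prodInvBil_apply, map_zsmul,
        prodMapX_tmul, prodBil_apply, cocBar_inr, cocOm_inl, cocOm_inr f hf rfl, cocAug_inl,
        barEval_barT, dOm_consT_omIncl]
      simp only [map_zero, LinearMap.zero_apply, add_zero, zero_add, LinearMap.id_apply]
      rw [map_zsmul, smul_smul, ← Units.val_mul, Int.units_mul_self, Units.val_one, one_smul]) z

/-- Decompose both factors into their bar and Ω^p components. Of the four products, Ω^p ⊗ Ω^p is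
zero, and the two mixed ones are brought to the form w ⊗ (1 ⊗ w') on which the inverse is defined.
-/
lemma prodInv_prodMapX (l : ℤ)
    (z : (DGMod.tens (cocycleData f hf).mod (cocycleData g hg).mod).X l) :
    prodInv f g hf hg l (prodMapX f g hf hg l z) = z :=
  DGMod.tens_congr (prodInv f g hf hg l ∘ₗ prodMapX f g hf hg l) LinearMap.id
    (fun i j h x y => by
      -- This is ε² = 0: the right factor has no bar component, so by `tmul_inr` it may be replaced
      -- by 0.
      have e₁ : ∀ x y, DGMod.tmul (cocycleData f hf).mod (cocycleData g hg).mod h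
          (cocInr f hf i x) (cocInr g hg j y) = 0 := fun x y =>
        (tmul_inr f g hf hg h x (by rw [cocAug_inr, map_zero])).trans (map_zero _)
      have e₂ : prodInv f g hf hg l (prodInr f g hf hg l (((m * p : ℤ).negOnePow : ℤ) •
          balMk _ _ (cocOm f hf i x) (cocAug g hg j y))) =
          DGMod.tmul _ _ h (cocInr f hf i (cocOm f hf i x)) (cocInl g hg j (cocBar g hg j y)) := by
        by_cases hj : (p : ℤ) = j
        · by_cases hi : (m : ℤ) - 1 = i
          · subst hi hj
            rw [map_zsmul, map_zsmul, prodInv_inr f g hf hg h, prodInvBil_apply, smul_smul,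
              ← Units.val_mul, Int.units_mul_self, Units.val_one, one_smul]
            refine tmul_inr f g hf hg h _ ?_
            rw [cocAug_inl, barEval_barT, dOm_consT_omIncl]
            rfl
          · rw [cocInr_of_ne f hf hi, prodInr_of_ne f g hf hg (by omega), map_zero, map_zero,
              LinearMap.zero_apply]
        · rw [cocAug_of_ne g hg hj, map_zero, smul_zero, map_zero, map_zero]
          refine ((tmul_inr f g hf hg h _ (z' := 0) ?_).trans (map_zero _)).symm
          rw [cocAug_of_ne g hg hj, map_zero]
      -- The right factor is (1 ⊗ w') ε, and moving ε to the left factor costs (-1)^((m-p-1)p) =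
      -- (-1)^(mp). This is why the comparison map has the sign (-1)^(mp) in only one of its two
      -- mixed terms.
      have e₃ : prodInv f g hf hg l (prodInr f g hf hg l
          (balMk _ _ (cocAug f hf i x) (cocOm g hg j y))) =
          DGMod.tmul _ _ h (cocInl f hf i (cocBar f hf i x)) (cocInr g hg j (cocOm g hg j y)) := by
        by_cases hj : (m : ℤ) - 1 = j
        · have hj' : (p : ℤ) + ((m : ℤ) - p - 1) = j := by omega
          have hs : (((m : ℤ) - p - 1) * p).negOnePow = ((m : ℤ) * p).negOnePow :=
            negOnePow_twist m p
          have e₄ := DGMod.tmul_e (M := (cocycleData f hf).mod) (N := (cocycleData g hg).mod)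
            (i := i) (j := (p : ℤ)) (i' := i + ((m : ℤ) - p - 1)) (j' := j) (by omega) h rfl
            (cocInl f hf i (cocBar f hf i x))
            (cocInl g hg p (barT rfl (consT p 1 (omIncl k A p (cocOm g hg j y)))))
          rw [coc_e g hg hj', cocAug_inl, barEval_barT, dOm_consT_omIncl, coc_e f hf rfl,
            cocAug_inl, hs] at e₄
          have e₅ := congrArg ((((m : ℤ) * p).negOnePow : ℤ) • ·) e₄
          rw [smul_smul, ← Units.val_mul, Int.units_mul_self, Units.val_one, one_smul] at e₅
          rw [← e₅]
          by_cases hi : (p : ℤ) = i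
          · subst hi hj
            rw [prodInv_inr f g hf hg (by omega), prodInvBil_apply]
            -- The degrees p + (m - p - 1) and m - 1 are equal only up to arithmetic.
            have ht : ∀ (i : ℤ) (h : i + (p : ℤ) = l) (h' : (m : ℤ) - 1 + p = l) w z,
                DGMod.tmul (cocycleData f hf).mod (cocycleData g hg).mod h' (cocInr f hf _ w) z =
                DGMod.tmul (cocycleData f hf).mod (cocycleData g hg).mod h (cocInr f hf i w) z := by
              intro i h h' w z
              obtain rfl : i = (m : ℤ) - 1 := by omega
              rfl
            exact congrArg _ (ht _ (by omega) (by omega) _ _)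
          · rw [cocAug_of_ne f hf hi, barEval_of_ne _ hi]
            simp only [map_zero, LinearMap.zero_apply, smul_zero]
        · rw [cocInr_of_ne g hg hj]
          by_cases hi : (p : ℤ) = i
          · rw [prodInr_of_ne f g hf hg (by omega), map_zero, map_zero]
          · rw [cocAug_of_ne f hf hi]
            simp only [map_zero, LinearMap.zero_apply]
      rw [LinearMap.comp_apply, prodMapX_tmul, prodBil_apply, map_add, map_add, map_add, e₂, e₃,
        prodInv_inl, LinearMap.id_apply]
      conv_rhs => rw [coc_eq_add f hf i x, coc_eq_add g hg j y]
      simp only [map_add, LinearMap.add_apply]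
      rw [e₁]
      abel) z

lemma isRelQuasiIso_prodComparison : DGMod.IsRelQuasiIso (prodComparison f g hf hg) :=
  DGMod.isRelQuasiIso_of_bijective _ fun l =>
    ⟨Function.LeftInverse.injective (prodInv_prodMapX f g hf hg l),
      Function.RightInverse.surjective (prodMapX_prodInv f g hf hg l)⟩

end Product

end

end SingDef

namespace SingDef

/-! ### Contractions over a field -/

section LinearSelection

variable {K V W : Type*} [Field K] [AddCommGroup V] [Module K V] [AddCommGroup W] [Module K W]

/-- A linear relation that is defined on a subspace contains the graph of a linear map there. -/
lemma exists_linear_selection (R : Submodule K (V × W)) (S : Submodule K V)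
    (h : ∀ v ∈ S, ∃ w, (v, w) ∈ R) : ∃ f : V →ₗ[K] W, ∀ v ∈ S, (v, f v) ∈ R := by
  let Q := R ⊓ S.comap (LinearMap.fst K V W)
  let φ : Q →ₗ[K] S := ((LinearMap.fst K V W).domRestrict Q).codRestrict S fun q => q.2.2
  have hφ : LinearMap.range φ = ⊤ := LinearMap.range_eq_top.2 fun v => by
    obtain ⟨w, hw⟩ := h v.1 v.2
    exact ⟨⟨(v.1, w), hw, v.2⟩, rfl⟩
  obtain ⟨g, hg⟩ := φ.exists_rightInverse_of_surjective hφ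
  obtain ⟨f, hf⟩ := LinearMap.exists_extend (LinearMap.snd K V W ∘ₗ Q.subtype ∘ₗ g)
  refine ⟨f, fun v hv => ?_⟩
  have e₁ : f v = (g ⟨v, hv⟩).1.2 := LinearMap.congr_fun hf ⟨v, hv⟩
  have e₂ : (g ⟨v, hv⟩).1.1 = v := congrArg Subtype.val (LinearMap.congr_fun hg ⟨v, hv⟩)
  have e₃ := (g ⟨v, hv⟩).2.1
  have e₄ : (v, f v) = (g ⟨v, hv⟩).1 := Prod.ext e₂.symm e₁
  rw [e₄]
  exact e₃

lemma exists_projection (U : Submodule K V) :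
    ∃ π : V →ₗ[K] V, (∀ v, π v ∈ U) ∧ ∀ v ∈ U, π v = v := by
  obtain ⟨π, hπ⟩ := LinearMap.exists_extend (LinearMap.id : U →ₗ[K] U)
  exact ⟨U.subtype ∘ₗ π, fun v => (π v).2,
    fun v hv => congrArg Subtype.val (LinearMap.congr_fun hπ ⟨v, hv⟩)⟩

end LinearSelection

namespace DGMod

variable {k : Type v} {A : Type u} [Field k] [Ring A] [Algebra k A] {n : ℤ} (K : DGMod k A n)

/-- An acyclic differential graded module over `R_n` is contractible if the image of `ε` is
acyclic, too. -/
lemma contractible_of_acyclic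
    (hd : ∀ i j l, i + 1 = j → l + 1 = i → ∀ z, K.d i l z = 0 → ∃ x, K.d j i x = z)
    (he : ∀ i j i' j' l', i + 1 = j → i + n = i' → j + n = j' → l' + 1 = i' → ∀ x,
      K.d i' l' (K.e i i' x) = 0 → ∃ y, K.e i i' x = K.d j' i' (K.e j j' y)) :
    Contractible .none K := by
  -- A cycle z with z ε = 0 has a primitive that is killed by ε. For any primitive x the element x ε
  -- is a cycle in the image of ε, hence x ε = d (y ε), and x - d y is as wanted.
  have ha : ∀ i j l i' j', i + 1 = j → l + 1 = i → i + n = i' → j + n = j' → ∀ z,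
      K.d i l z = 0 → K.e i i' z = 0 → ∃ x, K.d j i x = z ∧ K.e j j' x = 0 := by
    intro i j l i' j' hj hl hi' hj' z h₁ h₂
    obtain ⟨x, rfl⟩ := hd i j l hj hl z h₁
    obtain ⟨y, hy⟩ := he j (j + 1) j' (j' + 1) i' rfl hj' (by omega) (by omega) x
      (by rw [K.d_e j i j' i' hj' hi', h₂])
    rw [K.d_e (j + 1) j (j' + 1) j' (by omega) hj'] at hy
    exact ⟨x - K.d (j + 1) j y, by rw [map_sub, K.d_d, sub_zero], by rw [map_sub, hy, sub_self]⟩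
  -- Choose primitives of cycles linearly, in such a way that cycles killed by ε get primitives
  -- killed by ε. The two linear selections are glued along a projection onto the subspace U of such
  -- cycles.
  have hτ : ∀ i j, ∃ τ : K.X i →ₗ[k] K.X j, i + 1 = j →
      (∀ z, K.d i (i - 1) z = 0 → K.d j i (τ z) = z) ∧
      ∀ z, K.d i (i - 1) z = 0 → K.e i (i + n) z = 0 → K.e j (j + n) (τ z) = 0 := by
    intro i j
    by_cases hj : i + 1 = j
    · let Z := LinearMap.ker (K.d i (i - 1))
      let U := Z ⊓ LinearMap.ker (K.e i (i + n))
      let R := LinearMap.ker (K.d j i ∘ₗ LinearMap.snd k (K.X i) (K.X j) -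
        LinearMap.fst k (K.X i) (K.X j))
      have hR : ∀ z x, (z, x) ∈ R ↔ K.d j i x = z := fun z x => by
        change K.d j i x - z = 0 ↔ _
        exact sub_eq_zero
      obtain ⟨τ₂, h₂⟩ := exists_linear_selection R Z fun z hz => by
        obtain ⟨x, hx⟩ := hd i j (i - 1) hj (by omega) z hz
        exact ⟨x, (hR _ _).2 hx⟩
      obtain ⟨τ₀, h₀⟩ := exists_linear_selection
        (R ⊓ LinearMap.ker (K.e j (j + n) ∘ₗ LinearMap.snd k (K.X i) (K.X j))) U fun z hz => by
          obtain ⟨x, hx, hx'⟩ := ha i j (i - 1) (i + n) (j + n) hj (by omega) rfl rfl z hz.1 hz.2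
          exact ⟨x, (hR _ _).2 hx, hx'⟩
      obtain ⟨π, h₁, h₃⟩ := exists_projection U
      refine ⟨τ₀ ∘ₗ π + τ₂ ∘ₗ (LinearMap.id - π), fun _ => ⟨fun z hz => ?_, fun z hz hz' => ?_⟩⟩
      · have e₁ := (hR _ _).1 (h₀ _ (h₁ z)).1
        have e₂ := (hR _ _).1 (h₂ (z - π z) (Z.sub_mem hz (h₁ z).1))
        change K.d j i (τ₀ (π z) + τ₂ (z - π z)) = z
        rw [map_add, e₁, e₂, add_sub_cancel]
      · have e₁ := h₃ z ⟨hz, hz'⟩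
        have e₂ := (h₀ z ⟨hz, hz'⟩).2
        change K.e j (j + n) (τ₀ (π z) + τ₂ (z - π z)) = 0
        rw [e₁, sub_self, map_zero, add_zero]
        exact e₂
    · exact ⟨0, fun h => (hj h).elim⟩
  choose τ hτ using hτ
  -- The map ξ repairs the failure of τ to commute with ε. It is prescribed on the elements z ε with
  -- z a cycle, where the defect τ(z) ε - τ(z ε) is itself a cycle killed by ε. A projection extends
  -- ξ without leaving the set of these values.
  have hξ : ∀ i j, ∃ ξ : K.X i →ₗ[k] K.X j, i + 1 = j →
      (∀ x, K.d j i (ξ x) = 0) ∧ (∀ x, K.e j (j + n) (ξ x) = 0) ∧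
      ∀ z, K.d (i - n) (i - n - 1) z = 0 →
        ξ (K.e (i - n) i z) = K.e (j - n) j (τ (i - n) (j - n) z) - τ i j (K.e (i - n) i z) := by
    intro i j
    by_cases hj : i + 1 = j
    · let Z := LinearMap.ker (K.d (i - n) (i - n - 1))
      let U := Z.map (K.e (i - n) i)
      let δ := K.e (j - n) j ∘ₗ τ (i - n) (j - n) - τ i j ∘ₗ K.e (i - n) i
      have hδ : ∀ z, δ z =
        K.e (j - n) j (τ (i - n) (j - n) z) - τ i j (K.e (i - n) i z) := fun z => rfl
      obtain ⟨ξ, h₁⟩ := exists_linear_selection (Z.map (LinearMap.prod (K.e (i - n) i) δ)) U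
        fun v hv => by
          obtain ⟨z, hz, rfl⟩ := hv
          exact ⟨δ z, z, hz, rfl⟩
      obtain ⟨π, h₂, h₃⟩ := exists_projection U
      have hd' : ∀ z ∈ Z, K.d i (i - 1) (K.e (i - n) i z) = 0 := fun z hz => by
        rw [K.d_e (i - n) (i - n - 1) i (i - 1) (by omega) (by omega),
          show K.d (i - n) (i - n - 1) z = 0 from hz, map_zero]
      have hτ₁ := hτ i j hj
      have hτ₂ := hτ (i - n) (j - n) (by omega)
      have hv : ∀ x, ∃ z ∈ Z, K.e (i - n) i z = π x ∧ ξ (π x) = δ z := fun x => by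
        obtain ⟨z, hz, h⟩ := h₁ _ (h₂ x)
        exact ⟨z, hz, congrArg Prod.fst h, (congrArg Prod.snd h).symm⟩
      refine ⟨ξ ∘ₗ π, fun _ => ⟨fun x => ?_, fun x => ?_, fun z hz => ?_⟩⟩
      · obtain ⟨z, hz, -, h⟩ := hv x
        rw [LinearMap.comp_apply, h, hδ, map_sub,
          K.d_e (j - n) (i - n) j i (by omega) (by omega), hτ₂.1 z hz, hτ₁.1 _ (hd' z hz), sub_self]
      · obtain ⟨z, hz, -, h⟩ := hv x
        rw [LinearMap.comp_apply, h, hδ, map_sub, K.e_e, hτ₁.2 _ (hd' z hz) (K.e_e _ _ _ _),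
          sub_zero]
      · obtain ⟨z', hz', h, h'⟩ := hv (K.e (i - n) i z)
        rw [h₃ _ ⟨z, hz, rfl⟩] at h h'
        rw [LinearMap.comp_apply, h₃ _ ⟨z, hz, rfl⟩, h', hδ, h]
        -- Independence of the choice of z: if z' ε = z ε, then z' - z is a cycle killed by ε, and
        -- so is its primitive τ(z' - z) killed by ε.
        refine congrArg (· - _) (sub_eq_zero.1 ?_)
        rw [← map_sub, ← map_sub]
        have e₁ : K.e (i - n) (i - n + n) (z' - z) = 0 := by
          rw [show i - n + n = i by omega, map_sub, h, sub_self]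
        have e₂ := hτ₂.2 (z' - z) (Z.sub_mem hz' hz) e₁
        rwa [show j - n + n = j by omega] at e₂
    · exact ⟨0, fun h => (hj h).elim⟩
  choose ξ hξ using hξ
  have hσ : ∀ i j, i + 1 = j → ∀ z, K.d i (i - 1) z = 0 → K.d j i (τ i j z + ξ i j z) = z :=
    fun i j hj z hz => by rw [map_add, (hτ i j hj).1 z hz, (hξ i j hj).1, add_zero]
  have hσe : ∀ i j i' j', i + 1 = j → i + n = i' → j + n = j' → ∀ z, K.d i (i - 1) z = 0 →
      τ i' j' (K.e i i' z) + ξ i' j' (K.e i i' z) = K.e j j' (τ i j z + ξ i j z) := by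
    intro i j i' j' hj hi' hj' z hz
    obtain rfl : i = i' - n := by omega
    obtain rfl : j = j' - n := by omega
    have e₁ := (hξ (i' - n) (j' - n) hj).2.1 z
    rw [show j' - n + n = j' by omega] at e₁
    rw [(hξ i' j' (by omega)).2.2 z hz, map_add, e₁, add_zero, add_sub_cancel]
  let σ : ∀ i j, K.X i →ₗ[k] K.X j := fun i j => τ i j + ξ i j
  have hH : ∀ i l, l + 1 = i → ∀ x, K.d i l (x - σ l i (K.d i l x)) = 0 := fun i l hl x => by
    rw [map_sub]
    exact sub_eq_zero.2 (hσ l i hl _ (K.d_d _ _ _ _)).symm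
  -- For σ = τ + ξ one has d σ = 1 on cycles, and σ commutes with ε there. The element x - σ d x is
  -- a cycle, so H = σ (1 - σ d) satisfies d H x = x - σ d x and H d x = σ d x.
  refine ⟨fun i j => σ i j ∘ₗ (LinearMap.id - σ (i - 1) i ∘ₗ K.d i (i - 1)), fun _ _ => trivial,
    fun i j i' j' hj hi hj' x => ?_, fun i j l hj hl x => ?_⟩
  · change σ i' j' (K.e i i' x - σ (i' - 1) i' (K.d i' (i' - 1) (K.e i i' x))) =
      K.e j j' (σ i j (x - σ (i - 1) i (K.d i (i - 1) x)))
    have e₁ := hσe (i - 1) i (i' - 1) i' (by omega) (by omega) hi (K.d i (i - 1) x) (K.d_d _ _ _ _)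
    have e₂ := hσe i j i' j' hj hi hj' _ (hH i (i - 1) (by omega) x)
    rw [K.d_e i (i - 1) i' (i' - 1) hi (by omega)]
    refine Eq.trans (congrArg (fun y => σ i' j' (K.e i i' x - y)) e₁) ?_
    rw [← map_sub]
    exact e₂
  · obtain rfl : l = i - 1 := by omega
    change K.d j i (σ i j (x - σ (i - 1) i (K.d i (i - 1) x))) +
      σ (i - 1) i (K.d i (i - 1) x - σ (i - 1 - 1) (i - 1) (K.d (i - 1) (i - 1 - 1)
        (K.d i (i - 1) x))) = x
    have e₁ := hσ i j hj _ (hH i (i - 1) hl x)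
    rw [K.d_d, map_zero, sub_zero]
    exact (congrArg (· + _) e₁).trans (sub_add_cancel _ _)

end DGMod

end SingDef

namespace SingDef

section

variable {k : Type v} {A : Type u} [CommRing k] [Ring A] [Algebra k A]

/-! ### The diagonal of the bar complex -/

section Bar

/-- The identity between equal degrees of the bar complex. -/
def barEq {j l : ℤ} (h : j = l) : barX k A j →ₗ[k] barX k A l :=
  piMap (fun r : {r : ℕ // (r : ℤ) = l} => (⟨r.1, r.2.trans h.symm⟩ : {r : ℕ // (r : ℤ) = j}))
    (fun _ => LinearMap.id)

variable (k A) in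
/-- The identity between equal degrees of the bar complex, and zero otherwise. -/
def barShift (j l : ℤ) : barX k A j →ₗ[k] barX k A l := if h : j = l then barEq h else 0

lemma isBimodMap_barD {i j : ℤ} (h : j + 1 = i) : IsBimodMap (barD k A i j h) :=
  isBimodMap_piMap fun _ => isBimodMap_dT _

lemma barShift_self (j : ℤ) (x : barX k A j) : barShift k A j j x = x := by
  rw [barShift, dif_pos rfl]
  rfl

lemma isBimodMap_barShift (j l : ℤ) : IsBimodMap (barShift k A j l) := by
  rw [barShift]
  split_ifs with h
  · exact ⟨fun _ _ => rfl, fun _ _ => rfl⟩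
  · exact IsBimodMap.zero

variable (k A) in
/-- The multiplication `A ⊗ A → A` on the degree zero part of the bar complex. -/
def barMu (i : ℤ) : barX k A i →ₗ[k] T k A 0 := barEval (r := 0) (dT k A 0) i

lemma isBimodMap_barMu (i : ℤ) : IsBimodMap (barMu k A i) := isBimodMap_barEval (isBimodMap_dT 0) i

lemma barMu_of_ne {i : ℤ} (h : i ≠ 0) (x : barX k A i) : barMu k A i x = 0 :=
  barEval_of_ne _ (by push_cast; omega) x

lemma barMu_barD {i j : ℤ} (h : j + 1 = i) (x : barX k A i) :
    barMu k A j (barD k A i j h x) = 0 := barEval_barD (dT_dT 0) h x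

/-- The map `x ↦ a ⊗ x` of degree one on the bar complex. -/
noncomputable def consBar {i j : ℤ} (h : i + 1 = j) : A →ₗ[k] barX k A i →ₗ[k] barX k A j :=
  (barDesc fun r hr => (consT (r + 1)).flip.compr₂
    (barT (r := r + 1) (show ((r + 1 : ℕ) : ℤ) = j by push_cast; omega))).flip

lemma consBar_barT {i j : ℤ} {r : ℕ} (h : i + 1 = j) (hr : (r : ℤ) = i)
    (hr' : ((r + 1 : ℕ) : ℤ) = j) (a : A) (x : T k A (r + 1)) :
    consBar h a (barT hr x) = barT hr' (consT (r + 1) a x) := by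
  rw [consBar, LinearMap.flip_apply, barDesc_barT]
  rfl

lemma consBar_mul {i j : ℤ} (h : i + 1 = j) (a b : A) (x : barX k A i) :
    consBar h (a * b) x = a • consBar h b x :=
  barX_congr (consBar h (a * b)) (Algebra.lsmul k k (barX k A j) a ∘ₗ consBar h b)
    (fun r hr x => by
      rw [LinearMap.comp_apply, consBar_barT h hr (by push_cast; omega),
        consBar_barT h hr (by push_cast; omega)]
      change _ = a • barT _ (consT (r + 1) b x)
      rw [← (isBimodMap_barT _).1, smul_consT]) x

lemma consBar_op_smul {i j : ℤ} (h : i + 1 = j) (a b : A) (x : barX k A i) :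
    consBar h a (op b • x) = op b • consBar h a x :=
  barX_congr (consBar h a ∘ₗ Algebra.lsmul k k (barX k A i) (op b))
    (Algebra.lsmul k k (barX k A j) (op b) ∘ₗ consBar h a)
    (fun r hr x => by
      rw [LinearMap.comp_apply, LinearMap.comp_apply, consBar_barT h hr (by push_cast; omega)]
      change consBar h a (op b • barT hr x) = op b • barT _ _
      rw [← (isBimodMap_barT hr).2, consBar_barT h hr (by push_cast; omega), ← op_smul_consT,
        (isBimodMap_barT _).2]) x

variable (k A) in
/-- The inclusion of `A^{⊗ (r+2)}` in degree `r`, and zero in other degrees. -/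
def barIn (r : ℕ) (i : ℤ) : T k A (r + 1) →ₗ[k] barX k A i := if h : (r : ℤ) = i then barT h else 0

lemma barIn_of_eq {r : ℕ} {i : ℤ} (h : (r : ℤ) = i) (x : T k A (r + 1)) :
    barIn k A r i x = barT h x := by
  rw [barIn, dif_pos h]

/-- This is d (a ⊗ x) = a x - a ⊗ d x. In degree zero d x is the product in A, which does not belong
to the bar complex, and the last term accounts for it. -/
lemma barD_consBar {i j l : ℤ} (h : i + 1 = j) (hl : l + 1 = i) (a : A) (x : barX k A i) :
    barD k A j i h (consBar h a x) =
      a • x - consBar hl a (barD k A i l hl x) - barIn k A 0 i (consT 0 a (barMu k A i x)) :=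
  barX_congr (barD k A j i h ∘ₗ consBar h a)
    (Algebra.lsmul k k (barX k A i) a - consBar hl a ∘ₗ barD k A i l hl -
      barIn k A 0 i ∘ₗ consT 0 a ∘ₗ barMu k A i) (fun r hr x => by
      have hr' : ((r + 1 : ℕ) : ℤ) = j := by push_cast; omega
      change barD k A j i h (consBar h a (barT hr x)) = a • barT hr x -
        consBar hl a (barD k A i l hl (barT hr x)) - barIn k A 0 i (consT 0 a (barMu k A i _))
      rw [consBar_barT h hr hr', barD_barT_succ h hr' hr, dT_cons, map_sub, (isBimodMap_barT hr).1,
        sub_sub]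
      refine congrArg _ ?_
      cases r with
      | zero =>
        rw [barX_eq_zero (by push_cast at hr; omega) (barD k A i l hl _), map_zero]
        refine Eq.trans ?_ (zero_add _).symm
        rw [barIn_of_eq hr, barMu, barEval_barT _ hr]
      | succ r =>
        have hl' : (r : ℤ) = l := by push_cast at hr; omega
        rw [barMu_of_ne (by push_cast at hr; omega), map_zero, map_zero, add_zero,
          barD_barT_succ hl hr hl', consBar_barT hl hl' hr]) x

end Bar

section Square

variable {c : ℤ}

/-- The map `x ⊗ y ↦ (a ⊗ x) ⊗ y` of degree one on `Bar_*(A) ⊗_A Bar_*(A)`. -/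
noncomputable def consSq {l l' : ℤ} (hl : l + 1 = l') :
    A →ₗ[k] (barSq k A c).X l →ₗ[k] (barSq k A c).X l' :=
  (barSqLift (fun i j h => LinearMap.mk₂ k
      (fun x y => (barSqT (show i + 1 + j = l' by omega)).flip y ∘ₗ (consBar rfl).flip x)
      (fun x x' y => by ext a; simp) (fun t x y => by ext a; simp) (fun x y y' => by ext a; simp)
      (fun t x y => by ext a; simp))
    (fun i j h b x y => LinearMap.ext fun a => by
      change barSqT _ (consBar rfl a (op b • x)) y = barSqT _ (consBar rfl a x) (b • y)
      rw [consBar_op_smul, barSqT_op_smul])).flip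

lemma consSq_barSqT {l l' i i' j : ℤ} (hl : l + 1 = l') (h : i + j = l) (h' : i' + j = l')
    (hi : i + 1 = i') (a : A) (x : barX k A i) (y : barX k A j) :
    consSq (c := c) hl a (barSqT h x y) = barSqT h' (consBar hi a x) y := by
  subst hi
  rw [consSq, LinearMap.flip_apply, barSqLift_barSqT]
  rfl

lemma consSq_mul {l l' : ℤ} (hl : l + 1 = l') (a b : A) (z : (barSq k A c).X l) :
    consSq hl (a * b) z = a • consSq hl b z :=
  barSq_congr (consSq hl (a * b)) (Algebra.lsmul k k ((barSq k A c).X l') a ∘ₗ consSq hl b)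
    (fun i j h x y => by
      rw [LinearMap.comp_apply, consSq_barSqT hl h (by omega) rfl,
        consSq_barSqT hl h (by omega) rfl, consBar_mul]
      exact (smul_barSqT _ a _ _).symm) z

lemma consSq_op_smul {l l' : ℤ} (hl : l + 1 = l') (a b : A) (z : (barSq k A c).X l) :
    consSq hl a (op b • z) = op b • consSq hl a z :=
  barSq_congr (consSq hl a ∘ₗ Algebra.lsmul k k ((barSq k A c).X l) (op b))
    (Algebra.lsmul k k ((barSq k A c).X l') (op b) ∘ₗ consSq hl a)
    (fun i j h x y => by
      change consSq hl a (op b • barSqT h x y) = op b • consSq hl a (barSqT h x y)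
      rw [op_smul_barSqT, consSq_barSqT hl h (show i + 1 + j = l' by omega) rfl,
        consSq_barSqT hl h (show i + 1 + j = l' by omega) rfl, op_smul_barSqT]) z

/-- The map `x ⊗ y ↦ μ(x) y`, where `μ` is the augmentation of the bar complex. -/
def contrSq (l : ℤ) : (barSq k A c).X l →ₗ[k] barX k A l :=
  barSqLift (fun i j _ => ((Algebra.lsmul k k (barX k A l) : A →ₐ[k] _).toLinearMap ∘ₗ toA ∘ₗ
      barMu k A i).compl₂ (barShift k A j l))
    (fun i j h a x y => by
      change toA (barMu k A i (op a • x)) • barShift k A j l y =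
        toA (barMu k A i x) • barShift k A j l (a • y)
      rw [(isBimodMap_barMu i).2, (isBimodMap_barShift j l).1, smul_smul]
      rfl)

lemma contrSq_barSqT {l i j : ℤ} (h : i + j = l) (x : barX k A i) (y : barX k A j) :
    contrSq (c := c) l (barSqT h x y) = toA (barMu k A i x) • barShift k A j l y :=
  barSqLift_barSqT _ _ h x y

lemma contrSq_zero {l : ℤ} (h : 0 + l = l) (x : barX k A 0) (y : barX k A l) :
    contrSq (c := c) l (barSqT h x y) = toA (barMu k A 0 x) • y := by
  rw [contrSq_barSqT, barShift_self]

lemma contrSq_eq_zero {l i j : ℤ} (h : i + j = l) (x : barX k A i) (y : barX k A j)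
    (hx : barMu k A i x = 0) : contrSq (c := c) l (barSqT h x y) = 0 := by
  rw [contrSq_barSqT, hx, map_zero, zero_smul]

/-- The contraction is μ ⊗ 1, and μ kills boundaries as well as all positive degrees. Only the
differential of the second factor over degree zero of the first survives, and there the sign is
trivial. -/
lemma contrSq_d {l l' : ℤ} (hl : l' + 1 = l) (z : (barSq k A c).X l) :
    contrSq l' ((barSq k A c).d l l' z) = barD k A l l' hl (contrSq l z) :=
  barSq_congr (contrSq l' ∘ₗ (barSq k A c).d l l') (barD k A l l' hl ∘ₗ contrSq l)
    (fun i j h x y => by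
      rw [LinearMap.comp_apply, LinearMap.comp_apply, barSq_d_barSqT (i' := i - 1) (j' := j - 1) hl
        h (by omega) (by omega) (by omega) (by omega), map_add, map_zsmul,
        contrSq_eq_zero _ _ _ (barMu_barD _ x), zero_add]
      by_cases hi : i = 0
      · subst hi
        obtain rfl : j = l := by omega
        obtain rfl : l' = j - 1 := by omega
        rw [contrSq_zero, contrSq_zero, Int.negOnePow_zero, Units.val_one, one_smul]
        exact ((isBimodMap_barD _).1 _ _).symm
      · rw [contrSq_eq_zero _ _ _ (barMu_of_ne hi x), contrSq_eq_zero _ _ _ (barMu_of_ne hi x),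
          smul_zero, map_zero]) z

lemma contrSq_consSq {l l' : ℤ} (hl : l + 1 = l') (a : A) (z : (barSq k A c).X l) :
    contrSq l' (consSq hl a z) = 0 :=
  barSq_congr (contrSq l' ∘ₗ consSq hl a) 0 (fun i j h x y => by
    rw [LinearMap.comp_apply, consSq_barSqT hl h (show i + 1 + j = l' by omega) rfl,
      contrSq_eq_zero, LinearMap.zero_apply]
    by_cases hi : i + 1 = 0
    · rw [barX_eq_zero (by omega) x, map_zero, map_zero]
    · exact barMu_of_ne hi _) z

variable (k A) in
/-- The map `a ↦ a ⊗ 1`. -/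
def consOne : A →ₗ[k] T k A 1 := (consT 0).flip (show T k A 0 from (1 : A))

lemma op_smul_consOne (a : A) (b : T k A 0) : op (toA b) • consOne k A a = consT 0 a b :=
  congrArg (consT 0 a) (one_mul (toA b))

/-- Placing a in front is a homotopy between multiplication by a and the map z ↦ (a ⊗ 1) ⊗ (μ ⊗
1)(z). For a = 1 it shows that the kernel of the contraction is acyclic. -/
lemma d_consSq {l l' l'' : ℤ} (hl : l + 1 = l') (hl' : l'' + 1 = l) (h₀ : 0 + l = l) (a : A)
    (z : (barSq k A c).X l) : (barSq k A c).d l' l (consSq hl a z) =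
      a • z - consSq hl' a ((barSq k A c).d l l'' z) -
        barSqT h₀ (barT (r := 0) rfl (consOne k A a)) (contrSq l z) :=
  barSq_congr ((barSq k A c).d l' l ∘ₗ consSq hl a)
    (Algebra.lsmul k k ((barSq k A c).X l) a - consSq hl' a ∘ₗ (barSq k A c).d l l'' -
      barSqT h₀ (barT (r := 0) rfl (consOne k A a)) ∘ₗ contrSq l) (fun i j h x y => by
      have hi : i - 1 + 1 = i := by omega
      have hj : j - 1 + 1 = j := by omega
      have h₁ : i + 1 + j = l' := by omega
      have h₂ : i + 1 + (j - 1) = l := by omega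
      have h₃ : i - 1 + j = l'' := by omega
      have h₄ : i + (j - 1) = l'' := by omega
      change (barSq k A c).d l' l (consSq hl a (barSqT h x y)) =
        a • barSqT h x y - consSq hl' a ((barSq k A c).d l l'' (barSqT h x y)) -
        barSqT h₀ (barT (r := 0) rfl (consOne k A a)) (contrSq l (barSqT h x y))
      rw [consSq_barSqT hl h h₁ rfl, barSq_d_barSqT hl h₁ rfl hj h h₂, barD_consBar rfl hi,
        barSq_d_barSqT hl' h hi hj h₃ h₄, map_add (consSq hl' a), map_zsmul,
        consSq_barSqT hl' h₃ h hi, consSq_barSqT hl' h₄ h₂ rfl, smul_barSqT,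
        Int.negOnePow_succ, Units.val_neg, neg_smul]
      have e : barSqT (n := c) h (barIn k A 0 i (consT 0 a (barMu k A i x))) y =
          barSqT h₀ (barT (r := 0) rfl (consOne k A a)) (contrSq (c := c) l (barSqT h x y)) := by
        by_cases hi : i = 0
        · subst hi
          obtain rfl : j = l := by omega
          rw [contrSq_zero, ← barSqT_op_smul, ← (isBimodMap_barT _).2, op_smul_consOne,
            barIn_of_eq (show ((0 : ℕ) : ℤ) = 0 from rfl)]
        · rw [contrSq_eq_zero _ _ _ (barMu_of_ne hi x), barMu_of_ne hi x]
          simp only [map_zero, LinearMap.zero_apply]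
      rw [← e]
      simp only [map_sub, LinearMap.sub_apply]
      abel) z

variable (k A c) in
/-- The diagonal map from `A^{⊗ (n+1)}`. -/
noncomputable def diagT : ∀ (n : ℕ) (l : ℤ), (n : ℤ) = l + 1 → (T k A n →ₗ[k] (barSq k A c).X l)
  -- The power A^{⊗ 1} would sit in degree -1, where Bar ⊗_A Bar is zero. Starting one step below
  -- the bar complex, the recursion is Δ(a ⊗ x) = (a ⊗ 1) ⊗ (1 ⊗ x) + a ⊗ Δ(x).
  | 0, _, _ => 0
  | n + 1, l, h => liftT ((barSqT (zero_add l)).compl₁₂ (barT (r := 0) rfl ∘ₗ consOne k A)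
      (barT (show (n : ℤ) = l by push_cast at h; omega) ∘ₗ consT n 1) +
    (consSq (show l - 1 + 1 = l by omega)).compl₂
      (diagT n (l - 1) (by push_cast at h; omega)))

lemma diagT_consT {n : ℕ} {l l' : ℤ} (h : ((n + 1 : ℕ) : ℤ) = l + 1) (h' : (n : ℤ) = l' + 1)
    (hl : l' + 1 = l) (hn : (n : ℤ) = l) (h₀ : 0 + l = l) (a : A) (x : T k A n) :
    diagT k A c (n + 1) l h (consT n a x) =
      barSqT h₀ (barT (r := 0) rfl (consOne k A a)) (barT hn (consT n 1 x)) +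
        consSq hl a (diagT k A c n l' h' x) := by
  obtain rfl : l' = l - 1 := by omega
  rw [diagT, liftT_consT]
  rfl

/-- The counit property: μ ⊗ 1 kills a ⊗ Δ(x), whose first factor has positive degree, and sends (a
⊗ 1) ⊗ (1 ⊗ x) to a ⊗ x. -/
lemma contrSq_diagT {n : ℕ} {l : ℤ} (h : ((n + 1 : ℕ) : ℤ) = l + 1) (hn : (n : ℤ) = l)
    (z : T k A (n + 1)) : contrSq l (diagT k A c (n + 1) l h z) = barT hn z :=
  LinearMap.congr_fun (f := contrSq l ∘ₗ diagT k A c (n + 1) l h) (g := barT hn)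
    (T_hom_ext fun a x => by
      rw [LinearMap.comp_apply, diagT_consT h (l' := l - 1) (by omega) (by omega) hn (zero_add l),
        map_add, contrSq_consSq, add_zero, contrSq_zero, barMu, barEval_barT,
        ← (isBimodMap_barT hn).1]
      have e : toA (dT k A 0 (consOne k A a)) = a :=
        (dT_zero a (show T k A 0 from (1 : A))).trans (mul_one a)
      rw [e, smul_consT, mul_one]) z

lemma isBimodMap_diagT : ∀ (n : ℕ) (l : ℤ) (h : (n : ℤ) = l + 1), IsBimodMap (diagT k A c n l h)
  | 0, _, _ => IsBimodMap.zero
  | n + 1, l, h => by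
    have hl : l - 1 + 1 = l := by omega
    have hn : (n : ℤ) = l := by push_cast at h; omega
    have h' : (n : ℤ) = l - 1 + 1 := by omega
    have ih := isBimodMap_diagT n (l - 1) h'
    constructor
    · refine isLeft_of_cons (M := T k A n) _ fun a b x => ?_
      change diagT k A c (n + 1) l h (consT n (a * b) x) = a • diagT k A c (n + 1) l h (consT n b x)
      rw [diagT_consT h h' hl hn (zero_add l), diagT_consT h h' hl hn (zero_add l), consSq_mul,
        smul_add, smul_barSqT, ← (isBimodMap_barT _).1]
      rfl
    · refine isRight_of_cons (M := T k A n) _ fun a b x => ?_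
      change diagT k A c (n + 1) l h (consT n b (op a • x)) =
        op a • diagT k A c (n + 1) l h (consT n b x)
      rw [diagT_consT h h' hl hn (zero_add l), diagT_consT h h' hl hn (zero_add l), ih.2,
        consSq_op_smul, smul_add, op_smul_barSqT, ← (isBimodMap_barT _).2, op_smul_consT]

/-- By `d_consSq` and induction, d (a ⊗ Δ(x)) = a Δ(x) - a ⊗ Δ(d x) - (a ⊗ 1) ⊗ x, where the counit
property gives the last term. It cancels against d (1 ⊗ x) = x - 1 ⊗ d x in the second factor, and
what is left is Δ(a x - a ⊗ d x). -/
lemma d_diagT : ∀ (n : ℕ) (l l' : ℤ) (h : ((n + 1 : ℕ) : ℤ) = l + 1) (h' : (n : ℤ) = l' + 1)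
    (z : T k A (n + 1)), (barSq k A c).d l l' (diagT k A c (n + 1) l h z) =
      diagT k A c n l' h' (dT k A n z)
  | 0, l, l', h, h', z => by
    refine LinearMap.congr_fun (f := (barSq k A c).d l l' ∘ₗ diagT k A c 1 l h) (g := 0)
      (T_hom_ext fun a x => ?_) z
    have hl : l' + 1 = l := by push_cast at h; omega
    have e : diagT k A c 0 l' h' x = 0 := rfl
    rw [LinearMap.comp_apply, diagT_consT h h' hl (by push_cast at h; omega) (zero_add l), e,
      map_zero, add_zero, barSq_d_barSqT (i' := -1) (j' := l') hl (zero_add l) (by omega) hl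
        (by omega) (by omega), barX_eq_zero (by omega) (barD k A 0 (-1) _ _),
      barX_eq_zero (by omega) (barD k A l l' _ _)]
    simp only [map_zero, LinearMap.zero_apply, smul_zero, add_zero]
  | n + 1, l, l', h, h', z => by
    refine LinearMap.congr_fun (f := (barSq k A c).d l l' ∘ₗ diagT k A c (n + 1 + 1) l h)
      (g := diagT k A c (n + 1) l' h' ∘ₗ dT k A (n + 1)) (T_hom_ext fun a x => ?_) z
    have hl : l' + 1 = l := by push_cast at h; omega
    have hl' : l' - 1 + 1 = l' := by omega
    have hn : ((n + 1 : ℕ) : ℤ) = l := by push_cast at h ⊢; omega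
    have hn' : (n : ℤ) = l' := by push_cast at h; omega
    have h'' : (n : ℤ) = l' - 1 + 1 := by omega
    rw [LinearMap.comp_apply, LinearMap.comp_apply, diagT_consT h h' hl hn (zero_add l), map_add,
      barSq_d_barSqT (i' := -1) hl (zero_add l) (by omega) hl (by omega) (zero_add l'),
      barX_eq_zero (by omega) (barD k A 0 (-1) _ _), d_consSq hl hl' (zero_add l'),
      d_diagT n l' (l' - 1) h' h'', contrSq_diagT h' hn', dT_cons, map_sub,
      (isBimodMap_diagT _ _ _).1, diagT_consT h' h'' hl' hn' (zero_add l'),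
      barD_barT_succ hl hn hn', dT_cons, one_smul, map_sub, map_sub, Int.negOnePow_zero,
      Units.val_one, one_smul, map_zero, LinearMap.zero_apply, zero_add]
    abel

end Square

/-! ### The diagonal and products of cochains -/

section Cup

variable {c : ℤ} {M N : Bimod k A}

lemma isLeft_barEval {r : ℕ} {φ : T k A (r + 1) →ₗ[k] M} (hφ : IsLeft φ) (i : ℤ) :
    IsLeft (barEval φ i) := by
  rw [barEval]
  split_ifs with h
  · exact hφ.comp (Bimod.isBimodMap_proj _).1
  · exact IsBimodMap.zero.1

lemma isRight_barEval {r : ℕ} {φ : T k A (r + 1) →ₗ[k] M} (hφ : IsRight φ) (i : ℤ) :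
    IsRight (barEval φ i) := by
  rw [barEval]
  split_ifs with h
  · exact hφ.comp (Bimod.isBimodMap_proj _).2
  · exact IsBimodMap.zero.2

lemma barEval_consBar_zero (φ : T k A (0 + 1) →ₗ[k] M) {i j : ℤ} (h : i + 1 = j) (a : A)
    (x : barX k A i) : barEval φ j (consBar h a x) = 0 := by
  by_cases hj : j = 0
  · rw [barX_eq_zero (by omega) x, map_zero, map_zero]
  · exact barEval_of_ne φ (by push_cast; omega) _

lemma barEval_consBar_succ {r : ℕ} (φ : T k A (r + 1 + 1) →ₗ[k] M) {i j : ℤ} (h : i + 1 = j)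
    (a : A) (x : barX k A i) :
    barEval φ j (consBar h a x) = barEval (φ ∘ₗ consT (r + 1) a) i x :=
  barX_congr (barEval φ j ∘ₗ consBar h a) (barEval (φ ∘ₗ consT (r + 1) a) i) (fun s hs x => by
    rw [LinearMap.comp_apply, consBar_barT h hs (by push_cast; omega)]
    by_cases hr : s = r
    · subst hr
      rw [barEval_barT, barEval_barT, LinearMap.comp_apply]
    · rw [barEval_of_ne _ (by push_cast; omega), barEval_of_ne _ (by omega)]) x

/-- The map `φ ⊗_A ψ` for maps `φ` and `ψ` that are linear on one side. -/
def crossEval {r s : ℕ} (φ : T k A (r + 1) →ₗ[k] M) (ψ : T k A (s + 1) →ₗ[k] N) (hφ : IsRight φ)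
    (hψ : IsLeft ψ) (l : ℤ) : (barSq k A c).X l →ₗ[k] M.bal N :=
  barSqLift (fun i j _ => (balMk M N).compl₁₂ (barEval φ i) (barEval ψ j)) (fun i j _ a x y => by
    simp only [LinearMap.compl₁₂_apply]
    rw [isRight_barEval hφ i, isLeft_barEval hψ j, balMk_balanced])

section Eval

variable {r s : ℕ} (φ : T k A (r + 1) →ₗ[k] M) (ψ : T k A (s + 1) →ₗ[k] N)

lemma crossEval_barSqT (hφ : IsRight φ) (hψ : IsLeft ψ) {l i j : ℤ} (h : i + j = l)
    (x : barX k A i) (y : barX k A j) : crossEval (c := c) φ ψ hφ hψ l (barSqT h x y) =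
      balMk M N (barEval φ i x) (barEval ψ j y) := barSqLift_barSqT _ _ h x y

lemma crossEval_of_ne (hφ : IsRight φ) (hψ : IsLeft ψ) {l : ℤ} (h : (r : ℤ) + s ≠ l)
    (z : (barSq k A c).X l) : crossEval φ ψ hφ hψ l z = 0 :=
  barSq_congr (crossEval φ ψ hφ hψ l) 0 (fun i j hij x y => by
    rw [crossEval_barSqT, LinearMap.zero_apply]
    by_cases hi : (r : ℤ) = i
    · rw [barEval_of_ne ψ (by omega), map_zero]
    · rw [barEval_of_ne φ hi, map_zero, LinearMap.zero_apply]) z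

lemma cross_eq (hφ : IsBimodMap φ) (hψ : IsBimodMap ψ) (d l l' : ℤ) (z : (barSq k A c).X l) :
    cross c φ ψ hφ hψ d l l' z = ptIn (M.bal N) d l' (crossEval φ ψ hφ.2 hψ.1 l z) :=
  barSq_congr (cross c φ ψ hφ hψ d l l') (ptIn (M.bal N) d l' ∘ₗ crossEval φ ψ hφ.2 hψ.1 l)
    (fun i j h x y => by rw [cross_barSqT, LinearMap.comp_apply, crossEval_barSqT]) z

end Eval

lemma cupT_zero {j : ℕ} (φ : T k A (0 + 1) →ₗ[k] M) (ψ : T k A (j + 1) →ₗ[k] N) (a : A)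
    (x : T k A j) : cupT 0 j φ ψ (consT j a x) = balMk M N (φ (consOne k A a)) (ψ (consT j 1 x)) := by
  rw [cupT, LinearMap.comp_apply]
  exact (congrArg _ (splitT_zero j a x)).trans (TensorProduct.lift.tmul _ _)

lemma cupT_succ {i j : ℕ} (φ : T k A (i + 1 + 1) →ₗ[k] M) (ψ : T k A (j + 1) →ₗ[k] N) (a : A)
    (x : T k A (j + i + 1)) :
    cupT (i + 1) j φ ψ (consT (j + i + 1) a x) = cupT i j (φ ∘ₗ consT (i + 1) a) ψ x := by
  rw [cupT, cupT, LinearMap.comp_apply, LinearMap.comp_apply]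
  refine (congrArg _ (splitT_succ i j a x)).trans ?_
  generalize splitT i j x = w
  induction w with
  | zero => simp only [map_zero]
  | add x y hx hy => simp only [map_add, hx, hy]
  | tmul x y =>
    change balMk M N (φ (snoc (i + 1) (consT i a x) 1)) _ =
      balMk M N (φ (consT (i + 1) a (snoc i x 1))) _
    rw [snoc_succ]
    rfl

/-- Induction on i, absorbing the first tensor factor a into φ. The new map φ(a ⊗ -) is only right
linear, which is why one-sided linearity is all that is required. For i = 0 only the term (a ⊗ 1) ⊗
(1 ⊗ x) contributes, for i > 0 only a ⊗ Δ(x). -/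
lemma crossEval_diagT : ∀ (i j : ℕ) (φ : T k A (i + 1) →ₗ[k] M) (ψ : T k A (j + 1) →ₗ[k] N)
    (hφ : IsRight φ) (hψ : IsLeft ψ) (l : ℤ) (h : ((j + i + 1 : ℕ) : ℤ) = l + 1)
    (z : T k A (j + i + 1)),
    crossEval (c := c) φ ψ hφ hψ l (diagT k A c (j + i + 1) l h z) = cupT i j φ ψ z
  | 0, j, φ, ψ, hφ, hψ, l, h, z => by
    refine LinearMap.congr_fun (f := crossEval φ ψ hφ hψ l ∘ₗ diagT k A c (j + 0 + 1) l h)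
      (g := cupT 0 j φ ψ) (T_hom_ext fun a x => ?_) z
    have e : ∀ u, crossEval (c := c) φ ψ hφ hψ l (consSq (show l - 1 + 1 = l by omega) a u) = 0 :=
      fun u => barSq_congr (crossEval φ ψ hφ hψ l ∘ₗ consSq (show l - 1 + 1 = l by omega) a) 0
        (fun i j h x y => by
          rw [LinearMap.comp_apply, consSq_barSqT _ h (show i + 1 + j = l by omega) rfl,
            crossEval_barSqT, barEval_consBar_zero, map_zero, LinearMap.zero_apply,
            LinearMap.zero_apply]) u
    have hn : (j : ℤ) = l := by push_cast at h; omega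
    rw [LinearMap.comp_apply]
    refine (congrArg _ (diagT_consT h (l' := l - 1) (by omega) (by omega) (by omega)
      (zero_add l) a x)).trans ?_
    rw [map_add, e, add_zero, crossEval_barSqT, barEval_barT]
    refine Eq.trans ?_ (cupT_zero φ ψ a x).symm
    exact congrArg _ (barEval_barT ψ hn _)
  | i + 1, j, φ, ψ, hφ, hψ, l, h, z => by
    refine LinearMap.congr_fun (f := crossEval φ ψ hφ hψ l ∘ₗ diagT k A c (j + i + 1 + 1) l h)
      (g := cupT (i + 1) j φ ψ) (T_hom_ext fun a x => ?_) z
    have hφ' : IsRight (φ ∘ₗ consT (i + 1) a) := fun b x => by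
      rw [LinearMap.comp_apply, LinearMap.comp_apply, ← op_smul_consT, hφ]
    have e : ∀ u, crossEval (c := c) φ ψ hφ hψ l (consSq (show l - 1 + 1 = l by omega) a u) =
        crossEval (φ ∘ₗ consT (i + 1) a) ψ hφ' hψ (l - 1) u :=
      fun u => barSq_congr (crossEval φ ψ hφ hψ l ∘ₗ consSq (show l - 1 + 1 = l by omega) a)
        (crossEval (φ ∘ₗ consT (i + 1) a) ψ hφ' hψ (l - 1))
        (fun i' j' h x y => by
          rw [LinearMap.comp_apply, consSq_barSqT _ h (show i' + 1 + j' = l by omega) rfl,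
            crossEval_barSqT, crossEval_barSqT, barEval_consBar_succ]) u
    rw [LinearMap.comp_apply]
    refine (congrArg _ (diagT_consT (n := j + i + 1) h (l' := l - 1) (by push_cast at h ⊢; omega)
      (by omega) (by push_cast at h ⊢; omega) (zero_add l) a x)).trans ?_
    rw [map_add, e, crossEval_diagT i j, crossEval_barSqT, barEval_of_ne φ (by push_cast; omega),
      map_zero, LinearMap.zero_apply, zero_add]
    exact (cupT_succ φ ψ a x).symm

end Cup

/-! ### The diagonal morphism -/

section Diagonal

variable (c : ℤ)

variable (k A) in
/-- The diagonal `Bar_*(A) → Bar_*(A) ⊗_A Bar_*(A)`. -/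
noncomputable def barDiag (i : ℤ) : barX k A i →ₗ[k] (barSq k A c).X i :=
  barDesc fun r h => diagT k A c (r + 1) i (by push_cast; omega)

variable {c}

lemma barDiag_barT {r : ℕ} {i : ℤ} (h : (r : ℤ) = i) (h' : ((r + 1 : ℕ) : ℤ) = i + 1)
    (x : T k A (r + 1)) : barDiag k A c i (barT h x) = diagT k A c (r + 1) i h' x :=
  barDesc_barT _ h x

lemma isBimodMap_barDiag (i : ℤ) : IsBimodMap (barDiag k A c i) :=
  ⟨Bimod.lin_piDesc (S := .left) fun _ => (isBimodMap_diagT _ _ _).1,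
    Bimod.lin_piDesc (S := .right) fun _ => (isBimodMap_diagT _ _ _).2⟩

lemma barDiag_barD {i j : ℤ} (h : j + 1 = i) (x : barX k A i) :
    barDiag k A c j (barD k A i j h x) = (barSq k A c).d i j (barDiag k A c i x) :=
  barX_congr (barDiag k A c j ∘ₗ barD k A i j h) ((barSq k A c).d i j ∘ₗ barDiag k A c i)
    (fun r hr x => by
      rw [LinearMap.comp_apply, LinearMap.comp_apply, barDiag_barT hr (by push_cast; omega),
        d_diagT r i j _ (by omega)]
      cases r with
      | zero =>
        rw [barX_eq_zero (by push_cast at hr; omega) (barD k A i j h _), map_zero]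
        rfl
      | succ r =>
        have hj : (r : ℤ) = j := by push_cast at hr; omega
        rw [barD_barT_succ h hr hj, barDiag_barT hj]) x

lemma contrSq_barDiag (i : ℤ) (x : barX k A i) : contrSq i (barDiag k A c i x) = x :=
  barX_congr (contrSq i ∘ₗ barDiag k A c i) LinearMap.id (fun r hr x => by
    rw [LinearMap.comp_apply, barDiag_barT hr (by push_cast; omega), contrSq_diagT _ hr,
      LinearMap.id_apply]) x

/-- The structure maps of C₆ are defined by splitting tensors directly. This identifies them with
the corresponding maps on Bar ⊗_A Bar composed with Δ, so that Δ induces a morphism of twisted sums.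
-/
lemma cross_barDiag {M N : Bimod k A} {r s : ℕ} (φ : T k A (r + 1) →ₗ[k] M)
    (ψ : T k A (s + 1) →ₗ[k] N) (hφ : IsBimodMap φ) (hψ : IsBimodMap ψ) {d i j : ℤ}
    (x : barX k A i) : cross c φ ψ hφ hψ d i j (barDiag k A c i x) =
      ptIn (M.bal N) d j (barEval (cupT r s φ ψ) i x) := by
  rw [cross_eq]
  refine congrArg _ (barX_congr (crossEval φ ψ hφ.2 hψ.1 i ∘ₗ barDiag k A c i)
    (barEval (cupT r s φ ψ) i) (fun q hq x => ?_) x)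
  rw [LinearMap.comp_apply]
  by_cases h : q = s + r
  · subst h
    rw [barDiag_barT hq (by push_cast at hq ⊢; omega), crossEval_diagT, barEval_barT]
  · rw [crossEval_of_ne _ _ _ _ (by omega), barEval_of_ne _ (by push_cast; omega)]

/-- A cycle of `Bar_*(A) ⊗_A Bar_*(A)` that is killed by the contraction onto `Bar_*(A)` is a
boundary. -/
lemma d_consSq_one {l l' l'' : ℤ} (hl : l + 1 = l') (hl' : l'' + 1 = l) {z : (barSq k A c).X l}
    (hz : (barSq k A c).d l l'' z = 0) (hz' : contrSq l z = 0) :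
    (barSq k A c).d l' l (consSq hl 1 z) = z := by
  rw [d_consSq hl hl' (zero_add l), hz, hz', map_zero, map_zero, sub_zero, sub_zero, one_smul]

end Diagonal

end

end SingDef

namespace SingDef

/-! ### Twisted direct sums with quasi-isomorphic first summands -/

namespace TwistData

variable {k : Type v} {A : Type u} [Field k] [Ring A] [Algebra k A] {n : ℤ}
  {D D' : TwistData k A n} (α : ∀ i, D.B i →ₗ[k] D'.B i) (γ : ∀ i, D.E i →ₗ[k] D'.E i)
  (hα : ∀ i, IsBimodMap (α i)) (hγ : ∀ i, IsBimodMap (γ i))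
  (α_d : ∀ i j h x, α j (D.dB i j h x) = D'.dB i j h (α i x))
  (γ_d : ∀ i j h y, γ j (D.dE i j h y) = D'.dE i j h (γ i y))
  (γ_t : ∀ i j h x, γ j (D.t i j h x) = D'.t i j h (α i x))
  (γ_ρ : ∀ i j h x, γ j (D.ρ i j h x) = D'.ρ i j h (α i x))

/-- A block diagonal morphism is a relative quasi-isomorphism if its first block has a retraction
with acyclic kernel, its second block is bijective and the differentials of the second summands
vanish. -/
lemma isRelQuasiIso_map (hE : ∀ i j h y, D.dE i j h y = 0) (hE' : ∀ i j h y, D'.dE i j h y = 0)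
    (bγ : ∀ i, Function.Bijective (γ i)) (π : ∀ i, D'.B i →ₗ[k] D.B i)
    (π_d : ∀ i j h x, π j (D'.dB i j h x) = D.dB i j h (π i x)) (π_α : ∀ i x, π i (α i x) = x)
    (hπ : ∀ i j l (hj : i + 1 = j) (hl : l + 1 = i) u, D'.dB i l hl u = 0 → π i u = 0 →
      ∃ s, D'.dB j i hj s = u)
    (hρ : ∀ i j h u, ∃ v, γ j (D.ρ i j h v) = D'.ρ i j h u) :
    DGMod.IsRelQuasiIso (map α γ hα hγ α_d γ_d γ_t γ_ρ) := by
  have φ_inl := map_inl α γ hα hγ α_d γ_d γ_t γ_ρ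
  have φ_inr := map_inr α γ hα hγ α_d γ_d γ_t γ_ρ
  generalize map α γ hα hγ α_d γ_d γ_t γ_ρ = φ at φ_inl φ_inr ⊢
  -- No R-linear homotopy inverse is constructed. Over a field it suffices that the mapping cone and
  -- the image of ε in it are acyclic.
  refine (DGMod.isHtpyEquiv_of_contractible _ (DGMod.contractible_of_acyclic _
    (fun i j l hj hl z hz => ?_) fun i j i' j' l' hj hi' hj' hl' x hx => ?_)).isRelQuasiIso
  · have h₁ : D'.mod.d i l (DGMod.mappingCone.fst φ i z) +
        φ.f l (DGMod.mappingCone.snd φ hl z) = 0 := by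
      rw [← DGMod.mappingCone.fst_d hl, hz, map_zero]
    rw [DGMod.mappingCone.eq_add hl z]
    generalize DGMod.mappingCone.fst φ i z = y at h₁ ⊢
    generalize DGMod.mappingCone.snd φ hl z = x at h₁ ⊢
    rw [D'.eq_add i y, D.eq_add l x] at h₁ ⊢
    generalize D'.snd i y = w at h₁ ⊢
    generalize D.snd l x = w' at h₁ ⊢
    generalize D'.fst i y = u at h₁ ⊢
    generalize D.fst l x = v at h₁ ⊢
    rw [map_add, map_add, D'.d_inl hl, D'.d_inr hl, φ_inl, φ_inr] at h₁
    have e₁ : D'.dB i l hl u = -α l v := by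
      have e := congrArg (D'.fst l) h₁
      simp only [map_add, map_zero, TwistData.fst_inl, TwistData.fst_inr, add_zero] at e
      exact eq_neg_of_add_eq_zero_left e
    have e₂ : D'.t i l hl u = -γ l w' := by
      have e := congrArg (D'.snd l) h₁
      simp only [map_add, map_zero, TwistData.snd_inl, TwistData.snd_inr, zero_add, hE',
        add_zero] at e
      exact eq_neg_of_add_eq_zero_left e
    have e₃ : D.dB i l hl (π i u) = -v := by rw [← π_d, e₁, map_neg, π_α]
    -- For a cycle with components u, w in the target and v, w' in the source, d u = -α v. Hence u -
    -- α π u is a cycle in the kernel of π and bounds some s.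
    obtain ⟨s, hs⟩ := hπ i j l hj hl (u - α i (π i u))
      (by rw [map_sub, ← α_d, e₃, e₁, map_neg, sub_self]) (by rw [map_sub, π_α, sub_self])
    -- The twisting map vanishes on the boundary d s because the second summands have no
    -- differential. So γ t π u = t α π u = t u = -γ w', and γ is injective.
    have e₄ : D.t i l hl (π i u) = -w' := (bγ l).1 (by
      have e := D'.t_dB j i l hj hl s
      rw [hE', add_zero, hs, map_sub, sub_eq_zero] at e
      rw [γ_t, ← e, e₂, map_neg])
    -- The component w₁ compensates the contribution t s of s to the second summand of the target.
    obtain ⟨w₁, hw₁⟩ := (bγ i).2 (w - D'.t j i hj s)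
    refine ⟨DGMod.mappingCone.inl φ j (D'.inl j s) +
      DGMod.mappingCone.inr φ hj (D.inl i (π i u) + D.inr i w₁), ?_⟩
    rw [map_add, DGMod.mappingCone.d_inl hj, DGMod.mappingCone.d_inr hj hl, map_add (φ.f i),
      map_add (D.mod.d i l), φ_inl, φ_inr, D'.d_inl hj, D.d_inl hl, D.d_inr hl, e₃, e₄, hs, hw₁, hE]
    simp only [map_add, map_sub, map_neg, map_zero]
    abel
  -- The image of ε lies in the second summands, on which the differential of the cone reduces to γ.
  -- So a cycle there has zero source component, and by `hρ` its target component is γ applied to a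
  -- value of ε on the source; the corresponding source element has it as its boundary.
  · have hi : i - 1 + 1 = i := by omega
    have hd : i' + 1 = j' := by omega
    have hl : i - 1 + n = l' := by omega
    rw [DGMod.mappingCone.eq_add hi x] at hx ⊢
    generalize DGMod.mappingCone.fst φ i x = y at hx ⊢
    generalize DGMod.mappingCone.snd φ hi x = x at hx ⊢
    rw [map_add, DGMod.mappingCone.e_inl hi', DGMod.mappingCone.e_inr hi' hi hl',
      D'.eq_add i y, D.eq_add (i - 1) x, map_add (D'.mod.e i i'), map_add (D.mod.e (i - 1) l'), D'.e_inl hi', D'.e_inr,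
      D.e_inl hl, D.e_inr, add_zero, add_zero] at hx ⊢
    obtain ⟨v, hv⟩ := hρ i i' hi' (D'.fst i y)
    generalize D.ρ (i - 1) l' hl _ = w at hx ⊢
    have hw : w = 0 := (bγ l').1 (by
      have e := congrArg (DGMod.mappingCone.fst φ l') hx
      rw [map_add, DGMod.mappingCone.d_inl hl', DGMod.mappingCone.d_inr hl' (sub_add_cancel l' 1),
        map_add, map_sub, DGMod.mappingCone.fst_inl, DGMod.mappingCone.fst_inl,
        DGMod.mappingCone.fst_inr, map_zero, sub_zero, D'.d_inr hl', hE', map_zero, zero_add,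
        φ_inr] at e
      have e' := congrArg (D'.snd l') e
      rw [TwistData.snd_inr, map_zero] at e'
      rw [e', map_zero])
    refine ⟨DGMod.mappingCone.inr φ hj (D.inl i v), ?_⟩
    rw [DGMod.mappingCone.e_inr hj' hj hd, D.e_inl hi', DGMod.mappingCone.d_inr hd hl', φ_inr,
      D.d_inr hl', hv, hw, hE]
    simp only [map_zero, add_zero, sub_zero]

end TwistData

section

variable {k : Type v} {A : Type u} [CommRing k] [Ring A] [Algebra k A] {m p : ℕ}

/-! ### The comparison with `C₆(f, g)` -/

variable (f g : Cochain m (Om k A p)) (hf : IsCocycle f) (hg : IsCocycle g)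

/-- The data that define `C6`. -/
def c6Data : TwistData k A ((m : ℤ) - p - 1) where
  B := barX k A
  E := ptX ((Om k A p).bal (Om k A p)) (m + p - 1)
  dB := barD k A
  dE _ _ _ := 0
  t i j h := -(((m * p : ℤ).negOnePow : ℤ) •
      barToPt (r := p + m) (by omega) (cupT m p (biext f) (dOm k A p)) +
    ((p : ℤ).negOnePow : ℤ) •
      barToPt (r := m + p) (by omega) (cupT p m (dOm k A p) (biext g)))
  ρ i j h := barToPt (r := p + p) (by omega) (cupT p p (dOm k A p) (dOm k A p))
  hdB _ _ _ := isBimodMap_barD _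
  hdE _ _ _ := IsBimodMap.zero
  ht _ _ _ := (((isBimodMap_barToPt
        (isBimodMap_cupT (isBimodMap_biext f) (isBimodMap_dOm p))).zsmul _).add
      ((isBimodMap_barToPt
        (isBimodMap_cupT (isBimodMap_dOm p) (isBimodMap_biext g))).zsmul _)).neg
  hρ _ _ _ := isBimodMap_barToPt (isBimodMap_cupT (isBimodMap_dOm p) (isBimodMap_dOm p))
  dB_dB := barD_barD k A
  dE_dE _ _ _ _ _ _ := rfl
  t_dB i j l h h' x := by
    rw [LinearMap.zero_apply, add_zero, LinearMap.neg_apply, LinearMap.add_apply,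
      LinearMap.smul_apply, LinearMap.smul_apply,
      barToPt_barD (cupT_dT (isBimodMap_biext f) (isBimodMap_dOm p) (biext_dT hf) (dOm_dT p)),
      barToPt_barD (cupT_dT (isBimodMap_dOm p) (isBimodMap_biext g) (dOm_dT p) (biext_dT hg)),
      smul_zero, smul_zero, add_zero, neg_zero]
  dE_ρ i j i' j' h h' h₁ h₂ x := by
    rw [barToPt_barD (cupT_dT (isBimodMap_dOm p) (isBimodMap_dOm p) (dOm_dT p) (dOm_dT p)),
      LinearMap.zero_apply]

lemma prod_t_barDiag {i j : ℤ} (h : j + 1 = i) (x : barX k A i) :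
    (productData f g hf hg).t i j h (barDiag k A ((m : ℤ) - p - 1) i x) =
      (c6Data f g hf hg).t i j h x := by
  have e₁ := cross_barDiag (c := (m : ℤ) - p - 1) (d := m + p - 1) (j := j) (biext f) (dOm k A p)
    (isBimodMap_biext f) (isBimodMap_dOm p) x
  have e₂ := cross_barDiag (c := (m : ℤ) - p - 1) (d := m + p - 1) (j := j) (dOm k A p) (biext g)
    (isBimodMap_dOm p) (isBimodMap_biext g) x
  have e₃ := barToPt_eq (c := (m : ℤ) + p - 1) (j := j) (cupT m p (biext f) (dOm k A p))
    (by omega) x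
  have e₄ := barToPt_eq (c := (m : ℤ) + p - 1) (j := j) (cupT p m (dOm k A p) (biext g))
    (by omega) x
  exact congrArg (fun z => -z) (congrArg₂ (· + ·)
    (congrArg (fun z => ((m * p : ℤ).negOnePow : ℤ) • z) (e₁.trans e₃.symm))
    (congrArg (fun z => ((p : ℤ).negOnePow : ℤ) • z) (e₂.trans e₄.symm)))

lemma prod_ρ_barDiag {i j : ℤ} (h : i + ((m : ℤ) - p - 1) = j) (x : barX k A i) :
    (productData f g hf hg).ρ i j h (barDiag k A ((m : ℤ) - p - 1) i x) =
      (c6Data f g hf hg).ρ i j h x :=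
  (cross_barDiag (c := (m : ℤ) - p - 1) (d := m + p - 1) (j := j) (dOm k A p) (dOm k A p)
    (isBimodMap_dOm p) (isBimodMap_dOm p) x).trans
    (barToPt_eq (c := (m : ℤ) + p - 1) (j := j) (cupT p p (dOm k A p) (dOm k A p))
      (by omega) x).symm

/-- The morphism from `C6` that is given by the diagonal of the bar complex. -/
noncomputable def c6Comparison :
    DGMod.Hom (c6Data f g hf hg).mod (productData f g hf hg).mod :=
  TwistData.map (D := c6Data f g hf hg) (D' := productData f g hf hg)
    (barDiag k A ((m : ℤ) - p - 1)) (fun _ => LinearMap.id) isBimodMap_barDiag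
    (fun _ => ⟨fun _ _ => rfl, fun _ _ => rfl⟩) (fun _ _ h x => barDiag_barD h x)
    (fun _ _ _ _ => rfl) (fun _ _ h x => (prod_t_barDiag f g hf hg h x).symm)
    (fun _ _ h x => (prod_ρ_barDiag f g hf hg h x).symm)

lemma splitT_concatT : ∀ (i j : ℕ) (x : T k A i) (y : T k A j),
    splitT i j (concatT i j x y) = x ⊗ₜ y
  | 0, j, x, y => splitT_zero j (toA x) y
  | i + 1, j, x, y => by
    refine consT_induction x ?_ (fun x y hx hy => ?_) fun a x => ?_
    · simp only [map_zero, LinearMap.zero_apply, TensorProduct.zero_tmul]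
    · simp only [map_add, LinearMap.add_apply, TensorProduct.add_tmul, hx, hy]
    · rw [concatT_succ]
      refine (splitT_succ i j a _).trans ?_
      rw [splitT_concatT i j x y, LinearMap.rTensor_tmul]

/-- The product of `d` with itself is surjective onto `Ω^p(A) ⊗_A Ω^p(A)`. -/
lemma cupT_dOm_surjective :
    Function.Surjective (cupT p p (dOm k A p) (dOm k A p) : T k A (p + p + 1) →ₗ[k] _) := by
  rw [← LinearMap.range_eq_top, eq_top_iff]
  have h : ∀ w w', balMk (Om k A p) (Om k A p) w w' ∈
      LinearMap.range (cupT p p (dOm k A p) (dOm k A p) : T k A (p + p + 1) →ₗ[k] _) := by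
    intro w w'
    -- The concatenation of w and w' is sent to d_p (w ⊗ 1) ⊗ d_p (1 ⊗ w'). Since w and w' lie in
    -- Ω^p(A), the factors are (-1)^p w and w'.
    refine ⟨(-1 : ℤ) ^ p • concatT p p (omIncl k A p w) (omIncl k A p w'), ?_⟩
    rw [map_zsmul, cupT, LinearMap.comp_apply, splitT_concatT, TensorProduct.lift.tmul]
    change (-1 : ℤ) ^ p • balMk _ _ (dOm k A p (snoc p (omIncl k A p w) 1))
      (dOm k A p (consT p 1 (omIncl k A p w'))) = _
    have e : dOm k A p (snoc p (omIncl k A p w) 1) = (-1 : ℤ) ^ p • w := Subtype.ext (by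
      refine (dT_snoc_omIncl p w 1).trans ?_
      rw [op_one, one_smul]
      exact (map_zsmul (omIncl k A p) _ w).symm)
    rw [e, dOm_consT_omIncl, map_zsmul, LinearMap.smul_apply, smul_smul, ← pow_add,
      Even.neg_one_pow ⟨p, rfl⟩, one_smul]
  intro z _
  have hq := bal_congr (LinearMap.range (cupT p p (dOm k A p) (dOm k A p) :
    T k A (p + p + 1) →ₗ[k] _)).mkQ 0 (fun w w' => (Submodule.Quotient.mk_eq_zero _).2 (h w w')) z
  exact (Submodule.Quotient.mk_eq_zero _).1 hq

/-- In C₆ the element ε already hits all of Ω^p(A) ⊗_A Ω^p(A). This is the condition that makes the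
image of ε in the cone of the diagonal morphism acyclic. -/
lemma exists_c6_ρ_eq {i j : ℤ} (h : i + ((m : ℤ) - p - 1) = j)
    (w : ptX ((Om k A p).bal (Om k A p)) (m + p - 1) j) :
    ∃ x : barX k A i, (c6Data f g hf hg).ρ i j h x = w := by
  by_cases hj : (m : ℤ) + p - 1 = j
  · have hi : ((p + p : ℕ) : ℤ) = i := by push_cast; omega
    obtain ⟨y, hy⟩ := cupT_dOm_surjective (k := k) (A := A) (p := p) (ptProj _ hj w)
    refine ⟨barT hi y, (barToPt_barT (fun _ => hi) _ hi hj y).trans ?_⟩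
    rw [hy]
    exact Bimod.single_proj (P := fun _ : {_u : Unit // (m : ℤ) + p - 1 = j} =>
      (Om k A p).bal (Om k A p)) ⟨(), hj⟩ w
  · exact ⟨0, (ptX_eq_zero hj _).trans (ptX_eq_zero hj w).symm⟩

end

section Field

variable {k : Type v} {A : Type u} [Field k] [Ring A] [Algebra k A] {m p : ℕ}
  (f g : Cochain m (Om k A p)) (hf : IsCocycle f) (hg : IsCocycle g)

/-- The retraction of the diagonal is μ ⊗ 1, and a cycle u in its kernel is the boundary of 1 ⊗ u,
that is of u with 1 placed in front. -/
lemma isRelQuasiIso_c6Comparison : DGMod.IsRelQuasiIso (c6Comparison f g hf hg) :=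
  TwistData.isRelQuasiIso_map (D := c6Data f g hf hg) (D' := productData f g hf hg) _ _ _ _ _ _ _ _
    (fun _ _ _ _ => rfl) (fun _ _ _ _ => rfl) (fun _ => Function.bijective_id) contrSq
    (fun _ _ h x => contrSq_d h x) contrSq_barDiag
    (fun _ _ _ hj hl _ hu hu' => ⟨consSq hj 1 _, d_consSq_one hj hl hu hu'⟩)
    (fun _ _ h u => exists_c6_ρ_eq f g hf hg h ((productData f g hf hg).ρ _ _ h u))

end Field

end SingDef

/-! ### The proposition -/

theorem mainTheorem5 (k : Type v) (A : Type u) [Field k] [Ring A] [Algebra k A] (m p : ℕ)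
    (f g : SingDef.Cochain m (SingDef.Om k A p))
    (hf : SingDef.IsCocycle f) (hg : SingDef.IsCocycle g) :
    (∃ _ : (SingDef.DGMod.tensorRightQ (SingDef.Ctheta2 g hg)).HasLeftDerivedFunctor
        (SingDef.DGMod.relQuasiIso k A ((m : ℤ) - p - 1)),
      CategoryTheory.IsIso
        (((SingDef.DGMod.tensorRightQ (SingDef.Ctheta2 g hg)).totalLeftDerivedCounit
          (SingDef.DGMod.relQuasiIso k A ((m : ℤ) - p - 1)).Q
          (SingDef.DGMod.relQuasiIso k A ((m : ℤ) - p - 1))).app (SingDef.Ctheta1 f hf))) ∧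
    Nonempty
      ((SingDef.DGMod.relQuasiIso k A ((m : ℤ) - p - 1)).Q.obj
          (SingDef.DGMod.tens (SingDef.Ctheta1 f hf) (SingDef.Ctheta2 g hg)) ≅
        (SingDef.DGMod.relQuasiIso k A ((m : ℤ) - p - 1)).Q.obj (SingDef.C6 f g hf hg)) := by
  -- The derived functor exists for tensoring with any module. The counit is invertible here because
  -- of the splitting of C(θ₁(f)), filtered by degree.
  refine ⟨SingDef.DGMod.exists_derived_tensor _ _ (SingDef.coneFilteredSplitting _ _ _), ⟨?_⟩⟩
  have iso : ∀ {M N : SingDef.DGMod k A ((m : ℤ) - p - 1)} (φ : SingDef.DGMod.Hom M N),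
      SingDef.DGMod.IsRelQuasiIso φ →
      ((SingDef.DGMod.relQuasiIso k A ((m : ℤ) - p - 1)).Q.obj M ≅
        (SingDef.DGMod.relQuasiIso k A ((m : ℤ) - p - 1)).Q.obj N) := fun {M N} φ hφ =>
    CategoryTheory.Localization.isoOfHom (SingDef.DGMod.relQuasiIso k A ((m : ℤ) - p - 1)).Q
      (SingDef.DGMod.relQuasiIso k A ((m : ℤ) - p - 1)) (X := M) (Y := N) φ hφ
  -- The first factor is replaced through a right linear equivalence and then the second through a
  -- left linear one. The product of the small modules is identified with the twisted sum over Bar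
  -- ⊗_A Bar, and the diagonal, pointing the other way, leads to C₆.
  exact (iso _ ((SingDef.isHtpyEquiv_theta1Aug f hf).tensHom (SingDef.Ctheta2 g hg))).trans
    ((iso _ ((SingDef.isHtpyEquiv_theta2Aug g hg).tensHomRight
      (SingDef.cocycleData f hf).mod)).trans
    ((iso _ (SingDef.isRelQuasiIso_prodComparison f g hf hg)).trans
    (iso _ (SingDef.isRelQuasiIso_c6Comparison f g hf hg)).symm))
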